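/- **Setting.** Let $G$ be a unimodular Lie group with Lie algebra $\mathfrak g$ and Haar measure $dg$, acting smoothly, properly and isometrically on a complete Riemannian manifold $M$ of even dimension, equipped with a $G$-equivariant $\mathrm{Spin}^c$-structure with ($\mathbb Z/2$-graded, Hermitian) spinor bundle $\mathcal S\to M$, Clifford multiplication $c$ (with $c(v)^2=-\|v\|^2$) and Hermitian determinant line bundle $L\to M$. Call a $G$-invariant set *cocompact* (*relatively cocompact*) if it (its closure) has compact image in $M/G$. Let $\nabla^L$ be a $G$-invariant Hermitian connection on $L$; together with the Levi-Civita connection it determines a Hermitian Clifford connection on $\mathcal S$, and hence one on $\mathcal S\otimes L^p$ for every integer $p\ge 0$. Let $\widetilde D$ and $\widetilde D^{L^p}$ be the corresponding $\mathrm{Spin}^c$-Dirac operators on $\mathcal S$ and $\mathcal S\otimes L^p$. Endomorphisms $T$ of $\mathcal S$ act on $\mathcal S\otimes L^p$ as $T\otimes 1$. For $X\in\mathfrak g$ let $X^M(m)=\frac{d}{dt}\big|_{t=0}\exp(-tX)m$, and let $\mu\colon M\to\mathfrak g^*$ be the moment map defined by $2\pi i\langle\mu,X\rangle=\mathcal L_X-\nabla^L_{X^M}$.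 Fix a $G$-invariant smooth metric on the bundle $M\times\mathfrak g\to M$ (with $G$ acting on $\mathfrak g$ by the adjoint action), and let $v^\mu(m)=X^M(m)$, where $X\in\mathfrak g$ is dual to $\mu(m)$ for the metric at $m$. Let $U$ be an open, relatively cocompact, $G$-invariant neighbourhood of $\mu^{-1}(0)$, and let $U'$ be a $G$-invariant neighbourhood of $\mu^{-1}(0)$ with $\overline{U'}\subset U$. Let $Z\subset M$ be a closed, cocompact, $G$-invariant subset whose interior contains $\overline U$. Let $\Phi$ be a smooth, $G$-equivariant, fibrewise self-adjoint endomorphism of $\mathcal S$ such that $\{\widetilde D,\Phi\}=\widetilde D\Phi+\Phi\widetilde D$ is a vector bundle endomorphism and, for some constant $k>0$, $$\{\widetilde D,\Phi\}+\Phi^2\ge k^2\quad\text{fibrewise outside } Z.$$ Let $f\in C^\infty(M)^G$ be nonnegative with cocompact support and $f\equiv1$ on $Z$. Let $\chi\in C^\infty(M)$ be a cutoff function: its support has compact intersection with every $G$-orbit, and $\int_G\chi(gx)^2\,dg=1$ for all $x\in M$. For a $G$-invariant real-valued $h\in C^\infty(M)$, $p\in\mathbb Z_{\ge0}$ and $t>0$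 put $$D_{p,h,t}=\widetilde D^{L^p}+t\bigl(h\Phi-if\,c(v^\mu)\bigr).$$ Let $\Gamma^\infty_{tc}(\mathcal S\otimes L^p)^G$ be the space of smooth $G$-invariant sections of $\mathcal S\otimes L^p$ whose supports have compact image in $M/G$, and for such $s$ put $\|\chi s\|_{W^1}^2=\|\chi\widetilde D^{L^p}s\|_{L^2}^2+\|\chi s\|_{L^2}^2$. **Proposition.** There are constants $C,b>0$, a function $h\in C^\infty(M)^G$ that is equal to a constant greater than or equal to $1$ on $M\setminus U$ and equal to $0$ on $U'$, and a $p_0\in\mathbb Z_{\ge0}$, such that for all integers $p\ge p_0$, all real $t\ge1$ and all $s\in\Gamma^\infty_{tc}(\mathcal S\otimes L^p)^G$ supported in $M\setminus U$, $$\|\chi D_{p,h,t}s\|_{L^2}^2\ \ge\ C\Bigl(\|\chi s\|_{W^1}^2+(t-b)\|\chi s\|_{L^2}^2\Bigr).$$ -/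

import Mathlib

open Bundle Manifold MeasureTheory Topology
open scoped ContDiff TensorProduct

namespace CalliasLocalisation

noncomputable section

/-! ## Group actions -/

section Actions

variable {n d : ℕ}
  {G : Type*} [TopologicalSpace G] [Group G] [ChartedSpace (EuclideanSpace ℝ (Fin d)) G]
  {M : Type*} [TopologicalSpace M] [ChartedSpace (EuclideanSpace ℝ (Fin n)) M] [MulAction G M]

/-- The derivative `T_m M → T_{gm} M` of the action of `g` on `M`. -/
def pushforward (g : G) (m : M) :
    TangentSpace (𝓡 n) m →L[ℝ] TangentSpace (𝓡 n) (g • m) :=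
  mfderiv (𝓡 n) (𝓡 n) (fun x : M ↦ g • x) m

variable (G M) in
/-- The Riemannian metric of `M` is invariant under the action of `G`. -/
def IsIsometricAction [RiemannianBundle (fun x : M ↦ TangentSpace (𝓡 n) x)] : Prop :=
  ∀ (g : G) (m : M) (v : TangentSpace (𝓡 n) m), ‖pushforward g m v‖ = ‖v‖

/-- The vector field `X^M` induced by `X` in the Lie algebra, with the sign convention
`X^M(m) = d/dt|_{t=0} exp(-tX) m`. -/
def inducedField (X : GroupLieAlgebra (𝓡 d) G) (m : M) : TangentSpace (𝓡 n) m :=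
  -(show TangentSpace (𝓡 n) m from mfderiv (𝓡 d) (𝓡 n) (fun g : G ↦ g • m) 1 X)

/-- The adjoint action of `G` on its Lie algebra. -/
def adjointAction (g : G) (X : GroupLieAlgebra (𝓡 d) G) : GroupLieAlgebra (𝓡 d) G :=
  show TangentSpace (𝓡 d) (1 : G) from
    mfderiv (𝓡 d) (𝓡 d) (fun k : G ↦ g * k * g⁻¹) 1 X

variable (G) in
/-- A subset of `M` is `G`-invariant. -/
def IsInvariantSet (A : Set M) : Prop := ∀ (g : G), ∀ m ∈ A, g • m ∈ A

variable (G) in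
/-- The image of the set `A` in the orbit space `M/G` is compact. -/
def IsCocompact (A : Set M) : Prop :=
  IsCompact ((Quotient.mk (MulAction.orbitRel G M) : M → _) '' A)

variable (G M) in
/-- A smooth `G`-invariant metric on the vector bundle `M × 𝔤 → M`, where `G` acts on `𝔤` by the
adjoint action. -/
structure LieAlgebraMetric where
  form : M → LinearMap.BilinForm ℝ (GroupLieAlgebra (𝓡 d) G)
  symm : ∀ m X Y, form m X Y = form m Y X
  pos : ∀ m X, X ≠ 0 → 0 < form m X X
  smooth : ∀ X Y, ContMDiff (𝓡 n) 𝓘(ℝ, ℝ) ∞ (fun m ↦ form m X Y)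
  invariant : ∀ (g : G) m X Y,
    form (g • m) (adjointAction g X) (adjointAction g Y) = form m X Y

instance finiteDimensional_lieAlgebra : FiniteDimensional ℝ (GroupLieAlgebra (𝓡 d) G) :=
  inferInstanceAs (FiniteDimensional ℝ (EuclideanSpace ℝ (Fin d)))

theorem LieAlgebraMetric.nondegenerate (B : LieAlgebraMetric (n := n) (d := d) G M) (m : M) :
    (B.form m).Nondegenerate := by
  have key : ∀ X, B.form m X X = 0 → X = 0 := fun X h ↦ by
    by_contra hX
    exact (B.pos m X hX).ne' h
  exact ⟨fun X h ↦ key X (h X), fun X h ↦ key X (h X)⟩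

/-- The map `M → 𝔤` dual to `μ : M → 𝔤^*`: its value `X` at `m` satisfies
`B_m(X, Y) = ⟨μ(m), Y⟩` for all `Y`. -/
def LieAlgebraMetric.dual (B : LieAlgebraMetric (n := n) (d := d) G M)
    (μ : M → GroupLieAlgebra (𝓡 d) G →ₗ[ℝ] ℝ) (m : M) : GroupLieAlgebra (𝓡 d) G :=
  ((B.form m).toDual (B.nondegenerate m)).symm (μ m)

/-- The vector field `v^μ(m) = X^M(m)`, where `X` is dual to `μ(m)`. -/
def momentField (B : LieAlgebraMetric (n := n) (d := d) G M)
    (μ : M → GroupLieAlgebra (𝓡 d) G →ₗ[ℝ] ℝ) (m : M) : TangentSpace (𝓡 n) m :=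
  inducedField (B.dual μ m) m

/-- A cutoff function: a smooth function `χ` on `M`, whose support has compact intersection with
every orbit, such that `∫_G χ(gx)^2 dg = 1` for all `x`. -/
structure IsCutoff [MeasurableSpace G] (haar : Measure G) (χ : M → ℝ) : Prop where
  smooth : ContMDiff (𝓡 n) 𝓘(ℝ, ℝ) ∞ χ
  compact : ∀ m, IsCompact (tsupport χ ∩ MulAction.orbit G m)
  integral : ∀ m, ∫ g, χ (g • m) ^ 2 ∂haar = 1

end Actions

/-! ## The Riemannian measure -/

section Measure

variable {n : ℕ} {M : Type*} [TopologicalSpace M] [ChartedSpace (EuclideanSpace ℝ (Fin n)) M]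
  [RiemannianBundle (fun x : M ↦ TangentSpace (𝓡 n) x)]

/-- The Gram matrix, at the point with coordinates `y` in the chart at `a`, of the coordinate
vector fields of that chart. -/
def chartGram (a : M) (y : EuclideanSpace ℝ (Fin n)) : Matrix (Fin n) (Fin n) ℝ :=
  let e := chartAt (EuclideanSpace ℝ (Fin n)) a
  let coord : Fin n → TangentSpace (𝓡 n) (e.symm y) := fun i ↦
    mfderiv (𝓡 n) (𝓡 n) e.symm y (EuclideanSpace.single i (1 : ℝ))
  Matrix.of fun i j ↦ inner ℝ (coord i) (coord j)

/-- The measure on the domain of the chart at `a` (extended by zero to `M`) which in coordinates is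
`√(det g) dy`. -/
def chartVolume [MeasurableSpace M] (a : M) : Measure M :=
  let e := chartAt (EuclideanSpace ℝ (Fin n)) a
  Measure.map e.symm ((volume.restrict e.target).withDensity
    fun y ↦ ENNReal.ofReal (Real.sqrt (chartGram a y).det))

/-- A choice of a smooth partition of unity subordinate to the domains of the charts. -/
def chartPartition (n : ℕ) (M : Type*) [TopologicalSpace M]
    [ChartedSpace (EuclideanSpace ℝ (Fin n)) M] [IsManifold (𝓡 n) ∞ M]
    [T2Space M] [SigmaCompactSpace M] : SmoothPartitionOfUnity M (𝓡 n) M Set.univ :=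
  (SmoothPartitionOfUnity.exists_isSubordinate_chartAt_source (𝓡 n) M).choose

variable (n M) in
/-- The Riemannian measure of `M`, glued from the measures `√(det g) dy` in charts by means of a
partition of unity (it does not depend on the partition of unity). -/
def riemannianMeasure [MeasurableSpace M] [IsManifold (𝓡 n) ∞ M] [T2Space M]
    [SigmaCompactSpace M] : Measure M :=
  Measure.sum fun a : M ↦
    (chartVolume (n := n) a).withDensity fun x ↦ ENNReal.ofReal (chartPartition n M a x)

end Measure

/-! ## Hermitian vector bundles and connections -/

section Bundles

variable {n d : ℕ}
  {G : Type*} [TopologicalSpace G] [Group G] [ChartedSpace (EuclideanSpace ℝ (Fin d)) G]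
  {M : Type*} [TopologicalSpace M] [ChartedSpace (EuclideanSpace ℝ (Fin n)) M] [MulAction G M]

section OneBundle

variable
  (F : Type*) [NormedAddCommGroup F] [NormedSpace ℂ F]
  {V : M → Type*} [TopologicalSpace (TotalSpace F V)]
  [∀ m, NormedAddCommGroup (V m)] [∀ m, InnerProductSpace ℂ (V m)]
  [FiberBundle F V]

/-- Smooth sections of the bundle `V` with model fibre `F`. -/
def IsSmoothSection (σ : ∀ m, V m) : Prop :=
  ContMDiff (𝓡 n) ((𝓡 n).prod 𝓘(ℝ, F)) ∞ (fun m ↦ TotalSpace.mk' F m (σ m))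

/-- Smooth vector bundle endomorphisms. -/
def IsSmoothEnd (T : ∀ m, V m →ₗ[ℂ] V m) : Prop :=
  ∀ σ : ∀ m, V m, IsSmoothSection (n := n) F σ → IsSmoothSection (n := n) F (fun m ↦ T m (σ m))

variable (d G V) in
/-- The structure of a `G`-equivariant Hermitian vector bundle on `V`: the Hermitian metric is
smooth, and `G` acts smoothly on the total space, by isometric complex linear maps
`V_m → V_{gm}`. -/
structure EquivariantStructure where
  metric_smooth : ∀ σ τ : ∀ m, V m, IsSmoothSection (n := n) F σ → IsSmoothSection (n := n) F τ →
    ContMDiff (𝓡 n) 𝓘(ℝ, ℂ) ∞ (fun m ↦ (inner ℂ (σ m) (τ m) : ℂ))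
  act : ∀ (g : G) (m : M), V m ≃ₗᵢ[ℂ] V (g • m)
  one_act : ∀ (m : M) (w : V m), (⟨1 • m, act (1 : G) m w⟩ : TotalSpace F V) = ⟨m, w⟩
  mul_act : ∀ (g k : G) (m : M) (w : V m),
    (⟨(g * k) • m, act (g * k) m w⟩ : TotalSpace F V) = ⟨g • k • m, act g (k • m) (act k m w)⟩
  smooth : ContMDiff ((𝓡 d).prod ((𝓡 n).prod 𝓘(ℝ, F))) ((𝓡 n).prod 𝓘(ℝ, F)) ∞
    (fun q : G × TotalSpace F V ↦
      (⟨q.1 • q.2.proj, act q.1 q.2.proj q.2.snd⟩ : TotalSpace F V))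

variable {F}

/-- The translate `m ↦ g⁻¹ (σ(gm))` of a section `σ`. -/
def EquivariantStructure.translate (a : EquivariantStructure (n := n) d G F V) (g : G)
    (σ : ∀ m, V m) (m : M) : V m :=
  (a.act g m).symm (σ (g • m))

/-- The Lie derivative `(L_X σ)(m) = d/dt|_{t=0} exp(tX) σ(exp(-tX) m)` of sections. It is
minus the derivative, at the identity in the direction `X`, of `g ↦ g⁻¹ (σ(gm)) ∈ V_m`. -/
def EquivariantStructure.lieDerivative (a : EquivariantStructure (n := n) d G F V)
    (X : GroupLieAlgebra (𝓡 d) G) (σ : ∀ m, V m) (m : M) : V m :=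
  -mvfderiv (𝓡 d) (fun g : G ↦ a.translate g σ m) 1 X

variable [IsManifold (𝓡 n) ∞ M] [VectorBundle ℝ F V]

/-- A smooth Hermitian connection on the Hermitian vector bundle `V`. -/
structure IsHermitianConnection (D : CovariantDerivative (𝓡 n) F V) : Prop where
  smooth : CovariantDerivative.ContMDiffCovariantDerivative D ∞
  complex_linear : ∀ (σ : ∀ m, V m), IsSmoothSection (n := n) F σ → ∀ m v,
    D (fun x ↦ Complex.I • σ x) m v = Complex.I • D σ m v
  hermitian : ∀ (σ τ : ∀ m, V m), IsSmoothSection (n := n) F σ → IsSmoothSection (n := n) F τ →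
    ∀ m v, mvfderiv (𝓡 n) (fun x ↦ inner ℂ (σ x) (τ x)) m v =
      inner ℂ (D σ m v) (τ m) + inner ℂ (σ m) (D τ m v)

/-- `G`-invariance of a connection. -/
def IsInvariantConnection (a : EquivariantStructure (n := n) d G F V)
    (D : CovariantDerivative (𝓡 n) F V) : Prop :=
  ∀ (g : G) (σ : ∀ m, V m), IsSmoothSection (n := n) F σ → ∀ m v,
    D (a.translate g σ) m v = (a.act g m).symm (D σ (g • m) (pushforward g m v))

/-- `μ` is the moment map of the connection `D` on the line bundle `V`:
`2πi ⟨μ, X⟩ = L_X - D_{X^M}` for all `X` in the Lie algebra. -/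
def IsMomentMap (a : EquivariantStructure (n := n) d G F V)
    (D : CovariantDerivative (𝓡 n) F V) (μ : M → GroupLieAlgebra (𝓡 d) G →ₗ[ℝ] ℝ) : Prop :=
  ∀ (X : GroupLieAlgebra (𝓡 d) G) (l : ∀ m, V m), IsSmoothSection (n := n) F l → ∀ m,
    (2 * Real.pi * Complex.I * (μ m X : ℂ)) • l m =
      a.lieDerivative X l m - D l m (inducedField X m)

end OneBundle

/-- Smooth vector fields. -/
def IsSmoothField [IsManifold (𝓡 n) ∞ M] (X : ∀ m : M, TangentSpace (𝓡 n) m) : Prop :=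
  ContMDiff (𝓡 n) (𝓡 n).tangent ∞ (fun m ↦ (⟨m, X m⟩ : TangentBundle (𝓡 n) M))

/-- The Levi-Civita connection: the torsion free connection on `TM` compatible with the metric. -/
structure IsLeviCivita [IsManifold (𝓡 n) ∞ M]
    [RiemannianBundle (fun x : M ↦ TangentSpace (𝓡 n) x)]
    (D : CovariantDerivative (𝓡 n) (EuclideanSpace ℝ (Fin n))
      (fun x : M ↦ TangentSpace (𝓡 n) x)) : Prop where
  smooth : CovariantDerivative.ContMDiffCovariantDerivative D ∞
  torsion_free : ∀ X Y : ∀ m : M, TangentSpace (𝓡 n) m, IsSmoothField X → IsSmoothField Y →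
    ∀ m, D Y m (X m) - D X m (Y m) = VectorField.mlieBracket (𝓡 n) X Y m
  metric : ∀ X Y : ∀ m : M, TangentSpace (𝓡 n) m, IsSmoothField X → IsSmoothField Y →
    ∀ m v, mvfderiv (𝓡 n) (fun x ↦ (inner ℝ (X x) (Y x) : ℝ)) m v =
      inner ℝ (D X m v) (Y m) + inner ℝ (X m) (D Y m v)

end Bundles

/-! ## Equivariant `Spin^c`-structures -/

section SpinC

variable {n d : ℕ}
  {G : Type*} [TopologicalSpace G] [Group G] [ChartedSpace (EuclideanSpace ℝ (Fin d)) G]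
  {M : Type*} [TopologicalSpace M] [ChartedSpace (EuclideanSpace ℝ (Fin n)) M] [MulAction G M]
  [IsManifold (𝓡 n) ∞ M] [RiemannianBundle (fun x : M ↦ TangentSpace (𝓡 n) x)]
  {FS : Type*} [NormedAddCommGroup FS] [NormedSpace ℂ FS]
  {S : M → Type*} [TopologicalSpace (TotalSpace FS S)]
  [∀ m, NormedAddCommGroup (S m)] [∀ m, InnerProductSpace ℂ (S m)]
  [FiberBundle FS S] [VectorBundle ℝ FS S]
  {FL : Type*} [NormedAddCommGroup FL] [NormedSpace ℂ FL]
  {L : M → Type*} [TopologicalSpace (TotalSpace FL L)]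
  [∀ m, NormedAddCommGroup (L m)] [∀ m, InnerProductSpace ℂ (L m)]
  [FiberBundle FL L] [VectorBundle ℝ FL L]

/-- A `G`-equivariant `Spin^c`-structure on the even-dimensional Riemannian manifold `M`, described
by its `ℤ/2`-graded spinor bundle `S` and its determinant line bundle `L`.

`S` is a Hermitian bundle of (irreducible, by the condition on its rank) modules over the Clifford
algebras of the tangent spaces, with `c(v)^2 = -‖v‖^2`. The grading operator, for which Clifford
multiplication is odd, encodes the orientation. The line bundle `L` is identified with the
determinant line bundle by the isometric bilinear pairing `S ⊗ S → L` induced by the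
`Spin`-invariant bilinear form on spinors; equivalently `L ≅ Hom_{Cliff(TM)}(S̄, S)`. -/
structure SpinCStructure (aS : EquivariantStructure (n := n) d G FS S)
    (aL : EquivariantStructure (n := n) d G FL L) where
  even_dim : Even n
  rank_spinor : Module.finrank ℂ FS = 2 ^ (n / 2)
  rank_det : Module.finrank ℂ FL = 1
  /-- Clifford multiplication -/
  c : ∀ m : M, TangentSpace (𝓡 n) m →ₗ[ℝ] (S m →ₗ[ℂ] S m)
  c_sq : ∀ m v (w : S m), c m v (c m v w) = -((‖v‖ ^ 2 : ℝ) : ℂ) • w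
  c_skew : ∀ m v (w z : S m), inner ℂ (c m v w) z = -inner ℂ w (c m v z)
  c_smooth : ∀ X : ∀ m : M, TangentSpace (𝓡 n) m, IsSmoothField X →
    IsSmoothEnd (n := n) FS (fun m ↦ c m (X m))
  c_equivariant : ∀ (g : G) m v (w : S m),
    aS.act g m (c m v w) = c (g • m) (pushforward g m v) (aS.act g m w)
  /-- the grading operator -/
  ε : ∀ m : M, S m →ₗ[ℂ] S m
  ε_sq : ∀ m (w : S m), ε m (ε m w) = w
  ε_selfadjoint : ∀ m (w z : S m), inner ℂ (ε m w) z = inner ℂ w (ε m z)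
  ε_odd : ∀ m v (w : S m), ε m (c m v w) = -c m v (ε m w)
  ε_smooth : IsSmoothEnd (n := n) FS ε
  ε_equivariant : ∀ (g : G) m (w : S m), aS.act g m (ε m w) = ε (g • m) (aS.act g m w)
  /-- the pairing of spinors with values in the determinant line bundle -/
  β : ∀ m : M, S m →ₗ[ℂ] S m →ₗ[ℂ] L m
  β_clifford : ∀ m v (w z : S m), β m (c m v w) z = β m w (c m v z)
  β_le : ∀ m (w z : S m), ‖β m w z‖ ≤ ‖w‖ * ‖z‖
  β_attained : ∀ m (w : S m), ∃ z : S m, ‖z‖ = 1 ∧ ‖β m w z‖ = ‖w‖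
  β_smooth : ∀ σ τ : ∀ m, S m, IsSmoothSection (n := n) FS σ → IsSmoothSection (n := n) FS τ →
    IsSmoothSection (n := n) FL (fun m ↦ β m (σ m) (τ m))
  β_equivariant : ∀ (g : G) m (w z : S m),
    aL.act g m (β m w z) = β (g • m) (aS.act g m w) (aS.act g m z)

variable {aS : EquivariantStructure (n := n) d G FS S}
  {aL : EquivariantStructure (n := n) d G FL L}

/-- The connection on the spinor bundle determined by the Levi-Civita connection `DT` on `TM` and
the connection `DL` on the determinant line bundle: the Hermitian Clifford connection which induces
`DL` on `L`. -/
structure IsSpinorConnection (P : SpinCStructure aS aL)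
    (DT : CovariantDerivative (𝓡 n) (EuclideanSpace ℝ (Fin n))
      (fun x : M ↦ TangentSpace (𝓡 n) x))
    (DL : CovariantDerivative (𝓡 n) FL L) (DS : CovariantDerivative (𝓡 n) FS S) : Prop where
  hermitian : IsHermitianConnection DS
  clifford : ∀ (X : ∀ m : M, TangentSpace (𝓡 n) m) (σ : ∀ m, S m), IsSmoothField X →
    IsSmoothSection (n := n) FS σ → ∀ m v,
    DS (fun x ↦ P.c x (X x) (σ x)) m v = P.c m (DT X m v) (σ m) + P.c m (X m) (DS σ m v)
  determinant : ∀ σ τ : ∀ m, S m, IsSmoothSection (n := n) FS σ →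
    IsSmoothSection (n := n) FS τ → ∀ m v,
    DL (fun x ↦ P.β x (σ x) (τ x)) m v = P.β m (DS σ m v) (τ m) + P.β m (σ m) (DS τ m v)

instance finiteDimensional_tangentSpace (m : M) : FiniteDimensional ℝ (TangentSpace (𝓡 n) m) :=
  inferInstanceAs (FiniteDimensional ℝ (EuclideanSpace ℝ (Fin n)))

/-- The `Spin^c`-Dirac operator `∑ᵢ c(eᵢ) ∇_{eᵢ}` on sections of `S`. -/
def dirac (P : SpinCStructure aS aL) (DS : CovariantDerivative (𝓡 n) FS S) (σ : ∀ m, S m)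
    (m : M) : S m :=
  let e := stdOrthonormalBasis ℝ (TangentSpace (𝓡 n) m)
  ∑ i, P.c m (e i) (DS σ m (e i))

/-- `Φ` is a `G`-equivariant Callias potential for the Dirac operator `D`, with constant `k`, outside
the set `Z`: a smooth, fibrewise self-adjoint, equivariant endomorphism such that `DΦ + ΦD` is a
vector bundle endomorphism and `DΦ + ΦD + Φ^2 ≥ k^2` fibrewise outside `Z`. -/
structure IsCalliasPotential (P : SpinCStructure aS aL) (DS : CovariantDerivative (𝓡 n) FS S)
    (Φ : ∀ m : M, S m →ₗ[ℂ] S m) (Z : Set M) (k : ℝ) : Prop where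
  smooth : IsSmoothEnd (n := n) FS Φ
  selfadjoint : ∀ m (w z : S m), inner ℂ (Φ m w) z = inner ℂ w (Φ m z)
  equivariant : ∀ (g : G) m (w : S m), aS.act g m (Φ m w) = Φ (g • m) (aS.act g m w)
  anticommutator : ∃ A : ∀ m : M, S m →ₗ[ℂ] S m,
    (∀ σ : ∀ m, S m, IsSmoothSection (n := n) FS σ → ∀ m,
      dirac P DS (fun x ↦ Φ x (σ x)) m + Φ m (dirac P DS σ m) = A m (σ m)) ∧
    ∀ m, m ∉ Z → ∀ w : S m, k ^ 2 * ‖w‖ ^ 2 ≤ (inner ℂ w (A m w + Φ m (Φ m w)) : ℂ).re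

/-! ## The twisted bundles `S ⊗ L^p` -/

/-- The fibre at `m` of `S ⊗ L^p`. -/
abbrev Twisted (S : M → Type*) [∀ m, NormedAddCommGroup (S m)] [∀ m, InnerProductSpace ℂ (S m)]
    (L : M → Type*) [∀ m, NormedAddCommGroup (L m)] [∀ m, InnerProductSpace ℂ (L m)]
    (p : ℕ) (m : M) : Type _ :=
  S m ⊗[ℂ] (⨂[ℂ] _ : Fin p, L m)

/-- Contraction `S_m ⊗ L_m^p → S_m` with `l ∈ L_m`, mapping `w ⊗ l₁ ⊗ ⋯ ⊗ l_p` to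
`⟨l, l₁⟩ ⋯ ⟨l, l_p⟩ w`. -/
def contract {p : ℕ} {m : M} (l : L m) : Twisted S L p m →ₗ[ℂ] S m :=
  (TensorProduct.rid ℂ (S m)).toLinearMap ∘ₗ
    LinearMap.lTensor (S m) (PiTensorProduct.lift
      ((MultilinearMap.mkPiAlgebra ℂ (Fin p) ℂ).compLinearMap fun _ ↦ innerₛₗ ℂ l))

/-- The Hermitian norm on `S_m ⊗ L_m^p`. As `L_m` is one-dimensional, contraction with any unit
vector of `L_m` is an isometry, so that the norm of `w ⊗ l^p` is `‖w‖ ‖l‖^p`. -/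
def twistedNorm {p : ℕ} {m : M} (z : Twisted S L p m) : ℝ :=
  ⨆ l : {l : L m // ‖l‖ = 1}, ‖contract l.1 z‖

/-- The section `s` equals `σ ⊗ l^p` near `m`, with `σ` and `l` smooth and `l(m) ≠ 0`. -/
def IsLocalForm (FS FL : Type*) [NormedAddCommGroup FS] [NormedSpace ℂ FS] [NormedAddCommGroup FL]
    [NormedSpace ℂ FL] {S : M → Type*} [TopologicalSpace (TotalSpace FS S)]
    [∀ m, NormedAddCommGroup (S m)] [∀ m, InnerProductSpace ℂ (S m)] [FiberBundle FS S]
    {L : M → Type*} [TopologicalSpace (TotalSpace FL L)]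
    [∀ m, NormedAddCommGroup (L m)] [∀ m, InnerProductSpace ℂ (L m)] [FiberBundle FL L]
    {p : ℕ} (s : ∀ m, Twisted S L p m) (m : M) (σ : ∀ m, S m) (l : ∀ m, L m) : Prop :=
  IsSmoothSection (n := n) FS σ ∧ IsSmoothSection (n := n) FL l ∧ l m ≠ 0 ∧
    ∀ᶠ x in 𝓝 m, s x = σ x ⊗ₜ[ℂ] PiTensorProduct.tprod ℂ (fun _ : Fin p ↦ l x)

variable {p : ℕ}

/-- Smooth sections of `S ⊗ L^p`: those that are locally of the form `σ ⊗ l^p`, with `σ` and `l`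
smooth and `l` nowhere vanishing (as `L` is a line bundle, this is no restriction). -/
def IsSmoothTwisted (FS FL : Type*) [NormedAddCommGroup FS] [NormedSpace ℂ FS]
    [NormedAddCommGroup FL] [NormedSpace ℂ FL]
    {S : M → Type*} [TopologicalSpace (TotalSpace FS S)]
    [∀ m, NormedAddCommGroup (S m)] [∀ m, InnerProductSpace ℂ (S m)] [FiberBundle FS S]
    {L : M → Type*} [TopologicalSpace (TotalSpace FL L)]
    [∀ m, NormedAddCommGroup (L m)] [∀ m, InnerProductSpace ℂ (L m)] [FiberBundle FL L]
    (s : ∀ m, Twisted S L p m) : Prop :=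
  ∀ m, ∃ σ l, IsLocalForm (n := n) FS FL s m σ l

/-- The action `S_m ⊗ L_m^p → S_{gm} ⊗ L_{gm}^p` of `g`. -/
def twistedAct (aS : EquivariantStructure (n := n) d G FS S)
    (aL : EquivariantStructure (n := n) d G FL L) (g : G) (m : M) :
    Twisted S L p m →ₗ[ℂ] Twisted S L p (g • m) :=
  TensorProduct.map (aS.act g m).toLinearEquiv.toLinearMap
    (PiTensorProduct.map fun _ ↦ (aL.act g m).toLinearEquiv.toLinearMap)

/-- The support of a section of `S ⊗ L^p`. -/
def sectionSupport (s : ∀ m, Twisted S L p m) : Set M := closure {m | s m ≠ 0}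

/-- The space `Γ^∞_tc(S ⊗ L^p)^G` of smooth, `G`-invariant, transversally compactly supported
sections of `S ⊗ L^p`. -/
structure IsInvariantTcSection (aS : EquivariantStructure (n := n) d G FS S)
    (aL : EquivariantStructure (n := n) d G FL L) (s : ∀ m, Twisted S L p m) : Prop where
  smooth : IsSmoothTwisted (n := n) FS FL s
  invariant : ∀ (g : G) m, s (g • m) = twistedAct aS aL g m (s m)
  cocompact : IsCocompact G (sectionSupport s)

open Classical in
/-- The connection on `S ⊗ L^p` induced by connections on `S` and `L`: if `s = σ ⊗ l^p` near `m`,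
then `∇_v s (m) = (∇_v σ) ⊗ l^p + ∑ⱼ σ ⊗ (l ⊗ ⋯ ⊗ ∇_v l ⊗ ⋯ ⊗ l)`, with `∇_v l` in the `j`-th
place. The value does not depend on the choice of `σ` and `l`. -/
def twistedConnection (DS : CovariantDerivative (𝓡 n) FS S) (DL : CovariantDerivative (𝓡 n) FL L)
    (s : ∀ m, Twisted S L p m) (m : M) (v : TangentSpace (𝓡 n) m) : Twisted S L p m :=
  if h : ∃ q : (∀ m, S m) × (∀ m, L m), IsLocalForm (n := n) FS FL s m q.1 q.2 then
    let σ := h.choose.1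
    let l := h.choose.2
    DS σ m v ⊗ₜ[ℂ] PiTensorProduct.tprod ℂ (fun _ : Fin p ↦ l m) +
      ∑ j : Fin p, σ m ⊗ₜ[ℂ]
        PiTensorProduct.tprod ℂ (Function.update (fun _ : Fin p ↦ l m) j (DL l m v))
  else 0

/-- The endomorphism `T ⊗ 1` of `S_m ⊗ L_m^p`. -/
def onSpinors {m : M} (T : S m →ₗ[ℂ] S m) : Twisted S L p m →ₗ[ℂ] Twisted S L p m :=
  LinearMap.rTensor _ T

/-- The `Spin^c`-Dirac operator on sections of `S ⊗ L^p`. -/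
def twistedDirac (P : SpinCStructure aS aL) (DS : CovariantDerivative (𝓡 n) FS S)
    (DL : CovariantDerivative (𝓡 n) FL L) (s : ∀ m, Twisted S L p m) (m : M) :
    Twisted S L p m :=
  let e := stdOrthonormalBasis ℝ (TangentSpace (𝓡 n) m)
  ∑ i, onSpinors (P.c m (e i)) (twistedConnection DS DL s m (e i))

/-- The deformed Dirac operator `D + t (h Φ - i f c(v))` on sections of `S ⊗ L^p`. -/
def deformedDirac (P : SpinCStructure aS aL) (DS : CovariantDerivative (𝓡 n) FS S)
    (DL : CovariantDerivative (𝓡 n) FL L) (Φ : ∀ m : M, S m →ₗ[ℂ] S m)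
    (v : ∀ m : M, TangentSpace (𝓡 n) m) (f h : M → ℝ) (t : ℝ)
    (s : ∀ m, Twisted S L p m) (m : M) : Twisted S L p m :=
  twistedDirac P DS DL s m +
    (t : ℂ) • ((h m : ℂ) • onSpinors (Φ m) (s m) -
      (Complex.I * (f m : ℂ)) • onSpinors (P.c m (v m)) (s m))

/-- The square `‖χ s‖^2` of the `L^2`-norm of `χ s`. -/
def cutoffL2NormSq (n : ℕ) {M : Type*} [TopologicalSpace M]
    [ChartedSpace (EuclideanSpace ℝ (Fin n)) M] [IsManifold (𝓡 n) ∞ M] [T2Space M]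
    [SigmaCompactSpace M] [MeasurableSpace M]
    [RiemannianBundle (fun x : M ↦ TangentSpace (𝓡 n) x)]
    {S : M → Type*} [∀ m, NormedAddCommGroup (S m)] [∀ m, InnerProductSpace ℂ (S m)]
    {L : M → Type*} [∀ m, NormedAddCommGroup (L m)] [∀ m, InnerProductSpace ℂ (L m)]
    {p : ℕ} (χ : M → ℝ) (s : ∀ m, Twisted S L p m) : ℝ :=
  ∫ m, twistedNorm ((χ m : ℂ) • s m) ^ 2 ∂(riemannianMeasure n M)

/-- The square `‖χ s‖_{W¹}^2 = ‖χ D s‖^2 + ‖χ s‖^2` of the first Sobolev norm of `χ s`. -/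
def cutoffW1NormSq [T2Space M] [SigmaCompactSpace M] [MeasurableSpace M]
    (P : SpinCStructure aS aL) (DS : CovariantDerivative (𝓡 n) FS S)
    (DL : CovariantDerivative (𝓡 n) FL L) (χ : M → ℝ) (s : ∀ m, Twisted S L p m) : ℝ :=
  cutoffL2NormSq n χ (twistedDirac P DS DL s) + cutoffL2NormSq n χ s

end SpinC

end

end CalliasLocalisation

open CalliasLocalisation

/-! Write `D` for the Dirac operator on `S ⊗ L^p`. Outside `U` the function `h` is a constant `a`,
so on the sections considered the deformed operator is `D + tΨ` with `Ψ = aΦ - i f c(v^μ)` a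
self-adjoint endomorphism (`deformation`), and no derivative of `h` appears. Pointwise, `‖Ds + tΨs‖²
= ‖Ds‖² + 2t Re⟨Ds, Ψs⟩ + t²‖Ψs‖²`. The cross term satisfies `2 Re⟨Ds, Ψs⟩ = E + div u`, where `E =
Re⟨Ds, Ψs⟩ + Re⟨s, DΨs⟩` (`anticommutatorForm`) and `u` is the vector field with `⟨u, w⟩ = Re⟨c(w)s,
Ψs⟩` (`divergence_twistedCurrent`). This field is invariant with cocompact support, so its
divergence integrates to zero against a cutoff function (`integral_mul_divergence_eq_zero`). Hence
the pointwise bound `E + t‖Ψs‖² ≥ ‖s‖²` off `U` integrates to the desired estimate, with `C = b = 1`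
(`cutoffW1NormSq_add_le`).

The pointwise bound is `exists_deformation_estimate`. Since `{D, Φ}` has order zero, `Φ`
anticommutes with Clifford multiplication. Therefore `‖Ψs‖² ≥ a²‖Φs‖²`, and the twist by `L^p` does
not change `{D, Φ}`. On `S`, the operator `{D, c(f X^M)} + 2f L_X` also has order zero. On an
invariant section of `S ⊗ L^p` the Lie derivative of the spinor part is governed by the line bundle,
and the definition of the moment map turns it into a term `4πp f⟨μ, X⟩` (`contract_anticommutator`).
With `X` dual to `μ` this gives `E = a⟨s, {D, Φ}s⟩ + ⟨s, Rs⟩ + 4πp f‖μ‖²‖s‖²`, where the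
endomorphism `R` of `S` is independent of `a`, `p` and `t`, and vanishes off the support of `f`.
Outside `Z`, the Callias condition contributes `a k²`, which absorbs `R` once `a` is large. On `Z`
outside `U`, one has `f = 1` and `‖μ‖²` is bounded below, so a large `p` absorbs both `a{D, Φ}` and
`R`. Cocompactness and invariance reduce all bounds to compact sets.

The remaining work supplies the foundations. The connection on `S` is not assumed invariant; this
follows from invariance of the Levi-Civita connection, irreducibility of spinors and the determinant
condition (`IsSpinorConnection.translate`). The Riemannian measure, glued from charts, is shown to
be invariant under isometries (`lintegral_riemannianMeasure_comp`) and to satisfy the divergence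
theorem (`integral_divergence_eq_zero`). Unimodularity makes averages over orbits invariant and Haar
measure invariant under inversion; this allows `χ²` to be replaced by a compactly supported weight
adapted to `s` (`cutoffL2NormSq_eq`). -/

namespace CalliasLocalisation

noncomputable section

set_option linter.unusedSectionVars false

/-! ## Irreducibility of Clifford modules of minimal dimension -/

section CliffordModule

/-- Induction on the number of pairs of generators. With `a₁`, `a₂` the last pair, `ω = i a₁ a₂` is
an involution that anticommutes with `a₁` and commutes with all other generators. Thus `a₁` carries
the `+1` eigenspace of `ω` to a disjoint space of the same dimension, and the eigenspace, of at most
half the dimension, is a module for the remaining `2q` generators. -/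
theorem two_pow_le_finrank_of_anticommuting (q : ℕ) :
    ∀ {V : Type*} [AddCommGroup V] [Module ℂ V] [FiniteDimensional ℂ V] [Nontrivial V]
      (a : ℕ → V →ₗ[ℂ] V), (∀ i < 2 * q, ∀ x, a i (a i x) = -x) →
      (∀ i < 2 * q, ∀ j < 2 * q, i ≠ j → ∀ x, a i (a j x) = -a j (a i x)) →
      2 ^ q ≤ Module.finrank ℂ V := by
  induction q with
  | zero =>
    intro V _ _ _ _ a _ _
    simpa using Nat.succ_le_of_lt (Module.finrank_pos (R := ℂ) (M := V))
  | succ q ih =>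
    intro V _ _ _ _ a hsq hanti
    set a₁ := a (2 * q) with ha₁
    set a₂ := a (2 * q + 1) with ha₂
    have s₁ : ∀ x, a₁ (a₁ x) = -x := hsq _ (by omega)
    have s₂ : ∀ x, a₂ (a₂ x) = -x := hsq _ (by omega)
    have h₁₂ : ∀ x, a₁ (a₂ x) = -a₂ (a₁ x) := hanti _ (by omega) _ (by omega) (by omega)
    have hI : Complex.I * Complex.I = -1 := Complex.I_mul_I
    let om : V →ₗ[ℂ] V := Complex.I • (a₁ ∘ₗ a₂)
    have hom : ∀ x, om x = Complex.I • a₁ (a₂ x) := fun x ↦ rfl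
    have homom : ∀ x, om (om x) = x := fun x ↦ by
      simp only [hom, map_smul, smul_smul, hI]
      rw [h₁₂ (a₁ (a₂ x)), s₁, map_neg, s₂]
      simp
    have homa : ∀ x, om (a₁ x) = -a₁ (om x) := fun x ↦ by
      simp only [hom, map_smul]
      rw [← smul_neg, ← map_neg, h₁₂ x, neg_neg]
    let Vp : Submodule ℂ V := LinearMap.ker (om - LinearMap.id)
    have memp : ∀ x, x ∈ Vp ↔ om x = x := fun x ↦ by
      simp [Vp, LinearMap.mem_ker, sub_eq_zero]
    have inj : Function.Injective a₁ := fun x y h ↦ by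
      have := congrArg a₁ h
      rw [s₁, s₁] at this
      exact neg_injective this
    have disj : Disjoint Vp (Vp.map a₁) := by
      rw [Submodule.disjoint_def]
      rintro y hy ⟨x, hx, rfl⟩
      have h := (memp _).1 hy
      rw [homa, (memp x).1 hx] at h
      have h2 : (2 : ℂ) • a₁ x = 0 := by rw [two_smul]; nth_rewrite 1 [← h]; simp
      exact (smul_eq_zero.1 h2).resolve_left two_ne_zero
    have hdim := Submodule.finrank_add_finrank_le_of_disjoint disj
    rw [← (Submodule.equivMapOfInjective a₁ inj Vp).finrank_eq] at hdim
    -- Both `x + ω x` and `a₁ (x - ω x)` are fixed by `ω`; if the eigenspace were zero they would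
    -- vanish, forcing `2x = 0`.
    have hnt : Nontrivial Vp := by
      obtain ⟨x, hx⟩ := exists_ne (0 : V)
      rw [Submodule.nontrivial_iff_ne_bot]
      intro hbot
      have h1 : x + om x ∈ Vp := by rw [memp, map_add, homom, add_comm]
      have h2 : a₁ (x - om x) ∈ Vp := by rw [memp, homa, map_sub, homom, ← map_neg, neg_sub]
      rw [hbot, Submodule.mem_bot] at h1 h2
      have h3 : x - om x = 0 := inj (by rw [h2, map_zero])
      have : (2 : ℂ) • x = 0 := by
        rw [two_smul]
        calc x + x = (x + om x) + (x - om x) := by abel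
          _ = 0 := by rw [h1, h3, add_zero]
      exact hx ((smul_eq_zero.1 this).resolve_left two_ne_zero)
    have comm : ∀ i < 2 * q, ∀ x, om (a i x) = a i (om x) := fun i hi x ↦ by
      simp only [hom, map_smul]
      rw [hanti (2 * q + 1) (by omega) i (by omega) (by omega), map_neg,
        hanti (2 * q) (by omega) i (by omega) (by omega), neg_neg]
    have inv : ∀ i < 2 * q, ∀ x ∈ Vp, a i x ∈ Vp := fun i hi x hx ↦ by
      rw [memp, comm i hi, (memp x).1 hx]
    classical
    -- Generators are indexed by `ℕ` with only the first `2q` constrained, so the irrelevant ones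
    -- may be set to zero.
    let b : ℕ → Vp →ₗ[ℂ] Vp := fun i ↦ if hi : i < 2 * q then (a i).restrict (inv i hi) else 0
    have hb : ∀ i < 2 * q, ∀ x : Vp, ((b i x : Vp) : V) = a i x := fun i hi x ↦ by
      simp [b, hi]
    have := ih b (fun i hi x ↦ Subtype.ext (by
        rw [hb i hi, hb i hi, hsq i (by omega)]; rfl))
      (fun i hi j hj hij x ↦ Subtype.ext (by
        rw [hb i hi, hb j hj, Submodule.coe_neg, hb j hj, hb i hi]
        exact hanti i (by omega) j (by omega) hij x))
    rw [pow_succ]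
    omega

/-- On a Clifford module of minimal dimension, only scalars commute with Clifford
multiplication. -/
theorem exists_eq_smul_of_commute_clifford {n : ℕ} (hn : Even n)
    {E : Type*} [NormedAddCommGroup E] [InnerProductSpace ℝ E]
    (e : OrthonormalBasis (Fin n) ℝ E)
    {V : Type*} [AddCommGroup V] [Module ℂ V] (hV : Module.finrank ℂ V = 2 ^ (n / 2))
    (c : E →ₗ[ℝ] (V →ₗ[ℂ] V))
    (hc : ∀ v w x, c v (c w x) + c w (c v x) = -((2 * inner ℝ v w : ℝ) : ℂ) • x)
    (T : V →ₗ[ℂ] V) (hT : ∀ v x, T (c v x) = c v (T x)) :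
    ∃ r : ℂ, ∀ x, T x = r • x := by
  have hfin : FiniteDimensional ℂ V :=
    FiniteDimensional.of_finrank_pos (by rw [hV]; positivity)
  have hnt : Nontrivial V :=
    Module.nontrivial_of_finrank_pos (R := ℂ) (by rw [hV]; positivity)
  -- Schur's lemma: an eigenspace of `T` is a nonzero Clifford submodule, so by the dimension bound
  -- it is already all of `V`.
  obtain ⟨r, hr⟩ := Module.End.exists_eigenvalue (K := ℂ) (V := V) T
  refine ⟨r, ?_⟩
  let K : Submodule ℂ V := LinearMap.ker (T - r • LinearMap.id)
  have memK : ∀ x, x ∈ K ↔ T x = r • x := fun x ↦ by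
    simp [K, LinearMap.mem_ker, sub_eq_zero]
  obtain ⟨x₀, hx₀⟩ := hr.exists_hasEigenvector
  have hKnt : Nontrivial K :=
    ⟨⟨⟨x₀, (memK x₀).2 hx₀.apply_eq_smul⟩, 0, fun h ↦ hx₀.2 (congrArg Subtype.val h)⟩⟩
  have inv : ∀ v, ∀ x ∈ K, c v x ∈ K := fun v x hx ↦ by
    rw [memK, hT, (memK x).1 hx, map_smul]
  classical
  let b : ℕ → K →ₗ[ℂ] K := fun i ↦
    if hi : i < n then (c (e ⟨i, hi⟩)).restrict (inv _) else 0
  have hb : ∀ i (hi : i < n) (x : K), ((b i x : K) : V) = c (e ⟨i, hi⟩) x := fun i hi x ↦ by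
    simp [b, hi]
  have h2 : 2 * (n / 2) = n := Nat.two_mul_div_two_of_even hn
  have key := two_pow_le_finrank_of_anticommuting (n / 2) b
    (fun i hi x ↦ Subtype.ext (by
      rw [h2] at hi
      rw [hb i hi, hb i hi, Submodule.coe_neg]
      have h := hc (e ⟨i, hi⟩) (e ⟨i, hi⟩) (x : V)
      rw [real_inner_self_eq_norm_sq, e.norm_eq_one, ← two_smul ℂ] at h
      have h' : (2 : ℂ) • (c (e ⟨i, hi⟩) (c (e ⟨i, hi⟩) (x : V))) = (2 : ℂ) • (-(x : V)) := by
        rw [h]; push_cast; simp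
      exact smul_right_injective V (two_ne_zero (α := ℂ)) h'))
    (fun i hi j hj hij x ↦ Subtype.ext (by
      rw [h2] at hi hj
      rw [hb i hi, hb j hj, Submodule.coe_neg, hb j hj, hb i hi]
      have h := hc (e ⟨i, hi⟩) (e ⟨j, hj⟩) (x : V)
      rw [e.inner_eq_zero (by simpa using hij)] at h
      rw [eq_neg_iff_add_eq_zero, h]
      simp))
  have htop : K = ⊤ := Submodule.eq_top_of_finrank_eq
    (le_antisymm (Submodule.finrank_le K) (by rw [hV]; exact key))
  intro x
  exact (memK x).1 (htop ▸ Submodule.mem_top)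

end CliffordModule

/-! ## The fibres of the twisted bundles -/

section TwistedFibre

variable {M : Type*} {S : M → Type*} [∀ m, NormedAddCommGroup (S m)]
  [∀ m, InnerProductSpace ℂ (S m)] {L : M → Type*} [∀ m, NormedAddCommGroup (L m)]
  [∀ m, InnerProductSpace ℂ (L m)] {p : ℕ} {m : M}

theorem contract_tmul_tprod (l : L m) (w : S m) (y : Fin p → L m) :
    contract l (w ⊗ₜ[ℂ] PiTensorProduct.tprod ℂ y) = (∏ j, inner ℂ l (y j)) • w := by
  simp [contract]

theorem eq_inner_smul_of_finrank_eq_one {E : Type*} [NormedAddCommGroup E]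
    [InnerProductSpace ℂ E] (hE : Module.finrank ℂ E = 1) {l : E} (hl : ‖l‖ = 1) (y : E) :
    y = (inner ℂ l y : ℂ) • l := by
  have hl0 : l ≠ 0 := fun h ↦ by simp [h] at hl
  obtain ⟨a, rfl⟩ := (finrank_eq_one_iff_of_nonzero' l hl0).1 hE y
  rw [inner_smul_right, inner_self_eq_norm_sq_to_K, hl]
  simp

/-- In a line, every `y j` equals `⟨l, y j⟩ l`, so each tensor is a spinor times `l^p`. Contraction
with a unit vector is therefore an isomorphism onto `S m`, and all identities in `S ⊗ L^p` can be
checked in `S`. -/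
theorem tmul_contract (hL : Module.finrank ℂ (L m) = 1) {l : L m} (hl : ‖l‖ = 1)
    (z : Twisted S L p m) :
    contract l z ⊗ₜ[ℂ] PiTensorProduct.tprod ℂ (fun _ : Fin p ↦ l) = z := by
  induction z using TensorProduct.induction_on with
  | zero => simp
  | add x y hx hy => rw [map_add, TensorProduct.add_tmul, hx, hy]
  | tmul w x =>
    induction x using PiTensorProduct.induction_on with
    | add x y hx hy =>
      rw [TensorProduct.tmul_add, map_add, TensorProduct.add_tmul, hx, hy]
    | smul_tprod r y =>
      have : y = fun j ↦ (inner ℂ l (y j) : ℂ) • l :=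
        funext fun j ↦ eq_inner_smul_of_finrank_eq_one hL hl (y j)
      rw [TensorProduct.tmul_smul, map_smul, contract_tmul_tprod]
      conv_rhs => rw [this]
      rw [MultilinearMap.map_smul_univ, TensorProduct.smul_tmul', TensorProduct.tmul_smul,
        TensorProduct.smul_tmul', smul_comm]

theorem contract_injective (hL : Module.finrank ℂ (L m) = 1) {l : L m} (hl : ‖l‖ = 1)
    {z z' : Twisted S L p m} (h : contract l z = contract l z') : z = z' := by
  rw [← tmul_contract hL hl z, ← tmul_contract hL hl z', h]

theorem contract_tmul_tprod_self {l : L m} (hl : ‖l‖ = 1) (w : S m) :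
    contract l (w ⊗ₜ[ℂ] PiTensorProduct.tprod ℂ (fun _ : Fin p ↦ l)) = w := by
  rw [contract_tmul_tprod]
  simp [inner_self_eq_norm_sq_to_K, hl]

theorem contract_onSpinors (l : L m) (T : S m →ₗ[ℂ] S m) (z : Twisted S L p m) :
    contract l (onSpinors T z) = T (contract l z) := by
  induction z using TensorProduct.induction_on with
  | zero => simp
  | add x y hx hy => rw [map_add, map_add, map_add, map_add, hx, hy]
  | tmul w x => simp [contract, onSpinors]

theorem onSpinors_tmul (T : S m →ₗ[ℂ] S m) (w : S m) (x : ⨂[ℂ] _ : Fin p, L m) :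
    onSpinors T (w ⊗ₜ[ℂ] x) = T w ⊗ₜ[ℂ] x := by
  simp [onSpinors]

/-- For unit vectors `l` and `l'` of a line, the contractions differ by a phase. -/
theorem exists_contract_eq (hL : Module.finrank ℂ (L m) = 1) {l l' : L m} (hl : ‖l‖ = 1)
    (hl' : ‖l'‖ = 1) :
    ∃ u : ℂ, ‖u‖ = 1 ∧ ∀ z : Twisted S L p m, contract l' z = u • contract l z := by
  refine ⟨∏ _j : Fin p, inner ℂ l' l, ?_, fun z ↦ ?_⟩
  · have h : ‖(inner ℂ l' l : ℂ)‖ = 1 := by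
      have := congrArg norm (eq_inner_smul_of_finrank_eq_one hL hl' l)
      rw [norm_smul, hl, hl', mul_one] at this
      exact this.symm
    rw [norm_prod, h]
    simp
  · conv_lhs => rw [← tmul_contract hL hl z]
    rw [contract_tmul_tprod]

theorem norm_contract_eq (hL : Module.finrank ℂ (L m) = 1) {l l' : L m} (hl : ‖l‖ = 1)
    (hl' : ‖l'‖ = 1) (z : Twisted S L p m) : ‖contract l' z‖ = ‖contract l z‖ := by
  obtain ⟨u, hu, h⟩ := exists_contract_eq (S := S) (p := p) hL hl hl'
  rw [h, norm_smul, hu, one_mul]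

/-- The supremum defining the norm runs over a constant family, as contractions with different unit
vectors differ by a phase. -/
theorem twistedNorm_eq (hL : Module.finrank ℂ (L m) = 1) {l : L m} (hl : ‖l‖ = 1)
    (z : Twisted S L p m) : twistedNorm z = ‖contract l z‖ := by
  have : Nonempty {l : L m // ‖l‖ = 1} := ⟨⟨l, hl⟩⟩
  rw [twistedNorm, iSup_congr fun l' : {l : L m // ‖l‖ = 1} ↦ norm_contract_eq hL hl l'.2 z]
  exact ciSup_const

theorem exists_norm_eq_one_of_finrank (hL : Module.finrank ℂ (L m) = 1) :
    ∃ l : L m, ‖l‖ = 1 := by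
  have : Nontrivial (L m) := Module.nontrivial_of_finrank_pos (R := ℂ) (by rw [hL]; simp)
  exact exists_norm_eq (L m) zero_le_one

/-- The real inner product on `S_m ⊗ L_m^p`, computed by contraction with a unit vector. -/
def twistedInner (z z' : Twisted S L p m) : ℝ :=
  open Classical in
  if h : ∃ l : L m, ‖l‖ = 1 then
    (inner ℂ (contract h.choose z) (contract h.choose z') : ℂ).re else 0

theorem twistedInner_eq (hL : Module.finrank ℂ (L m) = 1) {l : L m} (hl : ‖l‖ = 1)
    (z z' : Twisted S L p m) :
    twistedInner z z' = (inner ℂ (contract l z) (contract l z') : ℂ).re := by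
  have h : ∃ l : L m, ‖l‖ = 1 := ⟨l, hl⟩
  rw [twistedInner, dif_pos h]
  obtain ⟨u, hu, hu'⟩ := exists_contract_eq (S := S) (p := p) hL hl h.choose_spec
  rw [hu', hu', inner_smul_left, inner_smul_right, ← mul_assoc, ← Complex.normSq_eq_conj_mul_self,
    Complex.normSq_eq_norm_sq, hu]
  simp

theorem twistedNorm_sq (hL : Module.finrank ℂ (L m) = 1) (z : Twisted S L p m) :
    twistedNorm z ^ 2 = twistedInner z z := by
  obtain ⟨l, hl⟩ := exists_norm_eq_one_of_finrank hL
  rw [twistedNorm_eq hL hl, twistedInner_eq hL hl, inner_self_eq_norm_sq_to_K]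
  norm_cast

end TwistedFibre

/-! ## Smooth sections: cutting off, extending, and frames -/

section SmoothSections

variable {n : ℕ} {M : Type*} [TopologicalSpace M] [ChartedSpace (EuclideanSpace ℝ (Fin n)) M]
  [IsManifold (𝓡 n) ∞ M] [T2Space M]

theorem exists_cutoff {m₀ : M} {N : Set M} (hN : N ∈ 𝓝 m₀) :
    ∃ ρ : M → ℝ, ContMDiff (𝓡 n) 𝓘(ℝ, ℝ) ∞ ρ ∧ HasCompactSupport ρ ∧ tsupport ρ ⊆ N ∧
      (∀ᶠ x in 𝓝 m₀, ρ x = 1) ∧ (∀ x, 0 ≤ ρ x) ∧ ∀ x, ρ x ≤ 1 := by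
  obtain ⟨ρ, -, h⟩ := (SmoothBumpFunction.nhds_basis_tsupport (I := 𝓡 n) m₀).mem_iff.1 hN
  exact ⟨ρ, ρ.contMDiff, ρ.hasCompactSupport, h, ρ.eventuallyEq_one, fun x ↦ ρ.nonneg,
    fun x ↦ ρ.le_one⟩

variable {F : Type*} [NormedAddCommGroup F] [NormedSpace ℝ F]
  {V : M → Type*} [TopologicalSpace (TotalSpace F V)]
  [∀ m, AddCommGroup (V m)] [∀ m, Module ℝ (V m)] [∀ m, TopologicalSpace (V m)]
  [FiberBundle F V] [VectorBundle ℝ F V]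

/-- Connections act on sections defined on all of `M`. Local frames and local formulas are made
global by a cutoff that does not change the germ at `m₀`, and connections are local. -/
theorem exists_section_eventuallyEq {m₀ : M} {N : Set M} (hN : N ∈ 𝓝 m₀) {s : ∀ m, V m}
    (hs : ContMDiffOn (𝓡 n) ((𝓡 n).prod 𝓘(ℝ, F)) ∞ (fun m ↦ TotalSpace.mk' F m (s m)) N) :
    ∃ s' : ∀ m, V m,
      ContMDiff (𝓡 n) ((𝓡 n).prod 𝓘(ℝ, F)) ∞ (fun m ↦ TotalSpace.mk' F m (s' m)) ∧
      ∀ᶠ x in 𝓝 m₀, s' x = s x := by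
  obtain ⟨ρ, hρ, -, hρN, hρ1, -, -⟩ := exists_cutoff (n := n) (interior_mem_nhds.2 hN)
  refine ⟨fun m ↦ ρ m • s m, ?_, hρ1.mono fun x hx ↦ by simp only [hx, one_smul]⟩
  exact ContMDiffOn.smul_section_of_tsupport (u := interior N) hρ.contMDiffOn isOpen_interior hρN
    (hs.mono interior_subset)

theorem exists_function_eventuallyEq {E : Type*} [NormedAddCommGroup E] [NormedSpace ℝ E]
    {m₀ : M} {N : Set M} (hN : N ∈ 𝓝 m₀) {u : M → E} (hu : ContMDiffOn (𝓡 n) 𝓘(ℝ, E) ∞ u N) :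
    ∃ u' : M → E, ContMDiff (𝓡 n) 𝓘(ℝ, E) ∞ u' ∧ ∀ᶠ x in 𝓝 m₀, u' x = u x := by
  obtain ⟨ρ, hρ, -, hρN, hρ1, -, -⟩ := exists_cutoff (n := n) (interior_mem_nhds.2 hN)
  refine ⟨fun m ↦ ρ m • u m, ?_, hρ1.mono fun x hx ↦ by simp only [hx, one_smul]⟩
  refine contMDiff_of_tsupport fun x hx ↦ ?_
  have hx' := hρN (tsupport_smul_subset_left ρ u hx)
  exact (hρ x).smul (hu.contMDiffAt (mem_interior_iff_mem_nhds.1 hx'))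

theorem exists_section_apply_eq [ContMDiffVectorBundle ∞ F V (𝓡 n)] {m₀ : M} (w : V m₀) :
    ∃ s : ∀ m, V m,
      ContMDiff (𝓡 n) ((𝓡 n).prod 𝓘(ℝ, F)) ∞ (fun m ↦ TotalSpace.mk' F m (s m)) ∧ s m₀ = w := by
  obtain ⟨N, hN, h⟩ := FiberBundle.exists_contMDiffOn_extend (k := ∞) (𝓡 n) F w
  obtain ⟨s, hs, hs'⟩ := exists_section_eventuallyEq hN h
  exact ⟨s, hs, by rw [hs'.self_of_nhds]; simp⟩

/-- Local frames of global smooth sections, with smooth coefficients. -/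
theorem exists_frame [ContMDiffVectorBundle ∞ F V (𝓡 n)] [FiniteDimensional ℝ F] (m₀ : M) :
    ∃ (r : ℕ) (s : Fin r → ∀ m, V m) (a : Fin r → ∀ m, V m →ₗ[ℝ] ℝ) (N : Set M),
      IsOpen N ∧ m₀ ∈ N ∧
      (∀ i, ContMDiff (𝓡 n) ((𝓡 n).prod 𝓘(ℝ, F)) ∞ (fun m ↦ TotalSpace.mk' F m (s i m))) ∧
      (∀ x ∈ N, ∀ w : V x, ∑ i, a i x w • s i x = w) ∧
      (∀ x ∈ N, LinearIndependent ℝ fun i ↦ s i x) ∧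
      ∀ σ : ∀ m, V m,
        ContMDiff (𝓡 n) ((𝓡 n).prod 𝓘(ℝ, F)) ∞ (fun m ↦ TotalSpace.mk' F m (σ m)) →
        ∃ u : Fin r → M → ℝ, (∀ i, ContMDiff (𝓡 n) 𝓘(ℝ, ℝ) ∞ (u i)) ∧
          ∀ x ∈ N, ∀ i, u i x = a i x (σ x) := by
  have : ContMDiffVectorBundle 1 F V (𝓡 n) := ContMDiffVectorBundle.of_le (n := ∞) (by simp)
  let e := trivializationAt F V m₀
  have he : e.baseSet ∈ 𝓝 m₀ :=
    e.open_baseSet.mem_nhds (FiberBundle.mem_baseSet_trivializationAt F V m₀)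
  let b := Module.finBasis ℝ F
  obtain ⟨ρ, hρ, -, hρN, hρ1, -, -⟩ := exists_cutoff (n := n) he
  obtain ⟨N, hN1, hNo, hmN⟩ := eventually_nhds_iff.1 (hρ1.and he)
  have hfr := e.isLocalFrameOn_localFrame_baseSet (𝓡 n) ∞ b
  refine ⟨_, fun i m ↦ ρ m • e.localFrame b i m, fun i ↦ e.localFrameCoeff (𝓡 n) b i, N, hNo, hmN,
    fun i ↦ ?_, fun x hx w ↦ ?_, fun x hx ↦ ?_, fun σ hσ ↦ ?_⟩
  · exact ContMDiffOn.smul_section_of_tsupport (u := e.baseSet) hρ.contMDiffOn e.open_baseSet hρN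
      (hfr.contMDiffOn i)
  · obtain ⟨h1, h2⟩ := hN1 x hx
    simp only [h1, one_smul]
    classical
    -- The expansion in a frame is available for sections, so the vector `w` is viewed as the
    -- section equal to `w` at `x` and zero elsewhere.
    have := e.eq_sum_localFrameCoeff_smul (I := 𝓡 n) (b := b) (s := fun y ↦
      if h : y = x then (h ▸ w : V y) else 0) h2
    simpa using this.symm
  · obtain ⟨h1, h2⟩ := hN1 x hx
    simp only [h1, one_smul]
    exact hfr.linearIndependent h2
  · have hc := fun i ↦ contMDiffOn_baseSet_localFrameCoeff (e := e) (I := 𝓡 n)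
      (k := ∞) b hσ.contMDiffOn i
    refine ⟨fun i m ↦ ρ m • e.localFrameCoeff (𝓡 n) b i m (σ m), fun i ↦ ?_, fun x hx i ↦ ?_⟩
    · refine contMDiff_of_tsupport fun x hx ↦ ?_
      have hx' := hρN (tsupport_smul_subset_left ρ _ hx)
      exact (hρ x).smul ((hc i).contMDiffAt (e.open_baseSet.mem_nhds hx'))
    · obtain ⟨h1, h2⟩ := hN1 x hx
      simp only [h1, one_smul]

end SmoothSections

/-! ## Coordinate vector fields and their duals -/

section CoordinateFields

variable {n : ℕ} {M : Type*} [TopologicalSpace M] [ChartedSpace (EuclideanSpace ℝ (Fin n)) M]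

theorem contMDiffOn_det {ι : Type*} [Fintype ι] [DecidableEq ι] {N : Set M}
    {A : M → Matrix ι ι ℝ} (hA : ∀ i j, ContMDiffOn (𝓡 n) 𝓘(ℝ, ℝ) ∞ (fun x ↦ A x i j) N) :
    ContMDiffOn (𝓡 n) 𝓘(ℝ, ℝ) ∞ (fun x ↦ (A x).det) N := by
  simp only [Matrix.det_apply]
  refine contMDiffOn_finsetSum fun τ _ ↦ ?_
  have : ContMDiffOn (𝓡 n) 𝓘(ℝ, ℝ) ∞ (fun x ↦ ∏ i, A x (τ i) i) N :=
    contMDiffOn_finsetProd fun i _ ↦ hA _ _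
  simp only [Units.smul_def, zsmul_eq_mul]
  exact contMDiffOn_const.mul this

/-- By Cramer's rule the entries of the inverse are quotients of determinants. -/
theorem contMDiffOn_inv_apply {ι : Type*} [Fintype ι] [DecidableEq ι] {N : Set M}
    {A : M → Matrix ι ι ℝ} (hA : ∀ i j, ContMDiffOn (𝓡 n) 𝓘(ℝ, ℝ) ∞ (fun x ↦ A x i j) N)
    (hdet : ∀ x ∈ N, (A x).det ≠ 0) (i j : ι) :
    ContMDiffOn (𝓡 n) 𝓘(ℝ, ℝ) ∞ (fun x ↦ (A x)⁻¹ i j) N := by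
  simp only [Matrix.inv_def, Matrix.smul_apply, Ring.inverse_eq_inv', smul_eq_mul,
    Matrix.adjugate_apply]
  refine ContMDiffOn.mul ((contMDiffOn_det hA).inv₀ hdet) (contMDiffOn_det fun k l ↦ ?_)
  by_cases hk : k = j
  · subst hk
    simp only [Matrix.updateRow_self]
    exact contMDiffOn_const
  · simp only [Matrix.updateRow_ne hk]
    exact hA k l

/-- The constant vector fields on `ℝⁿ`. -/
def constField (w : EuclideanSpace ℝ (Fin n)) (y : EuclideanSpace ℝ (Fin n)) :
    TangentSpace (𝓡 n) y :=
  (NormedSpace.fromTangentSpace (𝕜 := ℝ) y).symm w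

/-- The coordinate vector fields of the chart at `a`. -/
def coordField (a : M) (i : Fin n) : ∀ x : M, TangentSpace (𝓡 n) x :=
  VectorField.mpullback (𝓡 n) (𝓡 n) (chartAt (EuclideanSpace ℝ (Fin n)) a)
    (constField (EuclideanSpace.single i (1 : ℝ)))

/-- The coefficient of a tangent vector with respect to the coordinate vector fields. -/
def coordCoeff (a : M) (i : Fin n) (x : M) (v : TangentSpace (𝓡 n) x) : ℝ :=
  (NormedSpace.fromTangentSpace (𝕜 := ℝ) (chartAt (EuclideanSpace ℝ (Fin n)) a x)
    (mfderiv (𝓡 n) (𝓡 n) (chartAt (EuclideanSpace ℝ (Fin n)) a) x v)) i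

variable [IsManifold (𝓡 n) ∞ M]

theorem isInvertible_mfderiv_chartAt {a x : M}
    (hx : x ∈ (chartAt (EuclideanSpace ℝ (Fin n)) a).source) :
    (mfderiv (𝓡 n) (𝓡 n) (chartAt (EuclideanSpace ℝ (Fin n)) a) x).IsInvertible := by
  have := isInvertible_mfderiv_extChartAt (I := 𝓡 n) (x := a) (y := x) (by simpa using hx)
  simpa [extChartAt] using! this

/-- The pullback description of coordinate fields gives smoothness and brackets, while the
Riemannian measure uses the derivative of the inverse chart. They agree because the two derivatives
are mutually inverse. -/
theorem coordField_eq_mfderiv_symm {a : M} {y : EuclideanSpace ℝ (Fin n)}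
    (hy : y ∈ (chartAt (EuclideanSpace ℝ (Fin n)) a).target) (i : Fin n) :
    coordField a i ((chartAt (EuclideanSpace ℝ (Fin n)) a).symm y) =
      mfderiv (𝓡 n) (𝓡 n) (chartAt (EuclideanSpace ℝ (Fin n)) a).symm y
        (EuclideanSpace.single i (1 : ℝ)) := by
  set e := chartAt (EuclideanSpace ℝ (Fin n)) a with he
  have hmd := mdifferentiable_chart (I := 𝓡 n) a
  have hinv := isInvertible_mfderiv_chartAt (a := a) (e.map_target hy)
  have h := hmd.comp_symm_deriv hy
  have h1 : constField (EuclideanSpace.single i (1 : ℝ)) (e (e.symm y)) =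
      mfderiv (𝓡 n) (𝓡 n) e (e.symm y) (mfderiv (𝓡 n) (𝓡 n) e.symm y
        (EuclideanSpace.single i (1 : ℝ))) :=
    (congrArg (fun T : EuclideanSpace ℝ (Fin n) →L[ℝ] EuclideanSpace ℝ (Fin n) ↦
      T (EuclideanSpace.single i (1 : ℝ))) h).symm
  rw [coordField, VectorField.mpullback_apply, h1]
  exact hinv.inverse_apply_eq.2 rfl

theorem sum_coordCoeff_smul_coordField {a x : M}
    (hx : x ∈ (chartAt (EuclideanSpace ℝ (Fin n)) a).source) (v : TangentSpace (𝓡 n) x) :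
    ∑ i, coordCoeff a i x v • coordField a i x = v := by
  have hinv := isInvertible_mfderiv_chartAt (a := a) hx
  have h1 : ∀ i : Fin n, coordField a i x =
      (mfderiv (𝓡 n) (𝓡 n) (chartAt (EuclideanSpace ℝ (Fin n)) a) x).inverse
        (constField (EuclideanSpace.single i (1 : ℝ)) _) := fun i ↦ rfl
  simp_rw [h1, ← map_smul]
  rw [← map_sum]
  refine hinv.inverse_apply_eq.2 ?_
  simp only [constField, ← map_smul, ← map_sum, coordCoeff]
  set w : EuclideanSpace ℝ (Fin n) := NormedSpace.fromTangentSpace (𝕜 := ℝ)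
    (chartAt (EuclideanSpace ℝ (Fin n)) a x)
    (mfderiv (𝓡 n) (𝓡 n) (chartAt (EuclideanSpace ℝ (Fin n)) a) x v) with hw
  have : ∑ i, w i • (EuclideanSpace.single i (1 : ℝ) : EuclideanSpace ℝ (Fin n)) = w := by
    have := (EuclideanSpace.basisFun (Fin n) ℝ).sum_repr w
    simpa using this
  rw [this, hw, ContinuousLinearEquiv.symm_apply_apply]

theorem linearIndependent_coordField {a x : M}
    (hx : x ∈ (chartAt (EuclideanSpace ℝ (Fin n)) a).source) :
    LinearIndependent ℝ fun i : Fin n ↦ coordField a i x := by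
  refine linearIndependent_of_top_le_span_of_card_eq_finrank (fun v _ ↦ ?_) ?_
  · rw [← sum_coordCoeff_smul_coordField hx v]
    exact Submodule.sum_mem _ fun i _ ↦ Submodule.smul_mem _ _ (Submodule.subset_span ⟨i, rfl⟩)
  · have : Module.finrank ℝ (TangentSpace (𝓡 n) x) = n :=
      finrank_euclideanSpace_fin (𝕜 := ℝ) (n := n)
    rw [this, Fintype.card_fin]

theorem contMDiffOn_coordField (a : M) (i : Fin n) :
    ContMDiffOn (𝓡 n) (𝓡 n).tangent ∞
      (fun x ↦ (⟨x, coordField a i x⟩ : TangentBundle (𝓡 n) M))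
      (chartAt (EuclideanSpace ℝ (Fin n)) a).source := by
  intro x hx
  have h1 : ContMDiffAt (𝓡 n) (𝓡 n) ∞ (chartAt (EuclideanSpace ℝ (Fin n)) a) x :=
    contMDiffOn_chart.contMDiffAt ((chartAt _ a).open_source.mem_nhds hx)
  refine (ContMDiffAt.mpullback_vectorField_preimage (n := ∞) (m := ∞) ?_ h1
    (isInvertible_mfderiv_chartAt hx) (by simp)).contMDiffWithinAt
  exact contMDiffAt_vectorSpace_iff_contDiffAt.2 contDiffAt_const

variable [RiemannianBundle (fun x : M ↦ TangentSpace (𝓡 n) x)]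

/-- The Gram matrix of the coordinate vector fields. -/
def coordGram (a x : M) : Matrix (Fin n) (Fin n) ℝ :=
  Matrix.of fun i j ↦ inner ℝ (coordField a i x) (coordField a j x)

theorem coordGram_posDef {a x : M} (hx : x ∈ (chartAt (EuclideanSpace ℝ (Fin n)) a).source) :
    (coordGram (n := n) a x).PosDef :=
  Matrix.posDef_gram_of_linearIndependent (linearIndependent_coordField hx)

/-- The frame dual, for the Riemannian metric, to the coordinate vector fields. -/
def dualCoordField (a : M) (i : Fin n) (x : M) : TangentSpace (𝓡 n) x :=
  ∑ j, (coordGram (n := n) a x)⁻¹ i j • coordField a j x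

theorem inner_dualCoordField {a x : M}
    (hx : x ∈ (chartAt (EuclideanSpace ℝ (Fin n)) a).source) (i j : Fin n) :
    inner ℝ (dualCoordField a i x) (coordField a j x) = if i = j then 1 else 0 := by
  have h : ((coordGram (n := n) a x)⁻¹ * coordGram (n := n) a x) i j = if i = j then 1 else 0 := by
    rw [Matrix.nonsing_inv_mul _ (coordGram_posDef hx).det_pos.ne'.isUnit, Matrix.one_apply]
  rw [← h, dualCoordField, sum_inner, Matrix.mul_apply]
  exact Finset.sum_congr rfl fun k _ ↦ real_inner_smul_left _ _ _

theorem sum_inner_dualCoordField_smul {a x : M}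
    (hx : x ∈ (chartAt (EuclideanSpace ℝ (Fin n)) a).source) (v : TangentSpace (𝓡 n) x) :
    ∑ i, (inner ℝ (dualCoordField a i x) v : ℝ) • coordField a i x = v := by
  conv_rhs => rw [← sum_coordCoeff_smul_coordField hx v]
  refine Finset.sum_congr rfl fun i _ ↦ ?_
  congr 1
  conv_lhs => rw [← sum_coordCoeff_smul_coordField hx v]
  rw [inner_sum]
  simp_rw [real_inner_smul_right, inner_dualCoordField hx]
  simp

variable [IsContMDiffRiemannianBundle (𝓡 n) ∞ (EuclideanSpace ℝ (Fin n))
      (fun x : M ↦ TangentSpace (𝓡 n) x)]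

theorem contMDiffOn_coordGram (a : M) (i j : Fin n) :
    ContMDiffOn (𝓡 n) 𝓘(ℝ, ℝ) ∞ (fun x ↦ coordGram (n := n) a x i j)
      (chartAt (EuclideanSpace ℝ (Fin n)) a).source :=
  ContMDiffOn.inner_bundle (contMDiffOn_coordField a i) (contMDiffOn_coordField a j)

theorem contMDiffOn_dualCoordField (a : M) (i : Fin n) :
    ContMDiffOn (𝓡 n) (𝓡 n).tangent ∞
      (fun x ↦ (⟨x, dualCoordField a i x⟩ : TangentBundle (𝓡 n) M))
      (chartAt (EuclideanSpace ℝ (Fin n)) a).source :=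
  ContMDiffOn.sum_section fun j _ ↦ ContMDiffOn.smul_section
    (contMDiffOn_inv_apply (contMDiffOn_coordGram a)
      (fun _ hx ↦ (coordGram_posDef hx).det_pos.ne') i j)
    (contMDiffOn_coordField a j)

/-- Near every point there are smooth vector fields `E i` and `E' i`, the coordinate vector fields
and their duals. -/
theorem exists_coordFrame [T2Space M] (a : M) :
    ∃ (E E' : Fin n → ∀ x : M, TangentSpace (𝓡 n) x) (N : Set M), IsOpen N ∧ a ∈ N ∧
      N ⊆ (chartAt (EuclideanSpace ℝ (Fin n)) a).source ∧
      (∀ i, IsSmoothField (E i)) ∧ (∀ i, IsSmoothField (E' i)) ∧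
      (∀ x ∈ N, ∀ i, E i x = coordField a i x) ∧
      (∀ x ∈ N, ∀ i, E' i x = dualCoordField a i x) := by
  have hs : (chartAt (EuclideanSpace ℝ (Fin n)) a).source ∈ 𝓝 a := chart_source_mem_nhds _ a
  choose E hE hE' using fun i ↦ exists_section_eventuallyEq hs (contMDiffOn_coordField a i)
  choose D hD hD' using fun i ↦ exists_section_eventuallyEq hs (contMDiffOn_dualCoordField a i)
  obtain ⟨N, hN, hNo, haN⟩ := eventually_nhds_iff.1
    (((Filter.eventually_all.2 hE').and (Filter.eventually_all.2 hD')).and hs)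
  exact ⟨E, D, N, hNo, haN, fun x hx ↦ (hN x hx).2, hE, hD, fun x hx ↦ (hN x hx).1.1,
    fun x hx ↦ (hN x hx).1.2⟩

end CoordinateFields

/-! ## Calculus of connections -/

section Sections

variable {n d : ℕ} {M : Type*} [TopologicalSpace M] [ChartedSpace (EuclideanSpace ℝ (Fin n)) M]
  {F : Type*} [NormedAddCommGroup F] [NormedSpace ℂ F]
  {V : M → Type*} [TopologicalSpace (TotalSpace F V)]
  [∀ m, NormedAddCommGroup (V m)] [∀ m, InnerProductSpace ℂ (V m)]
  [FiberBundle F V]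

theorem finrank_fibre [VectorBundle ℂ F V] (m : M) :
    Module.finrank ℂ (V m) = Module.finrank ℂ F :=
  LinearEquiv.finrank_eq (VectorBundle.continuousLinearEquivAt ℂ F V m).toLinearEquiv

variable {σ τ : ∀ m, V m}

theorem IsSmoothSection.smul_complex [VectorBundle ℂ F V] (hσ : IsSmoothSection (n := n) F σ)
    {u : M → ℂ} (hu : ContMDiff (𝓡 n) 𝓘(ℝ, ℂ) ∞ u) :
    IsSmoothSection (n := n) F (fun m ↦ u m • σ m) := by
  intro x
  refine (contMDiffAt_section (IB := 𝓡 n) (F := F) x).2 ?_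
  have h1 := (contMDiffAt_section (IB := 𝓡 n) (F := F) x).1 (hσ x)
  have h2 : ContDiff ℝ ∞ fun q : ℂ × F ↦ q.1 • q.2 := contDiff_smul
  refine (h2.contDiffAt.comp_contMDiffAt ((hu x).prodMk_space h1)).congr_of_eventuallyEq ?_
  filter_upwards [(trivializationAt F V x).open_baseSet.mem_nhds
    (FiberBundle.mem_baseSet_trivializationAt F V x)] with y hy
  exact ((trivializationAt F V x).linear ℂ hy).map_smul _ _

variable [VectorBundle ℝ F V]

theorem IsSmoothSection.add (hσ : IsSmoothSection (n := n) F σ)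
    (hτ : IsSmoothSection (n := n) F τ) : IsSmoothSection (n := n) F (fun m ↦ σ m + τ m) :=
  ContMDiff.add_section hσ hτ

theorem IsSmoothSection.sub (hσ : IsSmoothSection (n := n) F σ)
    (hτ : IsSmoothSection (n := n) F τ) : IsSmoothSection (n := n) F (fun m ↦ σ m - τ m) :=
  ContMDiff.sub_section hσ hτ

theorem IsSmoothSection.neg (hσ : IsSmoothSection (n := n) F σ) :
    IsSmoothSection (n := n) F (fun m ↦ -σ m) :=
  ContMDiff.neg_section hσ

theorem IsSmoothSection.smul (hσ : IsSmoothSection (n := n) F σ) {u : M → ℝ}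
    (hu : ContMDiff (𝓡 n) 𝓘(ℝ, ℝ) ∞ u) : IsSmoothSection (n := n) F (fun m ↦ u m • σ m) :=
  ContMDiff.smul_section hu hσ

theorem IsSmoothSection.sum {ι : Type*} {s : Finset ι} {σ : ι → ∀ m, V m}
    (hσ : ∀ i, IsSmoothSection (n := n) F (σ i)) :
    IsSmoothSection (n := n) F (fun m ↦ ∑ i ∈ s, σ i m) :=
  ContMDiff.sum_section fun i _ ↦ hσ i

theorem IsSmoothSection.const_smul [VectorBundle ℂ F V] (hσ : IsSmoothSection (n := n) F σ)
    (c : ℂ) : IsSmoothSection (n := n) F (fun m ↦ c • σ m) :=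
  hσ.smul_complex contMDiff_const

theorem isSmoothSection_zero : IsSmoothSection (n := n) F (fun m ↦ (0 : V m)) :=
  contMDiff_zeroSection ℝ V

theorem IsSmoothSection.mdifferentiableAt (hσ : IsSmoothSection (n := n) F σ) (m : M) :
    MDifferentiableAt (𝓡 n) ((𝓡 n).prod 𝓘(ℝ, F)) (fun m ↦ TotalSpace.mk' F m (σ m)) m :=
  (hσ m).mdifferentiableAt (by simp)

theorem isSmoothSection_of_eventuallyEq
    (h : ∀ m, ∃ τ : ∀ m, V m, IsSmoothSection (n := n) F τ ∧ ∀ᶠ x in 𝓝 m, σ x = τ x) :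
    IsSmoothSection (n := n) F σ := by
  intro m
  obtain ⟨τ, hτ, he⟩ := h m
  exact (hτ m).congr_of_eventuallyEq (he.mono fun x hx ↦ by simp only [hx])

theorem isSmoothField_of_eventuallyEq [IsManifold (𝓡 n) ∞ M] {X : ∀ m : M, TangentSpace (𝓡 n) m}
    (h : ∀ m, ∃ Y : ∀ m : M, TangentSpace (𝓡 n) m, IsSmoothField Y ∧ ∀ᶠ x in 𝓝 m, X x = Y x) :
    IsSmoothField X := by
  intro m
  obtain ⟨τ, hτ, he⟩ := h m
  exact (hτ m).congr_of_eventuallyEq (he.mono fun x hx ↦ by simp only [hx])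

variable [IsManifold (𝓡 n) ∞ M] {D : CovariantDerivative (𝓡 n) F V}

theorem connection_congr (D : CovariantDerivative (𝓡 n) F V) (hσ : IsSmoothSection (n := n) F σ)
    (hτ : IsSmoothSection (n := n) F τ) {m : M} (h : ∀ᶠ x in 𝓝 m, σ x = τ x) :
    D σ m = D τ m :=
  D.isCovariantDerivativeOnUniv.congr_of_eventuallyEq (hσ.mdifferentiableAt m)
    (hτ.mdifferentiableAt m) Filter.univ_mem h

theorem connection_add (D : CovariantDerivative (𝓡 n) F V) (hσ : IsSmoothSection (n := n) F σ)
    (hτ : IsSmoothSection (n := n) F τ) (m : M) (v : TangentSpace (𝓡 n) m) :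
    D (fun x ↦ σ x + τ x) m v = D σ m v + D τ m v := by
  have := D.isCovariantDerivativeOnUniv.add (hσ.mdifferentiableAt m)
    (hτ.mdifferentiableAt m)
  exact congrArg (fun T ↦ T v) this

theorem connection_smul (D : CovariantDerivative (𝓡 n) F V) (hσ : IsSmoothSection (n := n) F σ)
    {u : M → ℝ} (hu : ContMDiff (𝓡 n) 𝓘(ℝ, ℝ) ∞ u) (m : M) (v : TangentSpace (𝓡 n) m) :
    D (fun x ↦ u x • σ x) m v = u m • D σ m v + mvfderiv (𝓡 n) u m v • σ m := by
  have := D.isCovariantDerivativeOnUniv.leibniz (hσ.mdifferentiableAt m)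
    ((hu m).mdifferentiableAt (by simp))
  exact congrArg (fun T ↦ T v) this

theorem mvfderiv_clm_comp {E₁ E₂ : Type*} [NormedAddCommGroup E₁] [NormedSpace ℝ E₁]
    [NormedAddCommGroup E₂] [NormedSpace ℝ E₂] (A : E₁ →L[ℝ] E₂) {u : M → E₁} {m : M}
    (hu : MDifferentiableAt (𝓡 n) 𝓘(ℝ, E₁) u m) (v : TangentSpace (𝓡 n) m) :
    mvfderiv (𝓡 n) (fun x ↦ A (u x)) m v = A (mvfderiv (𝓡 n) u m v) := by
  have h := (A.hasMFDerivAt (x := u m)).comp m hu.hasMFDerivAt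
  exact congrArg (fun T ↦ T v) h.mfderiv

/-- A covariant derivative satisfies the Leibniz rule for real functions only. Splitting `u` into
real and imaginary parts and using complex linearity of the connection gives the complex rule,
needed for changes of unit section of `L`. -/
theorem connection_smul_complex [VectorBundle ℂ F V] (hD : IsHermitianConnection D)
    (hσ : IsSmoothSection (n := n) F σ)
    {u : M → ℂ} (hu : ContMDiff (𝓡 n) 𝓘(ℝ, ℂ) ∞ u) (m : M) (v : TangentSpace (𝓡 n) m) :
    D (fun x ↦ u x • σ x) m v = u m • D σ m v + mvfderiv (𝓡 n) u m v • σ m := by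
  have hre : ContMDiff (𝓡 n) 𝓘(ℝ, ℝ) ∞ fun x ↦ (u x).re :=
    Complex.reCLM.contDiff.comp_contMDiff hu
  have him : ContMDiff (𝓡 n) 𝓘(ℝ, ℝ) ∞ fun x ↦ (u x).im :=
    Complex.imCLM.contDiff.comp_contMDiff hu
  have hud : MDifferentiableAt (𝓡 n) 𝓘(ℝ, ℂ) u m := (hu m).mdifferentiableAt (by simp)
  have h1 : (fun x ↦ u x • σ x) = fun x ↦ (u x).re • σ x + (u x).im • (Complex.I • σ x) := by
    funext x
    rw [← Complex.coe_smul, ← Complex.coe_smul, smul_smul, ← add_smul, Complex.re_add_im]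
  have hIσ := hσ.const_smul (n := n) Complex.I
  have hre' : mvfderiv (𝓡 n) (fun x ↦ (u x).re) m v = (mvfderiv (𝓡 n) u m v).re :=
    mvfderiv_clm_comp Complex.reCLM hud v
  have him' : mvfderiv (𝓡 n) (fun x ↦ (u x).im) m v = (mvfderiv (𝓡 n) u m v).im :=
    mvfderiv_clm_comp Complex.imCLM hud v
  rw [h1, connection_add D (hσ.smul hre) (hIσ.smul him), connection_smul D hσ hre,
    connection_smul D hIσ him, hD.complex_linear σ hσ, hre', him']
  simp only [← Complex.coe_smul, smul_smul]
  conv_rhs => rw [← Complex.re_add_im (u m), ← Complex.re_add_im (mvfderiv (𝓡 n) u m v)]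
  module

theorem contMDiff_connection (hD : IsHermitianConnection D) (hσ : IsSmoothSection (n := n) F σ)
    {X : ∀ m : M, TangentSpace (𝓡 n) m} (hX : IsSmoothField X) :
    IsSmoothSection (n := n) F (fun m ↦ D σ m (X m)) := by
  have h1 := hD.smooth.contMDiff.contMDiff (σ := σ) (by simpa using hσ.contMDiffOn)
  rw [contMDiffOn_univ] at h1
  exact ContMDiff.clm_bundle_apply h1 hX

end Sections

/-! ## Calculus of Dirac operators -/

/-- A metric trace may be computed with any frame and its dual. The Dirac operator and the
divergence are defined by an orthonormal basis chosen at each point without regularity; this lemma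
rewrites them in smooth frames. -/
theorem sum_orthonormalBasis_eq {E W ι κ : Type*} [NormedAddCommGroup E] [InnerProductSpace ℝ E]
    [AddCommGroup W] [Module ℝ W] [Fintype ι] [Fintype κ] (b : E →ₗ[ℝ] E →ₗ[ℝ] W)
    (e : OrthonormalBasis ι ℝ E) {X X' : κ → E}
    (h : ∀ v, ∑ i, (inner ℝ (X' i) v : ℝ) • X i = v) :
    ∑ k, b (e k) (e k) = ∑ i, b (X' i) (X i) := by
  have h1 : ∀ k, b (e k) (e k) = ∑ i, (inner ℝ (X' i) (e k) : ℝ) • b (e k) (X i) := fun k ↦ by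
    have h0 := congrArg (b (e k)) (h (e k))
    rw [← h0]
    simp only [map_sum, map_smul]
  have h2 : ∀ i, b (X' i) (X i) = ∑ k, (inner ℝ (X' i) (e k) : ℝ) • b (e k) (X i) := fun i ↦ by
    conv_lhs => rw [← e.sum_repr' (X' i)]
    simp only [map_sum, map_smul, LinearMap.sum_apply, LinearMap.smul_apply, real_inner_comm]
  simp only [h1, h2]
  exact Finset.sum_comm

section Gradient

variable {n : ℕ} {M : Type*} [TopologicalSpace M] [ChartedSpace (EuclideanSpace ℝ (Fin n)) M]
  [RiemannianBundle (fun x : M ↦ TangentSpace (𝓡 n) x)]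

/-- The gradient of a function. -/
def gradient (u : M → ℝ) (m : M) : TangentSpace (𝓡 n) m :=
  ∑ i, mvfderiv (𝓡 n) u m (stdOrthonormalBasis ℝ (TangentSpace (𝓡 n) m) i) •
    stdOrthonormalBasis ℝ (TangentSpace (𝓡 n) m) i

theorem inner_gradient (u : M → ℝ) (m : M) (v : TangentSpace (𝓡 n) m) :
    inner ℝ (gradient u m) v = mvfderiv (𝓡 n) u m v := by
  conv_rhs => rw [← (stdOrthonormalBasis ℝ (TangentSpace (𝓡 n) m)).sum_repr' v]
  simp only [gradient, sum_inner, map_sum, map_smul, inner_smul_left, smul_eq_mul]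
  exact Finset.sum_congr rfl fun i _ ↦ by simp [mul_comm]

/-- A linear function in a chart, cut off. Functions with prescribed differential detect principal
symbols and separate tangent vectors. -/
theorem exists_mvfderiv_eq [IsManifold (𝓡 n) ∞ M] [T2Space M] {m : M}
    (A : TangentSpace (𝓡 n) m →L[ℝ] ℝ) :
    ∃ u : M → ℝ, ContMDiff (𝓡 n) 𝓘(ℝ, ℝ) ∞ u ∧ ∀ v, mvfderiv (𝓡 n) u m v = A v := by
  set e := chartAt (EuclideanSpace ℝ (Fin n)) m
  have hm : m ∈ e.source := mem_chart_source _ m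
  obtain ⟨T, hT⟩ := isInvertible_mfderiv_chartAt (n := n) hm
  let B : EuclideanSpace ℝ (Fin n) →L[ℝ] ℝ :=
    (A.comp T.symm.toContinuousLinearMap).comp
      (NormedSpace.fromTangentSpace (𝕜 := ℝ) (e m)).symm.toContinuousLinearMap
  have hs : e.source ∈ 𝓝 m := e.open_source.mem_nhds hm
  have hB : ContMDiffOn (𝓡 n) 𝓘(ℝ, ℝ) ∞ (fun x ↦ B (e x)) e.source :=
    (ContinuousLinearMap.contMDiff B).comp_contMDiffOn contMDiffOn_chart
  obtain ⟨u, hu, hue⟩ := exists_function_eventuallyEq hs hB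
  refine ⟨u, hu, fun v ↦ ?_⟩
  have hd : MDifferentiableAt (𝓡 n) (𝓡 n) e m :=
    (contMDiffOn_chart.contMDiffAt hs).mdifferentiableAt (n := ∞) (by simp)
  have h1 : mvfderiv (𝓡 n) u m v = mvfderiv (𝓡 n) (fun x ↦ B (e x)) m v := by
    have := Filter.EventuallyEq.mfderiv_eq (I := 𝓡 n) (I' := 𝓘(ℝ, ℝ)) hue
    simp only [mvfderiv, ContinuousLinearMap.comp_apply]
    rw [this]; rfl
  have h2 := mvfderiv_clm_comp (n := n) B hd v
  rw [h1, h2]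
  have h3 : mvfderiv (𝓡 n) e m v = NormedSpace.fromTangentSpace (𝕜 := ℝ) (e m) (T v) := by
    rw [← ContinuousLinearEquiv.coe_coe T, hT]; rfl
  rw [h3]
  simp [B]

end Gradient

section Dirac

variable {n d : ℕ}
  {G : Type*} [TopologicalSpace G] [Group G] [ChartedSpace (EuclideanSpace ℝ (Fin d)) G]
  {M : Type*} [TopologicalSpace M] [ChartedSpace (EuclideanSpace ℝ (Fin n)) M] [MulAction G M]
  [IsManifold (𝓡 n) ∞ M] [RiemannianBundle (fun x : M ↦ TangentSpace (𝓡 n) x)]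
  {FS : Type*} [NormedAddCommGroup FS] [NormedSpace ℂ FS]
  {S : M → Type*} [TopologicalSpace (TotalSpace FS S)]
  [∀ m, NormedAddCommGroup (S m)] [∀ m, InnerProductSpace ℂ (S m)]
  [FiberBundle FS S] [VectorBundle ℝ FS S]
  {FL : Type*} [NormedAddCommGroup FL] [NormedSpace ℂ FL]
  {L : M → Type*} [TopologicalSpace (TotalSpace FL L)]
  [∀ m, NormedAddCommGroup (L m)] [∀ m, InnerProductSpace ℂ (L m)]
  [FiberBundle FL L] [VectorBundle ℝ FL L]
  {aS : EquivariantStructure (n := n) d G FS S}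
  {aL : EquivariantStructure (n := n) d G FL L}
  (P : SpinCStructure aS aL) (DS : CovariantDerivative (𝓡 n) FS S)

theorem SpinCStructure.c_anticomm (m : M) (v w : TangentSpace (𝓡 n) m) (x : S m) :
    P.c m v (P.c m w x) + P.c m w (P.c m v x) = -((2 * inner ℝ v w : ℝ) : ℂ) • x := by
  have h := P.c_sq m (v + w) x
  simp only [map_add, LinearMap.add_apply, P.c_sq] at h
  have h2 : P.c m v (P.c m w x) + P.c m w (P.c m v x) =
      -((‖v + w‖ ^ 2 : ℝ) : ℂ) • x + ((‖v‖ ^ 2 : ℝ) : ℂ) • x + ((‖w‖ ^ 2 : ℝ) : ℂ) • x := by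
    rw [← h]; module
  rw [h2, norm_add_sq_real]
  push_cast
  module

/-- The bilinear map `(v, w) ↦ c(v) ∇_w σ`. -/
def cliffordConnection (σ : ∀ m, S m) (m : M) :
    TangentSpace (𝓡 n) m →ₗ[ℝ] TangentSpace (𝓡 n) m →ₗ[ℝ] S m :=
  LinearMap.mk₂ ℝ (fun v w ↦ P.c m v (DS σ m w)) (by simp) (by simp)
    (by simp) (fun a v w ↦ by
      rw [map_smul, ← Complex.coe_smul, map_smul, Complex.coe_smul])

theorem dirac_eq_sum {ι : Type*} [Fintype ι] (σ : ∀ m, S m) (m : M)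
    {X X' : ι → TangentSpace (𝓡 n) m}
    (h : ∀ v, ∑ i, (inner ℝ (X' i) v : ℝ) • X i = v) :
    dirac P DS σ m = ∑ i, P.c m (X' i) (DS σ m (X i)) :=
  sum_orthonormalBasis_eq (cliffordConnection P DS σ m)
    (stdOrthonormalBasis ℝ (TangentSpace (𝓡 n) m)) h

variable {P DS}

theorem dirac_congr {σ τ : ∀ m, S m} (hσ : IsSmoothSection (n := n) FS σ)
    (hτ : IsSmoothSection (n := n) FS τ) {m : M} (h : ∀ᶠ x in 𝓝 m, σ x = τ x) :
    dirac P DS σ m = dirac P DS τ m := by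
  simp only [dirac, connection_congr DS hσ hτ h]

theorem dirac_add {σ τ : ∀ m, S m} (hσ : IsSmoothSection (n := n) FS σ)
    (hτ : IsSmoothSection (n := n) FS τ) (m : M) :
    dirac P DS (fun x ↦ σ x + τ x) m = dirac P DS σ m + dirac P DS τ m := by
  simp only [dirac, connection_add DS hσ hτ, map_add, Finset.sum_add_distrib]

theorem dirac_smul {σ : ∀ m, S m} (hσ : IsSmoothSection (n := n) FS σ) {u : M → ℝ}
    (hu : ContMDiff (𝓡 n) 𝓘(ℝ, ℝ) ∞ u) (m : M) :
    dirac P DS (fun x ↦ u x • σ x) m =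
      u m • dirac P DS σ m + P.c m (gradient u m) (σ m) := by
  simp only [dirac, connection_smul DS hσ hu, map_add, Finset.sum_add_distrib, gradient, map_sum,
    Finset.smul_sum, LinearMap.sum_apply, map_smul, LinearMap.smul_apply]
  congr 1 <;> refine Finset.sum_congr rfl fun i _ ↦ ?_
  · rw [← Complex.coe_smul, map_smul, Complex.coe_smul]
  · rw [← Complex.coe_smul, map_smul, Complex.coe_smul]

variable [T2Space M] [IsContMDiffRiemannianBundle (𝓡 n) ∞ (EuclideanSpace ℝ (Fin n))
      (fun x : M ↦ TangentSpace (𝓡 n) x)]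

theorem isSmoothSection_dirac (hD : IsHermitianConnection DS) {σ : ∀ m, S m}
    (hσ : IsSmoothSection (n := n) FS σ) : IsSmoothSection (n := n) FS (dirac P DS σ) := by
  refine isSmoothSection_of_eventuallyEq fun m ↦ ?_
  obtain ⟨E, E', N, hN, hm, hNc, hE, hE', h, h'⟩ := exists_coordFrame (n := n) m
  refine ⟨fun x ↦ ∑ i, P.c x (E' i x) (DS σ x (E i x)),
    IsSmoothSection.sum fun i ↦ P.c_smooth _ (hE' i) _ (contMDiff_connection hD hσ (hE i)), ?_⟩
  filter_upwards [hN.mem_nhds hm] with x hx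
  refine dirac_eq_sum P DS σ x fun v ↦ ?_
  simp only [h x hx, h' x hx]
  exact sum_inner_dualCoordField_smul (hNc hx) v

/-- The Clifford action anticommutes with a Callias potential. -/
theorem IsCalliasPotential.c_anticomm [ContMDiffVectorBundle ∞ FS S (𝓡 n)]
    {Φ : ∀ m : M, S m →ₗ[ℂ] S m} {Z : Set M} {k : ℝ}
    (hΦ : IsCalliasPotential P DS Φ Z k) (m : M) (v : TangentSpace (𝓡 n) m) (w : S m) :
    P.c m v (Φ m w) = -Φ m (P.c m v w) := by
  obtain ⟨A, hA, -⟩ := hΦ.anticommutator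
  obtain ⟨σ, hσ, rfl⟩ := exists_section_apply_eq (n := n) (F := FS) w
  -- For `u` with gradient `v` at `m`, the difference `{D, Φ}(uσ) - u{D, Φ}σ` equals `c(v)Φσ +
  -- Φc(v)σ`. It vanishes because `{D, Φ}` is an endomorphism.
  obtain ⟨u, hu, huv⟩ := exists_mvfderiv_eq (innerSL ℝ v)
  have hg : gradient u m = v := ext_inner_right ℝ fun z ↦ by rw [inner_gradient, huv]; rfl
  have h1 := hA _ (IsSmoothSection.smul hσ hu) m
  have h2 : (fun x ↦ Φ x (u x • σ x)) = fun x ↦ u x • Φ x (σ x) := by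
    funext x; rw [← Complex.coe_smul, map_smul, Complex.coe_smul]
  have h3 := hA σ hσ m
  rw [h2, dirac_smul hσ hu, dirac_smul (hΦ.smooth σ hσ) hu, hg, map_add,
    ← Complex.coe_smul, ← Complex.coe_smul, ← Complex.coe_smul, map_smul, map_smul, ← h3] at h1
  rw [eq_neg_iff_add_eq_zero]
  have : (u m : ℂ) • dirac P DS (fun x ↦ Φ x (σ x)) m + (P.c m v) (Φ m (σ m)) +
      ((u m : ℂ) • Φ m (dirac P DS σ m) + Φ m ((P.c m v) (σ m))) -
      (u m : ℂ) • (dirac P DS (fun x ↦ Φ x (σ x)) m + Φ m (dirac P DS σ m)) = 0 := by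
    rw [h1, sub_self]
  rw [← this]; module

end Dirac

/-! ## Twisted sections in terms of local unit sections of the line bundle -/

section Twisted

variable {n d : ℕ}
  {G : Type*} [TopologicalSpace G] [Group G] [ChartedSpace (EuclideanSpace ℝ (Fin d)) G]
  {M : Type*} [TopologicalSpace M] [ChartedSpace (EuclideanSpace ℝ (Fin n)) M] [MulAction G M]
  [IsManifold (𝓡 n) ∞ M]
  {FS : Type*} [NormedAddCommGroup FS] [NormedSpace ℂ FS]
  {S : M → Type*} [TopologicalSpace (TotalSpace FS S)]
  [∀ m, NormedAddCommGroup (S m)] [∀ m, InnerProductSpace ℂ (S m)]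
  [FiberBundle FS S] [VectorBundle ℂ FS S] [VectorBundle ℝ FS S]
  {FL : Type*} [NormedAddCommGroup FL] [NormedSpace ℂ FL]
  {L : M → Type*} [TopologicalSpace (TotalSpace FL L)]
  [∀ m, NormedAddCommGroup (L m)] [∀ m, InnerProductSpace ℂ (L m)]
  [FiberBundle FL L] [VectorBundle ℂ FL L] [VectorBundle ℝ FL L]
  {p : ℕ}

/-- On the open set `N`, the section `s` is `σ ⊗ l^p` with `‖l‖ = 1`. -/
structure IsUnitForm (FS FL : Type*) [NormedAddCommGroup FS] [NormedSpace ℂ FS]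
    [NormedAddCommGroup FL] [NormedSpace ℂ FL] {S : M → Type*} [TopologicalSpace (TotalSpace FS S)]
    [∀ m, NormedAddCommGroup (S m)] [∀ m, InnerProductSpace ℂ (S m)] [FiberBundle FS S]
    {L : M → Type*} [TopologicalSpace (TotalSpace FL L)]
    [∀ m, NormedAddCommGroup (L m)] [∀ m, InnerProductSpace ℂ (L m)] [FiberBundle FL L]
    {p : ℕ} (s : ∀ m, Twisted S L p m) (σ : ∀ m, S m) (l : ∀ m, L m) (N : Set M) : Prop where
  smooth_spinor : IsSmoothSection (n := n) FS σ
  smooth_line : IsSmoothSection (n := n) FL l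
  isOpen : IsOpen N
  norm_eq : ∀ x ∈ N, ‖l x‖ = 1
  eq : ∀ x ∈ N, s x = σ x ⊗ₜ[ℂ] PiTensorProduct.tprod ℂ (fun _ : Fin p ↦ l x)


/-- Near `m` these are `u = 1/‖l‖` and `w = ‖l‖`, extended by cutoffs. Both are needed: normalising
`l` must be compensated by the factor `w ^ p` on the spinor. -/
theorem exists_unit_section [T2Space M] (aL : EquivariantStructure (n := n) d G FL L)
    {l : ∀ m, L m} (hl : IsSmoothSection (n := n) FL l) {m : M}
    (hm : l m ≠ 0) : ∃ (u w : M → ℝ) (N : Set M), ContMDiff (𝓡 n) 𝓘(ℝ, ℝ) ∞ u ∧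
      ContMDiff (𝓡 n) 𝓘(ℝ, ℝ) ∞ w ∧ IsOpen N ∧ m ∈ N ∧ (∀ x ∈ N, ‖u x • l x‖ = 1) ∧
      ∀ x ∈ N, w x * u x = 1 := by
  let q : M → ℝ := fun x ↦ (inner ℂ (l x) (l x) : ℂ).re
  have hq : ContMDiff (𝓡 n) 𝓘(ℝ, ℝ) ∞ q :=
    (ContinuousLinearMap.contMDiff Complex.reCLM).comp (aL.metric_smooth l l hl hl)
  have hq' : ∀ x, q x = ‖l x‖ ^ 2 := fun x ↦ inner_self_eq_norm_sq (𝕜 := ℂ) (l x)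
  let N₀ : Set M := {x | q x ≠ 0}
  have hN₀ : IsOpen N₀ := isOpen_ne_fun hq.continuous continuous_const
  have hmN : m ∈ N₀ := by
    simp only [N₀, Set.mem_ofPred_eq, hq']; exact pow_ne_zero _ (norm_ne_zero_iff.2 hm)
  have hw : ContMDiffOn (𝓡 n) 𝓘(ℝ, ℝ) ∞ (fun x ↦ √(q x)) N₀ := fun x hx ↦
    ((Real.contDiffAt_sqrt hx).contMDiffAt.comp x (hq x)).contMDiffWithinAt
  have hu : ContMDiffOn (𝓡 n) 𝓘(ℝ, ℝ) ∞ (fun x ↦ (√(q x))⁻¹) N₀ := fun x hx ↦ by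
    have h0 : √(q x) ≠ 0 := by
      rw [hq', Real.sqrt_sq (norm_nonneg _)]
      intro h
      exact hx (by rw [hq', h]; norm_num)
    exact ((contDiffAt_inv ℝ h0).contMDiffAt.comp x
      ((Real.contDiffAt_sqrt hx).contMDiffAt.comp x (hq x))).contMDiffWithinAt
  obtain ⟨u, hu1, hu2⟩ := exists_function_eventuallyEq (hN₀.mem_nhds hmN) hu
  obtain ⟨w, hw1, hw2⟩ := exists_function_eventuallyEq (hN₀.mem_nhds hmN) hw
  obtain ⟨N, hN, hNo, hmN'⟩ := mem_nhds_iff.1 (Filter.inter_mem (Filter.inter_mem hu2 hw2)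
    (hN₀.mem_nhds hmN))
  refine ⟨u, w, N, hu1, hw1, hNo, hmN', fun x hx ↦ ?_, fun x hx ↦ ?_⟩
  all_goals
    obtain ⟨⟨h1, h2⟩, h3⟩ := hN hx
    have h4 : ‖l x‖ ≠ 0 := fun h ↦ h3 (by rw [hq', h]; norm_num)
    simp only [Set.mem_ofPred_eq] at h1 h2
    rw [hq', Real.sqrt_sq (norm_nonneg _)] at h1 h2
  · rw [h1, norm_smul, norm_inv, norm_norm, inv_mul_cancel₀ h4]
  · rw [h1, h2, mul_inv_cancel₀ h4]


theorem IsSmoothTwisted.exists_unitForm [T2Space M]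
    (aL : EquivariantStructure (n := n) d G FL L) {s : ∀ m, Twisted S L p m}
    (hs : IsSmoothTwisted (n := n) FS FL s) (m : M) :
    ∃ σ l N, m ∈ N ∧ IsUnitForm (n := n) FS FL s σ l N := by
  obtain ⟨σ, l, hσ, hl, hm, he⟩ := hs m
  obtain ⟨u, w, N, hu, hw, hN, hmN, h1, h2⟩ := exists_unit_section aL hl hm
  obtain ⟨N', hN', hNo, hmN'⟩ := mem_nhds_iff.1 he
  refine ⟨fun x ↦ w x ^ p • σ x, fun x ↦ u x • l x, N ∩ N', ⟨hmN, hmN'⟩,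
    hσ.smul (hw.pow p), hl.smul hu, hN.inter hNo, fun x hx ↦ h1 x hx.1, fun x hx ↦ ?_⟩
  have h3 : PiTensorProduct.tprod ℂ (fun _ : Fin p ↦ u x • l x) =
      (u x ^ p : ℝ) • PiTensorProduct.tprod ℂ (fun _ : Fin p ↦ l x) := by
    have := (PiTensorProduct.tprod ℂ (s := fun _ : Fin p ↦ L x)).map_smul_univ
      (fun _ ↦ (u x : ℂ)) (fun _ ↦ l x)
    simp only [Complex.coe_smul, Finset.prod_const, Finset.card_univ, Fintype.card_fin] at this
    rw [this, ← Complex.coe_smul]; push_cast; rfl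
  rw [h3, hN' hx.2, ← Complex.coe_smul, ← Complex.coe_smul, TensorProduct.tmul_smul,
    ← TensorProduct.smul_tmul', smul_smul]
  have h4 : ((u x ^ p : ℝ) : ℂ) * ((w x ^ p : ℝ) : ℂ) = 1 := by
    rw [← Complex.ofReal_mul, ← mul_pow, mul_comm, h2 x hx.1]; simp
  rw [h4, one_smul]

theorem IsUnitForm.isLocalForm {s : ∀ m, Twisted S L p m} {σ : ∀ m, S m} {l : ∀ m, L m} {N : Set M}
    (h : IsUnitForm (n := n) FS FL s σ l N) {m : M} (hm : m ∈ N) :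
    IsLocalForm (n := n) FS FL s m σ l :=
  ⟨h.smooth_spinor, h.smooth_line, fun h0 ↦ by simpa [h0] using h.norm_eq m hm,
    Filter.mem_of_superset (h.isOpen.mem_nhds hm) h.eq⟩

variable {DS : CovariantDerivative (𝓡 n) FS S} {DL : CovariantDerivative (𝓡 n) FL L}

theorem contract_tmul_update {x : M} (l l' y : L x) (w : S x) :
    contract l (∑ j : Fin p, w ⊗ₜ[ℂ]
        PiTensorProduct.tprod ℂ (Function.update (fun _ : Fin p ↦ l') j y)) =
      ((p : ℂ) * inner ℂ l l' ^ (p - 1) * inner ℂ l y) • w := by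
  rw [map_sum]
  have : ∀ j : Fin p, contract l (w ⊗ₜ[ℂ]
      PiTensorProduct.tprod ℂ (Function.update (fun _ : Fin p ↦ l') j y)) =
      ((inner ℂ l l' : ℂ) ^ (p - 1) * inner ℂ l y) • w := fun j ↦ by
    rw [contract_tmul_tprod]
    congr 1
    have h1 : ∀ i, (inner ℂ l (Function.update (fun _ : Fin p ↦ l') j y i) : ℂ) =
        Function.update (fun _ : Fin p ↦ (inner ℂ l l' : ℂ)) j (inner ℂ l y) i := fun i ↦ by
      by_cases h : i = j <;> simp [h]
    simp only [h1]
    rw [Finset.prod_update_of_mem (Finset.mem_univ j), mul_comm, Finset.prod_const,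
      Finset.card_sdiff_of_subset (Finset.subset_univ _)]
    simp
  simp only [this, Finset.sum_const, Finset.card_univ, Fintype.card_fin]
  rw [← Nat.cast_smul_eq_nsmul ℂ, smul_smul, mul_assoc]


/-- The twisted connection in terms of a local unit section `l` of the line bundle. -/
theorem contract_twistedConnection (aL : EquivariantStructure (n := n) d G FL L)
    (hL : Module.finrank ℂ FL = 1) (hDS : IsHermitianConnection DS)
    (hDL : IsHermitianConnection DL) {s : ∀ m, Twisted S L p m} {σ : ∀ m, S m} {l : ∀ m, L m}
    {N : Set M} (h : IsUnitForm (n := n) FS FL s σ l N) {m : M} (hm : m ∈ N)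
    (v : TangentSpace (𝓡 n) m) :
    contract (l m) (twistedConnection DS DL s m v) =
      DS σ m v + ((p : ℂ) * inner ℂ (l m) (DL l m v)) • σ m := by
  have hex : ∃ q : (∀ m, S m) × (∀ m, L m), IsLocalForm (n := n) FS FL s m q.1 q.2 :=
    ⟨(σ, l), h.isLocalForm hm⟩
  have hL' : ∀ x, Module.finrank ℂ (L x) = 1 := fun x ↦ by
    rw [finrank_fibre (F := FL), hL]
  obtain ⟨hσ', hl', -, he⟩ := hex.choose_spec
  rw [twistedConnection, dif_pos hex]
  set σ' := hex.choose.1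
  set l' := hex.choose.2
  dsimp only
  -- The pair `(σ', l')` selected by the definition is compared with the given pair through `l' = u
  -- l` and `σ = u ^ p σ'`. The derivatives of `u` arising from `l'` in each of the `p` places match
  -- the derivative of `u ^ p` in `∇σ`.
  let u : M → ℂ := fun x ↦ inner ℂ (l x) (l' x)
  have hu : ContMDiff (𝓡 n) 𝓘(ℝ, ℂ) ∞ u := aL.metric_smooth l l' h.smooth_line hl'
  have hup : ContMDiff (𝓡 n) 𝓘(ℝ, ℂ) ∞ fun x ↦ u x ^ p :=
    ((contDiff_id (𝕜 := ℝ) (E := ℂ)).pow p).contMDiff.comp hu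
  have hlu : ∀ᶠ x in 𝓝 m, l' x = u x • l x := by
    filter_upwards [h.isOpen.mem_nhds hm] with x hx
    exact eq_inner_smul_of_finrank_eq_one (hL' x) (h.norm_eq x hx) _
  have hσu : ∀ᶠ x in 𝓝 m, σ x = u x ^ p • σ' x := by
    filter_upwards [h.isOpen.mem_nhds hm, he] with x hx hx'
    rw [← contract_tmul_tprod_self (p := p) (h.norm_eq x hx) (σ x), ← h.eq x hx, hx',
      contract_tmul_tprod]
    simp [u, σ', l']
  have h1 : DL l' m v = u m • DL l m v + mvfderiv (𝓡 n) u m v • l m := by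
    rw [connection_congr DL hl' (h.smooth_line.smul_complex hu) hlu,
      connection_smul_complex hDL h.smooth_line hu]
  have hdup : mvfderiv (𝓡 n) (fun x ↦ u x ^ p) m v =
      (p : ℂ) * u m ^ (p - 1) * mvfderiv (𝓡 n) u m v := by
    have hd : MDifferentiableAt (𝓡 n) 𝓘(ℝ, ℂ) u m := (hu m).mdifferentiableAt (by simp)
    have h2 : HasFDerivAt (fun z : ℂ ↦ z ^ p)
        ((((p : ℂ) * u m ^ (p - 1)) • (1 : ℂ →L[ℂ] ℂ)).restrictScalars ℝ) (u m) := by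
      have h0 : ((p : ℂ) * u m ^ (p - 1)) • (1 : ℂ →L[ℂ] ℂ) =
          ContinuousLinearMap.toSpanSingleton ℂ ((p : ℂ) * u m ^ (p - 1)) := by
        ext; simp
      rw [h0]
      exact (hasDerivAt_pow p (u m)).hasFDerivAt.restrictScalars ℝ
    have h3 := h2.hasMFDerivAt.comp m hd.hasMFDerivAt
    have h4 := congrArg (fun T ↦ T v) h3.mfderiv
    exact h4
  have h2 : DS σ m v = u m ^ p • DS σ' m v +
      ((p : ℂ) * u m ^ (p - 1) * mvfderiv (𝓡 n) u m v) • σ' m := by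
    rw [connection_congr DS h.smooth_spinor (hσ'.smul_complex hup) hσu,
      connection_smul_complex hDS hσ' hup, hdup]
  have hlm : (inner ℂ (l m) (l m) : ℂ) = 1 := by
    rw [inner_self_eq_norm_sq_to_K, h.norm_eq m hm]; simp
  rw [map_add, contract_tmul_tprod, contract_tmul_update, h1, inner_add_right, inner_smul_right,
    inner_smul_right, hlm, h2, hσu.self_of_nhds, smul_smul]
  simp only [Finset.prod_const, Finset.card_univ, Fintype.card_fin]
  change u m ^ p • _ + ((p : ℂ) * u m ^ (p - 1) * _) • _ = _
  -- For `p = 0` the truncated exponent is harmless because of the factor `p`.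
  have hpow : (p : ℂ) * u m ^ (p - 1) * u m = p * u m ^ p := by
    rcases p with _ | p
    · simp
    · rw [mul_assoc, ← pow_succ]; rfl
  have : ((p : ℂ) * inner ℂ (l m) (DL l m v) * u m ^ p) =
      (p : ℂ) * u m ^ (p - 1) * u m * inner ℂ (l m) (DL l m v) := by rw [hpow]; ring
  rw [this]
  module

section Dirac

variable {aS : EquivariantStructure (n := n) d G FS S}
  {aL : EquivariantStructure (n := n) d G FL L}
variable [RiemannianBundle (fun x : M ↦ TangentSpace (𝓡 n) x)] (P : SpinCStructure aS aL)

/-- The vector representing the real part of `-i ⟪l, ∇ l⟫`. -/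
def lineForm (DL : CovariantDerivative (𝓡 n) FL L) (l : ∀ m, L m) (m : M) :
    TangentSpace (𝓡 n) m :=
  ∑ i, (inner ℂ (l m) (DL l m (stdOrthonormalBasis ℝ (TangentSpace (𝓡 n) m) i)) : ℂ).im •
    stdOrthonormalBasis ℝ (TangentSpace (𝓡 n) m) i

theorem inner_lineForm (l : ∀ m, L m) (m : M) (v : TangentSpace (𝓡 n) m) :
    inner ℝ (lineForm DL l m) v = (inner ℂ (l m) (DL l m v) : ℂ).im := by
  conv_rhs => rw [← (stdOrthonormalBasis ℝ (TangentSpace (𝓡 n) m)).sum_repr' v]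
  simp only [lineForm, sum_inner, map_sum, map_smul, inner_smul_left, inner_sum,
    ← Complex.coe_smul, inner_smul_right, Complex.im_sum, Complex.im_ofReal_mul]
  exact Finset.sum_congr rfl fun i _ ↦ by simp [mul_comm]


/-- Differentiating `‖l‖² = 1` shows that `⟨l, ∇l⟩` is imaginary. Hence the twist by `L^p`
contributes `i p c(θ)` to the Dirac operator, where `θ` is the real vector `lineForm DL l`. -/
theorem inner_connection_unit (hDL : IsHermitianConnection DL) {l : ∀ m, L m}
    (hl : IsSmoothSection (n := n) FL l) {m : M} (h1 : ∀ᶠ x in 𝓝 m, ‖l x‖ = 1)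
    (v : TangentSpace (𝓡 n) m) :
    (inner ℂ (l m) (DL l m v) : ℂ) = Complex.I * ((inner ℝ (lineForm DL l m) v : ℝ) : ℂ) := by
  have h2 := hDL.hermitian l l hl hl m v
  have h3 : mvfderiv (𝓡 n) (fun x ↦ (inner ℂ (l x) (l x) : ℂ)) m v = 0 := by
    have h4 : (fun x ↦ (inner ℂ (l x) (l x) : ℂ)) =ᶠ[𝓝 m] fun _ ↦ (1 : ℂ) := by
      filter_upwards [h1] with x hx
      rw [inner_self_eq_norm_sq_to_K, hx]; simp
    simp only [mvfderiv, ContinuousLinearMap.comp_apply]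
    rw [h4.mfderiv_eq (I := 𝓡 n) (I' := 𝓘(ℝ, ℂ)), mfderiv_const]
    exact map_zero (NormedSpace.fromTangentSpace (𝕜 := ℝ) _)
  rw [h3] at h2
  have h5 : (inner ℂ (l m) (DL l m v) : ℂ).re = 0 := by
    have := congrArg Complex.re h2
    rw [Complex.add_re, ← inner_conj_symm, Complex.conj_re, Complex.zero_re] at this
    linarith
  rw [inner_lineForm]
  apply Complex.ext <;> simp [h5]

/-- The twisted Dirac operator in terms of a local unit section `l` of the line bundle. -/
theorem contract_twistedDirac (hDS : IsHermitianConnection DS) (hDL : IsHermitianConnection DL)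
    {s : ∀ m, Twisted S L p m} {σ : ∀ m, S m} {l : ∀ m, L m}
    {N : Set M} (h : IsUnitForm (n := n) FS FL s σ l N) {m : M} (hm : m ∈ N) :
    contract (l m) (twistedDirac P DS DL s m) =
      dirac P DS σ m + ((p : ℂ) * Complex.I) • P.c m (lineForm DL l m) (σ m) := by
  have h1 : ∀ᶠ x in 𝓝 m, ‖l x‖ = 1 := Filter.mem_of_superset (h.isOpen.mem_nhds hm) h.norm_eq
  have h2 := contract_twistedConnection aL P.rank_det hDS hDL h hm
  simp only [twistedDirac, map_sum, contract_onSpinors, h2, map_add, Finset.sum_add_distrib]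
  rw [dirac]
  congr 1
  conv_rhs => rw [← (stdOrthonormalBasis ℝ (TangentSpace (𝓡 n) m)).sum_repr' (lineForm DL l m)]
  simp only [map_sum, map_smul, LinearMap.sum_apply, LinearMap.smul_apply, Finset.smul_sum]
  refine Finset.sum_congr rfl fun i _ ↦ ?_
  rw [inner_connection_unit hDL h.smooth_line h1, ← Complex.coe_smul, smul_smul,
    real_inner_comm, mul_assoc]

end Dirac

end Twisted

/-! ## Lie derivatives and induced vector fields -/

theorem contMDiff_smul_left {n d : ℕ}
    {G : Type*} [TopologicalSpace G] [Group G] [ChartedSpace (EuclideanSpace ℝ (Fin d)) G]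
    {M : Type*} [TopologicalSpace M] [ChartedSpace (EuclideanSpace ℝ (Fin n)) M] [MulAction G M]
    [ContMDiffSMul (𝓡 d) (𝓡 n) ∞ G M] (g : G) :
    ContMDiff (𝓡 n) (𝓡 n) ∞ (fun x : M ↦ g • x) :=
  (ContMDiffSMul.contMDiff_smul (I := 𝓡 d) (I' := 𝓡 n) (G := G) (M := M)).comp
    (contMDiff_const.prodMk contMDiff_id)

section Induced

variable {n d : ℕ}
  {G : Type*} [TopologicalSpace G] [Group G] [ChartedSpace (EuclideanSpace ℝ (Fin d)) G]
  {M : Type*} [TopologicalSpace M] [ChartedSpace (EuclideanSpace ℝ (Fin n)) M] [MulAction G M]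
  [LieGroup (𝓡 d) ∞ G] [IsManifold (𝓡 n) ∞ M] [ContMDiffSMul (𝓡 d) (𝓡 n) ∞ G M]

theorem contMDiff_smul_right (m : M) : ContMDiff (𝓡 d) (𝓡 n) ∞ (fun g : G ↦ g • m) :=
  (ContMDiffSMul.contMDiff_smul (I := 𝓡 d) (I' := 𝓡 n) (G := G) (M := M)).comp
    (contMDiff_id.prodMk contMDiff_const)

theorem inducedField_add (X Y : GroupLieAlgebra (𝓡 d) G) (m : M) :
    inducedField (n := n) (X + Y) m = inducedField X m + inducedField Y m := by
  -- The derivative of `g ↦ g • m` at the identity lands in the tangent space at `1 • m`, which is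
  -- not syntactically `m`. Both tangent spaces are the model space, so linearity is checked there.
  let T : EuclideanSpace ℝ (Fin d) →L[ℝ] EuclideanSpace ℝ (Fin n) :=
    mfderiv (𝓡 d) (𝓡 n) (fun g : G ↦ g • m) 1
  exact (-T).map_add X Y

theorem inducedField_smul (r : ℝ) (X : GroupLieAlgebra (𝓡 d) G) (m : M) :
    inducedField (n := n) (r • X) m = r • inducedField X m := by
  let T : EuclideanSpace ℝ (Fin d) →L[ℝ] EuclideanSpace ℝ (Fin n) :=
    mfderiv (𝓡 d) (𝓡 n) (fun g : G ↦ g • m) 1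
  exact (-T).map_smul r X

/-- The map `X ↦ X^M(m)`. -/
def inducedLinear (m : M) : GroupLieAlgebra (𝓡 d) G →ₗ[ℝ] TangentSpace (𝓡 n) m where
  toFun X := inducedField X m
  map_add' X Y := inducedField_add X Y m
  map_smul' r X := inducedField_smul r X m

/-- Up to sign, `X^M` is the tangent map of the action `G × M → M` applied to the vector `X` at the
identity and the zero section of `TM`. -/
theorem isSmoothField_inducedField (X : GroupLieAlgebra (𝓡 d) G) :
    IsSmoothField (M := M) (inducedField (n := n) X) := by
  have h0 : ContMDiff (𝓡 n) (𝓡 n).tangent ∞ (fun m : M ↦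
      (⟨m, show TangentSpace (𝓡 n) m from mfderiv (𝓡 d) (𝓡 n) (fun g : G ↦ g • m) 1 X⟩ :
        TangentBundle (𝓡 n) M)) := by
    let fg : M → TangentBundle (𝓡 n) M := fun m ↦ TotalSpace.mk' _ m 0
    have sfg : ContMDiff (𝓡 n) (𝓡 n).tangent ∞ fg := contMDiff_zeroSection ℝ _
    let fv : M → TangentBundle (𝓡 d) G := fun _ ↦ ⟨1, X⟩
    have sfv : ContMDiff (𝓡 n) (𝓡 d).tangent ∞ fv := contMDiff_const
    let F₂ : TangentBundle (𝓡 d) G × TangentBundle (𝓡 n) M →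
        TangentBundle ((𝓡 d).prod (𝓡 n)) (G × M) := (equivTangentBundleProd (𝓡 d) G (𝓡 n) M).symm
    have S₂ : ContMDiff _ _ ∞ F₂ := contMDiff_equivTangentBundleProd_symm
    have hs := ContMDiffSMul.contMDiff_smul (I := 𝓡 d) (I' := 𝓡 n) (n := ∞) (G := G) (M := M)
    have S₃ := hs.contMDiff_tangentMap (m := ∞) le_rfl
    have S := (S₃.comp S₂).comp (sfv.prodMk sfg)
    convert! S with m
    · simp [F₂, fg, fv]
    · simp only [Function.comp_apply, tangentMap, F₂, fg, fv]
      rw [mfderiv_prod_eq_add_apply (hs.mdifferentiableAt (by simp))]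
      exact ((congrArg₂ (· + ·) rfl (map_zero _)).trans (add_zero _)).symm
  exact ContMDiff.neg_section h0

end Induced

/-! ### Lie derivatives of sections of equivariant bundles -/

section LieDerivative

variable {n d : ℕ}
  {G : Type*} [TopologicalSpace G] [Group G] [ChartedSpace (EuclideanSpace ℝ (Fin d)) G]
  {M : Type*} [TopologicalSpace M] [ChartedSpace (EuclideanSpace ℝ (Fin n)) M] [MulAction G M]
  [LieGroup (𝓡 d) ∞ G] [IsManifold (𝓡 n) ∞ M] [ContMDiffSMul (𝓡 d) (𝓡 n) ∞ G M]
  {F : Type*} [NormedAddCommGroup F] [NormedSpace ℂ F]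
  {V : M → Type*} [TopologicalSpace (TotalSpace F V)]
  [∀ m, NormedAddCommGroup (V m)] [∀ m, InnerProductSpace ℂ (V m)]
  [FiberBundle F V] [VectorBundle ℂ F V] [VectorBundle ℝ F V]
  (a : EquivariantStructure (n := n) d G F V)

/-- Translation is defined by the inverse of `act g`, whereas smoothness is known for the action
itself. Writing it as the action of `g⁻¹`, in the total space because the fibres over `g⁻¹ • g • m`
and `m` must be compared, gives joint smoothness in `m` and `g`. -/
theorem EquivariantStructure.mk_translate (g : G) (σ : ∀ m, V m) (m : M) :
    (⟨m, a.translate g σ m⟩ : TotalSpace F V) =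
      ⟨g⁻¹ • g • m, a.act g⁻¹ (g • m) (σ (g • m))⟩ := by
  have h1 := a.mul_act g⁻¹ g m (a.translate g σ m)
  have h2 : a.act g m (a.translate g σ m) = σ (g • m) := (a.act g m).apply_symm_apply _
  rw [h2] at h1
  rw [← h1, ← a.one_act m (a.translate g σ m), inv_mul_cancel]

theorem EquivariantStructure.contMDiff_translate {σ : ∀ m, V m}
    (hσ : IsSmoothSection (n := n) F σ) :
    ContMDiff ((𝓡 n).prod (𝓡 d)) ((𝓡 n).prod 𝓘(ℝ, F)) ∞
      (fun q : M × G ↦ (⟨q.1, a.translate q.2 σ q.1⟩ : TotalSpace F V)) := by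
  have h1 : ContMDiff ((𝓡 n).prod (𝓡 d)) (𝓡 n) ∞ (fun q : M × G ↦ q.2 • q.1) :=
    (ContMDiffSMul.contMDiff_smul (I := 𝓡 d) (I' := 𝓡 n) (G := G) (M := M)).comp
      (contMDiff_snd.prodMk contMDiff_fst)
  have h2 : ContMDiff ((𝓡 n).prod (𝓡 d)) (𝓡 d) ∞ (fun q : M × G ↦ q.2⁻¹) :=
    (contMDiff_inv (𝓡 d) ∞).comp contMDiff_snd
  refine (a.smooth.comp (h2.prodMk (hσ.comp h1))).congr fun q ↦ ?_
  exact a.mk_translate _ _ _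

theorem EquivariantStructure.isSmoothSection_translate {σ : ∀ m, V m}
    (hσ : IsSmoothSection (n := n) F σ) (g : G) :
    IsSmoothSection (n := n) F (a.translate g σ) :=
  (a.contMDiff_translate hσ).comp (contMDiff_id.prodMk contMDiff_const)

theorem EquivariantStructure.translate_one (σ : ∀ m, V m) (m : M) :
    a.translate 1 σ m = σ m := by
  have h := a.mk_translate 1 σ m
  rw [inv_one, a.one_act, one_smul] at h
  exact eq_of_heq (TotalSpace.mk.inj h).2

theorem EquivariantStructure.contMDiff_translate_apply {σ : ∀ m, V m}
    (hσ : IsSmoothSection (n := n) F σ) (m : M) :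
    ContMDiff (𝓡 d) 𝓘(ℝ, V m) ∞ (fun g : G ↦ a.translate g σ m) := by
  let e := trivializationAt F V m
  have hm : m ∈ e.baseSet := FiberBundle.mem_baseSet_trivializationAt F V m
  let T := e.continuousLinearEquivAt ℝ m hm
  have h1 : ContMDiff (𝓡 d) ((𝓡 n).prod 𝓘(ℝ, F)) ∞
      (fun g : G ↦ (⟨m, a.translate g σ m⟩ : TotalSpace F V)) :=
    (a.contMDiff_translate hσ).comp (contMDiff_const.prodMk contMDiff_id)
  have h2 : ContMDiff (𝓡 d) 𝓘(ℝ, F) ∞ (fun g : G ↦ T (a.translate g σ m)) := fun g ↦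
    (contMDiffAt_totalSpace.1 (h1 g)).2
  have h3 := (ContinuousLinearMap.contMDiff (n := ∞) (T.symm : F →L[ℝ] V m)).comp h2
  refine h3.congr fun g ↦ ?_
  simp

/-- The derivative in `g` at the fixed point `1` of a family smooth in `(m, g)` is smooth in `m`.
The rest of the argument removes tangent coordinate changes, which are trivial at a fixed base
point. -/
theorem EquivariantStructure.isSmoothSection_lieDerivative {σ : ∀ m, V m}
    (hσ : IsSmoothSection (n := n) F σ) (X : GroupLieAlgebra (𝓡 d) G) :
    IsSmoothSection (n := n) F (a.lieDerivative X σ) := by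
  refine (IsSmoothSection.neg (σ := fun m ↦ mvfderiv (𝓡 d) (fun g : G ↦ a.translate g σ m) 1 X)
    fun m₀ ↦ ?_)
  refine (contMDiffAt_section (IB := 𝓡 n) (F := F) m₀).2 ?_
  let e := trivializationAt F V m₀
  have hm : m₀ ∈ e.baseSet := FiberBundle.mem_baseSet_trivializationAt F V m₀
  let ψ : M → G → F := fun m g ↦ (e ⟨m, a.translate g σ m⟩).2
  have h1 : ContMDiffAt ((𝓡 n).prod (𝓡 d)) 𝓘(ℝ, F) ∞ (Function.uncurry ψ) (m₀, 1) :=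
    (contMDiffAt_totalSpace.1 (a.contMDiff_translate hσ (m₀, 1))).2
  have h2 := ContMDiffAt.mfderiv_apply (m := ∞) (I := 𝓡 d) (I' := 𝓘(ℝ, F)) ψ
    (fun _ ↦ 1) id (fun _ ↦ (show EuclideanSpace ℝ (Fin d) from X)) h1 contMDiffAt_const
    contMDiffAt_id contMDiffAt_const le_rfl
  refine h2.congr_of_eventuallyEq ?_
  filter_upwards [e.open_baseSet.mem_nhds hm] with m hm'
  let T := e.continuousLinearEquivAt ℝ m hm'
  have h3 := mvfderiv_clm_comp (n := d) (T : V m →L[ℝ] F)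
    (((a.contMDiff_translate_apply hσ m) 1).mdifferentiableAt (by simp)) X
  have h4 := inTangentCoordinates_eq (I := 𝓡 d) (I' := 𝓘(ℝ, F)) (fun _ : M ↦ (1 : G))
    (fun m ↦ ψ m 1) (fun x ↦ mfderiv (𝓡 d) 𝓘(ℝ, F) (ψ x) 1) (x₀ := m₀) (x := m)
    (mem_chart_source _ _) (Set.mem_univ _)
  have h5 : (tangentBundleCore (𝓡 d) G).coordChange (achart _ 1) (achart _ 1) 1 X = X :=
    (tangentBundleCore (𝓡 d) G).coordChange_self _ _ (mem_chart_source _ _) X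
  have h6 := congrArg (fun A : EuclideanSpace ℝ (Fin d) →L[ℝ] F ↦ A X) h4
  refine h3.symm.trans (Eq.trans ?_ h6.symm)
  rw [tangentBundleCore_coordChange_model_space]
  exact congrArg (fun Y : EuclideanSpace ℝ (Fin d) ↦
    (show EuclideanSpace ℝ (Fin d) →L[ℝ] F from mfderiv (𝓡 d) 𝓘(ℝ, F) (ψ m) 1) Y) h5.symm

theorem mvfderiv_smul_right {u : M → ℝ} (hu : ContMDiff (𝓡 n) 𝓘(ℝ, ℝ) ∞ u)
    (X : GroupLieAlgebra (𝓡 d) G) (m : M) :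
    mvfderiv (𝓡 d) (fun g : G ↦ u (g • m)) 1 X = -mvfderiv (𝓡 n) u m (inducedField X m) := by
  have h1 := ((hu ((1 : G) • m)).mdifferentiableAt (by simp)).hasMFDerivAt.comp (1 : G)
    ((contMDiff_smul_right (d := d) (n := n) (G := G) m 1).mdifferentiableAt (by simp)).hasMFDerivAt
  have h2 : mvfderiv (𝓡 d) (fun g : G ↦ u (g • m)) 1 X =
      mvfderiv (𝓡 n) u ((1 : G) • m) (mfderiv (𝓡 d) (𝓡 n) (fun g : G ↦ g • m) 1 X) :=
    congrArg (fun T ↦ T X) h1.mfderiv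
  rw [h2]
  have h3 : ∀ (m' : M) (w : EuclideanSpace ℝ (Fin n)), m' = m →
      mvfderiv (𝓡 n) u m' (show TangentSpace (𝓡 n) m' from w) =
        mvfderiv (𝓡 n) u m (show TangentSpace (𝓡 n) m from w) := by
    rintro m' w rfl; rfl
  rw [inducedField, map_neg, neg_neg]
  exact h3 _ _ (one_smul G m)

theorem EquivariantStructure.lieDerivative_smul {σ : ∀ m, V m}
    (hσ : IsSmoothSection (n := n) F σ) {u : M → ℝ} (hu : ContMDiff (𝓡 n) 𝓘(ℝ, ℝ) ∞ u)
    (X : GroupLieAlgebra (𝓡 d) G) (m : M) :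
    a.lieDerivative X (fun x ↦ u x • σ x) m =
      mvfderiv (𝓡 n) u m (inducedField X m) • σ m + u m • a.lieDerivative X σ m := by
  have h1 : (fun g : G ↦ a.translate g (fun x ↦ u x • σ x) m) =
      fun g ↦ u (g • m) • a.translate g σ m := by
    funext g
    simp only [translate]
    rw [← Complex.coe_smul, map_smul, Complex.coe_smul]
  have h2 : MDifferentiableAt (𝓡 d) 𝓘(ℝ, ℝ) (fun g : G ↦ u (g • m)) 1 :=
    (hu.comp (contMDiff_smul_right m) 1).mdifferentiableAt (by simp)
  have h3 := (a.contMDiff_translate_apply hσ m 1).mdifferentiableAt (by simp)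
  simp only [lieDerivative]
  rw [h1, mvfderiv_fun_smul h2 h3]
  simp [mvfderiv_smul_right hu, a.translate_one]

theorem EquivariantStructure.lieDerivative_add {σ τ : ∀ m, V m}
    (hσ : IsSmoothSection (n := n) F σ) (hτ : IsSmoothSection (n := n) F τ)
    (X : GroupLieAlgebra (𝓡 d) G) (m : M) :
    a.lieDerivative X (fun x ↦ σ x + τ x) m =
      a.lieDerivative X σ m + a.lieDerivative X τ m := by
  have h1 : (fun g : G ↦ a.translate g (fun x ↦ σ x + τ x) m) =
      fun g ↦ a.translate g σ m + a.translate g τ m := by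
    funext g
    simp only [translate, map_add]
  have h2 := (a.contMDiff_translate_apply hσ m 1).mdifferentiableAt (by simp)
  have h3 := (a.contMDiff_translate_apply hτ m 1).mdifferentiableAt (by simp)
  simp only [lieDerivative]
  rw [h1, mvfderiv_fun_add h2 h3]
  simp [add_comm]

end LieDerivative

/-! ## The moment map -/

section Moment

variable {n d : ℕ}
  {G : Type*} [TopologicalSpace G] [Group G] [ChartedSpace (EuclideanSpace ℝ (Fin d)) G]
  {M : Type*} [TopologicalSpace M] [ChartedSpace (EuclideanSpace ℝ (Fin n)) M] [MulAction G M]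
  [LieGroup (𝓡 d) ∞ G] [IsManifold (𝓡 n) ∞ M] [ContMDiffSMul (𝓡 d) (𝓡 n) ∞ G M]
  {B : LieAlgebraMetric (n := n) (d := d) G M} {μ : M → GroupLieAlgebra (𝓡 d) G →ₗ[ℝ] ℝ}

theorem LieAlgebraMetric.form_dual (B : LieAlgebraMetric (n := n) (d := d) G M)
    (μ : M → GroupLieAlgebra (𝓡 d) G →ₗ[ℝ] ℝ) (m : M) (Y : GroupLieAlgebra (𝓡 d) G) :
    B.form m (B.dual μ m) Y = μ m Y :=
  LinearMap.BilinForm.apply_toDual_symm_apply (μ m) Y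

/-- In a fixed basis of the Lie algebra, the coordinates of the dual of `μ` are the inverse Gram
matrix applied to those of `μ`. Statements about the variable element `B.dual μ m` are thereby
reduced to constant elements of the Lie algebra. -/
theorem LieAlgebraMetric.exists_dual_eq_sum (B : LieAlgebraMetric (n := n) (d := d) G M)
    (hμ : ∀ X, ContMDiff (𝓡 n) 𝓘(ℝ, ℝ) ∞ fun m ↦ μ m X) :
    ∃ (r : ℕ) (b : Fin r → GroupLieAlgebra (𝓡 d) G) (x : Fin r → M → ℝ),
      (∀ i, ContMDiff (𝓡 n) 𝓘(ℝ, ℝ) ∞ (x i)) ∧ ∀ m, B.dual μ m = ∑ i, x i m • b i := by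
  classical
  let b := Module.finBasis ℝ (GroupLieAlgebra (𝓡 d) G)
  let A : M → Matrix _ _ ℝ := fun m ↦ LinearMap.BilinForm.toMatrix b (B.form m)
  have hA : ∀ i j, ContMDiff (𝓡 n) 𝓘(ℝ, ℝ) ∞ fun m ↦ A m i j := fun i j ↦ by
    simpa [A, LinearMap.BilinForm.toMatrix_apply] using B.smooth (b i) (b j)
  have hdet : ∀ m, (A m).det ≠ 0 := fun m ↦
    (LinearMap.BilinForm.nondegenerate_iff_det_ne_zero b).1 (B.nondegenerate m)
  refine ⟨_, b, fun i m ↦ ∑ j, (A m)⁻¹ i j * μ m (b j), fun i ↦ ?_, fun m ↦ ?_⟩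
  · have h1 : ∀ i j, ContMDiff (𝓡 n) 𝓘(ℝ, ℝ) ∞ fun m ↦ (A m)⁻¹ i j := fun i j ↦ by
      rw [← contMDiffOn_univ]
      exact contMDiffOn_inv_apply (fun i j ↦ (hA i j).contMDiffOn) (fun x _ ↦ hdet x) i j
    exact contMDiff_finsetSum fun j _ ↦ (h1 i j).mul (hμ (b j))
  · set x := B.dual μ m with hx
    have h2 : Matrix.mulVec (A m) (b.repr x) = fun j ↦ μ m (b j) := by
      funext j
      rw [Matrix.mulVec, dotProduct]
      rw [← B.form_dual μ m (b j), ← hx, B.symm]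
      have h5 := congrArg (B.form m (b j)) (b.sum_repr x)
      rw [map_sum] at h5
      rw [← h5]
      refine Finset.sum_congr (s₁ := Finset.univ) rfl fun i _ ↦ ?_
      rw [map_smul, smul_eq_mul, mul_comm]
      exact congrArg _ (LinearMap.BilinForm.toMatrix_apply b (B.form m) j i)
    have h3 : ∀ i, ∑ j, (A m)⁻¹ i j * μ m (b j) = b.repr x i := fun i ↦ by
      have : Matrix.mulVec (A m)⁻¹ (fun j ↦ μ m (b j)) = b.repr x := by
        rw [← h2, Matrix.mulVec_mulVec, Matrix.nonsing_inv_mul _ (hdet m).isUnit,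
          Matrix.one_mulVec]
      exact congrFun this i
    simp only [h3]
    exact (b.sum_repr x).symm

theorem isSmoothField_momentField (B : LieAlgebraMetric (n := n) (d := d) G M)
    (hμ : ∀ X, ContMDiff (𝓡 n) 𝓘(ℝ, ℝ) ∞ fun m ↦ μ m X) :
    IsSmoothField (momentField B μ) := by
  obtain ⟨r, b, x, hx, h⟩ := B.exists_dual_eq_sum hμ
  have h1 : momentField B μ = fun m ↦ ∑ i, x i m • inducedField (n := n) (b i) m := by
    funext m
    have := map_sum (inducedLinear (n := n) (d := d) (G := G) m) (fun i ↦ x i m • b i) Finset.univ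
    simp only [map_smul] at this
    rw [← h] at this
    exact this
  rw [h1]
  exact ContMDiff.sum_section fun i _ ↦ (hx i).smul_section (isSmoothField_inducedField (b i))

variable {FL : Type*} [NormedAddCommGroup FL] [NormedSpace ℂ FL]
  {L : M → Type*} [TopologicalSpace (TotalSpace FL L)]
  [∀ m, NormedAddCommGroup (L m)] [∀ m, InnerProductSpace ℂ (L m)]
  [FiberBundle FL L] [VectorBundle ℂ FL L] [VectorBundle ℝ FL L]
  [ContMDiffVectorBundle ∞ FL L (𝓡 n)]
  {aL : EquivariantStructure (n := n) d G FL L} {DL : CovariantDerivative (𝓡 n) FL L}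

/-- Smoothness of `μ` is not part of its definition. It follows by pairing the defining identity
with a section `l` nonzero at `m₀` and dividing by `2πi⟨l, l⟩`. -/
theorem IsMomentMap.contMDiff [T2Space M] (hFL : Module.finrank ℂ FL = 1)
    (hDL : IsHermitianConnection DL) (hμ : IsMomentMap aL DL μ) (X : GroupLieAlgebra (𝓡 d) G) :
    ContMDiff (𝓡 n) 𝓘(ℝ, ℝ) ∞ fun m ↦ μ m X := by
  intro m₀
  obtain ⟨l₀, hl₀⟩ := exists_norm_eq_one_of_finrank (L := L) (m := m₀)
    (by rw [finrank_fibre (F := FL), hFL])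
  obtain ⟨l, hl, rfl⟩ := exists_section_apply_eq (n := n) (F := FL) l₀
  have hs := aL.isSmoothSection_lieDerivative hl X
  have hs' := contMDiff_connection hDL hl (isSmoothField_inducedField X)
  let q : M → ℂ := fun m ↦ inner ℂ (l m) (l m)
  have hq : ContMDiff (𝓡 n) 𝓘(ℝ, ℂ) ∞ q := aL.metric_smooth l l hl hl
  have hr := aL.metric_smooth l _ hl (hs.sub hs')
  have hq0 : q m₀ ≠ 0 := by simp [q, inner_self_eq_norm_sq_to_K, hl₀]
  have h1 : ContMDiffAt (𝓡 n) 𝓘(ℝ, ℂ) ∞ (fun m ↦ (q m)⁻¹) m₀ :=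
    ((contDiffAt_inv ℂ hq0).restrict_scalars ℝ).contMDiffAt.comp m₀ (hq m₀)
  have hm : ContDiff ℝ ∞ fun z : ℂ × ℂ ↦ ((2 * Real.pi * Complex.I)⁻¹ * (z.1 * z.2)).re :=
    Complex.reCLM.contDiff.comp (contDiff_const.mul (contDiff_fst.mul contDiff_snd))
  have h2 := hm.contDiffAt.comp_contMDiffAt ((hr m₀).prodMk_space h1)
  refine h2.congr_of_eventuallyEq ?_
  filter_upwards [hq.continuous.continuousAt.eventually_ne hq0] with m hm
  simp only [Function.comp_apply]
  rw [← hμ X l hl m, inner_smul_right]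
  have h3 : (2 * Real.pi * Complex.I : ℂ) ≠ 0 := by
    simp [Real.pi_ne_zero]
  change _ = ((2 * Real.pi * Complex.I)⁻¹ * ((2 * Real.pi * Complex.I * (μ m X : ℂ)) * q m *
    (q m)⁻¹)).re
  rw [mul_assoc _ (q m), mul_inv_cancel₀ hm, mul_one, ← mul_assoc, inv_mul_cancel₀ h3, one_mul,
    Complex.ofReal_re]

end Moment

/-! ## Tensoriality -/

section Tensorial

variable {n : ℕ} {M : Type*} [TopologicalSpace M] [ChartedSpace (EuclideanSpace ℝ (Fin n)) M]
  [IsManifold (𝓡 n) ∞ M] [T2Space M]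
  {F : Type*} [NormedAddCommGroup F] [NormedSpace ℂ F] [FiniteDimensional ℝ F]
  {V : M → Type*} [TopologicalSpace (TotalSpace F V)]
  [∀ m, NormedAddCommGroup (V m)] [∀ m, InnerProductSpace ℂ (V m)]
  [FiberBundle F V] [VectorBundle ℂ F V] [VectorBundle ℝ F V] [ContMDiffVectorBundle ∞ F V (𝓡 n)]
  {W : Type*} [AddCommGroup W] [Module ℂ W]

/-- An operation linear over smooth functions depends only on the value of the section at `m`. It
recognises as endomorphisms the difference of two connections and the anticommutator corrected by a
Lie derivative. -/
theorem exists_linearMap_of_tensorial {m : M} (Θ : (∀ x, V x) → W)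
    (hadd : ∀ σ τ : ∀ x, V x, IsSmoothSection (n := n) F σ → IsSmoothSection (n := n) F τ →
      Θ (fun x ↦ σ x + τ x) = Θ σ + Θ τ)
    (hsmul : ∀ (u : M → ℝ) (σ : ∀ x, V x), ContMDiff (𝓡 n) 𝓘(ℝ, ℝ) ∞ u →
      IsSmoothSection (n := n) F σ → Θ (fun x ↦ u x • σ x) = u m • Θ σ)
    (hI : ∀ σ : ∀ x, V x, IsSmoothSection (n := n) F σ →
      Θ (fun x ↦ Complex.I • σ x) = Complex.I • Θ σ) :
    ∃ T : V m →ₗ[ℂ] W, ∀ σ : ∀ x, V x, IsSmoothSection (n := n) F σ → Θ σ = T (σ m) := by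
  -- If `σ` vanishes at `m`, then `ρσ` is a combination of global sections with coefficients
  -- vanishing at `m`, where the cutoff `ρ` is `1` at `m`.
  have hzero : ∀ σ : ∀ x, V x, IsSmoothSection (n := n) F σ → σ m = 0 → Θ σ = 0 := by
    intro σ hσ h0
    obtain ⟨r, s, a, N, hN, hm, hs, ha, -, hu⟩ := exists_frame (n := n) (F := F) (V := V) m
    obtain ⟨u, hu, hue⟩ := hu σ hσ
    obtain ⟨ρ, hρ, -, hρN, hρ1, -, -⟩ := exists_cutoff (n := n) (hN.mem_nhds hm)
    obtain ⟨w, hw, hwe⟩ : ∃ w : Fin r → M → ℝ, (∀ i, ContMDiff (𝓡 n) 𝓘(ℝ, ℝ) ∞ (w i)) ∧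
        ∀ i x, w i x = ρ x * u i x := ⟨fun i x ↦ ρ x * u i x, fun i ↦ hρ.mul (hu i), fun _ _ ↦ rfl⟩
    have h1 : (fun x ↦ ρ x • σ x) = fun x ↦ ∑ i, w i x • s i x := by
      funext x
      simp only [hwe]
      by_cases hx : x ∈ N
      · simp only [mul_smul, ← Finset.smul_sum, hue x hx, ha x hx]
      · have : ρ x = 0 := image_eq_zero_of_notMem_tsupport fun h ↦ hx (hρN h)
        simp [this]
    have h2 : Θ (fun x ↦ ρ x • σ x) = Θ σ := by
      rw [hsmul ρ σ hρ hσ, hρ1.self_of_nhds, one_smul]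
    have h0' : Θ (fun x ↦ (0 : V x)) = 0 := by
      have := hsmul (fun _ ↦ (0 : ℝ)) (fun x ↦ (0 : V x)) contMDiff_const isSmoothSection_zero
      simpa using this
    have hsum : ∀ t : Finset (Fin r), Θ (fun x ↦ ∑ i ∈ t, w i x • s i x) =
        ∑ i ∈ t, Θ (fun x ↦ w i x • s i x) := by
      intro t
      induction t using Finset.induction_on with
      | empty => simpa using h0'
      | insert i t hi ih =>
        simp only [Finset.sum_insert hi]
        rw [hadd _ _ (IsSmoothSection.smul (hs i) (hw i))
          (IsSmoothSection.sum fun i ↦ IsSmoothSection.smul (hs i) (hw i)), ih]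
    rw [← h2, h1, hsum]
    refine Finset.sum_eq_zero fun i _ ↦ ?_
    rw [hsmul _ _ (hw i) (hs i), hwe, hue m hm, h0]
    simp
  have hneg : ∀ σ τ : ∀ x, V x, IsSmoothSection (n := n) F σ → IsSmoothSection (n := n) F τ →
      σ m = τ m → Θ σ = Θ τ := by
    intro σ τ hσ hτ h
    have h1 := hzero _ (hσ.sub hτ) (by simp [h])
    have h2 := hadd _ τ (hσ.sub hτ) hτ
    simpa [h1] using h2
  choose s hs hs' using fun w : V m ↦ exists_section_apply_eq (n := n) (F := F) w
  have hR : ∀ (r : ℝ) (w : V m), Θ (s (r • w)) = r • Θ (s w) := fun r w ↦ by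
    rw [← hsmul (fun _ ↦ r) (s w) contMDiff_const (hs w)]
    exact hneg _ _ (hs _) (IsSmoothSection.smul (hs w) contMDiff_const) (by simp [hs'])
  have hA : ∀ w w' : V m, Θ (s (w + w')) = Θ (s w) + Θ (s w') := fun w w' ↦ by
    rw [← hadd _ _ (hs w) (hs w')]
    exact hneg _ _ (hs _) (IsSmoothSection.add (hs w) (hs w')) (by simp [hs'])
  have hI' : ∀ w : V m, Θ (s (Complex.I • w)) = Complex.I • Θ (s w) := fun w ↦ by
    rw [← hI _ (hs w)]
    exact hneg _ _ (hs _) (IsSmoothSection.const_smul (hs w) _) (by simp [hs'])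
  refine ⟨⟨⟨fun w ↦ Θ (s w), hA⟩, fun c w ↦ ?_⟩, fun σ hσ ↦ hneg _ _ hσ (hs _) (hs' _).symm⟩
  change Θ (s (c • w)) = c • Θ (s w)
  conv_lhs => rw [← Complex.re_add_im c]
  rw [add_smul, mul_comm, mul_smul, Complex.coe_smul, Complex.coe_smul, hA, hR, hI', hR,
    ← Complex.coe_smul, ← Complex.coe_smul]
  conv_rhs => rw [← Complex.re_add_im c]
  module

end Tensorial

/-! ## Invariance of the Levi-Civita connection -/

section LeviCivita

variable {n : ℕ} {G : Type*} [Group G]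
  {M : Type*} [TopologicalSpace M] [ChartedSpace (EuclideanSpace ℝ (Fin n)) M] [MulAction G M]
  [RiemannianBundle (fun x : M ↦ TangentSpace (𝓡 n) x)]

theorem IsIsometricAction.inner_pushforward (h : IsIsometricAction (n := n) G M) (g : G) (m : M)
    (v w : TangentSpace (𝓡 n) m) :
    inner ℝ (pushforward g m v) (pushforward g m w) = inner ℝ v w :=
  LinearIsometry.inner_map_map
    (⟨(pushforward g m).toLinearMap, h g m⟩ : TangentSpace (𝓡 n) m →ₗᵢ[ℝ] _) v w

theorem IsIsometricAction.exists_pushforward_eq (h : IsIsometricAction (n := n) G M) (g : G)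
    (m : M) : ∃ T : TangentSpace (𝓡 n) m ≃L[ℝ] TangentSpace (𝓡 n) (g • m),
      ∀ v, T v = pushforward g m v := by
  have hd : Module.finrank ℝ (TangentSpace (𝓡 n) m) =
      Module.finrank ℝ (TangentSpace (𝓡 n) (g • m)) :=
    rfl
  let A : TangentSpace (𝓡 n) m →ₗᵢ[ℝ] TangentSpace (𝓡 n) (g • m) :=
    ⟨(pushforward g m).toLinearMap, h g m⟩
  exact ⟨(A.toLinearIsometryEquiv hd).toContinuousLinearEquiv, fun v ↦ rfl⟩

theorem IsIsometricAction.surjective_pushforward (h : IsIsometricAction (n := n) G M) (g : G)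
    (m : M) (w : TangentSpace (𝓡 n) (g • m)) : ∃ v, pushforward g m v = w := by
  obtain ⟨T, hT⟩ := h.exists_pushforward_eq g m
  exact ⟨T.symm w, by rw [← hT, T.apply_symm_apply]⟩

theorem IsIsometricAction.isInvertible (h : IsIsometricAction (n := n) G M) (g : G)
    (m : M) : (mfderiv (𝓡 n) (𝓡 n) (fun x : M ↦ g • x) m).IsInvertible := by
  obtain ⟨T, hT⟩ := h.exists_pushforward_eq g m
  exact ⟨T, ContinuousLinearMap.ext hT⟩

/-- The vector field `m ↦ g⁻¹ (X(gm))`. -/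
def translateField (g : G) (X : ∀ m : M, TangentSpace (𝓡 n) m) :
    ∀ m : M, TangentSpace (𝓡 n) m :=
  VectorField.mpullback (𝓡 n) (𝓡 n) (fun x : M ↦ g • x) X

theorem pushforward_translateField (h : IsIsometricAction (n := n) G M) (g : G)
    (X : ∀ m : M, TangentSpace (𝓡 n) m) (m : M) :
    pushforward g m (translateField g X m) = X (g • m) := by
  obtain ⟨T, hT⟩ := h.isInvertible g m
  simp only [pushforward, translateField, VectorField.mpullback_apply]
  rw [← hT, ContinuousLinearMap.inverse_equiv]
  exact T.apply_symm_apply _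

theorem mvfderiv_smul_left {E : Type*} [NormedAddCommGroup E] [NormedSpace ℝ E] {u : M → E}
    (hu : ContMDiff (𝓡 n) 𝓘(ℝ, E) ∞ u) {g : G}
    (hg : ContMDiff (𝓡 n) (𝓡 n) ∞ fun x : M ↦ g • x) (m : M) (v : TangentSpace (𝓡 n) m) :
    mvfderiv (𝓡 n) (fun x ↦ u (g • x)) m v = mvfderiv (𝓡 n) u (g • m) (pushforward g m v) := by
  have h1 := ((hu (g • m)).mdifferentiableAt (by simp)).hasMFDerivAt.comp m
    ((hg m).mdifferentiableAt (by simp)).hasMFDerivAt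
  exact congrArg (fun T ↦ T v) h1.mfderiv

variable [IsManifold (𝓡 n) ∞ M]

theorem IsSmoothField.translateField (h : IsIsometricAction (n := n) G M) {g : G}
    (hg : ContMDiff (𝓡 n) (𝓡 n) ∞ fun x : M ↦ g • x) {X : ∀ m : M, TangentSpace (𝓡 n) m} (hX : IsSmoothField X) :
    IsSmoothField (translateField g X) := fun m ↦
  ContMDiffAt.mpullback_vectorField_preimage (hX (g • m))
    (hg m) (h.isInvertible g m) (by simp)

theorem exists_field_apply_eq [T2Space M] {m : M} (v : TangentSpace (𝓡 n) m) :
    ∃ X : ∀ m : M, TangentSpace (𝓡 n) m, IsSmoothField X ∧ X m = v :=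
  exists_section_apply_eq (n := n) v

variable {DT : CovariantDerivative (𝓡 n) (EuclideanSpace ℝ (Fin n))
      (fun x : M ↦ TangentSpace (𝓡 n) x)}

/-- The connection is expressed through the metric and Lie brackets only. This yields its invariance
under isometries and, for coordinate fields, the formula for their divergence. -/
theorem IsLeviCivita.koszul (h : IsLeviCivita DT) {X Y Z : ∀ m : M, TangentSpace (𝓡 n) m}
    (hX : IsSmoothField X) (hY : IsSmoothField Y) (hZ : IsSmoothField Z) (m : M) :
    2 * (inner ℝ (DT Y m (X m)) (Z m) : ℝ) =
      mvfderiv (𝓡 n) (fun x ↦ (inner ℝ (Y x) (Z x) : ℝ)) m (X m) +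
      mvfderiv (𝓡 n) (fun x ↦ (inner ℝ (Z x) (X x) : ℝ)) m (Y m) -
      mvfderiv (𝓡 n) (fun x ↦ (inner ℝ (X x) (Y x) : ℝ)) m (Z m) +
      inner ℝ (VectorField.mlieBracket (𝓡 n) X Y m) (Z m) -
      inner ℝ (VectorField.mlieBracket (𝓡 n) X Z m) (Y m) -
      inner ℝ (VectorField.mlieBracket (𝓡 n) Y Z m) (X m) := by
  rw [h.metric Y Z hY hZ, h.metric Z X hZ hX, h.metric X Y hX hY,
    ← h.torsion_free X Y hX hY, ← h.torsion_free X Z hX hZ, ← h.torsion_free Y Z hY hZ]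
  simp only [inner_sub_left]
  rw [real_inner_comm (X m) (DT Y m (Z m)), real_inner_comm (Y m) (DT X m (Z m)),
    real_inner_comm (X m) (DT Z m (Y m)), real_inner_comm (Y m) (DT Z m (X m)),
    real_inner_comm (Z m) (DT Y m (X m)), real_inner_comm (Z m) (DT X m (Y m))]
  linarith

variable [IsContMDiffRiemannianBundle (𝓡 n) ∞ (EuclideanSpace ℝ (Fin n))
      (fun x : M ↦ TangentSpace (𝓡 n) x)]

theorem contMDiff_inner {X Y : ∀ m : M, TangentSpace (𝓡 n) m}
    (hX : IsSmoothField X) (hY : IsSmoothField Y) :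
    ContMDiff (𝓡 n) 𝓘(ℝ, ℝ) ∞ fun m ↦ (inner ℝ (X m) (Y m) : ℝ) :=
  ContMDiff.inner_bundle hX hY

theorem IsLeviCivita.pushforward_translateField [T2Space M] (h : IsLeviCivita DT)
    (hG : IsIsometricAction (n := n) G M) {g : G}
    (hg : ContMDiff (𝓡 n) (𝓡 n) ∞ fun x : M ↦ g • x) {Y : ∀ m : M, TangentSpace (𝓡 n) m}
    (hY : IsSmoothField Y) (m : M) (v : TangentSpace (𝓡 n) m) :
    pushforward g m (DT (translateField g Y) m v) = DT Y (g • m) (pushforward g m v) := by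
  refine ext_inner_right ℝ fun z ↦ ?_
  obtain ⟨X, hX, hXv⟩ := exists_field_apply_eq (pushforward g m v)
  obtain ⟨Z, hZ, rfl⟩ := exists_field_apply_eq z
  have hp := CalliasLocalisation.pushforward_translateField (n := n) hG g
  have hXv' : translateField g X m = v := by
    obtain ⟨T, hT⟩ := hG.exists_pushforward_eq g m
    apply T.injective
    rw [hT, hT, hp, hXv]
  have hin : ∀ {X Y : ∀ m : M, TangentSpace (𝓡 n) m} (x : M),
      (inner ℝ (translateField g X x) (translateField g Y x) : ℝ) =
        inner ℝ (X (g • x)) (Y (g • x)) := fun {X Y} x ↦ by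
    rw [← hG.inner_pushforward g, hp, hp]
  have hd : ∀ {X Y Z : ∀ m : M, TangentSpace (𝓡 n) m}, IsSmoothField X → IsSmoothField Y →
      mvfderiv (𝓡 n) (fun x ↦ (inner ℝ (translateField g X x) (translateField g Y x) : ℝ)) m
        (translateField g Z m) =
      mvfderiv (𝓡 n) (fun x ↦ (inner ℝ (X x) (Y x) : ℝ)) (g • m) (Z (g • m)) :=
    fun {X Y Z} hX hY ↦ by
      simp only [hin]
      rw [mvfderiv_smul_left (contMDiff_inner hX hY) hg, hp]
  have hb : ∀ {X Y Z : ∀ m : M, TangentSpace (𝓡 n) m}, IsSmoothField X → IsSmoothField Y →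
      (inner ℝ (VectorField.mlieBracket (𝓡 n) (translateField g X) (translateField g Y) m)
        (translateField g Z m) : ℝ) =
      inner ℝ (VectorField.mlieBracket (𝓡 n) X Y (g • m)) (Z (g • m)) := fun {X Y Z} hX hY ↦ by
    have h2 : (2 : ℕ∞ω) ≤ ∞ := WithTop.coe_le_coe.2 (le_top (a := (2 : ℕ∞)))
    have : IsManifold (𝓡 n) (minSmoothness ℝ 2) M :=
      IsManifold.of_le (n := ∞) (by simpa using h2)
    have h1 := VectorField.mpullback_mlieBracket (I := 𝓡 n) (I' := 𝓡 n) (n := ∞)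
      (f := fun x : M ↦ g • x) (x₀ := m) (V := X) (W := Y)
      ((hX (g • m)).mdifferentiableAt (by simp)) ((hY (g • m)).mdifferentiableAt (by simp))
      (hg m) (by simpa using h2)
    change inner ℝ (VectorField.mlieBracket (𝓡 n) (VectorField.mpullback _ _ _ _)
      (VectorField.mpullback _ _ _ _) m) _ = _
    rw [← h1]
    exact hin m
  have k1 := h.koszul (hX.translateField hG hg) (hY.translateField hG hg)
    (hZ.translateField hG hg) m
  have k2 := h.koszul hX hY hZ (g • m)
  rw [hd hY hZ, hd hZ hX, hd hX hY, hb hX hY, hb hX hZ, hb hY hZ, ← k2, hXv', hXv,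
    ← hG.inner_pushforward g, hp] at k1
  linarith

end LeviCivita

/-! ## Invariance of the spinor connection and of the Dirac operators -/

section Spinor

variable {n d : ℕ}
  {G : Type*} [TopologicalSpace G] [Group G] [ChartedSpace (EuclideanSpace ℝ (Fin d)) G]
  {M : Type*} [TopologicalSpace M] [ChartedSpace (EuclideanSpace ℝ (Fin n)) M] [MulAction G M]
  [LieGroup (𝓡 d) ∞ G] [ContMDiffSMul (𝓡 d) (𝓡 n) ∞ G M] [T2Space M]
  [IsManifold (𝓡 n) ∞ M] [RiemannianBundle (fun x : M ↦ TangentSpace (𝓡 n) x)]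
  [IsContMDiffRiemannianBundle (𝓡 n) ∞ (EuclideanSpace ℝ (Fin n))
      (fun x : M ↦ TangentSpace (𝓡 n) x)]
  {FS : Type*} [NormedAddCommGroup FS] [NormedSpace ℂ FS]
  {S : M → Type*} [TopologicalSpace (TotalSpace FS S)]
  [∀ m, NormedAddCommGroup (S m)] [∀ m, InnerProductSpace ℂ (S m)]
  [FiberBundle FS S] [VectorBundle ℂ FS S] [VectorBundle ℝ FS S]
  [ContMDiffVectorBundle ∞ FS S (𝓡 n)]
  {FL : Type*} [NormedAddCommGroup FL] [NormedSpace ℂ FL]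
  {L : M → Type*} [TopologicalSpace (TotalSpace FL L)]
  [∀ m, NormedAddCommGroup (L m)] [∀ m, InnerProductSpace ℂ (L m)]
  [FiberBundle FL L] [VectorBundle ℂ FL L] [VectorBundle ℝ FL L]
  [ContMDiffVectorBundle ∞ FL L (𝓡 n)]
  {aS : EquivariantStructure (n := n) d G FS S} {aL : EquivariantStructure (n := n) d G FL L}
  {P : SpinCStructure aS aL}
  {DT : CovariantDerivative (𝓡 n) (EuclideanSpace ℝ (Fin n))
      (fun x : M ↦ TangentSpace (𝓡 n) x)}
  {DL : CovariantDerivative (𝓡 n) FL L} {DS : CovariantDerivative (𝓡 n) FS S}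

theorem SpinCStructure.finiteDimensional_spinor (P : SpinCStructure aS aL) :
    FiniteDimensional ℝ FS := by
  have : FiniteDimensional ℂ FS := Module.finite_of_finrank_pos (by rw [P.rank_spinor]; positivity)
  exact FiniteDimensional.complexToReal FS

theorem SpinCStructure.nontrivial_spinor (P : SpinCStructure aS aL) (m : M) :
    ∃ w : S m, w ≠ 0 := by
  have h : 0 < Module.finrank ℂ (S m) := by
    rw [finrank_fibre (F := FS), P.rank_spinor]; positivity
  have := Module.nontrivial_of_finrank_pos h
  exact exists_ne 0

theorem SpinCStructure.c_pushforward_symm (P : SpinCStructure aS aL) (g : G) (m : M)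
    (v : TangentSpace (𝓡 n) m) (w : S (g • m)) :
    (aS.act g m).symm (P.c (g • m) (pushforward g m v) w) = P.c m v ((aS.act g m).symm w) := by
  rw [LinearIsometryEquiv.symm_apply_eq, P.c_equivariant, LinearIsometryEquiv.apply_symm_apply]

theorem SpinCStructure.translate_c (P : SpinCStructure aS aL)
    (hG : IsIsometricAction (n := n) G M) (g : G) (X : ∀ m : M, TangentSpace (𝓡 n) m)
    (σ : ∀ m, S m) :
    aS.translate g (fun x ↦ P.c x (X x) (σ x)) =
      fun x ↦ P.c x (translateField g X x) (aS.translate g σ x) := by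
  funext x
  simp only [EquivariantStructure.translate]
  rw [← pushforward_translateField hG g X x, P.c_pushforward_symm]

theorem SpinCStructure.translate_β (P : SpinCStructure aS aL) (g : G) (σ τ : ∀ m, S m) :
    aL.translate g (fun x ↦ P.β x (σ x) (τ x)) =
      fun x ↦ P.β x (aS.translate g σ x) (aS.translate g τ x) := by
  funext x
  simp only [EquivariantStructure.translate]
  rw [LinearIsometryEquiv.symm_apply_eq, P.β_equivariant]
  simp

/-- The difference `Θ` between the translated connection and the original one is tensorial. It
commutes with Clifford multiplication since the Levi-Civita connection is invariant, so
irreducibility makes it a scalar `r`. Both connections induce the invariant connection on `L`, which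
forces `2r = 0`. -/
theorem IsSpinorConnection.translate (hG : IsIsometricAction (n := n) G M)
    (hDT : IsLeviCivita DT) (hDL_inv : IsInvariantConnection aL DL)
    (hDS : IsSpinorConnection P DT DL DS) : IsInvariantConnection aS DS := by
  intro g σ₀ hσ₀ m v
  have := P.finiteDimensional_spinor
  have hg : ContMDiff (𝓡 n) (𝓡 n) ∞ fun x : M ↦ g • x := contMDiff_smul_left (d := d) g
  let Θ : (∀ x, S x) → S m := fun σ ↦
    DS (aS.translate g σ) m v - (aS.act g m).symm (DS σ (g • m) (pushforward g m v))
  have htr : ∀ {σ : ∀ x, S x}, IsSmoothSection (n := n) FS σ →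
      IsSmoothSection (n := n) FS (aS.translate g σ) := fun h ↦ aS.isSmoothSection_translate h g
  have hreal : ∀ (r : ℝ) (w : S (g • m)),
      (aS.act g m).symm (r • w) = r • (aS.act g m).symm w := fun r w ↦ by
    rw [← Complex.coe_smul, map_smul, Complex.coe_smul]
  obtain ⟨T, hT⟩ := exists_linearMap_of_tensorial (n := n) (F := FS) (m := g • m) Θ
    (fun σ τ hσ hτ ↦ by
      have h1 : aS.translate g (fun x ↦ σ x + τ x) =
          fun x ↦ aS.translate g σ x + aS.translate g τ x := by
        funext x; simp [EquivariantStructure.translate]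
      simp only [Θ]
      rw [h1, connection_add DS (htr hσ) (htr hτ), connection_add DS hσ hτ, map_add]
      abel)
    (fun u σ hu hσ ↦ by
      have h1 : aS.translate g (fun x ↦ u x • σ x) =
          fun x ↦ u (g • x) • aS.translate g σ x := by
        funext x
        simp only [EquivariantStructure.translate]
        rw [← Complex.coe_smul, map_smul, Complex.coe_smul]
      simp only [Θ]
      rw [h1, connection_smul DS (htr hσ) (u := fun x ↦ u (g • x)) (hu.comp hg),
        connection_smul DS hσ hu, map_add, hreal,
        hreal, mvfderiv_smul_left hu hg, smul_sub]
      simp only [EquivariantStructure.translate]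
      abel)
    (fun σ hσ ↦ by
      have h1 : aS.translate g (fun x ↦ Complex.I • σ x) =
          fun x ↦ Complex.I • aS.translate g σ x := by
        funext x; simp [EquivariantStructure.translate]
      simp only [Θ]
      rw [h1, hDS.hermitian.complex_linear _ (htr hσ), hDS.hermitian.complex_linear _ hσ, map_smul,
        smul_sub])
  have hcliff : ∀ (y : TangentSpace (𝓡 n) m) (w : S (g • m)),
      T (P.c (g • m) (pushforward g m y) w) = P.c m y (T w) := fun y w ↦ by
    obtain ⟨X, hX, hXy⟩ := exists_field_apply_eq (pushforward g m y)
    obtain ⟨σ, hσ, rfl⟩ := exists_section_apply_eq (n := n) (F := FS) w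
    have hXm : translateField g X m = y := by
      obtain ⟨A, hA⟩ := hG.exists_pushforward_eq g m
      apply A.injective
      rw [hA, hA, pushforward_translateField hG, hXy]
    rw [← hXy, ← hT _ (P.c_smooth X hX σ hσ), ← hT _ hσ]
    simp only [Θ]
    rw [P.translate_c hG, hDS.clifford _ _ (hX.translateField hG hg) (htr hσ),
      hDS.clifford _ _ hX hσ, map_add, ← hDT.pushforward_translateField hG hg hX,
      P.c_pushforward_symm, hXm, hXy, P.c_pushforward_symm, map_sub]
    simp only [EquivariantStructure.translate]
    abel
  -- The map `T` goes from the fibre at `g • m` to that at `m`; composing it with the action of `g`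
  -- gives an endomorphism to which Schur's lemma applies.
  obtain ⟨r, hr⟩ := exists_eq_smul_of_commute_clifford (n := n) P.even_dim
    ((stdOrthonormalBasis ℝ (TangentSpace (𝓡 n) m)).reindex
      (finCongr (finrank_euclideanSpace_fin (𝕜 := ℝ) (n := n))))
    (by rw [finrank_fibre (F := FS), P.rank_spinor]) (P.c m) (P.c_anticomm m)
    (T ∘ₗ (aS.act g m).toLinearEquiv.toLinearMap)
    (fun v x ↦ by
      simp only [LinearMap.comp_apply, LinearEquiv.coe_coe, LinearIsometryEquiv.coe_toLinearEquiv]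
      rw [P.c_equivariant, hcliff])
  have hTr : ∀ w, T w = r • (aS.act g m).symm w := fun w ↦ by
    have := hr ((aS.act g m).symm w)
    simpa using this
  have hΘ : ∀ σ, IsSmoothSection (n := n) FS σ → DS (aS.translate g σ) m v =
      (aS.act g m).symm (DS σ (g • m) (pushforward g m v)) + r • aS.translate g σ m :=
    fun σ hσ ↦ by
      have h1 := hT σ hσ
      rw [hTr] at h1
      simp only [Θ] at h1
      rw [sub_eq_iff_eq_add'] at h1
      exact h1
  -- On `L` the discrepancy is `β(rσ, τ) + β(σ, rτ) = 2r β(σ, τ)`, and for any nonzero `σ` there is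
  -- a `τ` with `β(σ, τ) ≠ 0`.
  have hr0 : r = 0 := by
    obtain ⟨w, hw⟩ := P.nontrivial_spinor (g • m)
    obtain ⟨z, -, hz⟩ := P.β_attained (g • m) w
    obtain ⟨σ, hσ, rfl⟩ := exists_section_apply_eq (n := n) (F := FS) w
    obtain ⟨τ, hτ, rfl⟩ := exists_section_apply_eq (n := n) (F := FS) z
    have h1 := hDL_inv g _ (P.β_smooth σ τ hσ hτ) m v
    rw [P.translate_β, hDS.determinant _ _ (htr hσ) (htr hτ), hDS.determinant _ _ hσ hτ,
      hΘ σ hσ, hΘ τ hτ, map_add] at h1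
    have h2 : ∀ a b : S (g • m), (aL.act g m).symm (P.β (g • m) a b) =
        P.β m ((aS.act g m).symm a) ((aS.act g m).symm b) := fun a b ↦ by
      rw [LinearIsometryEquiv.symm_apply_eq, P.β_equivariant]; simp
    simp only [h2, map_add, LinearMap.add_apply, map_smul, LinearMap.smul_apply,
      EquivariantStructure.translate] at h1
    have h3 : (2 * r) • P.β m ((aS.act g m).symm (σ (g • m))) ((aS.act g m).symm (τ (g • m))) =
        0 := by
      rw [mul_smul, two_smul]
      rw [← sub_eq_zero] at h1
      rw [← h1]
      abel
    rw [← h2, smul_eq_zero] at h3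
    rcases h3 with h3 | h3
    · simpa using h3
    · rw [map_eq_zero_iff _ (aL.act g m).symm.injective] at h3
      rw [h3, norm_zero, eq_comm, norm_eq_zero] at hz
      exact absurd hz hw
  rw [hΘ σ₀ hσ₀, hr0, zero_smul, add_zero]

theorem dirac_translate (hG : IsIsometricAction (n := n) G M) (hDS : IsInvariantConnection aS DS)
    (g : G) {σ : ∀ m, S m} (hσ : IsSmoothSection (n := n) FS σ) (m : M) :
    dirac P DS (aS.translate g σ) m = (aS.act g m).symm (dirac P DS σ (g • m)) := by
  let e := stdOrthonormalBasis ℝ (TangentSpace (𝓡 n) m)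
  have h : ∀ w : TangentSpace (𝓡 n) (g • m),
      ∑ i, (inner ℝ (pushforward g m (e i)) w : ℝ) • pushforward g m (e i) = w := fun w ↦ by
    obtain ⟨v, rfl⟩ := hG.surjective_pushforward g m w
    simp only [hG.inner_pushforward]
    conv_rhs => rw [← e.sum_repr' v]
    simp only [map_sum, map_smul]
  rw [dirac_eq_sum P DS σ (g • m) h, map_sum]
  refine Finset.sum_congr rfl fun i _ ↦ ?_
  rw [hDS g σ hσ, P.c_pushforward_symm]

theorem lineForm_translate (hG : IsIsometricAction (n := n) G M)
    (hDL : IsInvariantConnection aL DL) (g : G) {l : ∀ m, L m}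
    (hl : IsSmoothSection (n := n) FL l) (m : M) :
    pushforward g m (lineForm DL (aL.translate g l) m) = lineForm DL l (g • m) := by
  refine ext_inner_right ℝ fun w ↦ ?_
  obtain ⟨v, rfl⟩ := hG.surjective_pushforward g m w
  rw [hG.inner_pushforward, inner_lineForm, inner_lineForm, hDL g l hl]
  simp only [EquivariantStructure.translate]
  rw [LinearIsometryEquiv.inner_map_map]

variable {p : ℕ}

theorem contract_twistedAct (g : G) {m : M} (l : L m) (z : Twisted S L p m) :
    contract (aL.act g m l) (twistedAct aS aL g m z) = aS.act g m (contract l z) := by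
  induction z using TensorProduct.induction_on with
  | zero => simp
  | add x y hx hy => rw [map_add, map_add, map_add, map_add, hx, hy]
  | tmul w x =>
    induction x using PiTensorProduct.induction_on with
    | add x y hx hy =>
      rw [TensorProduct.tmul_add, map_add, map_add, map_add, map_add, hx, hy]
    | smul_tprod r x =>
      simp only [twistedAct, TensorProduct.tmul_smul, map_smul, TensorProduct.map_tmul,
        PiTensorProduct.map_tprod, contract_tmul_tprod]
      simp

/-- For an invariant `s`, translating both factors of a local form gives another local form of the
same `s`. This transports formulas from `g • m` to `m` and, for `g` near the identity, determines
the Lie derivative of `σ`. -/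
theorem IsUnitForm.translate {s : ∀ m, Twisted S L p m} (hs : ∀ (g : G) m,
    s (g • m) = twistedAct aS aL g m (s m)) (hFL : Module.finrank ℂ FL = 1)
    {σ : ∀ m, S m} {l : ∀ m, L m} {N : Set M}
    (h : IsUnitForm (n := n) FS FL s σ l N) (g : G) :
    IsUnitForm (n := n) FS FL s (aS.translate g σ) (aL.translate g l)
      ((fun x ↦ g • x) ⁻¹' N) where
  smooth_spinor := aS.isSmoothSection_translate h.smooth_spinor g
  smooth_line := aL.isSmoothSection_translate h.smooth_line g
  isOpen := h.isOpen.preimage (contMDiff_smul_left (d := d) (n := n) g).continuous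
  norm_eq x hx := by
    simp only [EquivariantStructure.translate, LinearIsometryEquiv.norm_map]
    exact h.norm_eq _ hx
  eq x hx := by
    have h1 : ‖aL.translate g l x‖ = 1 := by
      simp only [EquivariantStructure.translate, LinearIsometryEquiv.norm_map]
      exact h.norm_eq _ hx
    have hL : Module.finrank ℂ (L x) = 1 := by rw [finrank_fibre (F := FL), hFL]
    refine contract_injective hL h1 ?_
    rw [contract_tmul_tprod_self h1]
    apply (aS.act g x).injective
    have h2 : aL.act g x (aL.translate g l x) = l (g • x) := (aL.act g x).apply_symm_apply _
    rw [← contract_twistedAct (aL := aL), h2, ← hs, h.eq _ hx,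
      contract_tmul_tprod_self (h.norm_eq _ hx)]
    exact ((aS.act g x).apply_symm_apply _).symm

theorem twistedDirac_smul_eq (hG : IsIsometricAction (n := n) G M)
    (hDS : IsHermitianConnection DS) (hDL : IsHermitianConnection DL)
    (hDSi : IsInvariantConnection aS DS) (hDLi : IsInvariantConnection aL DL)
    {s : ∀ m, Twisted S L p m} (hs : IsSmoothTwisted (n := n) FS FL s)
    (hsi : ∀ (g : G) m, s (g • m) = twistedAct aS aL g m (s m)) (g : G) (m : M) :
    twistedDirac P DS DL s (g • m) = twistedAct aS aL g m (twistedDirac P DS DL s m) := by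
  obtain ⟨σ, l, N, hm, h⟩ := hs.exists_unitForm aL (g • m)
  have hL : Module.finrank ℂ (L (g • m)) = 1 := by rw [finrank_fibre (F := FL), P.rank_det]
  refine contract_injective hL (h.norm_eq _ hm) ?_
  have h2 : aL.act g m (aL.translate g l m) = l (g • m) := (aL.act g m).apply_symm_apply _
  have h' := h.translate hsi P.rank_det g
  rw [contract_twistedDirac P hDS hDL h hm]
  conv_rhs => rw [← h2]
  rw [contract_twistedAct, contract_twistedDirac P hDS hDL h' hm, map_add, map_smul,
    dirac_translate hG hDSi g h.smooth_spinor, P.c_equivariant, lineForm_translate hG hDLi g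
    h.smooth_line]
  simp [EquivariantStructure.translate]

theorem twistedAct_onSpinors {g : G} {m : M} {T : S m →ₗ[ℂ] S m}
    {T' : S (g • m) →ₗ[ℂ] S (g • m)} (h : ∀ w, aS.act g m (T w) = T' (aS.act g m w))
    (z : Twisted S L p m) :
    twistedAct aS aL g m (onSpinors T z) = onSpinors T' (twistedAct aS aL g m z) := by
  induction z using TensorProduct.induction_on with
  | zero => simp
  | add x y hx hy => rw [map_add, map_add, map_add, map_add, hx, hy]
  | tmul w x => simp [twistedAct, onSpinors_tmul, h]

theorem twistedInner_twistedAct (hFL : Module.finrank ℂ FL = 1) (g : G) {m : M}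
    (z z' : Twisted S L p m) :
    twistedInner (twistedAct aS aL g m z) (twistedAct aS aL g m z') = twistedInner z z' := by
  have hL : ∀ x, Module.finrank ℂ (L x) = 1 := fun x ↦ by rw [finrank_fibre (F := FL), hFL]
  obtain ⟨l, hl⟩ := exists_norm_eq_one_of_finrank (hL m)
  have hl' : ‖aL.act g m l‖ = 1 := by rw [LinearIsometryEquiv.norm_map, hl]
  rw [twistedInner_eq (hL _) hl', twistedInner_eq (hL m) hl, contract_twistedAct,
    contract_twistedAct, LinearIsometryEquiv.inner_map_map]

end Spinor

/-! ## Equivariance of the moment map and of its vector field -/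

section Adjoint

variable {n d : ℕ}
  {G : Type*} [TopologicalSpace G] [Group G] [ChartedSpace (EuclideanSpace ℝ (Fin d)) G]
  {M : Type*} [TopologicalSpace M] [ChartedSpace (EuclideanSpace ℝ (Fin n)) M] [MulAction G M]
  [LieGroup (𝓡 d) ∞ G]

theorem contMDiff_conj (g : G) : ContMDiff (𝓡 d) (𝓡 d) ∞ fun k : G ↦ g * k * g⁻¹ :=
  (contMDiff_mul_right (I := 𝓡 d) (n := ∞) (a := g⁻¹)).comp
    (contMDiff_mul_left (I := 𝓡 d) (n := ∞) (a := g))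

/-- The adjoint action of `g` as a linear map. -/
def adjointLinear (g : G) : GroupLieAlgebra (𝓡 d) G →ₗ[ℝ] GroupLieAlgebra (𝓡 d) G where
  toFun := adjointAction g
  map_add' X Y := by
    let T : EuclideanSpace ℝ (Fin d) →L[ℝ] EuclideanSpace ℝ (Fin d) :=
      mfderiv (𝓡 d) (𝓡 d) (fun k : G ↦ g * k * g⁻¹) 1
    exact T.map_add X Y
  map_smul' r X := by
    let T : EuclideanSpace ℝ (Fin d) →L[ℝ] EuclideanSpace ℝ (Fin d) :=
      mfderiv (𝓡 d) (𝓡 d) (fun k : G ↦ g * k * g⁻¹) 1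
    exact T.map_smul r X

theorem mfderiv_comp_conj {E : Type*} [NormedAddCommGroup E] [NormedSpace ℝ E] {φ : G → E}
    (hφ : ContMDiff (𝓡 d) 𝓘(ℝ, E) ∞ φ) (g : G) (X : GroupLieAlgebra (𝓡 d) G) :
    mvfderiv (𝓡 d) (fun k ↦ φ (g * k * g⁻¹)) 1 X =
      mvfderiv (𝓡 d) φ 1 (adjointAction g X) := by
  have h1 := ((hφ (g * 1 * g⁻¹)).mdifferentiableAt (by simp)).hasMFDerivAt.comp (1 : G)
    ((contMDiff_conj (d := d) g 1).mdifferentiableAt (by simp)).hasMFDerivAt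
  have h2 : mvfderiv (𝓡 d) (fun k ↦ φ (g * k * g⁻¹)) 1 X =
      mvfderiv (𝓡 d) φ (g * 1 * g⁻¹) (mfderiv (𝓡 d) (𝓡 d) (fun k : G ↦ g * k * g⁻¹) 1 X) :=
    congrArg (fun T ↦ T X) h1.mfderiv
  have h3 : ∀ (k : G) (w : EuclideanSpace ℝ (Fin d)), k = 1 →
      mvfderiv (𝓡 d) φ k (show TangentSpace (𝓡 d) k from w) =
        mvfderiv (𝓡 d) φ 1 (show TangentSpace (𝓡 d) (1 : G) from w) := by
    rintro k w rfl; rfl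
  rw [h2]
  exact h3 _ _ (by group)

variable [ContMDiffSMul (𝓡 d) (𝓡 n) ∞ G M]

/-- Tangent vectors are compared by differentiating functions, and `(g k g⁻¹) • (g • m) = g • (k •
m)`. -/
theorem inducedField_adjointAction [IsManifold (𝓡 n) ∞ M] [T2Space M]
    [RiemannianBundle (fun x : M ↦ TangentSpace (𝓡 n) x)] (g : G)
    (X : GroupLieAlgebra (𝓡 d) G) (m : M) :
    inducedField (n := n) (adjointAction g X) (g • m) = pushforward g m (inducedField X m) := by
  have key : ∀ u : M → ℝ, ContMDiff (𝓡 n) 𝓘(ℝ, ℝ) ∞ u →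
      mvfderiv (𝓡 n) u (g • m) (inducedField (adjointAction g X) (g • m)) =
        mvfderiv (𝓡 n) u (g • m) (pushforward g m (inducedField X m)) := fun u hu ↦ by
    have hg : ContMDiff (𝓡 n) (𝓡 n) ∞ fun x : M ↦ g • x := contMDiff_smul_left (d := d) g
    rw [← mvfderiv_smul_left hu hg, ← neg_inj, ← mvfderiv_smul_right (u := fun x ↦ u (g • x))
      (hu.comp hg), ← mvfderiv_smul_right hu, ← mfderiv_comp_conj
      (φ := fun k ↦ u (k • g • m)) (hu.comp (contMDiff_smul_right (g • m)))]
    simp only [mul_smul, inv_smul_smul]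
  rw [← sub_eq_zero]
  set w := inducedField (n := n) (adjointAction g X) (g • m) -
    pushforward g m (inducedField X m) with hw
  by_contra hne
  let T : TangentSpace (𝓡 n) (g • m) ≃L[ℝ] EuclideanSpace ℝ (Fin n) := ContinuousLinearEquiv.refl _ _
  obtain ⟨A, hA⟩ : ∃ A : TangentSpace (𝓡 n) (g • m) →L[ℝ] ℝ, A w ≠ 0 := by
    refine ⟨(innerSL ℝ (T w)).comp T.toContinuousLinearMap, ?_⟩
    change inner ℝ (T w) (T w) ≠ 0
    rw [inner_self_ne_zero]
    simpa using hne
  obtain ⟨u, hu, hue⟩ := exists_mvfderiv_eq A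
  apply hA
  rw [← hue, hw, map_sub, key u hu, sub_self]

end Adjoint

section Moment

variable {n d : ℕ}
  {G : Type*} [TopologicalSpace G] [Group G] [ChartedSpace (EuclideanSpace ℝ (Fin d)) G]
  {M : Type*} [TopologicalSpace M] [ChartedSpace (EuclideanSpace ℝ (Fin n)) M] [MulAction G M]
  [LieGroup (𝓡 d) ∞ G] [ContMDiffSMul (𝓡 d) (𝓡 n) ∞ G M] [T2Space M]
  [IsManifold (𝓡 n) ∞ M] [RiemannianBundle (fun x : M ↦ TangentSpace (𝓡 n) x)]
  {F : Type*} [NormedAddCommGroup F] [NormedSpace ℂ F]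
  {V : M → Type*} [TopologicalSpace (TotalSpace F V)]
  [∀ m, NormedAddCommGroup (V m)] [∀ m, InnerProductSpace ℂ (V m)]
  [FiberBundle F V] [VectorBundle ℂ F V] [VectorBundle ℝ F V]
  (a : EquivariantStructure (n := n) d G F V)

/-- The action of `g` on the total space. -/
def EquivariantStructure.totalAct (g : G) (z : TotalSpace F V) : TotalSpace F V :=
  ⟨g • z.proj, a.act g z.proj z.2⟩

theorem EquivariantStructure.totalAct_mul (g k : G) (z : TotalSpace F V) :
    a.totalAct g (a.totalAct k z) = a.totalAct (g * k) z :=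
  (a.mul_act g k z.proj z.2).symm

theorem EquivariantStructure.mk_act_symm (g : G) (m : M) (w : V (g • m)) :
    (⟨m, (a.act g m).symm w⟩ : TotalSpace F V) = a.totalAct g⁻¹ ⟨g • m, w⟩ := by
  have h1 := a.mul_act g⁻¹ g m ((a.act g m).symm w)
  rw [LinearIsometryEquiv.apply_symm_apply] at h1
  refine Eq.trans ?_ h1
  rw [inv_mul_cancel, a.one_act]

theorem EquivariantStructure.translate_translate (g k : G) (σ : ∀ m, V m) (m : M) :
    a.translate k (a.translate g σ) m =
      (a.act g m).symm (a.translate (g * k * g⁻¹) σ (g • m)) := by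
  have h : (⟨m, a.translate k (a.translate g σ) m⟩ : TotalSpace F V) =
      ⟨m, (a.act g m).symm (a.translate (g * k * g⁻¹) σ (g • m))⟩ := by
    simp only [translate, mk_act_symm, totalAct_mul]
    have h1 : k⁻¹ * g⁻¹ = g⁻¹ * (g * k * g⁻¹)⁻¹ := by group
    have h2 : (g * k * g⁻¹) • g • m = g • k • m := by simp only [mul_smul, inv_smul_smul]
    rw [h1, h2]
  exact eq_of_heq (TotalSpace.mk.inj h).2

theorem EquivariantStructure.lieDerivative_translate (g : G) {σ : ∀ m, V m}
    (hσ : IsSmoothSection (n := n) F σ) (X : GroupLieAlgebra (𝓡 d) G) (m : M) :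
    a.lieDerivative X (a.translate g σ) m =
      (a.act g m).symm (a.lieDerivative (adjointAction g X) σ (g • m)) := by
  simp only [lieDerivative, a.translate_translate, map_neg]
  rw [neg_inj, ← mfderiv_comp_conj (a.contMDiff_translate_apply hσ (g • m))]
  have hd := ((a.contMDiff_translate_apply hσ (g • m)).comp (contMDiff_conj g)
    (1 : G)).mdifferentiableAt (by simp)
  have h := mvfderiv_clm_comp (n := d) (((a.act g m).symm.toContinuousLinearEquiv :
    V (g • m) →L[ℂ] V m).restrictScalars ℝ) hd X
  exact h

variable [ContMDiffVectorBundle ∞ F V (𝓡 n)] {a} {D : CovariantDerivative (𝓡 n) F V}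
  {μ : M → GroupLieAlgebra (𝓡 d) G →ₗ[ℝ] ℝ}

/-- The moment map identity for the translated section at `m` and for the original section at `g •
m` have the same right-hand side, because the connection is invariant and Lie derivatives and
induced fields are equivariant. -/
theorem IsMomentMap.apply_adjointAction (hF : Module.finrank ℂ F = 1) (hμ : IsMomentMap a D μ)
    (hD : IsInvariantConnection a D)
    (g : G) (X : GroupLieAlgebra (𝓡 d) G) (m : M) : μ (g • m) (adjointAction g X) = μ m X := by
  obtain ⟨l₀, hl₀⟩ := exists_norm_eq_one_of_finrank (L := V) (m := g • m)
    (by rw [finrank_fibre (F := F), hF])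
  obtain ⟨l, hl, rfl⟩ := exists_section_apply_eq (n := n) (F := F) l₀
  have h1 := hμ X (a.translate g l) (a.isSmoothSection_translate hl g) m
  have h2 := congrArg (a.act g m).symm (hμ (adjointAction g X) l hl (g • m))
  rw [a.lieDerivative_translate g hl, hD g l hl, ← map_sub, ← inducedField_adjointAction, ← h2,
    map_smul] at h1
  have hne : (a.act g m).symm (l (g • m)) ≠ 0 := by
    rw [← norm_ne_zero_iff, LinearIsometryEquiv.norm_map, hl₀]; norm_num
  have h3 := smul_left_injective ℂ hne h1
  have h4 : (2 * Real.pi * Complex.I : ℂ) ≠ 0 := by simp [Real.pi_ne_zero]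
  exact_mod_cast (mul_left_cancel₀ h4 h3).symm

variable {B : LieAlgebraMetric (n := n) (d := d) G M}

/-- Both sides pair equally with every vector `Ad_g Z`. These exhaust the Lie algebra: invariance
and positivity of the metric make `Ad_g` injective, hence surjective by dimension. -/
theorem LieAlgebraMetric.dual_smul (B : LieAlgebraMetric (n := n) (d := d) G M)
    (h : ∀ (g : G) (X : GroupLieAlgebra (𝓡 d) G) (m : M), μ (g • m) (adjointAction g X) = μ m X)
    (g : G) (m : M) : B.dual μ (g • m) = adjointAction g (B.dual μ m) := by
  have hinj : Function.Injective (adjointLinear (d := d) g) := by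
    rw [injective_iff_map_eq_zero]
    intro X hX
    by_contra hne
    have h1 := B.invariant g m X X
    have h2 : adjointAction g X = 0 := hX
    rw [h2, map_zero] at h1
    exact (B.pos m X hne).ne h1
  have hsurj := LinearMap.surjective_of_injective hinj
  have key : ∀ Y, B.form (g • m) (B.dual μ (g • m) - adjointAction g (B.dual μ m)) Y = 0 := by
    intro Y
    obtain ⟨Z, rfl⟩ := hsurj Y
    change B.form (g • m) _ (adjointAction g Z) = 0
    rw [map_sub, LinearMap.sub_apply, B.form_dual, B.invariant, B.form_dual, h, sub_self]
  have h0 := (B.nondegenerate (g • m)).1 _ key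
  exact sub_eq_zero.1 h0

theorem momentField_smul
    (h : ∀ (g : G) (X : GroupLieAlgebra (𝓡 d) G) (m : M), μ (g • m) (adjointAction g X) = μ m X)
    (g : G) (m : M) : momentField B μ (g • m) = pushforward g m (momentField B μ m) := by
  simp only [momentField]
  rw [B.dual_smul h, inducedField_adjointAction]

end Moment

/-! ## The Riemannian measure in charts -/

theorem setLIntegral_eq_of_subset_of_eq_zero {α : Type*} [MeasurableSpace α] {ν : Measure α}
    {A D : Set α} (hA : MeasurableSet A) (hD : MeasurableSet D) (h : D ⊆ A) {f : α → ENNReal}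
    (hf : ∀ x ∈ A, x ∉ D → f x = 0) : ∫⁻ x in A, f x ∂ν = ∫⁻ x in D, f x ∂ν := by
  rw [← lintegral_indicator hA, ← lintegral_indicator hD]
  congr 1
  funext x
  by_cases hx : x ∈ D
  · simp [hx, h hx]
  · by_cases hx' : x ∈ A
    · simp [hx, hx', hf x hx' hx]
    · simp [hx, hx']

section ChartVolume

variable {n : ℕ} {M : Type*} [TopologicalSpace M] [ChartedSpace (EuclideanSpace ℝ (Fin n)) M]
  [IsManifold (𝓡 n) ∞ M] [RiemannianBundle (fun x : M ↦ TangentSpace (𝓡 n) x)]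

theorem chartGram_eq {a : M} {y : EuclideanSpace ℝ (Fin n)}
    (hy : y ∈ (chartAt (EuclideanSpace ℝ (Fin n)) a).target) :
    chartGram a y = coordGram (n := n) a ((chartAt (EuclideanSpace ℝ (Fin n)) a).symm y) := by
  ext i j
  simp only [chartGram, coordGram, Matrix.of_apply, coordField_eq_mfderiv_symm hy]

/-- The density of the Riemannian measure in the chart at `a`. -/
def chartDensity (a x : M) : ℝ := √(coordGram (n := n) a x).det

variable [IsContMDiffRiemannianBundle (𝓡 n) ∞ (EuclideanSpace ℝ (Fin n))
      (fun x : M ↦ TangentSpace (𝓡 n) x)]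

theorem contMDiffOn_chartDensity (a : M) :
    ContMDiffOn (𝓡 n) 𝓘(ℝ, ℝ) ∞ (chartDensity (n := n) a)
      (chartAt (EuclideanSpace ℝ (Fin n)) a).source := fun x hx ↦
  (Real.contDiffAt_sqrt (coordGram_posDef hx).det_pos.ne').contMDiffAt.comp_contMDiffWithinAt x
    (contMDiffOn_det (contMDiffOn_coordGram a) x hx)

theorem continuousOn_chartDensity_symm (a : M) :
    ContinuousOn (fun y ↦ chartDensity (n := n) a
      ((chartAt (EuclideanSpace ℝ (Fin n)) a).symm y))
      (chartAt (EuclideanSpace ℝ (Fin n)) a).target :=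
  (contMDiffOn_chartDensity a).continuousOn.comp
    (chartAt (EuclideanSpace ℝ (Fin n)) a).continuousOn_symm
    (chartAt (EuclideanSpace ℝ (Fin n)) a).mapsTo_symm

variable [MeasurableSpace M] [BorelSpace M]

theorem lintegral_chartVolume (a : M) {F : M → ENNReal} (hF : Measurable F) :
    ∫⁻ x, F x ∂(chartVolume (n := n) a) =
      ∫⁻ y in (chartAt (EuclideanSpace ℝ (Fin n)) a).target,
        ENNReal.ofReal (chartDensity (n := n) a
          ((chartAt (EuclideanSpace ℝ (Fin n)) a).symm y)) *
          F ((chartAt (EuclideanSpace ℝ (Fin n)) a).symm y) := by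
  set e := chartAt (EuclideanSpace ℝ (Fin n)) a with he
  have hte : MeasurableSet e.target := e.open_target.measurableSet
  have h1 : AEMeasurable e.symm (volume.restrict e.target) :=
    e.continuousOn_symm.aemeasurable hte
  have h0 : AEMeasurable (fun y ↦ ENNReal.ofReal (Real.sqrt (chartGram a y).det))
      (volume.restrict e.target) := by
    have h2 : ContinuousOn (fun y ↦ Real.sqrt (chartGram a y).det) e.target :=
      (continuousOn_chartDensity_symm (n := n) a).congr fun y hy ↦ by
        simp only [chartDensity, chartGram_eq hy]
    exact (h2.aemeasurable hte).ennreal_ofReal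
  rw [chartVolume, lintegral_map' hF.aemeasurable
    (h1.mono_ac (withDensity_absolutelyContinuous _ _)),
    lintegral_withDensity_eq_lintegral_mul₀ h0 (g := fun y ↦ F (e.symm y))
      (hF.comp_aemeasurable h1)]
  refine setLIntegral_congr_fun hte fun y hy ↦ ?_
  simp only [Pi.mul_apply, chartDensity, chartGram_eq hy]
  rfl

/-- The densities in two charts, related by the derivative of an isometry. -/
theorem chartDensity_eq_abs_det_mul {φ : M → M} (hφ : ContMDiff (𝓡 n) (𝓡 n) ∞ φ)
    (hiso : ∀ x (v w : TangentSpace (𝓡 n) x), inner ℝ (mfderiv (𝓡 n) (𝓡 n) φ x v)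
      (mfderiv (𝓡 n) (𝓡 n) φ x w) = (inner ℝ v w : ℝ)) {a b : M}
    {y : EuclideanSpace ℝ (Fin n)}
    (hy : y ∈ (chartAt (EuclideanSpace ℝ (Fin n)) a).target)
    (hb : φ ((chartAt (EuclideanSpace ℝ (Fin n)) a).symm y) ∈
      (chartAt (EuclideanSpace ℝ (Fin n)) b).source) :
    ∃ A : EuclideanSpace ℝ (Fin n) →L[ℝ] EuclideanSpace ℝ (Fin n),
      HasFDerivAt (fun z ↦ chartAt (EuclideanSpace ℝ (Fin n)) b
        (φ ((chartAt (EuclideanSpace ℝ (Fin n)) a).symm z))) A y ∧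
      chartDensity (n := n) a ((chartAt (EuclideanSpace ℝ (Fin n)) a).symm y) =
        |A.det| * chartDensity (n := n) b (φ ((chartAt (EuclideanSpace ℝ (Fin n)) a).symm y)) := by
  set ea := chartAt (EuclideanSpace ℝ (Fin n)) a with hea
  set eb := chartAt (EuclideanSpace ℝ (Fin n)) b with heb
  set x := ea.symm y with hx
  have hxs : x ∈ ea.source := ea.map_target hy
  have h1 : HasMFDerivAt (𝓡 n) (𝓡 n) ea.symm y (mfderiv (𝓡 n) (𝓡 n) ea.symm y) :=
    ((contMDiffOn_chart_symm.contMDiffAt (ea.open_target.mem_nhds hy)).mdifferentiableAt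
      (n := ∞) (by simp)).hasMFDerivAt
  have h2 : HasMFDerivAt (𝓡 n) (𝓡 n) φ x (mfderiv (𝓡 n) (𝓡 n) φ x) :=
    ((hφ x).mdifferentiableAt (by simp)).hasMFDerivAt
  have h3 : HasMFDerivAt (𝓡 n) (𝓡 n) eb (φ x) (mfderiv (𝓡 n) (𝓡 n) eb (φ x)) :=
    ((contMDiffOn_chart.contMDiffAt (eb.open_source.mem_nhds hb)).mdifferentiableAt
      (n := ∞) (by simp)).hasMFDerivAt
  have h4 := h3.comp y (h2.comp y h1)
  let A : EuclideanSpace ℝ (Fin n) →L[ℝ] EuclideanSpace ℝ (Fin n) :=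
    (mfderiv (𝓡 n) (𝓡 n) eb (φ x)).comp ((mfderiv (𝓡 n) (𝓡 n) φ x).comp
      (mfderiv (𝓡 n) (𝓡 n) ea.symm y))
  refine ⟨A, hasMFDerivAt_iff_hasFDerivAt.1 h4, ?_⟩
  let J : Matrix (Fin n) (Fin n) ℝ := LinearMap.toMatrix
    (EuclideanSpace.basisFun (Fin n) ℝ).toBasis (EuclideanSpace.basisFun (Fin n) ℝ).toBasis
    A.toLinearMap
  have hdet : J.det = A.det := LinearMap.det_toMatrix _ _
  have hJ : ∀ k i, J k i = coordCoeff b k (φ x) (mfderiv (𝓡 n) (𝓡 n) φ x (coordField a i x)) := by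
    intro k i
    have h7 : J k i = (A (EuclideanSpace.single i 1)) k :=
      (LinearMap.toMatrix_apply _ _ _ k i).trans (by simp)
    rw [hx, coordField_eq_mfderiv_symm hy]
    exact h7
  -- As `φ` is an isometry, the Gram matrices are congruent through its Jacobian `J`; taking square
  -- roots of determinants produces the factor `|det J|`.
  have hgram : coordGram (n := n) a x = J.transpose * coordGram (n := n) b (φ x) * J := by
    ext i j
    have h5 : ∀ i, mfderiv (𝓡 n) (𝓡 n) φ x (coordField a i x) =
        ∑ k, J k i • coordField b k (φ x) := fun i ↦ by
      simp only [hJ]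
      exact (sum_coordCoeff_smul_coordField hb _).symm
    have h6 : coordGram (n := n) a x i j =
        inner ℝ (coordField (n := n) a i x) (coordField a j x) := rfl
    rw [h6, ← hiso, h5, h5, Matrix.mul_assoc, Matrix.mul_apply]
    simp only [sum_inner, inner_sum, inner_smul_left, inner_smul_right, Matrix.mul_apply,
      Matrix.transpose_apply, coordGram, Matrix.of_apply, Finset.mul_sum, conj_trivial]
    rw [Finset.sum_comm]
    exact Finset.sum_congr rfl fun k _ ↦ Finset.sum_congr rfl fun l _ ↦ by ring
  simp only [chartDensity]
  rw [hgram, Matrix.det_mul, Matrix.det_mul, Matrix.det_transpose, hdet,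
    show A.det * (coordGram (n := n) b (φ x)).det * A.det =
      A.det ^ 2 * (coordGram (n := n) b (φ x)).det by ring,
    Real.sqrt_mul (sq_nonneg _), Real.sqrt_sq_eq_abs]

/-- Change of variables under an isometry, for functions supported in the intersection of two
charts. -/
theorem lintegral_chartVolume_comp {φ ψ : M → M} (hφ : ContMDiff (𝓡 n) (𝓡 n) ∞ φ)
    (hψ : Continuous ψ) (hφψ : ∀ x, φ (ψ x) = x) (hψφ : ∀ x, ψ (φ x) = x)
    (hiso : ∀ x (v w : TangentSpace (𝓡 n) x), inner ℝ (mfderiv (𝓡 n) (𝓡 n) φ x v)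
      (mfderiv (𝓡 n) (𝓡 n) φ x w) = (inner ℝ v w : ℝ)) (a b : M) {F : M → ENNReal}
    (hF : Measurable F) (hFs : ∀ x, F x ≠ 0 → x ∈ (chartAt (EuclideanSpace ℝ (Fin n)) b).source ∧
      ψ x ∈ (chartAt (EuclideanSpace ℝ (Fin n)) a).source) :
    ∫⁻ x, F (φ x) ∂(chartVolume (n := n) a) = ∫⁻ x, F x ∂(chartVolume (n := n) b) := by
  set ea := chartAt (EuclideanSpace ℝ (Fin n)) a with hea
  set eb := chartAt (EuclideanSpace ℝ (Fin n)) b with heb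
  rw [lintegral_chartVolume a (F := fun x ↦ F (φ x))
    (hF.comp hφ.continuous.measurable), lintegral_chartVolume b hF,
    ← hea, ← heb]
  let D : Set (EuclideanSpace ℝ (Fin n)) := ea.target ∩ ea.symm ⁻¹' (φ ⁻¹' eb.source)
  let D' : Set (EuclideanSpace ℝ (Fin n)) := eb.target ∩ eb.symm ⁻¹' (ψ ⁻¹' ea.source)
  have hD : IsOpen D := ea.continuousOn_symm.isOpen_inter_preimage ea.open_target
    (eb.open_source.preimage hφ.continuous)
  have hD' : IsOpen D' := eb.continuousOn_symm.isOpen_inter_preimage eb.open_target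
    (ea.open_source.preimage hψ)
  -- The isometry read in the two charts maps `D` bijectively onto `D'`, and the integrands vanish
  -- on the rest of the chart targets. The Euclidean change of variables then applies.
  let T : EuclideanSpace ℝ (Fin n) → EuclideanSpace ℝ (Fin n) := fun z ↦ eb (φ (ea.symm z))
  have hTD : T '' D = D' := by
    ext z
    constructor
    · rintro ⟨y, ⟨hy1, hy2⟩, rfl⟩
      refine ⟨eb.map_source hy2, ?_⟩
      simp only [Set.mem_preimage, T]
      rw [eb.left_inv hy2, hψφ]
      exact ea.map_target hy1
    · rintro ⟨hz1, hz2⟩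
      refine ⟨ea (ψ (eb.symm z)), ⟨ea.map_source hz2, ?_⟩, ?_⟩
      · simp only [Set.mem_preimage]
        rw [ea.left_inv hz2, hφψ]
        exact eb.map_target hz1
      · simp only [T]
        rw [ea.left_inv hz2, hφψ, eb.right_inv hz1]
  have hTinj : Set.InjOn T D := by
    intro y hy z hz hyz
    have h1 := eb.injOn hy.2 hz.2 hyz
    have h2 := congrArg ψ h1
    rw [hψφ, hψφ] at h2
    exact ea.symm.injOn hy.1 hz.1 h2
  have hex : ∀ y, ∃ A : EuclideanSpace ℝ (Fin n) →L[ℝ] EuclideanSpace ℝ (Fin n), y ∈ D →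
      HasFDerivAt T A y ∧ chartDensity (n := n) a (ea.symm y) =
        |A.det| * chartDensity (n := n) b (φ (ea.symm y)) := fun y ↦ by
    by_cases hy : y ∈ D
    · obtain ⟨A, hA⟩ := chartDensity_eq_abs_det_mul hφ hiso hy.1 hy.2
      exact ⟨A, fun _ ↦ hA⟩
    · exact ⟨0, fun h ↦ absurd h hy⟩
  choose A hA using hex
  rw [setLIntegral_eq_of_subset_of_eq_zero ea.open_target.measurableSet hD.measurableSet
      Set.inter_subset_left, setLIntegral_eq_of_subset_of_eq_zero eb.open_target.measurableSet
      hD'.measurableSet Set.inter_subset_left, ← hTD,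
    lintegral_image_eq_lintegral_abs_det_fderiv_mul volume hD.measurableSet
      (fun y hy ↦ (hA y hy).1.hasFDerivWithinAt) hTinj]
  · refine setLIntegral_congr_fun hD.measurableSet fun y hy ↦ ?_
    simp only [T]
    rw [eb.left_inv hy.2, (hA y hy).2, ENNReal.ofReal_mul (abs_nonneg _), mul_assoc]
  · intro y hy hyD
    by_contra hne
    exact hyD ⟨hy, (hFs _ (right_ne_zero_of_mul hne)).2⟩
  · intro y hy hyD
    by_contra hne
    exact hyD ⟨hy, (hFs _ (right_ne_zero_of_mul hne)).1⟩

end ChartVolume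

/-! ## The Riemannian measure -/

section RiemannianMeasure

variable {n : ℕ} {M : Type*} [TopologicalSpace M] [ChartedSpace (EuclideanSpace ℝ (Fin n)) M]
  [IsManifold (𝓡 n) ∞ M] [T2Space M] [SigmaCompactSpace M]

theorem chartPartition_ne_zero {a x : M} (h : chartPartition n M a x ≠ 0) :
    x ∈ (chartAt (EuclideanSpace ℝ (Fin n)) a).source :=
  (SmoothPartitionOfUnity.exists_isSubordinate_chartAt_source (𝓡 n) M).choose_spec a
    (subset_tsupport _ h)

variable (n M) in
/-- The indices of the nonzero functions of the partition of unity. -/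
def partitionIndex : Set M := {a | (Function.support (chartPartition n M a)).Nonempty}

/-- A locally finite family on a σ-compact space has only countably many nonempty members.
Countability is what allows the sum over the partition to be exchanged with integrals. -/
instance countable_partitionIndex : Countable (partitionIndex n M) := by
  have h : LocallyFinite fun a : partitionIndex n M ↦ Function.support (chartPartition n M a) :=
    (chartPartition n M).locallyFinite.comp_injective Subtype.val_injective
  exact Set.countable_univ_iff.1 (h.countable_univ fun a ↦ a.2)

theorem tsum_chartPartition_smul (x : M) :
    ∑' a : partitionIndex n M, ENNReal.ofReal (chartPartition n M a x) = 1 := by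
  have h0 : ∀ a ∉ partitionIndex n M, ENNReal.ofReal (chartPartition n M a x) = 0 := fun a ha ↦ by
    have : chartPartition n M a x = 0 := by
      by_contra hne
      exact ha ⟨x, hne⟩
    simp [this]
  rw [tsum_subtype_eq_of_support_subset (f := fun a ↦ ENNReal.ofReal (chartPartition n M a x))
    (fun a ha ↦ by by_contra h; exact ha (h0 a h))]
  have hfin := (chartPartition n M).sum_finsupport x (Set.mem_univ x)
  rw [tsum_eq_sum (s := (chartPartition n M).finsupport x) fun a ha ↦ by
    rw [SmoothPartitionOfUnity.mem_finsupport, Function.notMem_support] at ha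
    rw [ha, ENNReal.ofReal_zero], ← ENNReal.ofReal_sum_of_nonneg
    fun a _ ↦ (chartPartition n M).nonneg a x, hfin, ENNReal.ofReal_one]

variable [RiemannianBundle (fun x : M ↦ TangentSpace (𝓡 n) x)]
  [IsContMDiffRiemannianBundle (𝓡 n) ∞ (EuclideanSpace ℝ (Fin n))
      (fun x : M ↦ TangentSpace (𝓡 n) x)]
  [MeasurableSpace M] [BorelSpace M]

theorem measurable_chartPartition (a : M) :
    Measurable fun x ↦ ENNReal.ofReal (chartPartition n M a x) :=
  (chartPartition n M a).contMDiff.continuous.measurable.ennreal_ofReal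

theorem lintegral_riemannianMeasure {F : M → ENNReal} (hF : Measurable F) :
    ∫⁻ x, F x ∂(riemannianMeasure n M) = ∑' a : partitionIndex n M,
      ∫⁻ x, ENNReal.ofReal (chartPartition n M a x) * F x ∂(chartVolume (n := n) (a : M)) := by
  rw [riemannianMeasure, lintegral_sum_measure]
  have h1 : ∀ a : M, ∫⁻ x, F x ∂((chartVolume (n := n) a).withDensity
      fun x ↦ ENNReal.ofReal (chartPartition n M a x)) =
      ∫⁻ x, ENNReal.ofReal (chartPartition n M a x) * F x ∂(chartVolume (n := n) (a : M)) :=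
    fun a ↦ lintegral_withDensity_eq_lintegral_mul _ (measurable_chartPartition a) hF
  simp only [h1]
  refine (tsum_subtype_eq_of_support_subset (fun a ha ↦ ?_)).symm
  by_contra h
  apply ha
  have : ∀ x, chartPartition n M a x = 0 := fun x ↦ by
    by_contra hne
    exact h ⟨x, hne⟩
  simp [this]

/-- When `F` lives in a single chart `b`, each term of the partition is moved to that chart by the
change of variables, and the functions of the partition then sum to one. The case `φ = id` shows
independence of the partition. -/
theorem lintegral_riemannianMeasure_comp_of_chart {φ ψ : M → M} (hφ : ContMDiff (𝓡 n) (𝓡 n) ∞ φ)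
    (hψ : Continuous ψ) (hφψ : ∀ x, φ (ψ x) = x) (hψφ : ∀ x, ψ (φ x) = x)
    (hiso : ∀ x (v w : TangentSpace (𝓡 n) x), inner ℝ (mfderiv (𝓡 n) (𝓡 n) φ x v)
      (mfderiv (𝓡 n) (𝓡 n) φ x w) = (inner ℝ v w : ℝ)) (b : M) {F : M → ENNReal}
    (hF : Measurable F)
    (hFs : ∀ x, F x ≠ 0 → x ∈ (chartAt (EuclideanSpace ℝ (Fin n)) b).source) :
    ∫⁻ x, F (φ x) ∂(riemannianMeasure n M) = ∫⁻ x, F x ∂(chartVolume (n := n) b) := by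
  rw [lintegral_riemannianMeasure (F := fun x ↦ F (φ x)) (hF.comp hφ.continuous.measurable)]
  have hm : ∀ a : M, Measurable fun x ↦ ENNReal.ofReal (chartPartition n M a (ψ x)) * F x :=
    fun a ↦ ((measurable_chartPartition a).comp hψ.measurable).mul hF
  have h1 : ∀ a : M, ∫⁻ x, ENNReal.ofReal (chartPartition n M a x) * F (φ x)
      ∂(chartVolume (n := n) a) =
      ∫⁻ x, ENNReal.ofReal (chartPartition n M a (ψ x)) * F x ∂(chartVolume (n := n) b) :=
    fun a ↦ by
      rw [← lintegral_chartVolume_comp hφ hψ hφψ hψφ hiso a b (hm a)]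
      · simp only [hψφ]
      · intro x hx
        refine ⟨hFs x (right_ne_zero_of_mul hx), chartPartition_ne_zero fun h ↦ ?_⟩
        apply left_ne_zero_of_mul hx
        rw [h, ENNReal.ofReal_zero]
  simp only [h1]
  rw [← lintegral_tsum fun a : partitionIndex n M ↦ (hm a).aemeasurable]
  simp only [ENNReal.tsum_mul_right, tsum_chartPartition_smul, one_mul]

theorem lintegral_riemannianMeasure_of_chart (b : M) {F : M → ENNReal} (hF : Measurable F)
    (hFs : ∀ x, F x ≠ 0 → x ∈ (chartAt (EuclideanSpace ℝ (Fin n)) b).source) :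
    ∫⁻ x, F x ∂(riemannianMeasure n M) = ∫⁻ x, F x ∂(chartVolume (n := n) b) :=
  lintegral_riemannianMeasure_comp_of_chart (φ := id) (ψ := id) contMDiff_id continuous_id
    (fun _ ↦ rfl) (fun _ ↦ rfl) (fun x v w ↦ by simp [mfderiv_id]) b hF hFs

theorem lintegral_riemannianMeasure_comp {φ ψ : M → M} (hφ : ContMDiff (𝓡 n) (𝓡 n) ∞ φ)
    (hψ : Continuous ψ) (hφψ : ∀ x, φ (ψ x) = x) (hψφ : ∀ x, ψ (φ x) = x)
    (hiso : ∀ x (v w : TangentSpace (𝓡 n) x), inner ℝ (mfderiv (𝓡 n) (𝓡 n) φ x v)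
      (mfderiv (𝓡 n) (𝓡 n) φ x w) = (inner ℝ v w : ℝ)) {F : M → ENNReal} (hF : Measurable F) :
    ∫⁻ x, F (φ x) ∂(riemannianMeasure n M) = ∫⁻ x, F x ∂(riemannianMeasure n M) := by
  have h1 : ∀ x, F x = ∑' b : partitionIndex n M, ENNReal.ofReal (chartPartition n M b x) * F x :=
    fun x ↦ by rw [ENNReal.tsum_mul_right, tsum_chartPartition_smul, one_mul]
  have hm : ∀ b : M, Measurable fun x ↦ ENNReal.ofReal (chartPartition n M b x) * F x :=
    fun b ↦ (measurable_chartPartition b).mul hF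
  have hs : ∀ (b x : M), ENNReal.ofReal (chartPartition n M b x) * F x ≠ 0 →
      x ∈ (chartAt (EuclideanSpace ℝ (Fin n)) b).source := fun b x hx ↦
    chartPartition_ne_zero fun h ↦ left_ne_zero_of_mul hx (by rw [h, ENNReal.ofReal_zero])
  calc ∫⁻ x, F (φ x) ∂(riemannianMeasure n M)
      = ∫⁻ x, ∑' b : partitionIndex n M, ENNReal.ofReal (chartPartition n M b (φ x)) * F (φ x)
          ∂(riemannianMeasure n M) := lintegral_congr fun x ↦ h1 (φ x)
    _ = ∑' b : partitionIndex n M, ∫⁻ x, ENNReal.ofReal (chartPartition n M b (φ x)) * F (φ x)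
          ∂(riemannianMeasure n M) :=
        lintegral_tsum fun b ↦ ((hm b).comp hφ.continuous.measurable).aemeasurable
    _ = ∑' b : partitionIndex n M, ∫⁻ x, ENNReal.ofReal (chartPartition n M b x) * F x
          ∂(riemannianMeasure n M) := by
        congr 1
        funext b
        rw [lintegral_riemannianMeasure_of_chart (b : M) (hm b) (hs b),
          ← lintegral_riemannianMeasure_comp_of_chart hφ hψ hφψ hψφ hiso (b : M) (hm b) (hs b)]
    _ = ∫⁻ x, F x ∂(riemannianMeasure n M) := by
        rw [← lintegral_tsum fun b : partitionIndex n M ↦ (hm b).aemeasurable]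
        exact lintegral_congr fun x ↦ (h1 x).symm

theorem riemannianMeasure_restrict_source (b : M) :
    (riemannianMeasure n M).restrict (chartAt (EuclideanSpace ℝ (Fin n)) b).source =
      chartVolume (n := n) b := by
  set e := chartAt (EuclideanSpace ℝ (Fin n)) b with he
  have hes : MeasurableSet e.source := e.open_source.measurableSet
  ext A hA
  have hm : MeasurableSet (A ∩ e.source) := hA.inter hes
  have h1 := lintegral_riemannianMeasure_of_chart (n := n) b (F := (A ∩ e.source).indicator 1)
    (measurable_one.indicator hm) (fun x hx ↦ by
      have : x ∈ A ∩ e.source := Set.mem_of_indicator_ne_zero hx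
      exact this.2)
  rw [lintegral_indicator_one hm, lintegral_indicator_one hm] at h1
  rw [Measure.restrict_apply hA, h1]
  have h2 := lintegral_chartVolume (n := n) b (F := (A ∩ e.source).indicator 1)
    (measurable_one.indicator hm)
  have h3 := lintegral_chartVolume (n := n) b (F := A.indicator 1) (measurable_one.indicator hA)
  rw [lintegral_indicator_one hm] at h2
  rw [lintegral_indicator_one hA] at h3
  rw [h2, h3]
  refine setLIntegral_congr_fun e.open_target.measurableSet fun y hy ↦ ?_
  have : e.symm y ∈ e.source := e.map_target hy
  have h4 : (A ∩ e.source).indicator (1 : M → ENNReal) (e.symm y) = A.indicator 1 (e.symm y) := by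
    by_cases hA' : e.symm y ∈ A <;> simp [hA', this]
  exact congrArg _ h4

instance isLocallyFiniteMeasure_riemannianMeasure :
    IsLocallyFiniteMeasure (riemannianMeasure n M) := by
  have : LocallyCompactSpace M :=
    ChartedSpace.locallyCompactSpace (EuclideanSpace ℝ (Fin n)) M
  refine ⟨fun b ↦ ?_⟩
  set e := chartAt (EuclideanSpace ℝ (Fin n)) b with he
  obtain ⟨K, hK, hKs, hKc⟩ := local_compact_nhds (e.open_source.mem_nhds (mem_chart_source _ b))
  refine ⟨K, hK, ?_⟩
  have hKm : MeasurableSet K := hKc.isClosed.measurableSet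
  have h1 : riemannianMeasure n M K = chartVolume (n := n) b K := by
    rw [← riemannianMeasure_restrict_source, Measure.restrict_apply hKm,
      Set.inter_eq_left.2 hKs]
  have h3 := lintegral_chartVolume (n := n) b (F := K.indicator 1) (measurable_one.indicator hKm)
  rw [lintegral_indicator_one hKm] at h3
  rw [h1, h3, ← he]
  have hKi : IsCompact (e '' K) := hKc.image_of_continuousOn (e.continuousOn.mono hKs)
  have hKt : e '' K ⊆ e.target := by
    rintro _ ⟨x, hx, rfl⟩
    exact e.map_source (hKs hx)
  rw [setLIntegral_eq_of_subset_of_eq_zero e.open_target.measurableSet hKi.isClosed.measurableSet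
    hKt]
  · have hc := (continuousOn_chartDensity_symm (n := n) b).mono hKt
    obtain ⟨C, hC⟩ := hKi.exists_bound_of_continuousOn hc
    refine lt_of_le_of_lt (setLIntegral_mono (g := fun _ ↦ ENNReal.ofReal C) measurable_const
      fun y hy ↦ ?_) ?_
    · have h4 : (K.indicator 1 (e.symm y) : ENNReal) ≤ 1 := Set.indicator_le_self' (by simp) _
      refine (mul_le_mul' (ENNReal.ofReal_le_ofReal ((le_abs_self _).trans (hC y hy))) h4).trans ?_
      rw [mul_one]
    · rw [setLIntegral_const]
      exact ENNReal.mul_lt_top ENNReal.ofReal_lt_top hKi.measure_lt_top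
  · intro y hy hyK
    have : e.symm y ∉ K := fun h ↦ hyK ⟨_, h, e.right_inv hy⟩
    simp [this]

end RiemannianMeasure

/-! ## The divergence of vector fields -/

/-- Jacobi's formula for the derivative of a determinant. -/
theorem hasFDerivAt_det {E ι : Type*} [NormedAddCommGroup E] [NormedSpace ℝ E] [Fintype ι]
    [DecidableEq ι] {A : E → Matrix ι ι ℝ} {A' : ι → ι → E →L[ℝ] ℝ} {y : E}
    (hA : ∀ i j, HasFDerivAt (fun z ↦ A z i j) (A' i j) y) (hy : IsUnit (A y).det) :
    HasFDerivAt (fun z ↦ (A z).det) ((A y).det • ∑ i, ∑ j, (A y)⁻¹ j i • A' i j) y := by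
  -- The determinant is multilinear in the rows, so its derivative is a sum over replacements of one
  -- row; Cramer's rule identifies these with entries of the inverse.
  let D : ContinuousMultilinearMap ℝ (fun _ : ι ↦ ι → ℝ) ℝ :=
    { (Matrix.detRowAlternating (n := ι) (R := ℝ)).toMultilinearMap with
      cont := Continuous.matrix_det (A := fun B : ι → ι → ℝ ↦ Matrix.of B) continuous_id }
  have h1 : HasFDerivAt (fun z (i : ι) (j : ι) ↦ A z i j)
      (ContinuousLinearMap.pi fun i ↦ ContinuousLinearMap.pi fun j ↦ A' i j) y :=
    hasFDerivAt_pi.2 fun i ↦ hasFDerivAt_pi.2 fun j ↦ hA i j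
  have h2 := (D.hasFDerivAt (fun i j ↦ A y i j)).comp y h1
  refine h2.congr_fderiv ?_
  ext v
  simp only [ContinuousLinearMap.comp_apply, ContinuousMultilinearMap.linearDeriv_apply,
    smul_apply, sum_apply, smul_eq_mul, Finset.mul_sum]
  refine Finset.sum_congr rfl fun i _ ↦ ?_
  change ((A y).updateRow i (fun j ↦ A' i j v)).det = _
  rw [← Matrix.cramer_transpose_apply, Matrix.cramer_eq_adjugate_mulVec, Matrix.mulVec]
  simp only [dotProduct]
  refine Finset.sum_congr rfl fun j _ ↦ ?_
  rw [Matrix.inv_def, ← Matrix.adjugate_transpose, Matrix.transpose_apply]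
  have : (A y).det * Ring.inverse (A y).det = 1 := Ring.mul_inverse_cancel _ hy
  rw [Matrix.smul_apply, smul_eq_mul, ← mul_assoc, ← mul_assoc, this, one_mul]

section Divergence

variable {n : ℕ} {M : Type*} [TopologicalSpace M] [ChartedSpace (EuclideanSpace ℝ (Fin n)) M]
  [IsManifold (𝓡 n) ∞ M]

theorem hasFDerivAt_comp_chartAt_symm {a : M} {y : EuclideanSpace ℝ (Fin n)}
    (hy : y ∈ (chartAt (EuclideanSpace ℝ (Fin n)) a).target) {u : M → ℝ}
    (hu : MDifferentiableAt (𝓡 n) 𝓘(ℝ, ℝ) u ((chartAt (EuclideanSpace ℝ (Fin n)) a).symm y)) :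
    ∃ T : EuclideanSpace ℝ (Fin n) →L[ℝ] ℝ,
      HasFDerivAt (fun z ↦ u ((chartAt (EuclideanSpace ℝ (Fin n)) a).symm z)) T y ∧
      ∀ i, T (EuclideanSpace.single i (1 : ℝ)) =
        mvfderiv (𝓡 n) u ((chartAt (EuclideanSpace ℝ (Fin n)) a).symm y)
          (coordField a i ((chartAt (EuclideanSpace ℝ (Fin n)) a).symm y)) := by
  set e := chartAt (EuclideanSpace ℝ (Fin n)) a with he
  have hd := (mdifferentiable_chart (I := 𝓡 n) a).symm.mdifferentiableAt (x := y) hy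
  have h1 := hu.hasMFDerivAt.comp y hd.hasMFDerivAt
  have h2 := hasMFDerivAt_iff_hasFDerivAt.1 h1
  refine ⟨_, h2, fun i ↦ ?_⟩
  rw [coordField_eq_mfderiv_symm hy]
  rfl

/-- Brackets commute with pullback by the chart, and constant fields have zero bracket. -/
theorem mlieBracket_coordField {a x : M}
    (hx : x ∈ (chartAt (EuclideanSpace ℝ (Fin n)) a).source) (i j : Fin n) :
    VectorField.mlieBracket (𝓡 n) (coordField a i) (coordField a j) x = 0 := by
  have h2 : (2 : ℕ∞ω) ≤ ∞ := WithTop.coe_le_coe.2 (le_top (a := (2 : ℕ∞)))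
  have : IsManifold (𝓡 n) (minSmoothness ℝ 3) M := IsManifold.of_le (n := ∞)
    (by simpa using WithTop.coe_le_coe.2 (le_top (a := (3 : ℕ∞))))
  have hc : ∀ k : Fin n, MDifferentiableAt (𝓡 n) (𝓡 n).tangent
      (fun y : EuclideanSpace ℝ (Fin n) ↦ (⟨y, constField (EuclideanSpace.single k (1 : ℝ)) y⟩ :
        TangentBundle (𝓡 n) (EuclideanSpace ℝ (Fin n))))
      (chartAt (EuclideanSpace ℝ (Fin n)) a x) := fun k ↦
    ContMDiffAt.mdifferentiableAt (n := ∞)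
      (contMDiffAt_vectorSpace_iff_contDiffAt.2 contDiffAt_const) (by simp)
  have h := VectorField.mpullback_mlieBracket (I := 𝓡 n) (I' := 𝓡 n) (n := ∞)
    (hc i) (hc j) (contMDiffOn_chart.contMDiffAt ((chartAt _ a).open_source.mem_nhds hx))
    (by simpa using h2)
  refine h.symm.trans ?_
  have h0 : VectorField.mlieBracket (𝓡 n) (constField (EuclideanSpace.single i (1 : ℝ)))
      (constField (EuclideanSpace.single j (1 : ℝ))) (chartAt (EuclideanSpace ℝ (Fin n)) a x) =
      0 := by
    rw [← VectorField.mlieBracketWithin_univ, VectorField.mlieBracketWithin_eq_lieBracketWithin]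
    have : ∀ k : Fin n, fderivWithin ℝ (fun y : EuclideanSpace ℝ (Fin n) ↦
      (EuclideanSpace.single k (1 : ℝ) : EuclideanSpace ℝ (Fin n))) Set.univ = 0 := fun k ↦ by
        funext z; exact fderivWithin_const_apply _
    change fderivWithin ℝ (fun y : EuclideanSpace ℝ (Fin n) ↦
      (EuclideanSpace.single j (1 : ℝ) : EuclideanSpace ℝ (Fin n))) Set.univ _ _ -
      fderivWithin ℝ (fun y : EuclideanSpace ℝ (Fin n) ↦
      (EuclideanSpace.single i (1 : ℝ) : EuclideanSpace ℝ (Fin n))) Set.univ _ _ = 0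
    rw [this, this]
    exact sub_self _
  rw [VectorField.mpullback_apply, h0, map_zero]

variable [RiemannianBundle (fun x : M ↦ TangentSpace (𝓡 n) x)]
  {DT : CovariantDerivative (𝓡 n) (EuclideanSpace ℝ (Fin n))
      (fun x : M ↦ TangentSpace (𝓡 n) x)}

theorem field_connection_congr {u w : ∀ m : M, TangentSpace (𝓡 n) m} (hu : IsSmoothField u)
    (hw : IsSmoothField w) {m : M} (h : ∀ᶠ x in 𝓝 m, u x = w x) : DT u m = DT w m :=
  DT.isCovariantDerivativeOnUniv.congr_of_eventuallyEq
    ((hu m).mdifferentiableAt (by simp)) ((hw m).mdifferentiableAt (by simp)) Filter.univ_mem h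

variable (DT) in
/-- The divergence of a vector field. -/
def divergence (u : ∀ m : M, TangentSpace (𝓡 n) m) (m : M) : ℝ :=
  let e := stdOrthonormalBasis ℝ (TangentSpace (𝓡 n) m)
  ∑ i, inner ℝ (e i) (DT u m (e i))

theorem divergence_eq_sum {ι : Type*} [Fintype ι] (u : ∀ m : M, TangentSpace (𝓡 n) m) (m : M)
    {X X' : ι → TangentSpace (𝓡 n) m}
    (h : ∀ v, ∑ i, (inner ℝ (X' i) v : ℝ) • X i = v) :
    divergence DT u m = ∑ i, inner ℝ (X' i) (DT u m (X i)) :=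
  sum_orthonormalBasis_eq ((innerₗ (TangentSpace (𝓡 n) m)).compl₂ (DT u m).toLinearMap)
    (stdOrthonormalBasis ℝ (TangentSpace (𝓡 n) m)) h

theorem divergence_congr {u w : ∀ m : M, TangentSpace (𝓡 n) m} (hu : IsSmoothField u)
    (hw : IsSmoothField w) {m : M} (h : ∀ᶠ x in 𝓝 m, u x = w x) :
    divergence DT u m = divergence DT w m := by
  simp only [divergence, field_connection_congr hu hw h]

theorem divergence_add {u w : ∀ m : M, TangentSpace (𝓡 n) m} (hu : IsSmoothField u)
    (hw : IsSmoothField w) (m : M) :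
    divergence DT (fun x ↦ u x + w x) m = divergence DT u m + divergence DT w m := by
  have h : DT (fun x ↦ u x + w x) m = DT u m + DT w m := DT.isCovariantDerivativeOnUniv.add
    ((hu m).mdifferentiableAt (by simp)) ((hw m).mdifferentiableAt (by simp))
  simp only [divergence, h, add_apply, inner_add_right, Finset.sum_add_distrib]

theorem divergence_smul {u : ∀ m : M, TangentSpace (𝓡 n) m} (hu : IsSmoothField u) {φ : M → ℝ}
    (hφ : ContMDiff (𝓡 n) 𝓘(ℝ, ℝ) ∞ φ) (m : M) :
    divergence DT (fun x ↦ φ x • u x) m =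
      φ m * divergence DT u m + mvfderiv (𝓡 n) φ m (u m) := by
  have h : ∀ v, DT (fun x ↦ φ x • u x) m v = φ m • DT u m v + mvfderiv (𝓡 n) φ m v • u m :=
    fun v ↦ congrArg (fun T ↦ T v) (DT.isCovariantDerivativeOnUniv.leibniz
      ((hu m).mdifferentiableAt (by simp)) ((hφ m).mdifferentiableAt (by simp)))
  simp only [divergence, h, inner_add_right, Finset.sum_add_distrib, inner_smul_right,
    Finset.mul_sum]
  congr 1
  conv_rhs => rw [← (stdOrthonormalBasis ℝ (TangentSpace (𝓡 n) m)).sum_repr' (u m)]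
  simp only [map_sum, map_smul, smul_eq_mul]
  exact Finset.sum_congr rfl fun i _ ↦ mul_comm _ _

theorem isSmoothField_zero : IsSmoothField (fun m : M ↦ (0 : TangentSpace (𝓡 n) m)) := by
  have := contMDiff_zeroSection ℝ (fun x : M ↦ TangentSpace (𝓡 n) x) (n := ∞) (IB := 𝓡 n)
    (F := EuclideanSpace ℝ (Fin n))
  exact this

theorem divergence_zero (m : M) :
    divergence DT (fun x : M ↦ (0 : TangentSpace (𝓡 n) x)) m = 0 := by
  have := divergence_smul (DT := DT) isSmoothField_zero
    (contMDiff_const (c := (0 : ℝ)) (I := 𝓡 n) (I' := 𝓘(ℝ, ℝ)) (n := ∞)) m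
  simpa [mvfderiv_const] using this

theorem IsSmoothField.smul {u : ∀ m : M, TangentSpace (𝓡 n) m} (hu : IsSmoothField u) {φ : M → ℝ}
    (hφ : ContMDiff (𝓡 n) 𝓘(ℝ, ℝ) ∞ φ) : IsSmoothField fun x ↦ φ x • u x :=
  ContMDiff.smul_section hφ hu

theorem IsSmoothField.sum {ι : Type*} {s : Finset ι} {u : ι → ∀ m : M, TangentSpace (𝓡 n) m}
    (hu : ∀ i ∈ s, IsSmoothField (u i)) : IsSmoothField fun x ↦ ∑ i ∈ s, u i x :=
  ContMDiff.sum_section hu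

theorem divergence_sum {ι : Type*} {s : Finset ι} {u : ι → ∀ m : M, TangentSpace (𝓡 n) m}
    (hu : ∀ i ∈ s, IsSmoothField (u i)) (m : M) :
    divergence DT (fun x ↦ ∑ i ∈ s, u i x) m = ∑ i ∈ s, divergence DT (u i) m := by
  classical
  induction s using Finset.induction_on with
  | empty => simpa using divergence_zero m
  | insert i s hi ih =>
    have h1 : ∀ j ∈ s, IsSmoothField (u j) := fun j hj ↦ hu j (Finset.mem_insert_of_mem hj)
    rw [Finset.sum_insert hi, ← ih h1,
      ← divergence_add (hu i (Finset.mem_insert_self i s)) (IsSmoothField.sum h1)]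
    simp only [Finset.sum_insert hi]

theorem divergence_eq_zero_of_notMem_tsupport {u : ∀ m : M, TangentSpace (𝓡 n) m}
    (hu : IsSmoothField u) {m : M} (hm : m ∉ closure {x | u x ≠ 0}) :
    divergence DT u m = 0 := by
  rw [divergence_congr hu isSmoothField_zero (m := m), divergence_zero]
  filter_upwards [isClosed_closure.isOpen_compl.mem_nhds hm] with x hx
  by_contra h
  exact hx (subset_closure h)

variable [IsContMDiffRiemannianBundle (𝓡 n) ∞ (EuclideanSpace ℝ (Fin n))
      (fun x : M ↦ TangentSpace (𝓡 n) x)] [T2Space M]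

theorem exists_coordFrame_of_mem {a x : M}
    (hx : x ∈ (chartAt (EuclideanSpace ℝ (Fin n)) a).source) :
    ∃ (E E' : Fin n → ∀ x : M, TangentSpace (𝓡 n) x) (N : Set M), IsOpen N ∧ x ∈ N ∧
      N ⊆ (chartAt (EuclideanSpace ℝ (Fin n)) a).source ∧
      (∀ i, IsSmoothField (E i)) ∧ (∀ i, IsSmoothField (E' i)) ∧
      (∀ x ∈ N, ∀ i, E i x = coordField a i x) ∧
      (∀ x ∈ N, ∀ i, E' i x = dualCoordField a i x) := by
  have hs : (chartAt (EuclideanSpace ℝ (Fin n)) a).source ∈ 𝓝 x :=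
    (chartAt _ a).open_source.mem_nhds hx
  choose E hE hE' using fun i ↦ exists_section_eventuallyEq hs (contMDiffOn_coordField a i)
  choose D hD hD' using fun i ↦ exists_section_eventuallyEq hs (contMDiffOn_dualCoordField a i)
  obtain ⟨N, hN, hNo, haN⟩ := eventually_nhds_iff.1
    (((Filter.eventually_all.2 hE').and (Filter.eventually_all.2 hD')).and hs)
  exact ⟨E, D, N, hNo, haN, fun x hx ↦ (hN x hx).2, hE, hD, fun x hx ↦ (hN x hx).1.1,
    fun x hx ↦ (hN x hx).1.2⟩

theorem contMDiff_divergence (hDT : IsLeviCivita DT) {u : ∀ m : M, TangentSpace (𝓡 n) m}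
    (hu : IsSmoothField u) : ContMDiff (𝓡 n) 𝓘(ℝ, ℝ) ∞ (divergence DT u) := by
  intro a
  obtain ⟨E, E', N, hN, ha, hNs, hE, hE', hEe, hEe'⟩ :=
    exists_coordFrame_of_mem (n := n) (mem_chart_source _ a)
  have h1 := hDT.smooth.contMDiff.contMDiff (σ := u) (by simpa using! hu.contMDiffOn)
  rw [contMDiffOn_univ] at h1
  have h2 : ContMDiff (𝓡 n) 𝓘(ℝ, ℝ) ∞
      fun m ↦ ∑ i, (inner ℝ (E' i m) (DT u m (E i m)) : ℝ) :=
    contMDiff_finsetSum fun i _ ↦ contMDiff_inner (hE' i)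
      (ContMDiff.clm_bundle_apply h1 (hE i))
  refine (h2 a).congr_of_eventuallyEq ?_
  filter_upwards [hN.mem_nhds ha] with x hx
  refine divergence_eq_sum u x fun v ↦ ?_
  simp only [hEe x hx, hEe' x hx]
  exact sum_inner_dualCoordField_smul (hNs hx) v

end Divergence

/-! ## The divergence theorem -/

section DivergenceTheorem

variable {n : ℕ} {M : Type*} [TopologicalSpace M] [ChartedSpace (EuclideanSpace ℝ (Fin n)) M]
  [IsManifold (𝓡 n) ∞ M] [RiemannianBundle (fun x : M ↦ TangentSpace (𝓡 n) x)]
  [IsContMDiffRiemannianBundle (𝓡 n) ∞ (EuclideanSpace ℝ (Fin n))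
      (fun x : M ↦ TangentSpace (𝓡 n) x)]

/-- Jacobi's formula applied to `ρ = √det g` gives `2 ∂ρ = ρ tr(g⁻¹ ∂g)`. -/
theorem mvfderiv_chartDensity {a x : M}
    (hx : x ∈ (chartAt (EuclideanSpace ℝ (Fin n)) a).source) (j : Fin n) :
    2 * mvfderiv (𝓡 n) (chartDensity (n := n) a) x (coordField a j x) =
      chartDensity (n := n) a x * ∑ i, ∑ k, (coordGram (n := n) a x)⁻¹ k i *
        mvfderiv (𝓡 n) (fun z ↦ coordGram (n := n) a z i k) x (coordField a j x) := by
  set e := chartAt (EuclideanSpace ℝ (Fin n)) a with he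
  obtain ⟨y, hy, rfl⟩ : ∃ y ∈ e.target, e.symm y = x := ⟨e x, e.map_source hx, e.left_inv hx⟩
  have hs : e.source ∈ 𝓝 (e.symm y) := e.open_source.mem_nhds hx
  obtain ⟨T, hT, hTe⟩ := hasFDerivAt_comp_chartAt_symm hy (u := chartDensity (n := n) a)
    (((contMDiffOn_chartDensity a).contMDiffAt hs).mdifferentiableAt (by simp))
  choose A' hA' hA'e using fun i k ↦ hasFDerivAt_comp_chartAt_symm hy
    (u := fun z ↦ coordGram (n := n) a z i k)
    (((contMDiffOn_coordGram a i k).contMDiffAt hs).mdifferentiableAt (by simp))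
  have hpos := (coordGram_posDef (n := n) hx).det_pos
  have h1 := hasFDerivAt_det (A := fun z ↦ coordGram (n := n) a (e.symm z)) hA' hpos.ne'.isUnit
  have h2 := (Real.hasDerivAt_sqrt hpos.ne').comp_hasFDerivAt y h1
  have h3 : T = _ := hT.unique h2
  have h4 := congrArg (fun B : EuclideanSpace ℝ (Fin n) →L[ℝ] ℝ ↦
    B (EuclideanSpace.single j (1 : ℝ))) h3
  simp only [smul_apply, sum_apply, smul_eq_mul, hTe, hA'e] at h4
  rw [h4, chartDensity]
  have h5 : √(coordGram (n := n) a (e.symm y)).det ^ 2 = (coordGram (n := n) a (e.symm y)).det :=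
    Real.sq_sqrt hpos.le
  have h6 : √(coordGram (n := n) a (e.symm y)).det ≠ 0 := (Real.sqrt_pos.2 hpos).ne'
  conv_lhs => rw [← h5]
  rw [h5]
  conv_lhs => enter [2, 2, 1]; rw [← h5]
  field_simp
  rfl

variable {DT : CovariantDerivative (𝓡 n) (EuclideanSpace ℝ (Fin n))
      (fun x : M ↦ TangentSpace (𝓡 n) x)}

/-- This is `ρ div(∂ⱼ) = ∂ⱼρ`. Coordinate fields commute, so Koszul's formula leaves three
derivatives of the metric; contracted with the symmetric inverse, two of them cancel and `tr(g⁻¹ ∂ⱼ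
g)/2` remains. -/
theorem chartDensity_mul_sum_inner_connection (hDT : IsLeviCivita DT) {a x : M} {N : Set M}
    (hN : IsOpen N) (hx : x ∈ N) (hNs : N ⊆ (chartAt (EuclideanSpace ℝ (Fin n)) a).source)
    {E : Fin n → ∀ x : M, TangentSpace (𝓡 n) x} (hE : ∀ i, IsSmoothField (E i))
    (hEe : ∀ x ∈ N, ∀ i, E i x = coordField a i x) (j : Fin n) :
    chartDensity (n := n) a x *
      ∑ i, (inner ℝ (dualCoordField a i x) (DT (E j) x (coordField a i x)) : ℝ) =
      mvfderiv (𝓡 n) (chartDensity (n := n) a) x (coordField a j x) := by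
  have hev : ∀ i, ∀ᶠ z in 𝓝 x, E i z = coordField a i z := fun i ↦ by
    filter_upwards [hN.mem_nhds hx] with z hz using hEe z hz i
  have hb : ∀ i k, VectorField.mlieBracket (𝓡 n) (E i) (E k) x = 0 := fun i k ↦ by
    rw [Filter.EventuallyEq.mlieBracket_vectorField_eq (hev i) (hev k),
      mlieBracket_coordField (hNs hx)]
  have hg : ∀ i k v, mvfderiv (𝓡 n) (fun z ↦ (inner ℝ (E i z) (E k z) : ℝ)) x v =
      mvfderiv (𝓡 n) (fun z ↦ coordGram (n := n) a z i k) x v := fun i k v ↦ by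
    have : (fun z ↦ (inner ℝ (E i z) (E k z) : ℝ)) =ᶠ[𝓝 x]
        fun z ↦ coordGram (n := n) a z i k := by
      filter_upwards [hev i, hev k] with z h1 h2
      simp only [h1, h2, coordGram, Matrix.of_apply]
    exact congrArg (fun T : EuclideanSpace ℝ (Fin n) →L[ℝ] ℝ ↦ T v) this.mfderiv_eq
  set g : Fin n → Fin n → Fin n → ℝ := fun i k l ↦
    mvfderiv (𝓡 n) (fun z ↦ coordGram (n := n) a z k l) x (coordField a i x) with hgdef
  have hsymm : ∀ i k l, g i k l = g i l k := fun i k l ↦ by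
    have : (fun z ↦ coordGram (n := n) a z k l) = fun z ↦ coordGram (n := n) a z l k := by
      funext z
      simp only [coordGram, Matrix.of_apply, real_inner_comm]
    simp only [hgdef, this]
  have hk : ∀ i k, 2 * (inner ℝ (DT (E j) x (coordField a i x)) (coordField a k x) : ℝ) =
      g i j k + g j k i - g k i j := fun i k ↦ by
    have := hDT.koszul (hE i) (hE j) (hE k) x
    rw [hb, hb, hb, inner_zero_left, inner_zero_left, inner_zero_left, hg, hg, hg,
      hEe x hx, hEe x hx, hEe x hx] at this
    rw [this]
    ring
  set H := (coordGram (n := n) a x)⁻¹ with hH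
  have hHs : ∀ i k, H i k = H k i := fun i k ↦ by
    have h1 : (coordGram (n := n) a x).IsHermitian := (coordGram_posDef (n := n) (hNs hx)).1
    have h2 := h1.inv.apply i k
    exact h2.symm.trans (by simp [hH])
  have h1 : 2 * ∑ i, (inner ℝ (dualCoordField a i x) (DT (E j) x (coordField a i x)) : ℝ) =
      ∑ i, ∑ k, H k i * g j i k := by
    have h2 : ∀ i, (inner ℝ (dualCoordField a i x) (DT (E j) x (coordField a i x)) : ℝ) =
        ∑ k, H i k * inner ℝ (DT (E j) x (coordField a i x)) (coordField a k x) := fun i ↦ by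
      rw [dualCoordField, sum_inner]
      exact Finset.sum_congr rfl fun k _ ↦ by
        rw [real_inner_smul_left, real_inner_comm]
    simp only [h2, Finset.mul_sum]
    have h3 : ∀ i k, 2 * (H i k * (inner ℝ (DT (E j) x (coordField a i x))
        (coordField a k x) : ℝ)) = H i k * g i j k + H k i * g j i k - H i k * g k i j :=
      fun i k ↦ by
        rw [mul_left_comm, hk, hsymm j k i]
        conv_rhs => rw [hHs k i]
        ring
    simp only [h3, Finset.sum_add_distrib, Finset.sum_sub_distrib]
    have h4 : ∑ i, ∑ k, H i k * g k i j = ∑ i, ∑ k, H i k * g i j k := by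
      rw [Finset.sum_comm]
      exact Finset.sum_congr rfl fun k _ ↦ Finset.sum_congr rfl fun i _ ↦ by
        rw [hHs, hsymm]
    rw [h4]
    ring
  have h5 := mvfderiv_chartDensity (n := n) (hNs hx) j
  rw [← mul_right_inj' (two_ne_zero (α := ℝ)), h5, mul_left_comm, h1]

/-- The coordinate expression `ρ div u = Σ ∂ᵢ(ρ uⁱ)`, with `uⁱ` obtained from the dual frame. It
turns the divergence theorem into the vanishing of integrals of derivatives on Euclidean space. -/
theorem chartDensity_mul_divergence [T2Space M] (hDT : IsLeviCivita DT) {a x : M}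
    (hx : x ∈ (chartAt (EuclideanSpace ℝ (Fin n)) a).source)
    {u : ∀ m : M, TangentSpace (𝓡 n) m} (hu : IsSmoothField u) :
    chartDensity (n := n) a x * divergence DT u x =
      ∑ i, mvfderiv (𝓡 n) (fun z ↦ chartDensity (n := n) a z *
        (inner ℝ (dualCoordField a i z) (u z) : ℝ)) x (coordField a i x) := by
  obtain ⟨E, E', N, hN, hxN, hNs, hE, hE', hEe, hEe'⟩ := exists_coordFrame_of_mem (n := n) hx
  set ρ := chartDensity (n := n) a with hρ
  have hρd : MDifferentiableAt (𝓡 n) 𝓘(ℝ, ℝ) ρ x :=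
    ((contMDiffOn_chartDensity a).contMDiffAt ((chartAt _ a).open_source.mem_nhds hx)
      ).mdifferentiableAt (by simp)
  have hI : ∀ i, ContMDiff (𝓡 n) 𝓘(ℝ, ℝ) ∞ fun z ↦ (inner ℝ (E' i z) (u z) : ℝ) := fun i ↦
    contMDiff_inner (hE' i) hu
  have h1 : ∀ i, mvfderiv (𝓡 n) (fun z ↦ ρ z * (inner ℝ (dualCoordField a i z) (u z) : ℝ)) x
      (coordField a i x) =
      ρ x * (inner ℝ (DT (E' i) x (coordField a i x)) (u x) +
        inner ℝ (dualCoordField a i x) (DT u x (coordField a i x))) +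
      mvfderiv (𝓡 n) ρ x (coordField a i x) * inner ℝ (dualCoordField a i x) (u x) := fun i ↦ by
    have h2 : (fun z ↦ ρ z * (inner ℝ (dualCoordField a i z) (u z) : ℝ)) =ᶠ[𝓝 x]
        fun z ↦ ρ z * (inner ℝ (E' i z) (u z) : ℝ) := by
      filter_upwards [hN.mem_nhds hxN] with z hz
      rw [hEe' z hz]
    have h3 : mvfderiv (𝓡 n) (fun z ↦ ρ z * (inner ℝ (dualCoordField a i z) (u z) : ℝ)) x
        (coordField a i x) = mvfderiv (𝓡 n) (fun z ↦ ρ z * (inner ℝ (E' i z) (u z) : ℝ)) x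
        (coordField a i x) :=
      congrArg (fun T : EuclideanSpace ℝ (Fin n) →L[ℝ] ℝ ↦ T (coordField a i x)) h2.mfderiv_eq
    rw [h3, mvfderiv_fun_mul hρd ((hI i x).mdifferentiableAt (by simp))]
    simp only [add_apply, smul_apply, smul_eq_mul]
    rw [hDT.metric _ _ (hE' i) hu, hEe' x hxN]
    ring
  rw [Finset.sum_congr rfl fun i _ ↦ h1 i]
  simp only [Finset.sum_add_distrib, ← Finset.mul_sum]
  rw [divergence_eq_sum u x (sum_inner_dualCoordField_smul hx)]
  -- Derivatives of the dual frame cancel those of `ρ`. Since `⟨E'ᵢ, Eⱼ⟩` is constant, derivatives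
  -- of `E'ᵢ` can be traded for those of `Eⱼ`, whose trace is `∂ⱼρ / ρ`.
  have hkey : ∀ w : TangentSpace (𝓡 n) x,
      ρ x * ∑ i, (inner ℝ (DT (E' i) x (coordField a i x)) w : ℝ) +
        ∑ i, mvfderiv (𝓡 n) ρ x (coordField a i x) * inner ℝ (dualCoordField a i x) w = 0 := by
    intro w
    have hj : ∀ j, ρ x * ∑ i, (inner ℝ (DT (E' i) x (coordField a i x)) (coordField a j x) : ℝ) +
        mvfderiv (𝓡 n) ρ x (coordField a j x) = 0 := fun j ↦ by
      rw [← chartDensity_mul_sum_inner_connection hDT hN hxN hNs hE hEe j, ← mul_add,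
        ← Finset.sum_add_distrib]
      refine mul_eq_zero_of_right _ (Finset.sum_eq_zero fun i _ ↦ ?_)
      have h4 := hDT.metric _ _ (hE' i) (hE j) x (coordField a i x)
      rw [hEe' x hxN, hEe x hxN] at h4
      rw [← h4]
      have h5 : (fun z ↦ (inner ℝ (E' i z) (E j z) : ℝ)) =ᶠ[𝓝 x]
          fun _ ↦ if i = j then 1 else 0 := by
        filter_upwards [hN.mem_nhds hxN] with z hz
        rw [hEe' z hz, hEe z hz, inner_dualCoordField (hNs hz)]
      have h6 : mvfderiv (𝓡 n) (fun z ↦ (inner ℝ (E' i z) (E j z) : ℝ)) x (coordField a i x) =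
          mvfderiv (𝓡 n) (fun _ : M ↦ if i = j then (1 : ℝ) else 0) x (coordField a i x) :=
        congrArg (fun T : EuclideanSpace ℝ (Fin n) →L[ℝ] ℝ ↦ T (coordField a i x)) h5.mfderiv_eq
      rw [h6, mvfderiv_const]
      rfl
    have hw : ∀ v : TangentSpace (𝓡 n) x, (inner ℝ v w : ℝ) =
        ∑ j, (inner ℝ (dualCoordField a j x) w : ℝ) * inner ℝ v (coordField a j x) := fun v ↦ by
      conv_lhs => rw [← sum_inner_dualCoordField_smul hx w]
      simp only [inner_sum, real_inner_smul_right]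
    rw [← sum_inner, hw, Finset.mul_sum, ← Finset.sum_add_distrib]
    refine Finset.sum_eq_zero fun j _ ↦ ?_
    have := congrArg (fun r ↦ (inner ℝ (dualCoordField a j x) w : ℝ) * r) (hj j)
    simp only [← sum_inner] at this
    rw [mul_zero] at this
    rw [← this]
    ring
  have := hkey (u x)
  linarith

theorem field_eq_zero_of_notMem {u : ∀ m : M, TangentSpace (𝓡 n) m} {x : M}
    (hx : x ∉ closure {x | u x ≠ 0}) : u x = 0 := by
  by_contra h
  exact hx (subset_closure h)

variable [T2Space M] [SigmaCompactSpace M] [MeasurableSpace M] [BorelSpace M]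

theorem integral_riemannianMeasure_of_chart (a : M) {F : M → ℝ} (hF : Continuous F)
    (hFs : ∀ x ∉ (chartAt (EuclideanSpace ℝ (Fin n)) a).source, F x = 0) :
    ∫ x, F x ∂(riemannianMeasure n M) =
      ∫ y in (chartAt (EuclideanSpace ℝ (Fin n)) a).target,
        chartDensity (n := n) a ((chartAt (EuclideanSpace ℝ (Fin n)) a).symm y) *
          F ((chartAt (EuclideanSpace ℝ (Fin n)) a).symm y) := by
  set e := chartAt (EuclideanSpace ℝ (Fin n)) a with he
  have hte : MeasurableSet e.target := e.open_target.measurableSet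
  have h1 : AEMeasurable e.symm (volume.restrict e.target) :=
    e.continuousOn_symm.aemeasurable hte
  have hd : ∀ y ∈ e.target, chartDensity (n := n) a (e.symm y) =
      Real.sqrt (chartGram (n := n) a y).det := fun y hy ↦ by
    rw [chartDensity, chartGram_eq hy]
  have h0 : AEMeasurable (fun y ↦ ENNReal.ofReal (Real.sqrt (chartGram (n := n) a y).det))
      (volume.restrict e.target) := by
    have h2 : ContinuousOn (fun y ↦ Real.sqrt (chartGram (n := n) a y).det) e.target :=
      (continuousOn_chartDensity_symm a).congr fun y hy ↦ (hd y hy).symm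
    exact (h2.aemeasurable hte).ennreal_ofReal
  rw [← setIntegral_eq_integral_of_forall_compl_eq_zero hFs, riemannianMeasure_restrict_source,
    chartVolume]
  rw [integral_map (h1.mono_ac (withDensity_absolutelyContinuous _ _))
    hF.aestronglyMeasurable,
    integral_withDensity_eq_integral_toReal_smul₀ h0 (Filter.Eventually.of_forall fun _ ↦
      ENNReal.ofReal_lt_top)]
  refine setIntegral_congr_fun hte fun y hy ↦ ?_
  simp only [smul_eq_mul, ENNReal.toReal_ofReal (Real.sqrt_nonneg _)]
  rw [hd y hy]

theorem integral_fderiv_eq_zero {E : Type*} [NormedAddCommGroup E] [NormedSpace ℝ E]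
    [FiniteDimensional ℝ E] [MeasurableSpace E] [BorelSpace E] {ν : Measure E}
    [ν.IsAddHaarMeasure] {F : E → ℝ} (hF : ContDiff ℝ 1 F) (hc : HasCompactSupport F) (v : E) :
    ∫ y, fderiv ℝ F y v ∂ν = 0 := by
  have h1 : Integrable (fun y ↦ fderiv ℝ F y v) ν :=
    ((hF.continuous_fderiv (by simp)).clm_apply continuous_const).integrable_of_hasCompactSupport
      (hc.fderiv_apply ℝ v)
  have h2 := integral_mul_fderiv_eq_neg_fderiv_mul_of_integrable (μ := ν) (v := v)
    (f := fun _ ↦ (1 : ℝ)) (g := F) (by simp) (by simpa using h1)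
    (by simpa using hF.continuous.integrable_of_hasCompactSupport hc)
    (fun _ _ ↦ differentiableAt_const _) (fun y _ ↦ (hF.differentiable (by simp)) y)
  simpa using h2

theorem integral_divergence_of_chart (hDT : IsLeviCivita DT) (a : M)
    {u : ∀ m : M, TangentSpace (𝓡 n) m} (hu : IsSmoothField u)
    (hc : IsCompact (closure {x | u x ≠ 0}))
    (hs : closure {x | u x ≠ 0} ⊆ (chartAt (EuclideanSpace ℝ (Fin n)) a).source) :
    ∫ x, divergence DT u x ∂(riemannianMeasure n M) = 0 := by
  set e := chartAt (EuclideanSpace ℝ (Fin n)) a with he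
  set K := closure {x | u x ≠ 0} with hK
  let w : Fin n → M → ℝ := fun i x ↦
    chartDensity (n := n) a x * (inner ℝ (dualCoordField a i x) (u x) : ℝ)
  have hw : ∀ i, ContMDiffOn (𝓡 n) 𝓘(ℝ, ℝ) ∞ (w i) e.source := fun i ↦
    (contMDiffOn_chartDensity a).mul
      (ContMDiffOn.inner_bundle (contMDiffOn_dualCoordField a i) hu.contMDiffOn)
  -- The components `ρ uⁱ` are extended by zero outside the chart target. The extension is smooth
  -- because the support of `u` is compact inside the chart.
  let F : Fin n → EuclideanSpace ℝ (Fin n) → ℝ := fun i ↦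
    e.target.indicator fun y ↦ w i (e.symm y)
  have hKe : IsCompact (e '' K) := hc.image_of_continuousOn (e.continuousOn.mono hs)
  have hF0 : ∀ i, ∀ y ∉ e '' K, F i y = 0 := fun i y hy ↦ by
    by_cases hyt : y ∈ e.target
    · have : e.symm y ∉ K := fun h ↦ hy ⟨_, h, e.right_inv hyt⟩
      simp only [F, Set.indicator_of_mem hyt, w, field_eq_zero_of_notMem this, inner_zero_right,
        mul_zero]
    · simp only [F, Set.indicator_of_notMem hyt]
  have hFc : ∀ i, HasCompactSupport (F i) := fun i ↦ HasCompactSupport.intro hKe (hF0 i)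
  have hFe : ∀ i, ∀ y ∈ e.target, F i =ᶠ[𝓝 y] fun z ↦ w i (e.symm z) := fun i y hy ↦ by
    filter_upwards [e.open_target.mem_nhds hy] with z hz
    exact Set.indicator_of_mem hz _
  have hFs : ∀ i, ContDiff ℝ 1 (F i) := fun i ↦ contDiff_iff_contDiffAt.2 fun y ↦ by
    by_cases hy : y ∈ e.target
    · refine ContDiffAt.congr_of_eventuallyEq ?_ (hFe i y hy)
      have h1 : ContMDiffAt (𝓡 n) 𝓘(ℝ, ℝ) ∞ (w i) (e.symm y) :=
        (hw i).contMDiffAt (e.open_source.mem_nhds (e.map_target hy))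
      have h2 : ContMDiffAt (𝓡 n) (𝓡 n) ∞ e.symm y :=
        (contMDiffOn_chart_symm (I := 𝓡 n) (x := a)).contMDiffAt (e.open_target.mem_nhds hy)
      exact (contMDiffAt_iff_contDiffAt.1 (h1.comp y h2)).of_le
        (WithTop.coe_le_coe.2 (le_top (a := (1 : ℕ∞))))
    · have : y ∉ e '' K := by
        rintro ⟨x, hx, rfl⟩
        exact hy (e.map_source (hs hx))
      refine (contDiffAt_const (c := (0 : ℝ))).congr_of_eventuallyEq ?_
      filter_upwards [hKe.isClosed.isOpen_compl.mem_nhds this] with z hz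
      exact hF0 i z hz
  have hdiv : ∀ y ∈ e.target, chartDensity (n := n) a (e.symm y) * divergence DT u (e.symm y) =
      ∑ i, fderiv ℝ (F i) y (EuclideanSpace.single i (1 : ℝ)) := fun y hy ↦ by
    rw [chartDensity_mul_divergence hDT (e.map_target hy) hu]
    refine Finset.sum_congr rfl fun i _ ↦ ?_
    obtain ⟨T, hT, hTe⟩ := hasFDerivAt_comp_chartAt_symm hy (u := w i)
      (((hw i).contMDiffAt (e.open_source.mem_nhds (e.map_target hy))).mdifferentiableAt (by simp))
    rw [(hFe i y hy).fderiv_eq, hT.fderiv, hTe]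
  have hdiv' : ∀ y ∉ e.target, ∑ i, fderiv ℝ (F i) y (EuclideanSpace.single i (1 : ℝ)) = 0 :=
    fun y hy ↦ Finset.sum_eq_zero fun i _ ↦ by
      have : y ∉ e '' K := by
        rintro ⟨x, hx, rfl⟩
        exact hy (e.map_source (hs hx))
      have h1 : F i =ᶠ[𝓝 y] fun _ ↦ (0 : ℝ) := by
        filter_upwards [hKe.isClosed.isOpen_compl.mem_nhds this] with z hz
        exact hF0 i z hz
      rw [h1.fderiv_eq, fderiv_const_apply]
      rfl
  rw [integral_riemannianMeasure_of_chart a (contMDiff_divergence hDT hu).continuous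
    fun x hx ↦ divergence_eq_zero_of_notMem_tsupport hu fun h ↦ hx (hs h),
    setIntegral_congr_fun e.open_target.measurableSet hdiv,
    setIntegral_eq_integral_of_forall_compl_eq_zero hdiv', integral_finsetSum]
  · exact Finset.sum_eq_zero fun i _ ↦ integral_fderiv_eq_zero (hFs i) (hFc i) _
  · exact fun i _ ↦ (((hFs i).continuous_fderiv (by simp)).clm_apply
      continuous_const).integrable_of_hasCompactSupport ((hFc i).fderiv_apply ℝ _)

/-- The divergence theorem: the divergence of a compactly supported vector field has integral
zero. -/
theorem integral_divergence_eq_zero (hDT : IsLeviCivita DT)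
    {u : ∀ m : M, TangentSpace (𝓡 n) m} (hu : IsSmoothField u)
    (hc : IsCompact (closure {x | u x ≠ 0})) :
    ∫ x, divergence DT u x ∂(riemannianMeasure n M) = 0 := by
  set K := closure {x | u x ≠ 0} with hK
  have hfin := (chartPartition n M).locallyFinite.finite_nonempty_inter_compact hc
  set I := hfin.toFinset with hI
  have hφ : ∀ a, ContMDiff (𝓡 n) 𝓘(ℝ, ℝ) ∞ (chartPartition n M a) := fun a ↦
    (chartPartition n M a).contMDiff
  have hsum : ∀ x, ∑ a ∈ I, chartPartition n M a x • u x = u x := fun x ↦ by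
    by_cases hx : x ∈ K
    · rw [← Finset.sum_smul]
      have h1 := (chartPartition n M).sum_eq_one (Set.mem_univ x)
      rw [finsum_eq_sum_of_support_subset (s := I)] at h1
      · rw [h1, one_smul]
      · intro a ha
        rw [hI, Finset.mem_coe, Set.Finite.mem_toFinset]
        exact ⟨x, ha, hx⟩
    · rw [field_eq_zero_of_notMem hx]
      simp
  have hsm : ∀ a, IsSmoothField fun x ↦ chartPartition n M a x • u x := fun a ↦ hu.smul (hφ a)
  have hsub : ∀ a, closure {x | chartPartition n M a x • u x ≠ 0} ⊆ K := fun a ↦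
    closure_mono fun x hx h ↦ hx (by rw [h, smul_zero])
  have hsub' : ∀ a, closure {x | chartPartition n M a x • u x ≠ 0} ⊆
      (chartAt (EuclideanSpace ℝ (Fin n)) a).source := fun a ↦ by
    refine Set.Subset.trans (closure_mono fun x hx ↦ ?_)
      ((SmoothPartitionOfUnity.exists_isSubordinate_chartAt_source (𝓡 n) M).choose_spec a)
    intro h
    exact hx (by rw [show chartPartition n M a x = 0 from h, zero_smul])
  have hcp : ∀ a, IsCompact (closure {x | chartPartition n M a x • u x ≠ 0}) := fun a ↦
    hc.of_isClosed_subset isClosed_closure (hsub a)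
  have h1 : ∀ x, divergence DT u x =
      ∑ a ∈ I, divergence DT (fun x ↦ chartPartition n M a x • u x) x := fun x ↦ by
    rw [← divergence_sum fun a _ ↦ hsm a]
    simp only [hsum]
  simp only [h1]
  rw [integral_finsetSum]
  · exact Finset.sum_eq_zero fun a _ ↦ integral_divergence_of_chart hDT a (hsm a) (hcp a) (hsub' a)
  · intro a _
    refine (contMDiff_divergence hDT (hsm a)).continuous.integrable_of_hasCompactSupport ?_
    exact HasCompactSupport.intro (hcp a) fun x hx ↦
      divergence_eq_zero_of_notMem_tsupport (hsm a) hx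

end DivergenceTheorem

/-! ## The current of a pair of spinors -/

section Current

variable {n d : ℕ}
  {G : Type*} [TopologicalSpace G] [Group G] [ChartedSpace (EuclideanSpace ℝ (Fin d)) G]
  {M : Type*} [TopologicalSpace M] [ChartedSpace (EuclideanSpace ℝ (Fin n)) M] [MulAction G M]
  [LieGroup (𝓡 d) ∞ G] [ContMDiffSMul (𝓡 d) (𝓡 n) ∞ G M] [T2Space M]
  [IsManifold (𝓡 n) ∞ M] [RiemannianBundle (fun x : M ↦ TangentSpace (𝓡 n) x)]
  [IsContMDiffRiemannianBundle (𝓡 n) ∞ (EuclideanSpace ℝ (Fin n))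
      (fun x : M ↦ TangentSpace (𝓡 n) x)]
  {FS : Type*} [NormedAddCommGroup FS] [NormedSpace ℂ FS]
  {S : M → Type*} [TopologicalSpace (TotalSpace FS S)]
  [∀ m, NormedAddCommGroup (S m)] [∀ m, InnerProductSpace ℂ (S m)]
  [FiberBundle FS S] [VectorBundle ℂ FS S] [VectorBundle ℝ FS S]
  [ContMDiffVectorBundle ∞ FS S (𝓡 n)]
  {FL : Type*} [NormedAddCommGroup FL] [NormedSpace ℂ FL]
  {L : M → Type*} [TopologicalSpace (TotalSpace FL L)]
  [∀ m, NormedAddCommGroup (L m)] [∀ m, InnerProductSpace ℂ (L m)]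
  [FiberBundle FL L] [VectorBundle ℂ FL L] [VectorBundle ℝ FL L]
  [ContMDiffVectorBundle ∞ FL L (𝓡 n)]
  {aS : EquivariantStructure (n := n) d G FS S} {aL : EquivariantStructure (n := n) d G FL L}
  (P : SpinCStructure aS aL)
  {DT : CovariantDerivative (𝓡 n) (EuclideanSpace ℝ (Fin n))
      (fun x : M ↦ TangentSpace (𝓡 n) x)}
  {DL : CovariantDerivative (𝓡 n) FL L} {DS : CovariantDerivative (𝓡 n) FS S}

/-- The tangent vector `u` with `⟪u, v⟫ = Re ⟪c(v) w, z⟫`. -/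
def spinorCurrent (m : M) (w z : S m) : TangentSpace (𝓡 n) m :=
  ∑ i, (inner ℂ (P.c m (stdOrthonormalBasis ℝ (TangentSpace (𝓡 n) m) i) w) z : ℂ).re •
    stdOrthonormalBasis ℝ (TangentSpace (𝓡 n) m) i

theorem inner_spinorCurrent (m : M) (w z : S m) (v : TangentSpace (𝓡 n) m) :
    (inner ℝ (spinorCurrent P m w z) v : ℝ) = (inner ℂ (P.c m v w) z : ℂ).re := by
  conv_rhs => rw [← (stdOrthonormalBasis ℝ (TangentSpace (𝓡 n) m)).sum_repr' v]
  simp only [spinorCurrent, sum_inner, map_sum, map_smul,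
    LinearMap.sum_apply, LinearMap.smul_apply, ← Complex.coe_smul, inner_smul_left,
    Complex.conj_ofReal, Complex.re_sum, Complex.re_ofReal_mul]
  exact Finset.sum_congr rfl fun i _ ↦ mul_comm _ _

theorem isSmoothField_spinorCurrent {σ τ : ∀ m, S m} (hσ : IsSmoothSection (n := n) FS σ)
    (hτ : IsSmoothSection (n := n) FS τ) :
    IsSmoothField fun m ↦ spinorCurrent P m (σ m) (τ m) := by
  refine isSmoothField_of_eventuallyEq fun a ↦ ?_
  obtain ⟨E, E', N, hN, ha, hNs, hE, hE', hEe, hEe'⟩ :=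
    exists_coordFrame_of_mem (n := n) (mem_chart_source _ a)
  refine ⟨fun m ↦ ∑ i, (inner ℂ (P.c m (E' i m) (σ m)) (τ m) : ℂ).re • E i m, ?_, ?_⟩
  · exact IsSmoothField.sum fun i _ ↦ (hE i).smul
      ((ContinuousLinearMap.contMDiff Complex.reCLM).comp
        (aS.metric_smooth _ _ (P.c_smooth _ (hE' i) σ hσ) hτ))
  · filter_upwards [hN.mem_nhds ha] with x hx
    rw [← sum_inner_dualCoordField_smul (hNs hx) (spinorCurrent P x (σ x) (τ x))]
    refine Finset.sum_congr rfl fun i _ ↦ ?_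
    rw [real_inner_comm, inner_spinorCurrent, hEe' x hx, hEe x hx]

/-- Pointwise form of the symmetry of the Dirac operator. In the derivative of `⟨c(E')σ, τ⟩`, the
terms containing `∇E'` cancel because the spinor connection is a Clifford connection; skewness of
`c` gives the sign of the second term. -/
theorem divergence_spinorCurrent (hDT : IsLeviCivita DT) (hDS : IsSpinorConnection P DT DL DS)
    {σ τ : ∀ m, S m} (hσ : IsSmoothSection (n := n) FS σ) (hτ : IsSmoothSection (n := n) FS τ)
    (a : M) :
    divergence DT (fun m ↦ spinorCurrent P m (σ m) (τ m)) a =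
      (inner ℂ (dirac P DS σ a) (τ a) : ℂ).re - (inner ℂ (σ a) (dirac P DS τ a) : ℂ).re := by
  obtain ⟨E, E', N, hN, ha, hNs, hE, hE', hEe, hEe'⟩ :=
    exists_coordFrame_of_mem (n := n) (mem_chart_source _ a)
  have hfr : ∀ v : TangentSpace (𝓡 n) a, ∑ i, (inner ℝ (E' i a) v : ℝ) • E i a = v := fun v ↦ by
    simp only [hEe' a ha, hEe a ha]
    exact sum_inner_dualCoordField_smul (hNs ha) v
  have hu := isSmoothField_spinorCurrent P hσ hτ
  rw [divergence_eq_sum _ a hfr, dirac_eq_sum P DS σ a hfr, dirac_eq_sum P DS τ a hfr]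
  simp only [sum_inner, inner_sum, Complex.re_sum, ← Finset.sum_sub_distrib]
  refine Finset.sum_congr rfl fun i _ ↦ ?_
  have h1 := hDT.metric _ _ (hE' i) hu a (E i a)
  have h2 := hDS.hermitian.hermitian _ _ (P.c_smooth _ (hE' i) σ hσ) hτ a (E i a)
  have h3 : mvfderiv (𝓡 n) (fun x ↦ (inner ℝ (E' i x) (spinorCurrent P x (σ x) (τ x)) : ℝ)) a
      (E i a) = (mvfderiv (𝓡 n) (fun x ↦ (inner ℂ (P.c x (E' i x) (σ x)) (τ x) : ℂ)) a
        (E i a)).re := by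
    have h4 := mvfderiv_clm_comp Complex.reCLM ((aS.metric_smooth _ _
      (P.c_smooth _ (hE' i) σ hσ) hτ a).mdifferentiableAt (by simp)) (E i a)
    refine Eq.trans ?_ h4
    congr 2
    funext x
    rw [real_inner_comm, inner_spinorCurrent]
    rfl
  rw [h3, h2, hDS.clifford _ _ (hE' i) hσ, real_inner_comm, inner_spinorCurrent, inner_add_left,
    P.c_skew a (E' i a) (σ a)] at h1
  simp only [Complex.add_re, Complex.neg_re] at h1
  linarith

variable {p : ℕ}

/-- The tangent vector `u` with `⟪u, v⟫ = Re ⟪c(v) z, z'⟫`, for `z` and `z'` in `S ⊗ L^p`. -/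
def twistedCurrent (m : M) (z z' : Twisted S L p m) : TangentSpace (𝓡 n) m :=
  ∑ i, twistedInner (onSpinors (P.c m (stdOrthonormalBasis ℝ (TangentSpace (𝓡 n) m) i)) z) z' •
    stdOrthonormalBasis ℝ (TangentSpace (𝓡 n) m) i

theorem twistedCurrent_eq {m : M} {l : L m} (hl : ‖l‖ = 1) (z z' : Twisted S L p m) :
    twistedCurrent P m z z' = spinorCurrent P m (contract l z) (contract l z') := by
  have hL : Module.finrank ℂ (L m) = 1 := by rw [finrank_fibre (F := FL), P.rank_det]
  simp only [twistedCurrent, spinorCurrent, twistedInner_eq hL hl, contract_onSpinors]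

/-- Near every point, `s` and `T s` are given by spinors `σ` and `T σ`. -/
theorem IsUnitForm.onSpinors {s : ∀ m, Twisted S L p m} {σ : ∀ m, S m} {l : ∀ m, L m} {N : Set M}
    (h : IsUnitForm (n := n) FS FL s σ l N) {T : ∀ m : M, S m →ₗ[ℂ] S m}
    (hT : IsSmoothEnd (n := n) FS T) :
    IsUnitForm (n := n) FS FL (fun m ↦ CalliasLocalisation.onSpinors (T m) (s m))
      (fun m ↦ T m (σ m)) l N where
  smooth_spinor := hT σ h.smooth_spinor
  smooth_line := h.smooth_line
  isOpen := h.isOpen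
  norm_eq := h.norm_eq
  eq x hx := by rw [h.eq x hx, onSpinors_tmul]

theorem IsUnitForm.contract_eq {s : ∀ m, Twisted S L p m} {σ : ∀ m, S m} {l : ∀ m, L m} {N : Set M}
    (h : IsUnitForm (n := n) FS FL s σ l N) {x : M} (hx : x ∈ N) : contract (l x) (s x) = σ x := by
  rw [h.eq x hx, contract_tmul_tprod_self (h.norm_eq x hx)]

section

variable {s s' : ∀ m, Twisted S L p m} {T : ∀ m : M, S m →ₗ[ℂ] S m}

theorem isSmoothField_twistedCurrent (hs : IsSmoothTwisted (n := n) FS FL s)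
    (hT : IsSmoothEnd (n := n) FS T) :
    IsSmoothField fun m ↦ twistedCurrent P m (s m) (onSpinors (T m) (s m)) := by
  refine isSmoothField_of_eventuallyEq fun a ↦ ?_
  obtain ⟨σ, l, N, ha, h⟩ := hs.exists_unitForm aL a
  refine ⟨_, isSmoothField_spinorCurrent P h.smooth_spinor (hT σ h.smooth_spinor), ?_⟩
  filter_upwards [h.isOpen.mem_nhds ha] with x hx
  rw [twistedCurrent_eq P (h.norm_eq x hx), contract_onSpinors, h.contract_eq hx]

/-- In a local form the twist adds `i p c(θ)` to the Dirac operator. This endomorphism is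
self-adjoint and drops out of the difference, which leaves the identity for spinors. -/
theorem divergence_twistedCurrent (hDT : IsLeviCivita DT) (hDS : IsSpinorConnection P DT DL DS)
    (hDL : IsHermitianConnection DL) (hs : IsSmoothTwisted (n := n) FS FL s)
    (hT : IsSmoothEnd (n := n) FS T) (a : M) :
    divergence DT (fun m ↦ twistedCurrent P m (s m) (onSpinors (T m) (s m))) a =
      twistedInner (twistedDirac P DS DL s a) (onSpinors (T a) (s a)) -
      twistedInner (s a) (twistedDirac P DS DL (fun m ↦ onSpinors (T m) (s m)) a) := by
  obtain ⟨σ, l, N, ha, h⟩ := hs.exists_unitForm aL a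
  have hL : Module.finrank ℂ (L a) = 1 := by rw [finrank_fibre (F := FL), P.rank_det]
  rw [divergence_congr (isSmoothField_twistedCurrent P hs hT)
    (isSmoothField_spinorCurrent P h.smooth_spinor (hT σ h.smooth_spinor)),
    divergence_spinorCurrent P hDT hDS h.smooth_spinor (hT σ h.smooth_spinor),
    twistedInner_eq hL (h.norm_eq a ha), twistedInner_eq hL (h.norm_eq a ha),
    contract_twistedDirac P hDS.hermitian hDL h ha,
    contract_twistedDirac P hDS.hermitian hDL (h.onSpinors hT) ha, contract_onSpinors,
    h.contract_eq ha]
  · rw [inner_add_left, inner_add_right, inner_smul_left, inner_smul_right, P.c_skew]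
    simp
  · filter_upwards [h.isOpen.mem_nhds ha] with x hx
    rw [twistedCurrent_eq P (h.norm_eq x hx), contract_onSpinors, h.contract_eq hx]

theorem twistedCurrent_smul (hG : IsIsometricAction (n := n) G M)
    (hs : ∀ (g : G) m, s (g • m) = twistedAct aS aL g m (s m))
    (hs' : ∀ (g : G) m, s' (g • m) = twistedAct aS aL g m (s' m)) (g : G) (m : M) :
    twistedCurrent P (g • m) (s (g • m)) (s' (g • m)) =
      pushforward g m (twistedCurrent P m (s m) (s' m)) := by
  have hL : Module.finrank ℂ (L m) = 1 := by rw [finrank_fibre (F := FL), P.rank_det]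
  obtain ⟨l, hl⟩ := exists_norm_eq_one_of_finrank hL
  have hl' : ‖aL.act g m l‖ = 1 := by rw [LinearIsometryEquiv.norm_map, hl]
  refine ext_inner_right ℝ fun w ↦ ?_
  obtain ⟨v, rfl⟩ := hG.surjective_pushforward g m w
  rw [hG.inner_pushforward, twistedCurrent_eq P hl, twistedCurrent_eq P hl', inner_spinorCurrent,
    inner_spinorCurrent, hs, hs', contract_twistedAct, contract_twistedAct, ← P.c_equivariant,
    LinearIsometryEquiv.inner_map_map]

end

end Current

/-! ## Averages over the group -/

section Parametric

variable {n d : ℕ} {G : Type*} [TopologicalSpace G] [ChartedSpace (EuclideanSpace ℝ (Fin d)) G]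
  [MeasurableSpace G] [BorelSpace G] [T2Space G] [SecondCountableTopology G]

theorem contMDiffAt_fderiv_of_contMDiffAt {F : Type*} [NormedAddCommGroup F] [NormedSpace ℝ F]
    [IsManifold (𝓡 d) ∞ G]
    {H : G → EuclideanSpace ℝ (Fin n) → F} {q : G × EuclideanSpace ℝ (Fin n)}
    (hH : ContMDiffAt ((𝓡 d).prod (𝓡 n)) 𝓘(ℝ, F) ∞ (Function.uncurry H) q) :
    ContMDiffAt ((𝓡 d).prod (𝓡 n)) 𝓘(ℝ, EuclideanSpace ℝ (Fin n) →L[ℝ] F) ∞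
      (Function.uncurry fun g y ↦ fderiv ℝ (H g) y) q := by
  have h1 : ContMDiffAt (((𝓡 d).prod (𝓡 n)).prod (𝓡 n)) ((𝓡 d).prod (𝓡 n)) ∞
      (fun r : (G × EuclideanSpace ℝ (Fin n)) × EuclideanSpace ℝ (Fin n) ↦ (r.1.1, r.2))
      (q, q.2) :=
    (contMDiffAt_fst.comp (q, q.2) contMDiffAt_fst).prodMk contMDiffAt_snd
  have h2 : ContMDiffAt (((𝓡 d).prod (𝓡 n)).prod (𝓡 n)) 𝓘(ℝ, F) ∞
      (Function.uncurry fun (r : G × EuclideanSpace ℝ (Fin n)) (y : EuclideanSpace ℝ (Fin n)) ↦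
        H r.1 y) (q, q.2) :=
    ContMDiffAt.comp (I' := (𝓡 d).prod (𝓡 n)) (q, q.2) (g := Function.uncurry H)
      (f := fun r : (G × EuclideanSpace ℝ (Fin n)) × EuclideanSpace ℝ (Fin n) ↦ (r.1.1, r.2)) hH h1
  have h3 := ContMDiffAt.mfderiv (m := ∞) (n := ∞)
    (fun (r : G × EuclideanSpace ℝ (Fin n)) (y : EuclideanSpace ℝ (Fin n)) ↦ H r.1 y)
    Prod.snd h2 contMDiffAt_snd (by simp)
  have h4 := inTangentCoordinates_model_space (I := 𝓡 n) (I' := 𝓘(ℝ, F)) Prod.snd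
    (fun r : G × EuclideanSpace ℝ (Fin n) ↦ H r.1 r.2) (fun r ↦ fderiv ℝ (H r.1) r.2) q
  simp only [mfderiv_eq_fderiv] at h3
  exact (congrArg (fun Θ : G × EuclideanSpace ℝ (Fin n) → EuclideanSpace ℝ (Fin n) →L[ℝ] F ↦
    ContMDiffAt ((𝓡 d).prod (𝓡 n)) 𝓘(ℝ, EuclideanSpace ℝ (Fin n) →L[ℝ] F) ∞ Θ q) h4).mp h3

/-- Differentiation under the integral sign, dominated by a constant on the compact set `C`. The
derivative is an integral of the same kind with values in linear maps, so the target space is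
quantified inside the induction on `k`. -/
theorem contDiffOn_integral_of_compact {ν : Measure G} [IsFiniteMeasureOnCompacts ν]
    [IsManifold (𝓡 d) ∞ G]
    {U : Set (EuclideanSpace ℝ (Fin n))} (hU : IsOpen U) {C : Set G} (hC : IsCompact C) (k : ℕ) :
    ∀ {F : Type} [NormedAddCommGroup F] [NormedSpace ℝ F]
      {H : G → EuclideanSpace ℝ (Fin n) → F},
      ContMDiffOn ((𝓡 d).prod (𝓡 n)) 𝓘(ℝ, F) ∞ (Function.uncurry H) (Set.univ ×ˢ U) →
      (∀ y ∈ U, ∀ g ∉ C, H g y = 0) →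
      ContDiffOn ℝ k (fun y ↦ ∫ g, H g y ∂ν) U := by
  have hopen : IsOpen ((Set.univ : Set G) ×ˢ U) := isOpen_univ.prod hU
  have hcont : ∀ {F : Type} [NormedAddCommGroup F] [NormedSpace ℝ F]
      {H : G → EuclideanSpace ℝ (Fin n) → F},
      ContMDiffOn ((𝓡 d).prod (𝓡 n)) 𝓘(ℝ, F) ∞ (Function.uncurry H) (Set.univ ×ˢ U) →
      ∀ y ∈ U, Continuous fun g ↦ H g y := fun {F} _ _ {H} hH y hy ↦
    (hH.continuousOn.comp_continuous (f := fun g : G ↦ (g, y)) (by fun_prop)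
      fun g ↦ ⟨Set.mem_univ g, hy⟩)
  have hint : ∀ {F : Type} [NormedAddCommGroup F] [NormedSpace ℝ F]
      {H : G → EuclideanSpace ℝ (Fin n) → F},
      ContMDiffOn ((𝓡 d).prod (𝓡 n)) 𝓘(ℝ, F) ∞ (Function.uncurry H) (Set.univ ×ˢ U) →
      (∀ y ∈ U, ∀ g ∉ C, H g y = 0) → ∀ y ∈ U, Integrable (fun g ↦ H g y) ν :=
    fun {F} _ _ {H} hH h0 y hy ↦ (hcont hH y hy).integrable_of_hasCompactSupport
      (HasCompactSupport.intro hC (h0 y hy))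
  induction k with
  | zero =>
    intro F _ _ H hH h0
    rw [Nat.cast_zero, contDiffOn_zero]
    refine continuousOn_integral_of_compact_support (f := fun y g ↦ H g y) hC ?_
      fun y g hy hg ↦ h0 y hy g hg
    exact hH.continuousOn.comp (f := fun r : EuclideanSpace ℝ (Fin n) × G ↦ (r.2, r.1))
      (by fun_prop) fun r hr ↦ ⟨Set.mem_univ _, hr.1⟩
  | succ k ih =>
    intro F _ _ H hH h0
    have hH' : ContMDiffOn ((𝓡 d).prod (𝓡 n)) 𝓘(ℝ, EuclideanSpace ℝ (Fin n) →L[ℝ] F) ∞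
        (Function.uncurry fun g y ↦ fderiv ℝ (H g) y) (Set.univ ×ˢ U) := fun q hq ↦
      (contMDiffAt_fderiv_of_contMDiffAt
        (hH.contMDiffAt (hopen.mem_nhds hq))).contMDiffWithinAt
    have h0' : ∀ y ∈ U, ∀ g ∉ C, fderiv ℝ (H g) y = 0 := fun y hy g hg ↦ by
      have : H g =ᶠ[𝓝 y] fun _ ↦ (0 : F) := by
        filter_upwards [hU.mem_nhds hy] with z hz using h0 z hz g hg
      rw [this.fderiv_eq, fderiv_const_apply]
    have hd : ∀ y ∈ U, ∀ g, HasFDerivAt (H g) (fderiv ℝ (H g) y) y := fun y hy g ↦ by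
      have h1 : ContMDiffAt (𝓡 n) 𝓘(ℝ, F) ∞ (H g) y :=
        ContMDiffAt.comp (I' := (𝓡 d).prod (𝓡 n)) y (g := Function.uncurry H)
          (f := fun z ↦ (g, z)) (hH.contMDiffAt (hopen.mem_nhds ⟨Set.mem_univ _, hy⟩))
          (contMDiffAt_const.prodMk contMDiffAt_id)
      exact ((contMDiffAt_iff_contDiffAt.1 h1).differentiableAt (by simp)).hasFDerivAt
    have hder : ∀ y ∈ U, HasFDerivAt (fun y ↦ ∫ g, H g y ∂ν) (∫ g, fderiv ℝ (H g) y ∂ν) y := by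
      intro y hy
      obtain ⟨K, hK, hKU, hKc⟩ := local_compact_nhds (hU.mem_nhds hy)
      have hb : ContinuousOn (fun q : G × EuclideanSpace ℝ (Fin n) ↦ ‖fderiv ℝ (H q.1) q.2‖)
          (C ×ˢ K) :=
        (hH'.continuousOn.mono (Set.prod_mono (Set.subset_univ _) hKU)).norm
      obtain ⟨b, hb'⟩ := (hC.prod hKc).bddAbove_image hb
      refine hasFDerivAt_integral_of_dominated_of_fderiv_le (F := fun y g ↦ H g y)
        (F' := fun y g ↦ fderiv ℝ (H g) y) (bound := C.indicator fun _ ↦ b) (s := K) hK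
        ?_ (hint hH h0 y hy) (hcont hH' y hy).aestronglyMeasurable ?_ ?_ ?_
      · filter_upwards [hU.mem_nhds hy] with z hz using (hcont hH z hz).aestronglyMeasurable
      · refine Filter.Eventually.of_forall fun g z hz ↦ ?_
        by_cases hg : g ∈ C
        · rw [Set.indicator_of_mem hg]
          exact hb' ⟨(g, z), ⟨hg, hz⟩, rfl⟩
        · rw [Set.indicator_of_notMem hg, h0' z (hKU hz) g hg, norm_zero]
      · exact (integrable_indicator_iff hC.isClosed.measurableSet).2
          (integrableOn_const (hC.measure_lt_top.ne))
      · exact Filter.Eventually.of_forall fun g z hz ↦ hd z (hKU hz) g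
    have hcast : ((k + 1 : ℕ) : ℕ∞ω) = (k : ℕ∞ω) + 1 := by push_cast; rfl
    rw [hcast, contDiffOn_succ_iff_fderiv_of_isOpen hU]
    refine ⟨fun y hy ↦ (hder y hy).differentiableAt.differentiableWithinAt, by simp, ?_⟩
    exact (ih hH' h0').congr fun y hy ↦ (hder y hy).fderiv

end Parametric

section Average

variable {n d : ℕ}
  {G : Type*} [TopologicalSpace G] [Group G] [IsTopologicalGroup G] [T2Space G]
  [SecondCountableTopology G] [MeasurableSpace G] [BorelSpace G]
  (haar : Measure G) [haar.IsHaarMeasure] [haar.IsMulRightInvariant]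
  {M : Type*} [TopologicalSpace M] [T2Space M] [LocallyCompactSpace M]
  [MulAction G M] [ProperSMul G M]

variable (G) in
theorem isCompact_transporter {K K' : Set M} (hK : IsCompact K) (hK' : IsCompact K') :
    IsCompact {q : G × M | q.2 ∈ K ∧ q.1 • q.2 ∈ K'} := by
  have h := (ProperSMul.isProperMap_smul_pair (G := G) (X := M)).isCompact_preimage
    (hK'.prod hK)
  convert h using 1
  ext q
  simp [and_comm]

/-- The average of a function over the orbits. -/
def average (φ : M → ℝ) (m : M) : ℝ := ∫ g, φ (g • m) ∂haar

/-- Moving `m` to `k • m` translates the integration variable on the right. This is one of the two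
uses of unimodularity, the other being invariance of Haar measure under inversion. -/
theorem average_smul (φ : M → ℝ) (k : G) (m : M) :
    average haar φ (k • m) = average haar φ m := by
  simp only [average, ← mul_smul]
  exact integral_mul_right_eq_self (fun g ↦ φ (g • m)) k

variable {haar}

theorem continuous_smul_apply {φ : M → ℝ} (hφ : Continuous φ) (m : M) :
    Continuous fun g : G ↦ φ (g • m) := by
  have : ContinuousSMul G M := inferInstance
  fun_prop

theorem hasCompactSupport_smul_apply {φ : M → ℝ} (hc : HasCompactSupport φ) (m : M) :
    HasCompactSupport fun g : G ↦ φ (g • m) :=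
  HasCompactSupport.intro ((isCompact_transporter G (isCompact_singleton (x := m)) hc).image
    continuous_fst) fun g hg ↦ by
      by_contra h
      exact hg ⟨(g, m), ⟨rfl, subset_tsupport _ h⟩, rfl⟩

theorem average_nonneg {φ : M → ℝ} (h0 : ∀ x, 0 ≤ φ x) (m : M) : 0 ≤ average haar φ m :=
  integral_nonneg fun _ ↦ h0 _

theorem average_pos {φ : M → ℝ} (hφ : Continuous φ) (hc : HasCompactSupport φ)
    (h0 : ∀ x, 0 ≤ φ x) {m : M} (hm : 0 < φ m) : 0 < average haar φ m := by
  refine (continuous_smul_apply hφ m).integral_pos_of_hasCompactSupport_nonneg_nonzero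
    (hasCompactSupport_smul_apply hc m) (fun g ↦ h0 _) (x := 1) ?_
  rw [one_smul]
  exact hm.ne'

variable (G) in
/-- A cocompact set is contained in the translates of a compact set. -/
theorem IsCocompact.exists_isCompact {A : Set M} (hA : IsCocompact G A) :
    ∃ K : Set M, IsCompact K ∧ ∀ m ∈ A, ∃ g : G, g • m ∈ K := by
  have hq : IsOpenMap (Quotient.mk (MulAction.orbitRel G M)) := isOpenMap_quotient_mk'_mul
  choose K hKc hK using fun m : M ↦ exists_compact_mem_nhds m
  obtain ⟨t, ht⟩ := hA.elim_finite_subcover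
    (fun m : M ↦ Quotient.mk (MulAction.orbitRel G M) '' interior (K m))
    (fun m ↦ hq _ isOpen_interior) (by
      rintro _ ⟨m, hm, rfl⟩
      exact Set.mem_iUnion.2 ⟨m, m, mem_interior_iff_mem_nhds.2 (hK m), rfl⟩)
  refine ⟨⋃ m ∈ t, K m, t.isCompact_biUnion fun m _ ↦ hKc m, fun m hm ↦ ?_⟩
  obtain ⟨a, hat, x, hx, hxm⟩ := Set.mem_iUnion₂.1 (ht ⟨m, hm, rfl⟩)
  obtain ⟨g, hg⟩ := Quotient.exact hxm
  exact ⟨g, Set.mem_iUnion₂.2 ⟨a, hat, by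
    have : g • m = x := hg
    rw [this]
    exact interior_subset hx⟩⟩

variable [ChartedSpace (EuclideanSpace ℝ (Fin n)) M] [IsManifold (𝓡 n) ∞ M]

/-- For `m` in a compact neighbourhood of `m₀`, properness confines the integration to a compact
subset of `G`, so differentiation under the integral sign applies in a chart. -/
theorem contMDiff_average [ChartedSpace (EuclideanSpace ℝ (Fin d)) G] [IsManifold (𝓡 d) ∞ G]
    (hsm : ContMDiff ((𝓡 d).prod (𝓡 n)) (𝓡 n) ∞ fun q : G × M ↦ q.1 • q.2) {φ : M → ℝ} (hφ : ContMDiff (𝓡 n) 𝓘(ℝ, ℝ) ∞ φ)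
    (hc : HasCompactSupport φ) : ContMDiff (𝓡 n) 𝓘(ℝ, ℝ) ∞ (average haar φ) := by
  intro m₀
  set e := chartAt (EuclideanSpace ℝ (Fin n)) m₀ with he
  obtain ⟨K, hK, hKs, hKc⟩ := local_compact_nhds (e.open_source.mem_nhds (mem_chart_source _ m₀))
  let U : Set (EuclideanSpace ℝ (Fin n)) := e.target ∩ e.symm ⁻¹' interior K
  have hU : IsOpen U := e.isOpen_inter_preimage_symm isOpen_interior
  let C : Set G := Prod.fst '' {q : G × M | q.2 ∈ K ∧ q.1 • q.2 ∈ tsupport φ}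
  have hC : IsCompact C := (isCompact_transporter G hKc hc).image continuous_fst
  have h1 : ContMDiffOn ((𝓡 d).prod (𝓡 n)) 𝓘(ℝ, ℝ) ∞
      (Function.uncurry fun (g : G) y ↦ φ (g • e.symm y)) (Set.univ ×ˢ U) := by
    have h2 : ContMDiffOn ((𝓡 d).prod (𝓡 n)) ((𝓡 d).prod (𝓡 n)) ∞
        (fun q : G × EuclideanSpace ℝ (Fin n) ↦ (q.1, e.symm q.2)) (Set.univ ×ˢ U) :=
      contMDiffOn_fst.prodMk ((contMDiffOn_chart_symm (I := 𝓡 n) (x := m₀)).comp contMDiffOn_snd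
        fun q hq ↦ hq.2.1)
    exact hφ.comp_contMDiffOn (hsm.comp_contMDiffOn h2)
  have h2 : ∀ y ∈ U, ∀ g ∉ C, φ (g • e.symm y) = 0 := fun y hy g hg ↦ by
    by_contra h
    exact hg ⟨(g, e.symm y), ⟨interior_subset hy.2, subset_tsupport _ h⟩, rfl⟩
  have h3 : ContDiffOn ℝ ∞ (fun y ↦ average haar φ (e.symm y)) U :=
    contDiffOn_infty.2 fun k ↦ contDiffOn_integral_of_compact hU hC k h1 h2
  have hm : e m₀ ∈ U := ⟨mem_chart_target _ m₀, by
    change e.symm (e m₀) ∈ interior K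
    rw [e.left_inv (mem_chart_source _ m₀)]
    exact mem_interior_iff_mem_nhds.2 hK⟩
  have h4 : ContMDiffAt (𝓡 n) (𝓡 n) ∞ e m₀ :=
    contMDiffOn_chart.contMDiffAt (e.open_source.mem_nhds (mem_chart_source _ m₀))
  have h5 := ((h3.contDiffAt (hU.mem_nhds hm)).contMDiffAt).comp m₀ h4
  refine h5.congr_of_eventuallyEq ?_
  filter_upwards [e.open_source.mem_nhds (mem_chart_source _ m₀)] with x hx
  simp only [Function.comp_apply, e.left_inv hx]

theorem exists_bump_compact {K W : Set M} (hK : IsCompact K) (hW : IsOpen W) (hKW : K ⊆ W) :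
    ∃ φ : M → ℝ, ContMDiff (𝓡 n) 𝓘(ℝ, ℝ) ∞ φ ∧ HasCompactSupport φ ∧ (∀ x, 0 ≤ φ x) ∧
      (∀ x ∈ K, 0 < φ x) ∧ ∀ x ∉ W, φ x = 0 := by
  choose! ρ h1 h2 h3 h4 h5 h6 using fun (m : M) (hm : m ∈ K) ↦
    exists_cutoff (n := n) (hW.mem_nhds (hKW hm))
  obtain ⟨t, htK⟩ := hK.elim_nhds_subcover' (fun m _ ↦ {x | ρ m x = 1}) fun m hm ↦ h4 m hm
  refine ⟨fun x ↦ ∑ m ∈ t, ρ m x, contMDiff_finsetSum fun m _ ↦ h1 m m.2, ?_,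
    fun x ↦ Finset.sum_nonneg fun m _ ↦ h5 m m.2 x, fun x hx ↦ ?_, fun x hx ↦ ?_⟩
  · refine HasCompactSupport.intro (t.isCompact_biUnion fun m _ ↦ h2 m m.2) fun x hx ↦ ?_
    refine Finset.sum_eq_zero fun m hm ↦ ?_
    by_contra h
    exact hx (Set.mem_iUnion₂.2 ⟨m, hm, subset_tsupport _ h⟩)
  · obtain ⟨m, hm, hmx⟩ := Set.mem_iUnion₂.1 (htK hx)
    refine Finset.sum_pos' (fun m _ ↦ h5 m m.2 x) ⟨m, hm, ?_⟩
    rw [show ρ m x = 1 from hmx]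
    exact one_pos
  · refine Finset.sum_eq_zero fun m _ ↦ ?_
    by_contra h
    exact hx (h3 m m.2 (subset_tsupport _ h))

end Average

/-! ## Invariant functions, cutoff functions and invariant vector fields -/

/-- The inverted measure is left invariant, hence equals `c μ`. Inverting twice gives `c² = 1`, by
comparison on a compact set of finite positive measure. -/
theorem isInvInvariant_of_isMulRightInvariant {G : Type*} [Group G] [TopologicalSpace G]
    [IsTopologicalGroup G] [LocallyCompactSpace G] [SecondCountableTopology G] [MeasurableSpace G]
    [BorelSpace G] (μ : Measure G) [μ.IsHaarMeasure] [μ.IsMulRightInvariant] :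
    μ.IsInvInvariant := by
  constructor
  let c : ENNReal := (Measure.haarScalarFactor μ.inv μ : NNReal)
  have hc : μ.inv = c • μ := Measure.isMulLeftInvariant_eq_smul μ.inv μ
  have h1 : Measure.map Inv.inv (Measure.map Inv.inv μ) = c ^ 2 • μ := by
    rw [← Measure.inv_def μ, hc, Measure.map_smul, ← Measure.inv_def μ, hc, smul_smul, pow_two]
  have h2 : μ = c ^ 2 • μ := by
    rw [Measure.map_map continuous_inv.measurable continuous_inv.measurable] at h1
    have h0 : (Inv.inv ∘ Inv.inv : G → G) = id := inv_involutive.comp_self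
    rw [h0, Measure.map_id] at h1
    exact h1
  have K : TopologicalSpace.PositiveCompacts G := Classical.arbitrary _
  have h3 : c ^ 2 * μ K = 1 ^ 2 * μ K := by
    conv_rhs => rw [h2]
    simp
  have h4 : c ^ 2 = 1 ^ 2 :=
    (ENNReal.mul_left_inj
      (Measure.measure_pos_of_nonempty_interior _ K.interior_nonempty).ne'
      K.isCompact.measure_lt_top.ne).1 h3
  rw [hc, (ENNReal.pow_right_strictMono two_ne_zero).injective h4, one_smul]

section Invariant

variable {n d : ℕ}
  {G : Type*} [TopologicalSpace G] [Group G] [IsTopologicalGroup G] [T2Space G]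
  [LocallyCompactSpace G]
  [SecondCountableTopology G] [MeasurableSpace G] [BorelSpace G]
  (haar : Measure G) [haar.IsHaarMeasure] [haar.IsMulRightInvariant]
  {M : Type*} [TopologicalSpace M] [T2Space M] [LocallyCompactSpace M]
  [MulAction G M] [ProperSMul G M]
  [ChartedSpace (EuclideanSpace ℝ (Fin n)) M] [IsManifold (𝓡 n) ∞ M]

/-- A bump function supported in `U` and positive on a compact set meeting every orbit in `U'` is
averaged. The average vanishes off `U` and is at least some `c > 0` on `U'`, so `1 -
smoothTransition (average / c)` has the required values. -/
theorem exists_invariant_function (haar : Measure G) [haar.IsHaarMeasure]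
    [haar.IsMulRightInvariant] [ChartedSpace (EuclideanSpace ℝ (Fin d)) G] [IsManifold (𝓡 d) ∞ G]
    (hsm : ContMDiff ((𝓡 d).prod (𝓡 n)) (𝓡 n) ∞ fun q : G × M ↦ q.1 • q.2) {U U' : Set M}
    (hU : IsOpen U) (hUi : IsInvariantSet G U) (hUc : IsCocompact G (closure U))
    (hU'i : IsInvariantSet G U') (hU' : closure U' ⊆ U) :
    ∃ η : M → ℝ, ContMDiff (𝓡 n) 𝓘(ℝ, ℝ) ∞ η ∧ (∀ (g : G) m, η (g • m) = η m) ∧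
      (∀ m ∉ U, η m = 1) ∧ ∀ m ∈ U', η m = 0 := by
  obtain ⟨K, hK, hKU⟩ := hUc.exists_isCompact
  have hK' : IsCompact (K ∩ closure U') := hK.inter_right isClosed_closure
  obtain ⟨φ, hφ, hφc, hφ0, hφK, hφU⟩ := exists_bump_compact (n := n) hK' hU fun x hx ↦ hU' hx.2
  have hA := contMDiff_average (haar := haar) hsm hφ hφc
  obtain ⟨c, hc, hcK⟩ := hK'.exists_forall_le' hA.continuous.continuousOn (a := 0)
    fun x hx ↦ average_pos hφ.continuous hφc hφ0 (hφK x hx)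
  refine ⟨fun m ↦ 1 - Real.smoothTransition (average haar φ m / c), ?_,
    fun g m ↦ by simp only [average_smul], fun m hm ↦ ?_, fun m hm ↦ ?_⟩
  · exact contMDiff_const.sub
      (Real.smoothTransition.contDiff.contMDiff.comp (hA.div_const c))
  · have : average haar φ m = 0 := by
      refine integral_eq_zero_of_ae (Filter.Eventually.of_forall fun g ↦ hφU _ fun h ↦ hm ?_)
      simpa using hUi g⁻¹ _ h
    simp [this]
  · obtain ⟨g, hg⟩ := hKU m (subset_closure (hU' (subset_closure hm)))
    have h1 := hcK (g • m) ⟨hg, subset_closure (hU'i g m hm)⟩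
    rw [average_smul] at h1
    simp only [Real.smoothTransition.one_of_one_le ((one_le_div hc).2 h1), sub_self]

/-- The given `χ` is only assumed to have support compact along each orbit. This supplies a
compactly supported weight, normalised only over the cocompact set of interest, so that every
integral against it converges. -/
theorem exists_compact_cutoff (haar : Measure G) [haar.IsHaarMeasure]
    [haar.IsMulRightInvariant] [ChartedSpace (EuclideanSpace ℝ (Fin d)) G] [IsManifold (𝓡 d) ∞ G]
    (hsm : ContMDiff ((𝓡 d).prod (𝓡 n)) (𝓡 n) ∞ fun q : G × M ↦ q.1 • q.2) {Y : Set M}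
    (hY : IsCocompact G Y) :
    ∃ κ : M → ℝ, ContMDiff (𝓡 n) 𝓘(ℝ, ℝ) ∞ κ ∧ HasCompactSupport κ ∧ (∀ x, 0 ≤ κ x) ∧
      ∀ m ∈ Y, average haar κ m = 1 := by
  obtain ⟨K, hK, hKY⟩ := hY.exists_isCompact
  obtain ⟨φ, hφ, hφc, hφ0, hφK, -⟩ :=
    exists_bump_compact (n := n) hK isOpen_univ (Set.subset_univ _)
  have hA := contMDiff_average (haar := haar) hsm hφ hφc
  have hA0 : ∀ m, 0 ≤ average haar φ m := average_nonneg hφ0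
  obtain ⟨c, hc, hcK⟩ := hK.exists_forall_le' hA.continuous.continuousOn (a := 0)
    fun x hx ↦ average_pos hφ.continuous hφc hφ0 (hφK x hx)
  -- The denominator must be positive everywhere, yet equal to the average of `φ` over `Y`. The
  -- added term is positive where the average is zero and vanishes where the average is at least
  -- `c`.
  let q : M → ℝ := fun m ↦
    average haar φ m + c * (1 - Real.smoothTransition (average haar φ m / c))
  have hq : ContMDiff (𝓡 n) 𝓘(ℝ, ℝ) ∞ q := hA.add (contMDiff_const.mul (contMDiff_const.sub
    (Real.smoothTransition.contDiff.contMDiff.comp (hA.div_const c))))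
  have hq0 : ∀ m, 0 < q m := fun m ↦ by
    have h1 : 0 ≤ c * (1 - Real.smoothTransition (average haar φ m / c)) :=
      mul_nonneg hc.le (sub_nonneg.2 (Real.smoothTransition.le_one _))
    rcases (hA0 m).lt_or_eq with h | h
    · exact add_pos_of_pos_of_nonneg h h1
    · simp only [q, ← h, zero_div, Real.smoothTransition.zero]
      linarith
  have hqi : ∀ (g : G) m, q (g • m) = q m := fun g m ↦ by simp only [q, average_smul]
  refine ⟨fun m ↦ φ m * (q m)⁻¹, hφ.mul (hq.inv₀ fun m ↦ (hq0 m).ne'), hφc.mul_right,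
    fun m ↦ mul_nonneg (hφ0 m) (inv_nonneg.2 (hq0 m).le), fun m hm ↦ ?_⟩
  obtain ⟨g, hg⟩ := hKY m hm
  have h1 := hcK (g • m) hg
  rw [average_smul] at h1
  have h2 : q m = average haar φ m := by
    simp only [q, Real.smoothTransition.one_of_one_le ((one_le_div hc).2 h1), sub_self, mul_zero,
      add_zero]
  simp only [average, hqi, integral_mul_const]
  rw [h2]
  exact mul_inv_cancel₀ (hc.trans_le h1).ne'

end Invariant

/-! ### Independence of weighted integrals from the cutoff function -/

section Fubini

variable {G : Type*} [TopologicalSpace G] [Group G] [IsTopologicalGroup G] [T2Space G]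
  [LocallyCompactSpace G]
  [SecondCountableTopology G] [MeasurableSpace G] [BorelSpace G]
  {haar : Measure G} [haar.IsHaarMeasure] [haar.IsInvInvariant]
  {M : Type*} [TopologicalSpace M] [T2Space M] [LocallyCompactSpace M] [SecondCountableTopology M]
  [MeasurableSpace M] [BorelSpace M] [MulAction G M] [ProperSMul G M]
  {ν : Measure M} [SFinite ν]

/-- Insert `1 = ∫ ψ(gm) dg`, exchange the integrals, translate `m` using invariance of `ν` and `F`,
and invert `g`. The roles of `φ` and `ψ` are then exchanged. Normalisation is needed only where `F`
does not vanish. -/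
theorem lintegral_mul_eq_of_average_eq_one (hν : ∀ g : G, MeasurePreserving (g • · : M → M) ν ν)
    {φ ψ F : M → ENNReal} (hφ : Measurable φ) (hψ : Measurable ψ) (hF : Measurable F)
    (hFi : ∀ (g : G) m, F (g • m) = F m) (h1 : ∀ m, F m ≠ 0 → ∫⁻ g, φ (g • m) ∂haar = 1)
    (h2 : ∀ m, F m ≠ 0 → ∫⁻ g, ψ (g • m) ∂haar = 1) :
    ∫⁻ m, φ m * F m ∂ν = ∫⁻ m, ψ m * F m ∂ν := by
  have hsm : Measurable fun q : G × M ↦ q.1 • q.2 := continuous_smul.measurable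
  have hsm' : ∀ m : M, Measurable fun g : G ↦ g • m := fun m ↦
    (continuous_id.smul continuous_const).measurable
  calc ∫⁻ m, φ m * F m ∂ν = ∫⁻ m, ∫⁻ g, φ m * F m * ψ (g • m) ∂haar ∂ν := by
        refine lintegral_congr fun m ↦ ?_
        rw [lintegral_const_mul _ (show Measurable fun g : G ↦ ψ (g • m) from hψ.comp (hsm' m))]
        by_cases h : F m = 0
        · simp [h]
        · rw [h2 m h, mul_one]
    _ = ∫⁻ g, ∫⁻ m, φ m * F m * ψ (g • m) ∂ν ∂haar := by
        refine lintegral_lintegral_swap (Measurable.aemeasurable ?_)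
        exact ((hφ.mul hF).comp measurable_fst).mul (hψ.comp (hsm.comp measurable_swap))
    _ = ∫⁻ g, ∫⁻ m, φ (g⁻¹ • m) * F m * ψ m ∂ν ∂haar := by
        refine lintegral_congr fun g ↦ ?_
        have hm : Measurable fun m ↦ φ (g⁻¹ • m) * F m * ψ m :=
          ((hφ.comp (measurable_const_smul _)).mul hF).mul hψ
        rw [← (hν g).lintegral_comp hm]
        simp only [inv_smul_smul, hFi]
    _ = ∫⁻ g, ∫⁻ m, φ (g • m) * F m * ψ m ∂ν ∂haar :=
        lintegral_inv_eq_self fun g ↦ ∫⁻ m, φ (g • m) * F m * ψ m ∂ν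
    _ = ∫⁻ m, ∫⁻ g, φ (g • m) * F m * ψ m ∂haar ∂ν := by
        refine lintegral_lintegral_swap (Measurable.aemeasurable ?_)
        exact ((hφ.comp hsm).mul (hF.comp measurable_snd)).mul (hψ.comp measurable_snd)
    _ = ∫⁻ m, ψ m * F m ∂ν := by
        refine lintegral_congr fun m ↦ ?_
        simp only [mul_assoc]
        rw [lintegral_mul_const _ (show Measurable fun g : G ↦ φ (g • m) from hφ.comp (hsm' m))]
        by_cases h : F m = 0
        · simp [h]
        · rw [h1 m h, one_mul, mul_comm]

theorem lintegral_ofReal_eq_one {φ : G → ℝ} (h0 : ∀ g, 0 ≤ φ g) (h : ∫ g, φ g ∂haar = 1) :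
    ∫⁻ g, ENNReal.ofReal (φ g) ∂haar = 1 := by
  have hi : Integrable φ haar := by
    by_contra hi
    rw [integral_undef hi] at h
    exact zero_ne_one h
  rw [← ofReal_integral_eq_lintegral_ofReal hi (Filter.Eventually.of_forall h0), h,
    ENNReal.ofReal_one]

/-- Stated for nonnegative functions and proved with lower integrals, so that no integrability is
required; for the weight `χ²` it is not known beforehand. -/
theorem integral_mul_eq_of_average_eq_one
    (hν : ∀ g : G, MeasurePreserving (g • · : M → M) ν ν)
    {φ ψ F : M → ℝ} (hφ : Continuous φ) (hψ : Continuous ψ) (hF : Continuous F)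
    (hφ0 : ∀ m, 0 ≤ φ m) (hψ0 : ∀ m, 0 ≤ ψ m) (hF0 : ∀ m, 0 ≤ F m)
    (hFi : ∀ (g : G) m, F (g • m) = F m) (h1 : ∀ m, F m ≠ 0 → ∫ g, φ (g • m) ∂haar = 1)
    (h2 : ∀ m, F m ≠ 0 → ∫ g, ψ (g • m) ∂haar = 1) :
    ∫ m, φ m * F m ∂ν = ∫ m, ψ m * F m ∂ν := by
  have hne : ∀ m, ENNReal.ofReal (F m) ≠ 0 → F m ≠ 0 := fun m hm h ↦ hm (by simp [h])
  have h := lintegral_mul_eq_of_average_eq_one (haar := haar) hν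
    (φ := fun m ↦ ENNReal.ofReal (φ m)) (ψ := fun m ↦ ENNReal.ofReal (ψ m))
    (F := fun m ↦ ENNReal.ofReal (F m)) hφ.measurable.ennreal_ofReal hψ.measurable.ennreal_ofReal
    hF.measurable.ennreal_ofReal (fun g m ↦ by simp only [hFi])
    (fun m hm ↦ lintegral_ofReal_eq_one (fun g ↦ hφ0 _) (h1 m (hne m hm)))
    (fun m hm ↦ lintegral_ofReal_eq_one (fun g ↦ hψ0 _) (h2 m (hne m hm)))
  simp only [← ENNReal.ofReal_mul (hφ0 _), ← ENNReal.ofReal_mul (hψ0 _)] at h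
  rw [integral_eq_lintegral_of_nonneg_ae
    (Filter.Eventually.of_forall fun m ↦ mul_nonneg (hφ0 m) (hF0 m))
    (hφ.mul hF).aestronglyMeasurable,
    integral_eq_lintegral_of_nonneg_ae
    (Filter.Eventually.of_forall fun m ↦ mul_nonneg (hψ0 m) (hF0 m))
    (hψ.mul hF).aestronglyMeasurable, h]

variable [IsFiniteMeasureOnCompacts ν]

theorem integrable_mul_smul_prod {θ κ : M → ℝ} (hθ : Continuous θ) (hθc : HasCompactSupport θ)
    (hκ : Continuous κ) (hκc : HasCompactSupport κ) :
    Integrable (fun q : G × M ↦ θ q.2 * κ (q.1 • q.2)) (haar.prod ν) := by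
  refine Continuous.integrable_of_hasCompactSupport ?_ ?_
  · exact (hθ.comp continuous_snd).mul (hκ.comp continuous_smul)
  · refine HasCompactSupport.intro (isCompact_transporter G hθc hκc) fun q hq ↦ ?_
    by_contra h
    exact hq ⟨subset_tsupport _ (left_ne_zero_of_mul h), subset_tsupport _ (right_ne_zero_of_mul h)⟩

theorem integrable_integral_mul_smul {θ κ : M → ℝ} (hθ : Continuous θ)
    (hθc : HasCompactSupport θ) (hκ : Continuous κ) (hκc : HasCompactSupport κ) :
    Integrable (fun g : G ↦ ∫ m, θ m * κ (g • m) ∂ν) haar :=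
  (integrable_mul_smul_prod hθ hθc hκ hκc).integral_prod_left

theorem integral_integral_mul_smul {θ κ : M → ℝ} (hθ : Continuous θ)
    (hθc : HasCompactSupport θ) (hκ : Continuous κ) (hκc : HasCompactSupport κ)
    (h : ∀ m, θ m ≠ 0 → average haar κ m = 1) :
    ∫ g, ∫ m, θ m * κ (g • m) ∂ν ∂haar = ∫ m, θ m ∂ν := by
  rw [integral_integral_swap (f := fun (g : G) m ↦ θ m * κ (g • m))
    (integrable_mul_smul_prod hθ hθc hκ hκc)]
  refine integral_congr_ae (Filter.Eventually.of_forall fun m ↦ ?_)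
  simp only [integral_const_mul]
  by_cases hm : θ m = 0
  · simp [hm]
  · have := h m hm
    rw [average] at this
    rw [this, mul_one]

end Fubini

/-! ### The divergence theorem for invariant vector fields, weighted by a cutoff -/

section InvariantField

variable {n : ℕ}
  {G : Type*} [TopologicalSpace G] [Group G] [IsTopologicalGroup G] [T2Space G]
  [LocallyCompactSpace G]
  [SecondCountableTopology G] [MeasurableSpace G] [BorelSpace G]
  {haar : Measure G} [haar.IsHaarMeasure] [haar.IsInvInvariant]
  {M : Type*} [TopologicalSpace M] [T2Space M] [LocallyCompactSpace M] [SecondCountableTopology M]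
  [SigmaCompactSpace M]
  [MeasurableSpace M] [BorelSpace M] [MulAction G M] [ProperSMul G M]
  [ChartedSpace (EuclideanSpace ℝ (Fin n)) M] [IsManifold (𝓡 n) ∞ M]
  [RiemannianBundle (fun x : M ↦ TangentSpace (𝓡 n) x)]
  [IsContMDiffRiemannianBundle (𝓡 n) ∞ (EuclideanSpace ℝ (Fin n))
      (fun x : M ↦ TangentSpace (𝓡 n) x)]
  {DT : CovariantDerivative (𝓡 n) (EuclideanSpace ℝ (Fin n))
      (fun x : M ↦ TangentSpace (𝓡 n) x)}

theorem measurePreserving_smul_riemannianMeasure (hG : IsIsometricAction (n := n) G M)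
    (hg : ∀ g : G, ContMDiff (𝓡 n) (𝓡 n) ∞ fun x : M ↦ g • x) (g : G) :
    MeasurePreserving (g • · : M → M) (riemannianMeasure n M) (riemannianMeasure n M) := by
  refine ⟨(hg g).continuous.measurable, ?_⟩
  ext A hA
  rw [Measure.map_apply (hg g).continuous.measurable hA]
  have h := lintegral_riemannianMeasure_comp (hg g) (hg g⁻¹).continuous (smul_inv_smul g)
    (inv_smul_smul g) (fun x v w ↦ hG.inner_pushforward g x v w) (F := A.indicator 1)
    (measurable_one.indicator hA)
  have h2 : (fun x : M ↦ A.indicator (1 : M → ENNReal) (g • x)) =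
      ((g • · : M → M) ⁻¹' A).indicator 1 := by
    funext x
    by_cases hx : g • x ∈ A
    · rw [Set.indicator_of_mem hx, Set.indicator_of_mem (show x ∈ (g • · : M → M) ⁻¹' A from hx)]
      rfl
    · rw [Set.indicator_of_notMem hx,
        Set.indicator_of_notMem (show x ∉ (g • · : M → M) ⁻¹' A from hx)]
  rw [lintegral_indicator_one hA, h2,
    lintegral_indicator_one ((hg g).continuous.measurable hA)] at h
  exact h

/-- The integral, against a cutoff function, of the divergence of an invariant vector field
vanishes. -/
theorem integral_mul_divergence_eq_zero (hG : IsIsometricAction (n := n) G M)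
    (hg : ∀ g : G, ContMDiff (𝓡 n) (𝓡 n) ∞ fun x : M ↦ g • x) (hDT : IsLeviCivita DT)
    {u : ∀ m : M, TangentSpace (𝓡 n) m} (hu : IsSmoothField u)
    (hui : ∀ (g : G) m, u (g • m) = pushforward g m (u m)) {κ : M → ℝ}
    (hκ : ContMDiff (𝓡 n) 𝓘(ℝ, ℝ) ∞ κ) (hκc : HasCompactSupport κ)
    (h1 : ∀ m ∈ closure {x | u x ≠ 0}, average haar κ m = 1) :
    ∫ m, κ m * divergence DT u m ∂(riemannianMeasure n M) = 0 := by
  have hν := measurePreserving_smul_riemannianMeasure (n := n) hG hg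
  set ν := riemannianMeasure n M with hνdef
  let v : M → ℝ := fun m ↦ mvfderiv (𝓡 n) κ m (u m)
  let θ : M → ℝ := fun m ↦ κ m * divergence DT u m
  have hdivc := (contMDiff_divergence hDT hu).continuous
  have hv : Continuous v := by
    have h2 : ∀ m, v m = divergence DT (fun x ↦ κ x • u x) m - κ m * divergence DT u m :=
      fun m ↦ by rw [divergence_smul hu hκ]; simp only [v]; ring
    rw [show v = _ from funext h2]
    exact (contMDiff_divergence hDT (hu.smul hκ)).continuous.sub (hκ.continuous.mul hdivc)
  have hκ0 : ∀ m ∉ tsupport κ, mvfderiv (𝓡 n) κ m = 0 := fun m hm ↦ by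
    have h2 : κ =ᶠ[𝓝 m] fun _ ↦ (0 : ℝ) := by
      filter_upwards [(isClosed_tsupport κ).isOpen_compl.mem_nhds hm] with x hx
      exact image_eq_zero_of_notMem_tsupport hx
    have h3 : mvfderiv (𝓡 n) κ m = mvfderiv (𝓡 n) (fun _ : M ↦ (0 : ℝ)) m := by
      ext w
      exact congrArg (fun T : EuclideanSpace ℝ (Fin n) →L[ℝ] ℝ ↦ T w) h2.mfderiv_eq
    rw [h3, mvfderiv_const]
  have hvc : HasCompactSupport v := HasCompactSupport.intro hκc fun m hm ↦ by
    simp only [v, hκ0 m hm]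
    rfl
  have hθ : Continuous θ := hκ.continuous.mul hdivc
  have hθc : HasCompactSupport θ := hκc.mul_right
  have hθ1 : ∀ m, θ m ≠ 0 → average haar κ m = 1 := fun m hm ↦ h1 m (by
    by_contra h
    exact right_ne_zero_of_mul hm (divergence_eq_zero_of_notMem_tsupport hu h))
  have hv1 : ∀ m, v m ≠ 0 → average haar κ m = 1 := fun m hm ↦ h1 m (by
    by_contra h
    refine hm ?_
    simp only [v, field_eq_zero_of_notMem h]
    exact map_zero _)
  have hsupp : ∀ (ψ : M → ℝ), HasCompactSupport ψ →
      IsCompact (closure {x | ψ x • u x ≠ 0}) := fun ψ hψ ↦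
    IsCompact.of_isClosed_subset hψ isClosed_closure (closure_mono fun x hx h ↦
      hx (by rw [show ψ x = 0 from h, zero_smul]))
  -- The divergence theorem for `κu`, where `θ = κ div u` and `v = dκ(u)`. It remains to separate
  -- the two integrals.
  have e1 : ∫ m, θ m ∂ν + ∫ m, v m ∂ν = 0 := by
    rw [← integral_add (hθ.integrable_of_hasCompactSupport hθc)
      (hv.integrable_of_hasCompactSupport hvc),
      ← integral_divergence_eq_zero hDT (hu.smul hκ) (hsupp κ hκc)]
    refine integral_congr_ae (Filter.Eventually.of_forall fun m ↦ ?_)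
    exact (divergence_smul hu hκ m).symm
  have hdv : ∀ (g : G) m, mvfderiv (𝓡 n) (fun x ↦ κ (g • x)) m (u m) = v (g • m) := fun g m ↦ by
    rw [mvfderiv_smul_left hκ (hg g) m (u m)]
    simp only [v, hui]
  -- The divergence theorem for `κ κ(g·) u`. By invariance of `u` and of the measure, the term in
  -- which `κ(g·)` is differentiated becomes an integral of `v` against `κ(g⁻¹·)`.
  have e2 : ∀ g : G, (∫ m, θ m * κ (g • m) ∂ν + ∫ m, v m * κ (g • m) ∂ν) +
      ∫ m, v m * κ (g⁻¹ • m) ∂ν = 0 := fun g ↦ by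
    have hκg : ContMDiff (𝓡 n) 𝓘(ℝ, ℝ) ∞ fun x : M ↦ κ (g • x) := hκ.comp (hg g)
    have hc1 : ∀ k : G, Continuous fun m : M ↦ κ (k • m) := fun k ↦ (hκ.comp (hg k)).continuous
    have h4 : ∫ m, v m * κ (g⁻¹ • m) ∂ν = ∫ m, κ m * v (g • m) ∂ν := by
      rw [← (hν g).integral_comp (Homeomorph.smul g).measurableEmbedding]
      simp only [inv_smul_smul, mul_comm]
    have a1 : Integrable (fun m ↦ θ m * κ (g • m)) ν :=
      (hθ.mul (hc1 g)).integrable_of_hasCompactSupport hθc.mul_right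
    have a2 : Integrable (fun m ↦ v m * κ (g • m)) ν :=
      (hv.mul (hc1 g)).integrable_of_hasCompactSupport hvc.mul_right
    have a3 : Integrable (fun m ↦ κ m * v (g • m)) ν :=
      (hκ.continuous.mul (hv.comp (hg g).continuous)).integrable_of_hasCompactSupport hκc.mul_right
    have a12 : Integrable (fun m ↦ θ m * κ (g • m) + v m * κ (g • m)) ν := a1.add a2
    rw [h4, ← integral_add a1 a2, ← integral_add a12 a3,
      ← integral_divergence_eq_zero hDT (hu.smul (hκ.mul hκg))
        (hsupp (fun x ↦ κ x * κ (g • x)) hκc.mul_right)]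
    refine integral_congr_ae (Filter.Eventually.of_forall fun m ↦ ?_)
    have h5 := divergence_smul (DT := DT) hu (hκ.mul hκg) m
    refine Eq.trans ?_ h5.symm
    have h6 : mvfderiv (𝓡 n) (fun x ↦ κ x * κ (g • x)) m (u m) =
        κ m * v (g • m) + κ (g • m) * v m := by
      rw [mvfderiv_fun_mul ((hκ m).mdifferentiableAt (by simp))
        ((hκg m).mdifferentiableAt (by simp))]
      simp only [add_apply, smul_apply, smul_eq_mul, hdv]
      rfl
    refine Eq.trans ?_ (congrArg (fun r ↦ κ m * κ (g • m) * divergence DT u m + r) h6.symm)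
    simp only [θ]
    ring
  have i1 : Integrable (fun g : G ↦ ∫ m, θ m * κ (g • m) ∂ν) haar :=
    integrable_integral_mul_smul hθ hθc hκ.continuous hκc
  have i2 : Integrable (fun g : G ↦ ∫ m, v m * κ (g • m) ∂ν) haar :=
    integrable_integral_mul_smul hv hvc hκ.continuous hκc
  -- Integrating over `G`, with `κ` of average one on the support of `u` and Haar measure invariant
  -- under inversion, gives `∫θ + 2∫v = 0`. Together with `e1` this forces `∫θ = 0`, without
  -- differentiating an average over `G`.
  have e3 : ∫ g : G, ((∫ m, θ m * κ (g • m) ∂ν + ∫ m, v m * κ (g • m) ∂ν) +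
      ∫ m, v m * κ (g⁻¹ • m) ∂ν) ∂haar = 0 := by simp only [e2, integral_zero]
  have i12 : Integrable (fun g : G ↦ ∫ m, θ m * κ (g • m) ∂ν + ∫ m, v m * κ (g • m) ∂ν) haar :=
    i1.add i2
  rw [integral_add i12 i2.comp_inv, integral_add i1 i2,
    integral_inv_eq_self (fun g : G ↦ ∫ m, v m * κ (g • m) ∂ν) haar,
    integral_integral_mul_smul hθ hθc hκ.continuous hκc hθ1,
    integral_integral_mul_smul hv hvc hκ.continuous hκc hv1] at e3
  change ∫ m, θ m ∂ν = 0
  linarith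

end InvariantField

/-! ## Bounds for endomorphisms over compact sets -/

section EndBound

variable {n d : ℕ}
  {G : Type*} [TopologicalSpace G] [Group G] [ChartedSpace (EuclideanSpace ℝ (Fin d)) G]
  {M : Type*} [TopologicalSpace M] [ChartedSpace (EuclideanSpace ℝ (Fin n)) M] [MulAction G M]
  [IsManifold (𝓡 n) ∞ M] [T2Space M]
  {F : Type*} [NormedAddCommGroup F] [NormedSpace ℂ F]
  {V : M → Type*} [TopologicalSpace (TotalSpace F V)]
  [∀ m, NormedAddCommGroup (V m)] [∀ m, InnerProductSpace ℂ (V m)]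
  [FiberBundle F V] [VectorBundle ℝ F V] [ContMDiffVectorBundle ∞ F V (𝓡 n)]

/-- In a frame, `‖w‖²` and `Re⟨w, Tw⟩` are continuous quadratic forms in the coefficients of `w`.
Their quotient is bounded on the compact unit sphere of coefficients over `m₀`, and by compactness
the bound, slightly enlarged, persists for nearby `m`. -/
theorem IsSmoothEnd.eventually_abs_inner_le [FiniteDimensional ℝ F]
    (aV : EquivariantStructure (n := n) d G F V) {T : ∀ m, V m →ₗ[ℂ] V m}
    (hT : IsSmoothEnd (n := n) F T) (m₀ : M) :
    ∃ C : ℝ, 0 ≤ C ∧ ∀ᶠ m in 𝓝 m₀, ∀ w : V m, |(inner ℂ w (T m w) : ℂ).re| ≤ C * ‖w‖ ^ 2 := by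
  obtain ⟨r, s, a, N, hN, hm, hs, ha, hli, -⟩ := exists_frame (n := n) (F := F) (V := V) m₀
  let w : (Fin r → ℝ) → ∀ m, V m := fun c m ↦ ∑ i, c i • s i m
  let q : (Fin r → ℝ) × M → ℝ := fun y ↦ ‖w y.1 y.2‖ ^ 2
  let e : (Fin r → ℝ) × M → ℝ := fun y ↦ (inner ℂ (w y.1 y.2) (T y.2 (w y.1 y.2)) : ℂ).re
  have hq : Continuous q := by
    have h : q = fun y ↦ ∑ i, ∑ j, y.1 i * y.1 j * (inner ℂ (s i y.2) (s j y.2) : ℂ).re := by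
      funext y
      have h0 := inner_self_eq_norm_sq (𝕜 := ℂ) (w y.1 y.2)
      simp only [q, ← h0]
      simp only [w, sum_inner, inner_sum, ← Complex.coe_smul, inner_smul_left,
        inner_smul_right, Complex.conj_ofReal, RCLike.re_eq_complex_re, Complex.re_sum,
        Complex.re_ofReal_mul, mul_assoc, Finset.mul_sum]
      rw [Finset.sum_comm]
      exact Finset.sum_congr rfl fun i _ ↦ Finset.sum_congr rfl fun j _ ↦ by
        ring_nf
    rw [h]
    refine continuous_finsetSum _ fun i _ ↦ continuous_finsetSum _ fun j _ ↦ ?_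
    have := (aV.metric_smooth _ _ (hs i) (hs j)).continuous
    exact ((by fun_prop : Continuous fun y : (Fin r → ℝ) × M ↦ y.1 i * y.1 j)).mul
      (Complex.continuous_re.comp (this.comp continuous_snd))
  have he : Continuous e := by
    have h : e = fun y ↦ ∑ i, ∑ j, y.1 i * y.1 j *
        (inner ℂ (s i y.2) (T y.2 (s j y.2)) : ℂ).re := by
      funext y
      simp only [e, w, map_sum, sum_inner, inner_sum, ← Complex.coe_smul, map_smul,
        inner_smul_left, inner_smul_right, Complex.conj_ofReal, Complex.re_sum,
        Complex.re_ofReal_mul, mul_assoc, Finset.mul_sum]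
      rw [Finset.sum_comm]
      exact Finset.sum_congr rfl fun i _ ↦ Finset.sum_congr rfl fun j _ ↦ by
        ring_nf
    rw [h]
    refine continuous_finsetSum _ fun i _ ↦ continuous_finsetSum _ fun j _ ↦ ?_
    have := (aV.metric_smooth _ _ (hs i) (hT _ (hs j))).continuous
    exact ((by fun_prop : Continuous fun y : (Fin r → ℝ) × M ↦ y.1 i * y.1 j)).mul
      (Complex.continuous_re.comp (this.comp continuous_snd))
  have hsc : ∀ (m : M) (ρ : ℝ) c, q (ρ • c, m) = ρ ^ 2 * q (c, m) ∧
      e (ρ • c, m) = ρ ^ 2 * e (c, m) := fun m ρ c ↦ by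
    have h : w (ρ • c) m = (ρ : ℂ) • w c m := by
      simp only [w, Pi.smul_apply, smul_eq_mul, Complex.coe_smul, Finset.smul_sum, mul_smul]
    constructor
    · simp only [q, h, norm_smul, mul_pow, Complex.norm_real, Real.norm_eq_abs, sq_abs]
    · simp only [e, h, map_smul, inner_smul_left, inner_smul_right, Complex.conj_ofReal,
        Complex.re_ofReal_mul]
      ring
  have hpos : ∀ c ∈ Metric.sphere (0 : Fin r → ℝ) 1, 0 < q (c, m₀) := fun c hc ↦ by
    have h0 : w c m₀ ≠ 0 := fun h ↦ by
      have h1 := Fintype.linearIndependent_iff.1 (hli m₀ hm) c h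
      have : c = 0 := funext h1
      simp [this] at hc
    exact pow_pos (norm_pos_iff.2 h0) 2
  have hK := isCompact_sphere (0 : Fin r → ℝ) 1
  obtain ⟨C, hC⟩ := hK.bddAbove_image (f := fun c ↦ |e (c, m₀)| / q (c, m₀)) <| by
    refine ContinuousOn.div ?_ ?_ fun c hc ↦ (hpos c hc).ne'
    · exact (he.abs.comp (by fun_prop : Continuous fun c : Fin r → ℝ ↦ (c, m₀))).continuousOn
    · exact (hq.comp (by fun_prop : Continuous fun c : Fin r → ℝ ↦ (c, m₀))).continuousOn
  -- Replacing `C` by `|C| + 1` makes the inequality strict over `m₀`, hence an open condition;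
  -- compactness of the sphere gives one neighbourhood for all coefficients.
  have hev : ∀ᶠ m in 𝓝 m₀, ∀ c ∈ Metric.sphere (0 : Fin r → ℝ) 1,
      |e (c, m)| < (|C| + 1) * q (c, m) := by
    refine hK.eventually_forall_of_forall_eventually fun c hc ↦ ?_
    have h1 : |e (c, m₀)| < (|C| + 1) * q (c, m₀) := by
      have h2 : |e (c, m₀)| / q (c, m₀) ≤ C := hC ⟨c, hc, rfl⟩
      rw [← div_lt_iff₀ (hpos c hc)]
      linarith [le_abs_self C]
    have h2 : Continuous fun y : M × (Fin r → ℝ) ↦ (y.2, y.1) := by fun_prop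
    exact ((he.abs.comp h2).continuousAt.eventually_lt
      ((continuous_const.mul (hq.comp h2)).continuousAt) h1)
  refine ⟨|C| + 1, by positivity, ?_⟩
  filter_upwards [hev, hN.mem_nhds hm] with m hm1 hm2 z
  have hz : w (fun i ↦ a i m z) m = z := ha m hm2 z
  have h1 : |e (fun i ↦ a i m z, m)| ≤ (|C| + 1) * q (fun i ↦ a i m z, m) := by
    generalize (fun i ↦ a i m z) = c
    rcases eq_or_ne c 0 with rfl | hc
    · have := hsc m 0 0
      simp only [smul_zero, ne_eq, OfNat.ofNat_ne_zero, not_false_eq_true, zero_pow,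
        zero_mul] at this
      rw [this.1, this.2]; simp
    · have hc' : ‖c‖ ≠ 0 := norm_ne_zero_iff.2 hc
      have h2 := hm1 (‖c‖⁻¹ • c) (by simp [norm_smul, hc'])
      rw [(hsc _ _ _).1, (hsc _ _ _).2, abs_mul, abs_of_nonneg (sq_nonneg _)] at h2
      have h3 : 0 < ‖c‖⁻¹ ^ 2 := by positivity
      nlinarith
  simp only [e, q, hz] at h1
  exact h1

theorem IsSmoothEnd.exists_abs_inner_le [FiniteDimensional ℝ F]
    (aV : EquivariantStructure (n := n) d G F V) {T : ∀ m, V m →ₗ[ℂ] V m}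
    (hT : IsSmoothEnd (n := n) F T) {K : Set M} (hK : IsCompact K) :
    ∃ C : ℝ, 0 ≤ C ∧ ∀ m ∈ K, ∀ w : V m, |(inner ℂ w (T m w) : ℂ).re| ≤ C * ‖w‖ ^ 2 := by
  refine hK.induction_on (p := fun K ↦ ∃ C : ℝ, 0 ≤ C ∧
    ∀ m ∈ K, ∀ w : V m, |(inner ℂ w (T m w) : ℂ).re| ≤ C * ‖w‖ ^ 2) ⟨0, le_rfl, by simp⟩ ?_ ?_ ?_
  · rintro s t hst ⟨C, hC0, hC⟩
    exact ⟨C, hC0, fun m hm ↦ hC m (hst hm)⟩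
  · rintro s t ⟨C, hC0, hC⟩ ⟨C', hC0', hC'⟩
    refine ⟨max C C', le_max_of_le_left hC0, ?_⟩
    rintro m (hm | hm) w
    · exact (hC m hm w).trans (by gcongr; exact le_max_left _ _)
    · exact (hC' m hm w).trans (by gcongr; exact le_max_right _ _)
  · intro m _
    obtain ⟨C, hC0, hC⟩ := hT.eventually_abs_inner_le aV m
    exact ⟨_, mem_nhdsWithin_of_mem_nhds hC, C, hC0, fun x hx ↦ hx⟩

end EndBound

/-! ## The anticommutator of the Dirac operator with Clifford multiplication by an induced field -/

section CliffordLie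

variable {n d : ℕ}
  {G : Type*} [TopologicalSpace G] [Group G] [ChartedSpace (EuclideanSpace ℝ (Fin d)) G]
  {M : Type*} [TopologicalSpace M] [ChartedSpace (EuclideanSpace ℝ (Fin n)) M] [MulAction G M]
  [LieGroup (𝓡 d) ∞ G] [ContMDiffSMul (𝓡 d) (𝓡 n) ∞ G M] [T2Space M]
  [IsManifold (𝓡 n) ∞ M] [RiemannianBundle (fun x : M ↦ TangentSpace (𝓡 n) x)]
  [IsContMDiffRiemannianBundle (𝓡 n) ∞ (EuclideanSpace ℝ (Fin n))
      (fun x : M ↦ TangentSpace (𝓡 n) x)]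
  {FS : Type*} [NormedAddCommGroup FS] [NormedSpace ℂ FS]
  {S : M → Type*} [TopologicalSpace (TotalSpace FS S)]
  [∀ m, NormedAddCommGroup (S m)] [∀ m, InnerProductSpace ℂ (S m)]
  [FiberBundle FS S] [VectorBundle ℂ FS S] [VectorBundle ℝ FS S]
  [ContMDiffVectorBundle ∞ FS S (𝓡 n)]
  {FL : Type*} [NormedAddCommGroup FL] [NormedSpace ℂ FL]
  {L : M → Type*} [TopologicalSpace (TotalSpace FL L)]
  [∀ m, NormedAddCommGroup (L m)] [∀ m, InnerProductSpace ℂ (L m)]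
  [FiberBundle FL L] [VectorBundle ℂ FL L] [VectorBundle ℝ FL L]
  [ContMDiffVectorBundle ∞ FL L (𝓡 n)]
  {aS : EquivariantStructure (n := n) d G FS S} {aL : EquivariantStructure (n := n) d G FL L}
  (P : SpinCStructure aS aL)
  (DS : CovariantDerivative (𝓡 n) FS S)

theorem dirac_zero (m : M) : dirac P DS (fun x ↦ (0 : S x)) m = 0 := by
  have h := dirac_add (P := P) (DS := DS) (isSmoothSection_zero (n := n) (F := FS) (V := S))
    isSmoothSection_zero m
  simp only [add_zero] at h
  exact left_eq_add.1 h

theorem EquivariantStructure.lieDerivative_sum_smul {r : ℕ} (x : Fin r → ℝ)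
    (b : Fin r → GroupLieAlgebra (𝓡 d) G) (σ : ∀ m, S m) (m : M) :
    aS.lieDerivative (∑ i, x i • b i) σ m = ∑ i, x i • aS.lieDerivative (b i) σ m := by
  let T : EuclideanSpace ℝ (Fin d) →L[ℝ] S m :=
    -mvfderiv (𝓡 d) (fun g : G ↦ aS.translate g σ m) 1
  exact (map_sum T (fun i ↦ x i • b i) Finset.univ).trans
    (Finset.sum_congr rfl fun i _ ↦ T.map_smul (x i) (b i))

theorem EquivariantStructure.lieDerivative_const_smul {σ : ∀ m, S m}
    (hσ : IsSmoothSection (n := n) FS σ) (c : ℂ) (X : GroupLieAlgebra (𝓡 d) G) (m : M) :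
    aS.lieDerivative X (fun x ↦ c • σ x) m = c • aS.lieDerivative X σ m := by
  have h2 := (aS.contMDiff_translate_apply hσ m 1).mdifferentiableAt (by simp)
  have h := mvfderiv_clm_comp (n := d)
    ((c • ContinuousLinearMap.id ℂ (S m)).restrictScalars ℝ) h2 X
  have h1 : (fun g : G ↦ aS.translate g (fun x ↦ c • σ x) m) =
      fun g ↦ ((c • ContinuousLinearMap.id ℂ (S m)).restrictScalars ℝ) (aS.translate g σ m) := by
    funext g
    simp [translate]
  simp only [lieDerivative]
  rw [h1, smul_neg, h]
  rfl

/-- The operator `D c(f X^M) + c(f X^M) D + 2 f L_X`. -/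
def cliffordLie (f : M → ℝ) (X : M → GroupLieAlgebra (𝓡 d) G) (σ : ∀ m, S m) (m : M) : S m :=
  dirac P DS (fun x ↦ P.c x (f x • inducedField (X x) x) (σ x)) m +
    P.c m (f m • inducedField (X m) m) (dirac P DS σ m) +
    (2 * f m) • aS.lieDerivative (X m) σ m

variable {f : M → ℝ} {X : M → GroupLieAlgebra (𝓡 d) G}

theorem cliffordLie_eq_zero {σ : ∀ m, S m} (hf : ContMDiff (𝓡 n) 𝓘(ℝ, ℝ) ∞ f)
    (hX : IsSmoothField fun m : M ↦ inducedField (n := n) (X m) m)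
    (hσ : IsSmoothSection (n := n) FS σ) {m : M} (hm : m ∉ tsupport f) :
    cliffordLie P DS f X σ m = 0 := by
  have h0 : f m = 0 := image_eq_zero_of_notMem_tsupport hm
  have h1 : dirac P DS (fun x ↦ P.c x (f x • inducedField (X x) x) (σ x)) m =
      dirac P DS (fun x ↦ (0 : S x)) m := by
    refine dirac_congr (P.c_smooth _ (hX.smul hf) σ hσ) isSmoothSection_zero ?_
    filter_upwards [(isClosed_tsupport f).isOpen_compl.mem_nhds hm] with x hx
    simp [image_eq_zero_of_notMem_tsupport hx]
  rw [cliffordLie, h1, h0, dirac_zero]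
  simp

/-- On `uσ`, the Clifford relations make the derivative of `u` enter the anticommutator through `-2f
du(X^M)σ`, while `2f L_X` contributes the opposite. The operator therefore has order zero, for a Lie
algebra element `X m` depending on the point. -/
theorem exists_cliffordLie_eq (hDS : IsHermitianConnection DS)
    (hf : ContMDiff (𝓡 n) 𝓘(ℝ, ℝ) ∞ f)
    (hX : IsSmoothField fun m : M ↦ inducedField (n := n) (X m) m) (m : M) :
    ∃ T : S m →ₗ[ℂ] S m, ∀ σ : ∀ x, S x, IsSmoothSection (n := n) FS σ →
      cliffordLie P DS f X σ m = T (σ m) := by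
  have := P.finiteDimensional_spinor
  have hW : IsSmoothField fun m : M ↦ f m • inducedField (n := n) (X m) m := hX.smul hf
  have hc : ∀ {σ : ∀ x, S x}, IsSmoothSection (n := n) FS σ → IsSmoothSection (n := n) FS
      fun x ↦ P.c x (f x • inducedField (X x) x) (σ x) := fun hσ ↦ P.c_smooth _ hW _ hσ
  refine exists_linearMap_of_tensorial (n := n) (F := FS)
    (fun σ ↦ cliffordLie P DS f X σ m) ?_ ?_ ?_
  · intro σ τ hσ hτ
    simp only [cliffordLie, map_add]
    rw [dirac_add (hc hσ) (hc hτ), dirac_add hσ hτ, aS.lieDerivative_add hσ hτ, map_add]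
    module
  · intro u σ hu hσ
    have hr : ∀ x (r : ℝ) (T : S x →ₗ[ℂ] S x) (w : S x), T (r • w) = r • T w := fun x r T w ↦ by
      rw [← Complex.coe_smul, map_smul, Complex.coe_smul]
    simp only [cliffordLie, hr]
    rw [dirac_smul (hc hσ) hu, dirac_smul hσ hu, aS.lieDerivative_smul hσ hu]
    have h1 := P.c_anticomm m (f m • inducedField (X m) m) (gradient u m) (σ m)
    have h2 : inner ℝ (f m • inducedField (n := n) (X m) m) (gradient u m) =
        f m * mvfderiv (𝓡 n) u m (inducedField (X m) m) := by
      rw [real_inner_comm, inner_gradient, map_smul, smul_eq_mul]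
    rw [h2, ← Complex.ofReal_neg, Complex.coe_smul] at h1
    rw [map_add, hr, add_comm] at *
    generalize mvfderiv (𝓡 n) u m (inducedField (X m) m) = y at *
    rw [← eq_sub_iff_add_eq] at h1
    rw [h1]
    module
  · intro σ hσ
    have hI : ∀ {τ : ∀ x, S x}, IsSmoothSection (n := n) FS τ →
        dirac P DS (fun x ↦ Complex.I • τ x) m = Complex.I • dirac P DS τ m := fun hτ ↦ by
      simp only [dirac, hDS.complex_linear _ hτ, map_smul, Finset.smul_sum]
    have h1 : (fun x ↦ P.c x (f x • inducedField (X x) x) (Complex.I • σ x)) =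
        fun x ↦ Complex.I • P.c x (f x • inducedField (X x) x) (σ x) :=
      funext fun x ↦ LinearMap.map_smul _ _ _
    simp only [cliffordLie]
    rw [h1, hI (hc hσ), hI hσ, (P.c m (f m • inducedField (X m) m)).map_smul, aS.lieDerivative_const_smul hσ, smul_add, smul_add,
      smul_comm Complex.I (2 * f m)]

/-- Smoothness of Lie derivatives is known for constant elements of the Lie algebra, hence the
expansion of `X` with smooth coefficients. -/
theorem isSmoothSection_cliffordLie (hDS : IsHermitianConnection DS)
    (hf : ContMDiff (𝓡 n) 𝓘(ℝ, ℝ) ∞ f)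
    (hX : IsSmoothField fun m : M ↦ inducedField (n := n) (X m) m) {r : ℕ}
    {b : Fin r → GroupLieAlgebra (𝓡 d) G} {x : Fin r → M → ℝ}
    (hx : ∀ i, ContMDiff (𝓡 n) 𝓘(ℝ, ℝ) ∞ (x i)) (hXx : ∀ m, X m = ∑ i, x i m • b i)
    {σ : ∀ m, S m} (hσ : IsSmoothSection (n := n) FS σ) :
    IsSmoothSection (n := n) FS (cliffordLie P DS f X σ) := by
  have hW : IsSmoothField fun m : M ↦ f m • inducedField (n := n) (X m) m := hX.smul hf
  have h : (fun m ↦ aS.lieDerivative (X m) σ m) =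
      fun m ↦ ∑ i, x i m • aS.lieDerivative (b i) σ m := by
    funext m
    rw [hXx, aS.lieDerivative_sum_smul]
  refine ((isSmoothSection_dirac hDS (P.c_smooth _ hW σ hσ)).add
    (P.c_smooth _ hW _ (isSmoothSection_dirac hDS hσ))).add
    (IsSmoothSection.smul (σ := fun m ↦ aS.lieDerivative (X m) σ m) ?_ (contMDiff_const.mul hf))
  rw [h]
  exact IsSmoothSection.sum fun i ↦ (aS.isSmoothSection_lieDerivative hσ (b i)).smul (hx i)

end CliffordLie

/-! ## The anticommutator of the Dirac operator with its deformation -/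

section

variable {n : ℕ} {M : Type*} [TopologicalSpace M] [ChartedSpace (EuclideanSpace ℝ (Fin n)) M]

theorem mvfderiv_comp_hasFDerivAt {E₁ E₂ : Type*} [NormedAddCommGroup E₁] [NormedSpace ℝ E₁]
    [NormedAddCommGroup E₂] [NormedSpace ℝ E₂] {ψ : E₁ → E₂} {A : E₁ →L[ℝ] E₂} {u : M → E₁} {m : M}
    (hψ : HasFDerivAt ψ A (u m)) (hu : MDifferentiableAt (𝓡 n) 𝓘(ℝ, E₁) u m)
    (v : TangentSpace (𝓡 n) m) :
    mvfderiv (𝓡 n) (fun x ↦ ψ (u x)) m v = A (mvfderiv (𝓡 n) u m v) := by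
  have h := hψ.hasMFDerivAt.comp m hu.hasMFDerivAt
  exact congrArg (fun T ↦ T v) h.mfderiv

end

section Deformation

variable {n d : ℕ}
  {G : Type*} [TopologicalSpace G] [Group G] [ChartedSpace (EuclideanSpace ℝ (Fin d)) G]
  {M : Type*} [TopologicalSpace M] [ChartedSpace (EuclideanSpace ℝ (Fin n)) M] [MulAction G M]
  [LieGroup (𝓡 d) ∞ G] [ContMDiffSMul (𝓡 d) (𝓡 n) ∞ G M] [T2Space M]
  [IsManifold (𝓡 n) ∞ M] [RiemannianBundle (fun x : M ↦ TangentSpace (𝓡 n) x)]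
  [IsContMDiffRiemannianBundle (𝓡 n) ∞ (EuclideanSpace ℝ (Fin n))
      (fun x : M ↦ TangentSpace (𝓡 n) x)]
  {FS : Type*} [NormedAddCommGroup FS] [NormedSpace ℂ FS]
  {S : M → Type*} [TopologicalSpace (TotalSpace FS S)]
  [∀ m, NormedAddCommGroup (S m)] [∀ m, InnerProductSpace ℂ (S m)]
  [FiberBundle FS S] [VectorBundle ℂ FS S] [VectorBundle ℝ FS S]
  [ContMDiffVectorBundle ∞ FS S (𝓡 n)]
  {FL : Type*} [NormedAddCommGroup FL] [NormedSpace ℂ FL]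
  {L : M → Type*} [TopologicalSpace (TotalSpace FL L)]
  [∀ m, NormedAddCommGroup (L m)] [∀ m, InnerProductSpace ℂ (L m)]
  [FiberBundle FL L] [VectorBundle ℂ FL L] [VectorBundle ℝ FL L]
  [ContMDiffVectorBundle ∞ FL L (𝓡 n)]
  {aS : EquivariantStructure (n := n) d G FS S} {aL : EquivariantStructure (n := n) d G FL L}
  (P : SpinCStructure aS aL)
  {DT : CovariantDerivative (𝓡 n) (EuclideanSpace ℝ (Fin n))
      (fun x : M ↦ TangentSpace (𝓡 n) x)}
  {DL : CovariantDerivative (𝓡 n) FL L} {DS : CovariantDerivative (𝓡 n) FS S} {p : ℕ}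
  {s : ∀ m, Twisted S L p m} {σ : ∀ m, S m} {l : ∀ m, L m} {N : Set M}

/-- The Lie derivative of the spinor part of an invariant section. -/
theorem IsUnitForm.lieDerivative_eq (hsi : ∀ (g : G) m, s (g • m) = twistedAct aS aL g m (s m))
    (hFL : Module.finrank ℂ FL = 1) (h : IsUnitForm (n := n) FS FL s σ l N) {m : M} (hm : m ∈ N)
    (X : GroupLieAlgebra (𝓡 d) G) :
    aS.lieDerivative X σ m = ((p : ℂ) * inner ℂ (aL.lieDerivative X l m) (l m)) • σ m := by
  let A : L m →L[ℝ] ℂ := (Complex.conjCLE : ℂ →L[ℝ] ℂ).comp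
    ((innerSL ℂ (l m)).restrictScalars ℝ)
  have hA : ∀ w, A w = inner ℂ w (l m) := fun w ↦ inner_conj_symm w (l m)
  have hA1 : A (l m) = 1 := by
    rw [hA, inner_self_eq_norm_sq_to_K, h.norm_eq m hm]; simp
  have h1 : Filter.Tendsto (fun g : G ↦ g • m) (𝓝 1) (𝓝 m) := by
    have := (contMDiff_smul_right (d := d) (n := n) (G := G) m).continuous.tendsto 1
    rwa [one_smul] at this
  -- The translated pair represents the same `s`, so contracting `s m` with the translate of `l`
  -- gives `g⁻¹σ = ⟨g⁻¹l, l⟩ ^ p σ`. Differentiating at `g = 1`, where the inner product is one,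
  -- gives the factor `p`.
  have h2 : (fun g : G ↦ aS.translate g σ m) =ᶠ[𝓝 1]
      fun g : G ↦ A (aL.translate g l m) ^ p • σ m := by
    filter_upwards [h1 (h.isOpen.mem_nhds hm)] with g hg
    have h3 := (h.translate hsi hFL g).contract_eq hg
    rw [← h3, h.eq m hm, contract_tmul_tprod]
    simp [hA]
  have hu : aL.translate (1 : G) l m = l m := by rw [aL.translate_one]
  have h4 : HasFDerivAt (fun w ↦ A w ^ p • σ m) _ (aL.translate (1 : G) l m) :=
    (A.hasFDerivAt.pow p).smul_const (σ m)
  have h5 := mvfderiv_comp_hasFDerivAt (n := d) (u := fun g : G ↦ aL.translate g l m) h4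
    ((aL.contMDiff_translate_apply h.smooth_line m 1).mdifferentiableAt (by simp)) X
  have h6 : aS.lieDerivative X σ m =
      -mvfderiv (𝓡 d) (fun g : G ↦ A (aL.translate g l m) ^ p • σ m) 1 X :=
    congrArg (fun T : EuclideanSpace ℝ (Fin d) →L[ℝ] S m ↦ -T X)
      (h2.mfderiv_eq (I := 𝓡 d) (I' := 𝓘(ℝ, S m)))
  rw [h6, h5, hu, ← hA, EquivariantStructure.lieDerivative]
  generalize mvfderiv (𝓡 d) (fun g : G ↦ aL.translate g l m) 1 X = y
  simp [hA1]

/-- The spinor part of the deformation `a Φ - i f c(v)` of the Dirac operator. -/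
def deformation (Φ : ∀ m : M, S m →ₗ[ℂ] S m) (v : ∀ m : M, TangentSpace (𝓡 n) m) (f : M → ℝ)
    (a : ℝ) (m : M) : S m →ₗ[ℂ] S m :=
  (a : ℂ) • Φ m - Complex.I • P.c m (f m • v m)

variable {Φ : ∀ m : M, S m →ₗ[ℂ] S m} {v : ∀ m : M, TangentSpace (𝓡 n) m} {f : M → ℝ} {a : ℝ}
  {Z : Set M} {k : ℝ} {X : M → GroupLieAlgebra (𝓡 d) G}

theorem onSpinors_deformation (m : M) (z : Twisted S L p m) :
    onSpinors (deformation P Φ v f a m) z =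
      (a : ℂ) • onSpinors (Φ m) z - (Complex.I * (f m : ℂ)) • onSpinors (P.c m (v m)) z := by
  have h : P.c m (f m • v m) = (f m : ℂ) • P.c m (v m) := by
    rw [map_smul, ← Complex.coe_smul]
  rw [deformation, h, smul_smul]
  simp only [onSpinors, LinearMap.rTensor_sub, LinearMap.rTensor_smul, LinearMap.sub_apply,
    LinearMap.smul_apply]

theorem isSmoothEnd_deformation (hΦ : IsSmoothEnd (n := n) FS Φ) (hv : IsSmoothField v)
    (hf : ContMDiff (𝓡 n) 𝓘(ℝ, ℝ) ∞ f) : IsSmoothEnd (n := n) FS (deformation P Φ v f a) :=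
  fun σ hσ ↦ ((hΦ σ hσ).const_smul _).sub ((P.c_smooth _ (hv.smul hf) σ hσ).const_smul _)

theorem inner_deformation (hΦ : ∀ m (w z : S m), inner ℂ (Φ m w) z = inner ℂ w (Φ m z)) (m : M)
    (w z : S m) :
    inner ℂ (deformation P Φ v f a m w) z = inner ℂ w (deformation P Φ v f a m z) := by
  simp only [deformation, LinearMap.sub_apply, LinearMap.smul_apply, inner_sub_left,
    inner_sub_right, inner_smul_left, inner_smul_right, hΦ, P.c_skew, Complex.conj_ofReal,
    Complex.conj_I]
  ring

/-- Clifford multiplication anticommutes with `Φ`, so `⟨Φw, c(v)w⟩` is real and its product with `i`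
has no real part. Consequently `‖Ψw‖²` is the sum of `a²‖Φw‖²` and the square of the Clifford term.
-/
theorem le_norm_deformation_sq (hΦ : IsCalliasPotential P DS Φ Z k) (m : M) (w : S m) :
    a ^ 2 * ‖Φ m w‖ ^ 2 ≤ ‖deformation P Φ v f a m w‖ ^ 2 := by
  set y := P.c m (f m • v m) w
  have h1 : (inner ℂ (Φ m w) (Complex.I • y) : ℂ).re = 0 := by
    have h2 : (inner ℂ (Φ m w) y : ℂ) = inner ℂ y (Φ m w) := by
      rw [hΦ.selfadjoint]
      have h3 := hΦ.c_anticomm m (f m • v m) w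
      rw [P.c_skew, h3, inner_neg_right, neg_neg]
    have h4 := inner_conj_symm (𝕜 := ℂ) y (Φ m w)
    rw [h2] at h4
    have h5 := Complex.conj_eq_iff_im.1 h4
    rw [inner_smul_right, h2]
    simp [h5]
  have h6 : deformation P Φ v f a m w = (a : ℂ) • Φ m w - Complex.I • y := rfl
  rw [h6, norm_sub_sq (𝕜 := ℂ), inner_smul_left, norm_smul, norm_smul]
  simp only [Complex.conj_ofReal, RCLike.re_eq_complex_re, Complex.re_ofReal_mul, h1,
    Complex.norm_real, Complex.norm_I, mul_pow, Real.norm_eq_abs, sq_abs]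
  nlinarith [sq_nonneg ‖y‖]

/-- The anticommutator of the twisted Dirac operator with its deformation, on invariant sections. -/
theorem contract_anticommutator (hDS : IsSpinorConnection P DT DL DS)
    (hDL : IsHermitianConnection DL) {μ : M → GroupLieAlgebra (𝓡 d) G →ₗ[ℝ] ℝ}
    (hμ : IsMomentMap aL DL μ) (hΦ : IsCalliasPotential P DS Φ Z k)
    (hX : IsSmoothField fun m : M ↦ inducedField (n := n) (X m) m)
    (hf : ContMDiff (𝓡 n) 𝓘(ℝ, ℝ) ∞ f)
    (hsi : ∀ (g : G) m, s (g • m) = twistedAct aS aL g m (s m))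
    (h : IsUnitForm (n := n) FS FL s σ l N) {m : M} (hm : m ∈ N) :
    contract (l m) (twistedDirac P DS DL (fun x ↦ onSpinors
        (deformation P Φ (fun x ↦ inducedField (X x) x) f a x) (s x)) m +
      onSpinors (deformation P Φ (fun x ↦ inducedField (X x) x) f a m)
        (twistedDirac P DS DL s m)) =
      (a : ℂ) • (dirac P DS (fun x ↦ Φ x (σ x)) m + Φ m (dirac P DS σ m)) -
        Complex.I • cliffordLie P DS f X σ m +
        ((4 * Real.pi * p * f m * μ m (X m) : ℝ) : ℂ) • σ m := by
  have h1 : ∀ᶠ x in 𝓝 m, ‖l x‖ = 1 := Filter.mem_of_superset (h.isOpen.mem_nhds hm) h.norm_eq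
  have hc : IsSmoothSection (n := n) FS fun x ↦ P.c x (f x • inducedField (X x) x) (σ x) :=
    P.c_smooth _ (hX.smul hf) σ h.smooth_spinor
  have hΦσ := hΦ.smooth σ h.smooth_spinor
  have hI : ∀ {c : ℂ} {τ : ∀ x, S x}, IsSmoothSection (n := n) FS τ →
      dirac P DS (fun x ↦ c • τ x) m = c • dirac P DS τ m := fun {c τ} hτ ↦ by
    have h2 : ∀ w, DS (fun x ↦ c • τ x) m w = c • DS τ m w := fun w ↦ by
      rw [connection_smul_complex hDS.hermitian hτ (u := fun _ ↦ c) contMDiff_const,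
        mvfderiv_const]
      simp
    simp only [dirac, h2, map_smul, Finset.smul_sum]
  have hD : dirac P DS (fun x ↦ deformation P Φ (fun x ↦ inducedField (X x) x) f a x (σ x)) m =
      (a : ℂ) • dirac P DS (fun x ↦ Φ x (σ x)) m -
        Complex.I • dirac P DS (fun x ↦ P.c x (f x • inducedField (X x) x) (σ x)) m := by
    have h3 : (fun x ↦ deformation P Φ (fun x ↦ inducedField (X x) x) f a x (σ x)) =
        fun x ↦ (a : ℂ) • Φ x (σ x) + (-Complex.I) • P.c x (f x • inducedField (X x) x) (σ x) := by
      funext x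
      simp only [deformation, LinearMap.sub_apply, LinearMap.smul_apply]
      module
    rw [h3, dirac_add (hΦσ.const_smul _) (hc.const_smul _), hI hΦσ, hI hc]
    module
  -- For an invariant section the Lie derivative of the spinor part is minus `p` times the
  -- logarithmic Lie derivative of `l`, which the moment map identity expresses by `μ` and the
  -- connection form.
  have hLie : aS.lieDerivative (X m) σ m = (-(p : ℂ) * Complex.I *
      ((2 * Real.pi * μ m (X m) + inner ℝ (lineForm DL l m) (inducedField (X m) m) : ℝ) : ℂ)) •
        σ m := by
    have h4 : aL.lieDerivative (X m) l m = (2 * Real.pi * Complex.I * (μ m (X m) : ℂ)) • l m +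
        DL l m (inducedField (X m) m) := by
      rw [hμ (X m) l h.smooth_line m]; module
    have h5 : (inner ℂ (l m) (aL.lieDerivative (X m) l m) : ℂ) = Complex.I *
        ((2 * Real.pi * μ m (X m) + inner ℝ (lineForm DL l m) (inducedField (X m) m) : ℝ) : ℂ) := by
      rw [h4, inner_add_right, inner_connection_unit hDL h.smooth_line h1, inner_smul_right,
        inner_self_eq_norm_sq_to_K, h.norm_eq m hm]
      push_cast
      ring
    rw [h.lieDerivative_eq hsi P.rank_det hm, ← inner_conj_symm, h5, map_mul, Complex.conj_I,
      Complex.conj_ofReal]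
    congr 1
    ring
  have hdef := isSmoothEnd_deformation P (a := a) hΦ.smooth hX hf
  have hθ := P.c_anticomm m (lineForm DL l m) (inducedField (X m) m) (σ m)
  have hθΦ := hΦ.c_anticomm m (lineForm DL l m) (σ m)
  rw [map_add, contract_onSpinors, contract_twistedDirac P hDS.hermitian hDL (h.onSpinors hdef) hm,
    contract_twistedDirac P hDS.hermitian hDL h hm, hD, cliffordLie, hLie]
  simp only [deformation, LinearMap.sub_apply, LinearMap.smul_apply, map_add, LinearMap.map_sub,
    LinearMap.map_smul_of_tower, map_smul]
  generalize dirac P DS (fun x ↦ f x • P.c x (inducedField (X x) x) (σ x)) m = w₁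
  rw [hθΦ, eq_sub_of_add_eq hθ]
  generalize Φ m (P.c m (lineForm DL l m) (σ m)) = w₂
  generalize P.c m (inducedField (X m) m) (P.c m (lineForm DL l m) (σ m)) = w₃
  simp only [← Complex.coe_smul]
  push_cast
  -- The terms in `⟨θ, X^M⟩` cancel between the anticommutator of `i p c(θ)` with the Clifford term
  -- and the Lie derivative; `4πp f μ(X)` survives. The term `i p c(θ)` anticommutes with `Φ`, so
  -- the potential receives no contribution.
  match_scalars
  all_goals first
    | ring1
    | (ring_nf; simp only [Complex.I_sq]; ring1)

end Deformation

/-! ## The pointwise estimate for the deformation -/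

section Estimate

variable {n d : ℕ}
  {G : Type*} [TopologicalSpace G] [Group G] [ChartedSpace (EuclideanSpace ℝ (Fin d)) G]
  {M : Type*} [TopologicalSpace M] [ChartedSpace (EuclideanSpace ℝ (Fin n)) M] [MulAction G M]
  [LieGroup (𝓡 d) ∞ G] [ContMDiffSMul (𝓡 d) (𝓡 n) ∞ G M] [T2Space M]
  [IsManifold (𝓡 n) ∞ M] [RiemannianBundle (fun x : M ↦ TangentSpace (𝓡 n) x)]
  [IsContMDiffRiemannianBundle (𝓡 n) ∞ (EuclideanSpace ℝ (Fin n))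
      (fun x : M ↦ TangentSpace (𝓡 n) x)]
  {FS : Type*} [NormedAddCommGroup FS] [NormedSpace ℂ FS]
  {S : M → Type*} [TopologicalSpace (TotalSpace FS S)]
  [∀ m, NormedAddCommGroup (S m)] [∀ m, InnerProductSpace ℂ (S m)]
  [FiberBundle FS S] [VectorBundle ℂ FS S] [VectorBundle ℝ FS S]
  [ContMDiffVectorBundle ∞ FS S (𝓡 n)]
  {FL : Type*} [NormedAddCommGroup FL] [NormedSpace ℂ FL]
  {L : M → Type*} [TopologicalSpace (TotalSpace FL L)]
  [∀ m, NormedAddCommGroup (L m)] [∀ m, InnerProductSpace ℂ (L m)]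
  [FiberBundle FL L] [VectorBundle ℂ FL L] [VectorBundle ℝ FL L]
  [ContMDiffVectorBundle ∞ FL L (𝓡 n)]
  {aS : EquivariantStructure (n := n) d G FS S} {aL : EquivariantStructure (n := n) d G FL L}
  (P : SpinCStructure aS aL)
  {DT : CovariantDerivative (𝓡 n) (EuclideanSpace ℝ (Fin n))
      (fun x : M ↦ TangentSpace (𝓡 n) x)}
  {DL : CovariantDerivative (𝓡 n) FL L} {DS : CovariantDerivative (𝓡 n) FS S} {p : ℕ}
  {s : ∀ m, Twisted S L p m} {σ : ∀ m, S m} {l : ∀ m, L m} {N : Set M}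
  {Φ : ∀ m : M, S m →ₗ[ℂ] S m} {v : ∀ m : M, TangentSpace (𝓡 n) m} {f : M → ℝ} {a : ℝ}
  {Z : Set M} {k : ℝ} {X : M → GroupLieAlgebra (𝓡 d) G}
  {μ : M → GroupLieAlgebra (𝓡 d) G →ₗ[ℝ] ℝ} {B : LieAlgebraMetric (n := n) (d := d) G M}

theorem act_deformation (hΦ : ∀ (g : G) m (w : S m), aS.act g m (Φ m w) = Φ (g • m) (aS.act g m w))
    (hv : ∀ (g : G) m, v (g • m) = pushforward g m (v m)) (hf : ∀ (g : G) m, f (g • m) = f m)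
    (g : G) (m : M) (w : S m) :
    aS.act g m (deformation P Φ v f a m w) =
      deformation P Φ v f a (g • m) (aS.act g m w) := by
  simp only [deformation, LinearMap.sub_apply, LinearMap.smul_apply, map_sub, hf, hv,
    ← map_smul (pushforward g m), ← P.c_equivariant]
  rw [LinearIsometryEquiv.map_smul, LinearIsometryEquiv.map_smul, hΦ]

theorem isSmoothTwisted_onSpinors (aL : EquivariantStructure (n := n) d G FL L)
    (hs : IsSmoothTwisted (n := n) FS FL s) (hΦ : IsSmoothEnd (n := n) FS Φ) :
    IsSmoothTwisted (n := n) FS FL fun m ↦ onSpinors (Φ m) (s m) := fun m ↦ by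
  obtain ⟨σ, l, N, hm, h⟩ := hs.exists_unitForm aL m
  exact ⟨_, _, (h.onSpinors hΦ).isLocalForm hm⟩

/-- The symmetrised anticommutator `⟨Ds, Ψs⟩ + ⟨s, DΨs⟩` of the Dirac operator `D` with an
endomorphism `Ψ`. -/
def anticommutatorForm (DS : CovariantDerivative (𝓡 n) FS S) (DL : CovariantDerivative (𝓡 n) FL L)
    (Ψ : ∀ m : M, S m →ₗ[ℂ] S m) (s : ∀ m, Twisted S L p m) (m : M) : ℝ :=
  twistedInner (twistedDirac P DS DL s m) (onSpinors (Ψ m) (s m)) +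
    twistedInner (s m) (twistedDirac P DS DL (fun x ↦ onSpinors (Ψ x) (s x)) m)

theorem anticommutatorForm_smul {Ψ : ∀ m : M, S m →ₗ[ℂ] S m}
    (hG : IsIsometricAction (n := n) G M)
    (hDS : IsHermitianConnection DS) (hDL : IsHermitianConnection DL)
    (hDSi : IsInvariantConnection aS DS) (hDLi : IsInvariantConnection aL DL)
    (hΨs : IsSmoothEnd (n := n) FS Ψ)
    (hΨ : ∀ (g : G) m (w : S m), aS.act g m (Ψ m w) = Ψ (g • m) (aS.act g m w))
    (hs : IsSmoothTwisted (n := n) FS FL s)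
    (hsi : ∀ (g : G) m, s (g • m) = twistedAct aS aL g m (s m)) (g : G) (m : M) :
    anticommutatorForm P DS DL Ψ s (g • m) = anticommutatorForm P DS DL Ψ s m := by
  have hi : ∀ (g : G) m, onSpinors (Ψ (g • m)) (s (g • m)) =
      twistedAct aS aL g m (onSpinors (Ψ m) (s m)) := fun g m ↦ by
    rw [twistedAct_onSpinors (hΨ g m), hsi]
  have h1 := twistedDirac_smul_eq (P := P) hG hDS hDL hDSi hDLi
    (isSmoothTwisted_onSpinors aL hs hΨs) hi g m
  simp only [anticommutatorForm]
  rw [h1, hi, twistedDirac_smul_eq (P := P) hG hDS hDL hDSi hDLi hs hsi, hsi,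
    twistedInner_twistedAct P.rank_det, twistedInner_twistedAct P.rank_det]

/-- Self-adjointness of the deformation turns the symmetrised form into the real part of `⟨s, {D,
Ψ}s⟩`, to which the anticommutator formula applies. -/
theorem anticommutatorForm_deformation (hDS : IsSpinorConnection P DT DL DS)
    (hDL : IsHermitianConnection DL)
    (hμ : IsMomentMap aL DL μ) (hΦ : IsCalliasPotential P DS Φ Z k)
    (hX : IsSmoothField fun m : M ↦ inducedField (n := n) (X m) m)
    (hf : ContMDiff (𝓡 n) 𝓘(ℝ, ℝ) ∞ f)
    (hsi : ∀ (g : G) m, s (g • m) = twistedAct aS aL g m (s m))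
    (h : IsUnitForm (n := n) FS FL s σ l N) {m : M} (hm : m ∈ N) :
    anticommutatorForm P DS DL (deformation P Φ (fun x ↦ inducedField (X x) x) f a) s m =
      a * (inner ℂ (σ m) (dirac P DS (fun x ↦ Φ x (σ x)) m + Φ m (dirac P DS σ m)) : ℂ).re +
        (inner ℂ (σ m) (-Complex.I • cliffordLie P DS f X σ m) : ℂ).re +
        4 * Real.pi * p * f m * μ m (X m) * ‖σ m‖ ^ 2 := by
  have hL : Module.finrank ℂ (L m) = 1 := by rw [finrank_fibre (F := FL), P.rank_det]
  have h1 := contract_anticommutator P (a := a) hDS hDL hμ hΦ hX hf hsi h hm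
  have hre : ∀ w z : S m, (inner ℂ w z : ℂ).re = (inner ℂ z w : ℂ).re := fun w z ↦ by
    rw [← inner_conj_symm, Complex.conj_re]
  rw [anticommutatorForm, twistedInner_eq hL (h.norm_eq m hm), twistedInner_eq hL (h.norm_eq m hm),
    h.contract_eq hm, contract_onSpinors, h.contract_eq hm,
    ← inner_deformation P hΦ.selfadjoint, hre, ← contract_onSpinors, ← Complex.add_re,
    ← inner_add_right, ← map_add, add_comm, h1, sub_eq_add_neg, ← neg_smul, inner_add_right,
    inner_add_right, Complex.add_re, Complex.add_re, inner_smul_right, Complex.re_ofReal_mul,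
    inner_smul_right (σ m) (σ m), Complex.re_ofReal_mul]
  congr 2
  exact inner_self_eq_norm_sq (𝕜 := ℂ) (σ m)

/-- Away from the zero set of the moment map, the anticommutator and the square of the deformation
are bounded from below, if the potential and the power of the determinant bundle are scaled
sufficiently. -/
theorem exists_deformation_estimate (hG : IsIsometricAction (n := n) G M)
    (hDT : IsLeviCivita DT) (hDL : IsHermitianConnection DL)
    (hDLi : IsInvariantConnection aL DL) (hDS : IsSpinorConnection P DT DL DS)
    (hμ : IsMomentMap aL DL μ) (hΦ : IsCalliasPotential P DS Φ Z k) (hk : 0 < k)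
    (hf : ContMDiff (𝓡 n) 𝓘(ℝ, ℝ) ∞ f) (hfi : ∀ (g : G) m, f (g • m) = f m)
    (hf0 : ∀ m, 0 ≤ f m) (hf1 : ∀ m ∈ Z, f m = 1) {U : Set M} (hU : IsOpen U)
    (hUi : IsInvariantSet G U) (hU0 : μ ⁻¹' {0} ⊆ U) (hZ : IsClosed Z) (hZi : IsInvariantSet G Z)
    {K K' : Set M} (hK : IsCompact K) (hfK : ∀ m ∈ tsupport f, ∃ g : G, g • m ∈ K)
    (hK' : IsCompact K') (hZK' : ∀ m ∈ Z, ∃ g : G, g • m ∈ K') :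
    ∃ a : ℝ, 1 ≤ a ∧ ∃ p₀ : ℕ, ∀ p ≥ p₀, ∀ t : ℝ, 1 ≤ t → ∀ s : ∀ m, Twisted S L p m,
      IsSmoothTwisted (n := n) FS FL s → (∀ (g : G) m, s (g • m) = twistedAct aS aL g m (s m)) →
      ∀ m, m ∉ U → twistedInner (s m) (s m) ≤
        anticommutatorForm P DS DL (deformation P Φ (momentField B μ) f a) s m +
          t * twistedInner (onSpinors (deformation P Φ (momentField B μ) f a m) (s m))
            (onSpinors (deformation P Φ (momentField B μ) f a m) (s m)) := by
  have := P.finiteDimensional_spinor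
  have hμs := hμ.contMDiff P.rank_det hDL
  have hadj := hμ.apply_adjointAction P.rank_det hDLi
  have hv := isSmoothField_momentField B hμs
  have hvi := momentField_smul (B := B) hadj
  have hDSi := hDS.translate hG hDT hDLi
  obtain ⟨r, b, x, hx, hXx⟩ := B.exists_dual_eq_sum hμs
  obtain ⟨A, hA, hAk⟩ := hΦ.anticommutator
  choose T hT using exists_cliffordLie_eq P DS (X := B.dual μ) hDS.hermitian hf hv
  have hAs : IsSmoothEnd (n := n) FS A := fun σ hσ ↦ by
    have h := (isSmoothSection_dirac (P := P) hDS.hermitian (hΦ.smooth σ hσ)).add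
      (hΦ.smooth _ (isSmoothSection_dirac (P := P) hDS.hermitian hσ))
    simpa only [hA σ hσ] using h
  have hTs : IsSmoothEnd (n := n) FS fun m ↦ -Complex.I • T m := fun σ hσ ↦ by
    have h := (isSmoothSection_cliffordLie P DS hDS.hermitian hf hv hx hXx hσ).const_smul
      (-Complex.I)
    have h1 : ∀ m, cliffordLie P DS f (B.dual μ) σ m = T m (σ m) := fun m ↦ hT m σ hσ
    simp only [h1] at h
    exact h
  -- Translates of `K` cover the support of `f`, and translates of `K'` cover `Z`. The endomorphisms
  -- act on `S` alone, so `C₁` and `C₂` do not depend on `p`, `t` or `a`.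
  obtain ⟨C₁, hC₁, hC₁T⟩ := hTs.exists_abs_inner_le aS (hK.union hK')
  obtain ⟨C₂, hC₂, hC₂A⟩ := hAs.exists_abs_inner_le aS hK'
  let e : M → ℝ := fun m ↦ μ m (B.dual μ m)
  have he : ∀ m, e m = B.form m (B.dual μ m) (B.dual μ m) := fun m ↦ (B.form_dual μ m _).symm
  have he0 : ∀ m, 0 ≤ e m := fun m ↦ by
    rw [he]
    by_cases h : B.dual μ m = 0
    · simp [h]
    · exact (B.pos m _ h).le
  have hec : Continuous e := by
    have h : e = fun m ↦ ∑ i, x i m * μ m (b i) := by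
      funext m
      simp only [e, hXx m, map_sum, map_smul, smul_eq_mul]
    rw [h]
    exact continuous_finsetSum _ fun i _ ↦ (hx i).continuous.mul (hμs (b i)).continuous
  -- The minimum of `‖μ‖²` over a compact set that avoids `U`, hence avoids the zeros of `μ`.
  obtain ⟨ε, hε, hεe⟩ := ((hK'.inter_right hZ).inter_right
    hU.isClosed_compl).exists_forall_le' hec.continuousOn (a := 0) fun m hm ↦ by
      rw [he]
      refine B.pos m _ fun h ↦ hm.2 (hU0 ?_)
      ext Y
      rw [← B.form_dual μ m Y, h]
      simp
  have hk2 : 0 < k ^ 2 := by positivity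
  -- Chosen so that `a k²` exceeds `C₁` by one, which settles the estimate outside `Z`. The bound `a
  -- ≥ 1` also gives `a ≤ a²`.
  set a := max 1 ((C₁ + 1) / k ^ 2) with ha
  have ha1 : 1 ≤ a := le_max_left _ _
  have hak : C₁ + 1 ≤ a * k ^ 2 := (div_le_iff₀ hk2).1 (le_max_right _ _)
  -- Once `a` is fixed, `p` is taken so large that `4πpε` exceeds by one the possible loss `aC₂ +
  -- C₁` on `Z` outside `U`.
  refine ⟨a, ha1, ⌈(a * C₂ + C₁ + 1) / (4 * Real.pi * ε)⌉₊, fun p hp t ht s hs hsi ↦ ?_⟩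
  have hpε : a * C₂ + C₁ + 1 ≤ 4 * Real.pi * p * ε := by
    have h1 : (a * C₂ + C₁ + 1) / (4 * Real.pi * ε) ≤ p := Nat.ceil_le.1 hp
    rw [div_le_iff₀ (by positivity)] at h1
    linarith
  have hdef := isSmoothEnd_deformation P (a := a) hΦ.smooth hv hf
  have hdefi := act_deformation P (a := a) hΦ.equivariant hvi hfi
  set Ψ := deformation P Φ (momentField B μ) f a with hΨ
  let Q : M → ℝ := fun m ↦ twistedInner (onSpinors (Ψ m) (s m)) (onSpinors (Ψ m) (s m))
  have hNi : ∀ (g : G) m, twistedInner (s (g • m)) (s (g • m)) = twistedInner (s m) (s m) :=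
    fun g m ↦ by rw [hsi, twistedInner_twistedAct P.rank_det]
  have hQi : ∀ (g : G) m, Q (g • m) = Q m := fun g m ↦ by
    simp only [Q]
    rw [hsi, ← twistedAct_onSpinors (hdefi g m), twistedInner_twistedAct P.rank_det]
  have hEi := anticommutatorForm_smul P hG hDS.hermitian hDL hDSi hDLi hdef hdefi hs hsi
  have key : ∀ m, ∃ w : S m, twistedInner (s m) (s m) = ‖w‖ ^ 2 ∧ a ^ 2 * ‖Φ m w‖ ^ 2 ≤ Q m ∧
      anticommutatorForm P DS DL Ψ s m = a * (inner ℂ w (A m w) : ℂ).re +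
        (inner ℂ w ((-Complex.I • T m) w) : ℂ).re + 4 * Real.pi * p * f m * e m * ‖w‖ ^ 2 :=
    fun m ↦ by
      obtain ⟨σ, l, N, hm, h⟩ := hs.exists_unitForm aL m
      have hL : Module.finrank ℂ (L m) = 1 := by rw [finrank_fibre (F := FL), P.rank_det]
      refine ⟨σ m, ?_, ?_, ?_⟩
      · rw [twistedInner_eq hL (h.norm_eq m hm), h.contract_eq hm]
        exact inner_self_eq_norm_sq (𝕜 := ℂ) (σ m)
      · simp only [Q]
        rw [twistedInner_eq hL (h.norm_eq m hm), contract_onSpinors, h.contract_eq hm]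
        exact (le_norm_deformation_sq P hΦ m (σ m)).trans
          (inner_self_eq_norm_sq (𝕜 := ℂ) (Ψ m (σ m))).ge
      · have h1 := anticommutatorForm_deformation P (a := a) (X := B.dual μ) hDS hDL hμ hΦ hv hf
          hsi h hm
        rw [hA σ h.smooth_spinor, hT m σ h.smooth_spinor] at h1
        exact h1
  have hQ0 : ∀ m, 0 ≤ Q m := fun m ↦ by
    obtain ⟨w, -, h2, -⟩ := key m
    exact le_trans (by positivity) h2
  -- The Callias bound, multiplied by `a`, requires `a‖Φw‖²`; this is supplied by `t‖Ψw‖² ≥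
  -- a²‖Φw‖²`, using `t ≥ 1` and `a ≥ 1`. The moment map term is nonnegative and is discarded. Off
  -- the support of `f` the remainder is zero, so no bound is needed there.
  have outside : ∀ m, m ∉ Z → (m ∈ K ∨ m ∉ tsupport f) → twistedInner (s m) (s m) ≤
      anticommutatorForm P DS DL Ψ s m + t * Q m := fun m hmZ hm ↦ by
    obtain ⟨w, h1, h2, h3⟩ := key m
    have h4 : |(inner ℂ w ((-Complex.I • T m) w) : ℂ).re| ≤ C₁ * ‖w‖ ^ 2 := by
      rcases hm with hm | hm
      · exact hC₁T m (Or.inl hm) w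
      · obtain ⟨σ, hσ, rfl⟩ := exists_section_apply_eq (n := n) (F := FS) w
        rw [LinearMap.smul_apply, ← hT m σ hσ, cliffordLie_eq_zero P DS hf hv hσ hm]
        simp only [smul_zero, inner_zero_right, Complex.zero_re, abs_zero]
        positivity
    have h5 := hAk m hmZ w
    have h6 : (inner ℂ w (Φ m (Φ m w)) : ℂ).re = ‖Φ m w‖ ^ 2 := by
      rw [← hΦ.selfadjoint]
      exact inner_self_eq_norm_sq (𝕜 := ℂ) (Φ m w)
    rw [inner_add_right, Complex.add_re, h6] at h5
    have h7 : 0 ≤ 4 * Real.pi * p * f m * e m * ‖w‖ ^ 2 := by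
      have := hf0 m
      have := he0 m
      positivity
    rw [h1, h3]
    have h8 : a * ‖Φ m w‖ ^ 2 ≤ t * Q m := by
      have h9 : a ≤ a ^ 2 := le_self_pow₀ ha1 two_ne_zero
      exact ((mul_le_mul_of_nonneg_right h9 (sq_nonneg _)).trans h2).trans
        (le_mul_of_one_le_left (hQ0 m) ht)
    have h9 := neg_le_of_abs_le h4
    have h10 := mul_le_mul_of_nonneg_left h5 (zero_le_one.trans ha1)
    have h11 := mul_le_mul_of_nonneg_right hak (sq_nonneg ‖w‖)
    linarith
  -- Here `f = 1`, and the moment map term alone dominates; the square of the deformation is only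
  -- used to be nonnegative.
  have inside : ∀ m, m ∈ Z → m ∈ K' → m ∉ U → twistedInner (s m) (s m) ≤
      anticommutatorForm P DS DL Ψ s m + t * Q m := fun m hmZ hmK hmU ↦ by
    obtain ⟨w, h1, h2, h3⟩ := key m
    have h4 := neg_le_of_abs_le (hC₁T m (Or.inr hmK) w)
    have h5 := neg_le_of_abs_le (hC₂A m hmK w)
    have h6 := mul_le_mul_of_nonneg_left h5 (zero_le_one.trans ha1)
    have h7 : 4 * Real.pi * p * ε * ‖w‖ ^ 2 ≤ 4 * Real.pi * p * f m * e m * ‖w‖ ^ 2 := by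
      rw [hf1 m hmZ, mul_one]
      gcongr
      exact hεe m ⟨⟨hmK, hmZ⟩, hmU⟩
    have h8 := mul_le_mul_of_nonneg_right hpε (sq_nonneg ‖w‖)
    have h9 : 0 ≤ t * Q m := mul_nonneg (zero_le_one.trans ht) (hQ0 m)
    rw [h1, h3]
    linarith
  -- All three quantities in the inequality are invariant, so it may be verified after moving `m`
  -- into the compact sets on which the constants hold.
  have hinv : ∀ {W : Set M}, IsInvariantSet G W → ∀ (g : G) m, g • m ∈ W → m ∈ W :=
    fun hW g m h ↦ by simpa using hW g⁻¹ _ h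
  intro m hmU
  change _ ≤ _ + t * Q m
  by_cases hmZ : m ∈ Z
  · obtain ⟨g, hg⟩ := hZK' m hmZ
    have h := inside _ (hZi g m hmZ) hg fun h ↦ hmU (hinv hUi g m h)
    rwa [hNi, hEi, hQi] at h
  · by_cases hmf : m ∈ tsupport f
    · obtain ⟨g, hg⟩ := hfK m hmf
      have h := outside _ (fun h ↦ hmZ (hinv hZi g m h)) (Or.inl hg)
      rwa [hNi, hEi, hQi] at h
    · exact outside m hmZ (Or.inr hmf)

end Estimate

/-! ## Integration of the pointwise estimate -/

section Integration

variable {n d : ℕ}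
  {G : Type*} [TopologicalSpace G] [Group G] [ChartedSpace (EuclideanSpace ℝ (Fin d)) G]
  {M : Type*} [TopologicalSpace M] [ChartedSpace (EuclideanSpace ℝ (Fin n)) M] [MulAction G M]
  [LieGroup (𝓡 d) ∞ G] [ContMDiffSMul (𝓡 d) (𝓡 n) ∞ G M] [T2Space M]
  [IsManifold (𝓡 n) ∞ M] [RiemannianBundle (fun x : M ↦ TangentSpace (𝓡 n) x)]
  [IsContMDiffRiemannianBundle (𝓡 n) ∞ (EuclideanSpace ℝ (Fin n))
      (fun x : M ↦ TangentSpace (𝓡 n) x)]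
  {FS : Type*} [NormedAddCommGroup FS] [NormedSpace ℂ FS]
  {S : M → Type*} [TopologicalSpace (TotalSpace FS S)]
  [∀ m, NormedAddCommGroup (S m)] [∀ m, InnerProductSpace ℂ (S m)]
  [FiberBundle FS S] [VectorBundle ℂ FS S] [VectorBundle ℝ FS S]
  [ContMDiffVectorBundle ∞ FS S (𝓡 n)]
  {FL : Type*} [NormedAddCommGroup FL] [NormedSpace ℂ FL]
  {L : M → Type*} [TopologicalSpace (TotalSpace FL L)]
  [∀ m, NormedAddCommGroup (L m)] [∀ m, InnerProductSpace ℂ (L m)]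
  [FiberBundle FL L] [VectorBundle ℂ FL L] [VectorBundle ℝ FL L]
  [ContMDiffVectorBundle ∞ FL L (𝓡 n)]
  {aS : EquivariantStructure (n := n) d G FS S} {aL : EquivariantStructure (n := n) d G FL L}
  (P : SpinCStructure aS aL)
  {DT : CovariantDerivative (𝓡 n) (EuclideanSpace ℝ (Fin n))
      (fun x : M ↦ TangentSpace (𝓡 n) x)}
  {DL : CovariantDerivative (𝓡 n) FL L} {DS : CovariantDerivative (𝓡 n) FS S} {p : ℕ}
  {s : ∀ m, Twisted S L p m} {Ψ : ∀ m : M, S m →ₗ[ℂ] S m}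

theorem isSmoothField_lineForm (aL : EquivariantStructure (n := n) d G FL L)
    (hDL : IsHermitianConnection DL) {l : ∀ m, L m}
    (hl : IsSmoothSection (n := n) FL l) : IsSmoothField (lineForm DL l) := by
  refine isSmoothField_of_eventuallyEq fun a ↦ ?_
  obtain ⟨E, E', N, hN, ha, hNs, hE, hE', hEe, hEe'⟩ :=
    exists_coordFrame_of_mem (n := n) (mem_chart_source _ a)
  refine ⟨fun m ↦ ∑ i, (inner ℂ (l m) (DL l m (E' i m)) : ℂ).im • E i m, ?_, ?_⟩
  · exact IsSmoothField.sum fun i _ ↦ (hE i).smul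
      ((ContinuousLinearMap.contMDiff Complex.imCLM).comp
        (aL.metric_smooth _ _ hl (contMDiff_connection hDL hl (hE' i))))
  · filter_upwards [hN.mem_nhds ha] with x hx
    rw [← sum_inner_dualCoordField_smul (hNs hx) (lineForm DL l x)]
    refine Finset.sum_congr rfl fun i _ ↦ ?_
    rw [real_inner_comm, inner_lineForm, hEe' x hx, hEe x hx]

theorem isSmoothTwisted_twistedDirac_add (hDS : IsHermitianConnection DS)
    (hDL : IsHermitianConnection DL) (hs : IsSmoothTwisted (n := n) FS FL s)
    (hΨ : IsSmoothEnd (n := n) FS Ψ) (c : ℂ) :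
    IsSmoothTwisted (n := n) FS FL
      fun m ↦ twistedDirac P DS DL s m + c • onSpinors (Ψ m) (s m) := fun a ↦ by
  obtain ⟨σ, l, N, ha, h⟩ := hs.exists_unitForm aL a
  refine ⟨fun m ↦ (dirac P DS σ m + ((p : ℂ) * Complex.I) • P.c m (lineForm DL l m) (σ m)) +
    c • Ψ m (σ m), l, ?_, h.smooth_line, (h.isLocalForm ha).2.2.1, ?_⟩
  · exact ((isSmoothSection_dirac hDS h.smooth_spinor).add
      ((P.c_smooth _ (isSmoothField_lineForm aL hDL h.smooth_line) σ h.smooth_spinor).const_smul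
        _)).add ((hΨ σ h.smooth_spinor).const_smul c)
  · filter_upwards [h.isOpen.mem_nhds ha] with x hx
    have hL : Module.finrank ℂ (L x) = 1 := by rw [finrank_fibre (F := FL), P.rank_det]
    refine contract_injective hL (h.norm_eq x hx) ?_
    rw [contract_tmul_tprod_self (h.norm_eq x hx), map_add, map_smul, contract_onSpinors,
      h.contract_eq hx, contract_twistedDirac P hDS hDL h hx]

theorem isSmoothTwisted_twistedDirac (hDS : IsHermitianConnection DS)
    (hDL : IsHermitianConnection DL) (hs : IsSmoothTwisted (n := n) FS FL s) :
    IsSmoothTwisted (n := n) FS FL (twistedDirac P DS DL s) := by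
  have h := isSmoothTwisted_twistedDirac_add P hDS hDL hs (Ψ := fun _ ↦ LinearMap.id)
    (fun σ hσ ↦ hσ) 0
  simpa only [zero_smul, add_zero] using h

theorem twistedDirac_eq_zero (hDS : IsHermitianConnection DS) (hDL : IsHermitianConnection DL)
    (hs : IsSmoothTwisted (n := n) FS FL s) {m : M} (hm : m ∉ sectionSupport s) :
    twistedDirac P DS DL s m = 0 := by
  obtain ⟨σ, l, N, hmN, h⟩ := hs.exists_unitForm aL m
  have hL : Module.finrank ℂ (L m) = 1 := by rw [finrank_fibre (F := FL), P.rank_det]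
  have h0 : ∀ᶠ x in 𝓝 m, σ x = 0 := by
    filter_upwards [h.isOpen.mem_nhds hmN, isClosed_closure.isOpen_compl.mem_nhds hm] with x hx hx'
    have h1 : s x = 0 := by
      by_contra hne
      exact hx' (subset_closure hne)
    rw [← h.contract_eq hx, h1, map_zero]
  refine contract_injective hL (h.norm_eq m hmN) ?_
  rw [contract_twistedDirac P hDS hDL h hmN, dirac_congr h.smooth_spinor isSmoothSection_zero h0,
    dirac_zero P DS, h0.self_of_nhds]
  simp

theorem continuous_twistedInner_self (aS : EquivariantStructure (n := n) d G FS S)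
    (aL : EquivariantStructure (n := n) d G FL L) (hFL : Module.finrank ℂ FL = 1)
    (hs : IsSmoothTwisted (n := n) FS FL s) :
    Continuous fun m ↦ twistedInner (s m) (s m) := by
  refine continuous_iff_continuousAt.2 fun m ↦ ?_
  obtain ⟨σ, l, N, hm, h⟩ := hs.exists_unitForm aL m
  have h1 : Continuous fun x ↦ (inner ℂ (σ x) (σ x) : ℂ).re := Complex.continuous_re.comp
    (aS.metric_smooth _ _ h.smooth_spinor h.smooth_spinor).continuous
  refine h1.continuousAt.congr ?_
  filter_upwards [h.isOpen.mem_nhds hm] with x hx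
  have hL : Module.finrank ℂ (L x) = 1 := by rw [finrank_fibre (F := FL), hFL]
  rw [twistedInner_eq hL (h.norm_eq x hx), h.contract_eq hx]

theorem twistedInner_self_nonneg {m : M} (hL : Module.finrank ℂ (L m) = 1)
    (z : Twisted S L p m) : 0 ≤ twistedInner z z := by
  rw [← twistedNorm_sq hL]
  positivity

theorem twistedInner_add_smul_self {m : M} (hL : Module.finrank ℂ (L m) = 1)
    (z z' : Twisted S L p m) (t : ℝ) :
    twistedInner (z + (t : ℂ) • z') (z + (t : ℂ) • z') =
      twistedInner z z + 2 * t * twistedInner z z' + t ^ 2 * twistedInner z' z' := by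
  obtain ⟨l, hl⟩ := exists_norm_eq_one_of_finrank hL
  have hre : ∀ w z : S m, (inner ℂ w z : ℂ).re = (inner ℂ z w : ℂ).re := fun w z ↦ by
    rw [← inner_conj_symm, Complex.conj_re]
  simp only [twistedInner_eq hL hl, map_add, map_smul, inner_add_left, inner_add_right,
    inner_smul_left, inner_smul_right, Complex.add_re, Complex.conj_ofReal, Complex.re_ofReal_mul]
  rw [hre (contract l z')  (contract l z)]
  ring

theorem twistedNorm_smul_sq {m : M} (hL : Module.finrank ℂ (L m) = 1) (r : ℝ)
    (z : Twisted S L p m) : twistedNorm ((r : ℂ) • z) ^ 2 = r ^ 2 * twistedInner z z := by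
  obtain ⟨l, hl⟩ := exists_norm_eq_one_of_finrank hL
  rw [← twistedNorm_sq hL, twistedNorm_eq hL hl, twistedNorm_eq hL hl, map_smul, norm_smul,
    mul_pow, Complex.norm_real, Real.norm_eq_abs, sq_abs]

variable [IsTopologicalGroup G] [T2Space G] [LocallyCompactSpace G] [SecondCountableTopology G]
  [MeasurableSpace G] [BorelSpace G] {haar : Measure G} [haar.IsHaarMeasure] [haar.IsInvInvariant]
  [LocallyCompactSpace M] [SecondCountableTopology M] [SigmaCompactSpace M]
  [MeasurableSpace M] [BorelSpace M] [ProperSMul G M] {χ κ : M → ℝ}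

/-- Norms of invariant sections do not depend on the cutoff. The weight `χ²` is replaced by a
compactly supported `κ`, against which integrals are additive and monotone without further
conditions. -/
theorem cutoffL2NormSq_eq (hG : IsIsometricAction (n := n) G M) (hFL : Module.finrank ℂ FL = 1)
    (hχ : IsCutoff (n := n) haar χ) (hs : IsSmoothTwisted (n := n) FS FL s)
    (hsi : ∀ (g : G) m, s (g • m) = twistedAct aS aL g m (s m))
    (hκ : Continuous κ) (hκ0 : ∀ m, 0 ≤ κ m)
    (h1 : ∀ m, s m ≠ 0 → average haar κ m = 1) :
    cutoffL2NormSq n χ s = ∫ m, κ m * twistedInner (s m) (s m) ∂(riemannianMeasure n M) := by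
  have hL : ∀ m, Module.finrank ℂ (L m) = 1 := fun m ↦ by rw [finrank_fibre (F := FL), hFL]
  simp only [cutoffL2NormSq, twistedNorm_smul_sq (hL _)]
  refine integral_mul_eq_of_average_eq_one (haar := haar)
    (measurePreserving_smul_riemannianMeasure hG fun g ↦ contMDiff_smul_left (d := d) g)
    (hχ.smooth.continuous.pow 2) hκ (continuous_twistedInner_self aS aL hFL hs)
    (fun m ↦ sq_nonneg _) hκ0 (fun m ↦ twistedInner_self_nonneg (hL m) _)
    (fun g m ↦ by rw [hsi, twistedInner_twistedAct hFL]) (fun m _ ↦ hχ.integral m)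
    fun m hm ↦ h1 m fun h ↦ hm ?_
  rw [h]
  obtain ⟨l, hl⟩ := exists_norm_eq_one_of_finrank (hL m)
  rw [twistedInner_eq (hL m) hl]
  simp

/-- A pointwise lower bound for the anticommutator of the Dirac operator with an invariant
self-adjoint endomorphism, and its square, gives a lower bound for the deformed Dirac operator. -/
theorem cutoffW1NormSq_add_le (hG : IsIsometricAction (n := n) G M)
    (hDT : IsLeviCivita DT) (hDL : IsHermitianConnection DL)
    (hDLi : IsInvariantConnection aL DL) (hDS : IsSpinorConnection P DT DL DS)
    (hχ : IsCutoff (n := n) haar χ)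
    (hs : IsSmoothTwisted (n := n) FS FL s)
    (hsi : ∀ (g : G) m, s (g • m) = twistedAct aS aL g m (s m))
    (hΨ : IsSmoothEnd (n := n) FS Ψ)
    (hΨi : ∀ (g : G) m (w : S m), aS.act g m (Ψ m w) = Ψ (g • m) (aS.act g m w))
    (hκ : ContMDiff (𝓡 n) 𝓘(ℝ, ℝ) ∞ κ) (hκc : HasCompactSupport κ) (hκ0 : ∀ m, 0 ≤ κ m)
    (h1 : ∀ m ∈ sectionSupport s, average haar κ m = 1) {t : ℝ} (ht : 0 ≤ t)
    (hle : ∀ m, s m ≠ 0 → twistedInner (s m) (s m) ≤ anticommutatorForm P DS DL Ψ s m +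
      t * twistedInner (onSpinors (Ψ m) (s m)) (onSpinors (Ψ m) (s m))) :
    cutoffW1NormSq P DS DL χ s + (t - 1) * cutoffL2NormSq n χ s ≤
      cutoffL2NormSq n χ
        (fun m ↦ twistedDirac P DS DL s m + (t : ℂ) • onSpinors (Ψ m) (s m)) := by
  have hL : ∀ m, Module.finrank ℂ (L m) = 1 := fun m ↦ by rw [finrank_fibre (F := FL), P.rank_det]
  have hDSi := hDS.translate hG hDT hDLi
  have hg : ∀ g : G, ContMDiff (𝓡 n) (𝓡 n) ∞ fun x : M ↦ g • x :=
    fun g ↦ contMDiff_smul_left (d := d) g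
  set ν := riemannianMeasure n M
  let Ds := twistedDirac P DS DL s
  let Ψs : ∀ m, Twisted S L p m := fun m ↦ onSpinors (Ψ m) (s m)
  let Dt : ∀ m, Twisted S L p m := fun m ↦ Ds m + (t : ℂ) • Ψs m
  have hDs : IsSmoothTwisted (n := n) FS FL Ds :=
    isSmoothTwisted_twistedDirac P hDS.hermitian hDL hs
  have hDt : IsSmoothTwisted (n := n) FS FL Dt :=
    isSmoothTwisted_twistedDirac_add P hDS.hermitian hDL hs hΨ t
  have hDsi : ∀ (g : G) m, Ds (g • m) = twistedAct aS aL g m (Ds m) :=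
    twistedDirac_smul_eq (P := P) hG hDS.hermitian hDL hDSi hDLi hs hsi
  have hΨsi : ∀ (g : G) m, Ψs (g • m) = twistedAct aS aL g m (Ψs m) := fun g m ↦ by
    simp only [Ψs]
    rw [twistedAct_onSpinors (hΨi g m), hsi]
  have hDti : ∀ (g : G) m, Dt (g • m) = twistedAct aS aL g m (Dt m) := fun g m ↦ by
    simp only [Dt, hDsi, hΨsi, map_add, map_smul]
  have hsupp : ∀ m, s m ≠ 0 → m ∈ sectionSupport s := fun m hm ↦ subset_closure hm
  have hDs1 : ∀ m, Ds m ≠ 0 → average haar κ m = 1 := fun m hm ↦ h1 m (by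
    by_contra h
    exact hm (twistedDirac_eq_zero P hDS.hermitian hDL hs h))
  have hDt1 : ∀ m, Dt m ≠ 0 → average haar κ m = 1 := fun m hm ↦ by
    by_cases h : s m = 0
    · refine hDs1 m fun h2 ↦ hm ?_
      simp only [Dt, Ψs, h2, h, map_zero, smul_zero, add_zero]
    · exact h1 m (hsupp m h)
  -- The current whose divergence measures the failure of `D` to be pointwise symmetric on `s` and
  -- `Ψs`. It is invariant and supported in the support of `s`.
  let u : ∀ m : M, TangentSpace (𝓡 n) m := fun m ↦ twistedCurrent P m (s m) (Ψs m)
  have hu : IsSmoothField u := isSmoothField_twistedCurrent P hs hΨ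
  have hu1 : ∀ m ∈ closure {x | u x ≠ 0}, average haar κ m = 1 := fun m hm ↦
    h1 m (closure_mono (fun x (hx : u x ≠ 0) (h : s x = 0) ↦ hx (by
      obtain ⟨l, hl⟩ := exists_norm_eq_one_of_finrank (hL x)
      refine ext_inner_right ℝ fun w ↦ ?_
      simp only [u]
      rw [twistedCurrent_eq P hl, inner_spinorCurrent, h]
      simp)) hm)
  have hdiv := integral_mul_divergence_eq_zero (haar := haar) hG hg hDT hu
    (twistedCurrent_smul P hG hsi hΨsi) hκ hκc hu1
  rw [cutoffW1NormSq, cutoffL2NormSq_eq hG P.rank_det hχ hDt hDti hκ.continuous hκ0 hDt1,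
    cutoffL2NormSq_eq hG P.rank_det hχ hDs hDsi hκ.continuous hκ0 hDs1,
    cutoffL2NormSq_eq hG P.rank_det hχ hs hsi hκ.continuous hκ0 fun m hm ↦ h1 m (hsupp m hm)]
  have hint : ∀ {F : M → ℝ}, Continuous F → Integrable (fun m ↦ κ m * F m) ν := fun hF ↦
    (hκ.continuous.mul hF).integrable_of_hasCompactSupport hκc.mul_right
  have hN := hint (continuous_twistedInner_self aS aL P.rank_det hs)
  have hF₀ := hint (continuous_twistedInner_self aS aL P.rank_det hDs)
  have hF := hint (continuous_twistedInner_self aS aL P.rank_det hDt)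
  have hd := hint (contMDiff_divergence hDT hu).continuous
  -- Expand the square, write `2⟨Ds, Ψs⟩` as the anticommutator form plus the divergence, and apply
  -- `t` times the pointwise bound: `t² ‖Ψs‖²` is exactly `t` times the quadratic term in that
  -- bound.
  have hpt : ∀ m, κ m * twistedInner (Ds m) (Ds m) + t * (κ m * twistedInner (s m) (s m)) +
      t * (κ m * divergence DT u m) ≤ κ m * twistedInner (Dt m) (Dt m) := fun m ↦ by
    have h2 : divergence DT u m = twistedInner (Ds m) (Ψs m) -
        twistedInner (s m) (twistedDirac P DS DL Ψs m) :=
      divergence_twistedCurrent P hDT hDS hDL hs hΨ m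
    have h3 : twistedInner (s m) (s m) ≤ anticommutatorForm P DS DL Ψ s m +
        t * twistedInner (Ψs m) (Ψs m) := by
      by_cases h : s m = 0
      · obtain ⟨l, hl⟩ := exists_norm_eq_one_of_finrank (hL m)
        simp only [anticommutatorForm, Ψs]
        rw [h]
        simp [twistedInner_eq (hL m) hl]
      · exact hle m h
    have h4 : anticommutatorForm P DS DL Ψ s m = twistedInner (Ds m) (Ψs m) +
        twistedInner (s m) (twistedDirac P DS DL Ψs m) := rfl
    have h5 := twistedInner_add_smul_self (hL m) (Ds m) (Ψs m) t
    have h6 : twistedInner (Ds m) (Ds m) + t * twistedInner (s m) (s m) +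
        t * divergence DT u m ≤ twistedInner (Dt m) (Dt m) := by
      rw [show Dt m = Ds m + (t : ℂ) • Ψs m from rfl, h5]
      have h7 := mul_le_mul_of_nonneg_left h3 ht
      rw [h4] at h7
      rw [h2]
      nlinarith
    have h8 := mul_le_mul_of_nonneg_left h6 (hκ0 m)
    nlinarith
  have hfin := integral_mono ((hF₀.add (hN.const_mul t)).add (hd.const_mul t)) hF hpt
  rw [integral_add' (hF₀.add (hN.const_mul t)) (hd.const_mul t),
    integral_add' hF₀ (hN.const_mul t), integral_const_mul, integral_const_mul, hdiv] at hfin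
  linarith

end Integration

end

end CalliasLocalisation

theorem proposition6p1
    {n d : ℕ}
    -- the unimodular Lie group `G`
    {G : Type*} [TopologicalSpace G] [ChartedSpace (EuclideanSpace ℝ (Fin d)) G] [Group G]
    [LieGroup (𝓡 d) ∞ G] [T2Space G] [SigmaCompactSpace G] [MeasurableSpace G] [BorelSpace G]
    (haar : Measure G) [haar.IsHaarMeasure] [haar.IsMulRightInvariant]
    -- the complete Riemannian manifold `M`
    {M : Type*} [EMetricSpace M] [ChartedSpace (EuclideanSpace ℝ (Fin n)) M]
    [IsManifold (𝓡 n) ∞ M] [SigmaCompactSpace M] [MeasurableSpace M] [BorelSpace M]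
    [RiemannianBundle (fun x : M ↦ TangentSpace (𝓡 n) x)]
    [IsContMDiffRiemannianBundle (𝓡 n) ∞ (EuclideanSpace ℝ (Fin n))
      (fun x : M ↦ TangentSpace (𝓡 n) x)]
    [IsRiemannianManifold (𝓡 n) M] [CompleteSpace M]
    -- the smooth, proper, isometric action
    [MulAction G M] [ContMDiffSMul (𝓡 d) (𝓡 n) ∞ G M] [ProperSMul G M]
    (h_isometric : IsIsometricAction (n := n) G M)
    -- the Hermitian vector bundles `S` and `L`
    {FS : Type*} [NormedAddCommGroup FS] [NormedSpace ℂ FS]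
    {S : M → Type*} [TopologicalSpace (TotalSpace FS S)]
    [∀ m, NormedAddCommGroup (S m)] [∀ m, InnerProductSpace ℂ (S m)]
    [FiberBundle FS S] [VectorBundle ℂ FS S] [VectorBundle ℝ FS S]
    [ContMDiffVectorBundle ∞ FS S (𝓡 n)]
    {FL : Type*} [NormedAddCommGroup FL] [NormedSpace ℂ FL]
    {L : M → Type*} [TopologicalSpace (TotalSpace FL L)]
    [∀ m, NormedAddCommGroup (L m)] [∀ m, InnerProductSpace ℂ (L m)]
    [FiberBundle FL L] [VectorBundle ℂ FL L] [VectorBundle ℝ FL L]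
    [ContMDiffVectorBundle ∞ FL L (𝓡 n)]
    -- the equivariant `Spin^c`-structure
    (aS : EquivariantStructure (n := n) d G FS S) (aL : EquivariantStructure (n := n) d G FL L)
    (P : SpinCStructure aS aL)
    -- the connections on `TM`, on `L` and on `S`
    (DT : CovariantDerivative (𝓡 n) (EuclideanSpace ℝ (Fin n))
      (fun x : M ↦ TangentSpace (𝓡 n) x)) (hDT : IsLeviCivita DT)
    (DL : CovariantDerivative (𝓡 n) FL L) (hDL : IsHermitianConnection DL)
    (hDL_inv : IsInvariantConnection aL DL)
    (DS : CovariantDerivative (𝓡 n) FS S) (hDS : IsSpinorConnection P DT DL DS)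
    -- the moment map, and the metric on `M × 𝔤`
    (μ : M → GroupLieAlgebra (𝓡 d) G →ₗ[ℝ] ℝ) (hμ : IsMomentMap aL DL μ)
    (B : LieAlgebraMetric (n := n) (d := d) G M)
    -- the neighbourhoods `U` and `U'` of `μ⁻¹(0)`
    (U U' : Set M) (hU_open : IsOpen U) (hU_inv : IsInvariantSet G U) (hU_zero : μ ⁻¹' {0} ⊆ U)
    (hU_coc : IsCocompact G (closure U))
    (hU'_nhds : U' ∈ 𝓝ˢ (μ ⁻¹' {0})) (hU'_inv : IsInvariantSet G U') (hU' : closure U' ⊆ U)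
    -- the set `Z` and the potential `Φ`
    (Z : Set M) (hZ_closed : IsClosed Z) (hZ_inv : IsInvariantSet G Z) (hZ_coc : IsCocompact G Z)
    (hUZ : closure U ⊆ interior Z)
    (Φ : ∀ m : M, S m →ₗ[ℂ] S m) (k : ℝ) (hk : 0 < k) (hΦ : IsCalliasPotential P DS Φ Z k)
    -- the function `f` and the cutoff function `χ`
    (f : M → ℝ) (hf_smooth : ContMDiff (𝓡 n) 𝓘(ℝ, ℝ) ∞ f) (hf_inv : ∀ (g : G) m, f (g • m) = f m)
    (hf_nonneg : ∀ m, 0 ≤ f m) (hf_coc : IsCocompact G (tsupport f)) (hf_one : ∀ m ∈ Z, f m = 1)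
    (χ : M → ℝ) (hχ : IsCutoff (n := n) haar χ) :
    ∃ C b : ℝ, 0 < C ∧ 0 < b ∧
      ∃ h : M → ℝ, ContMDiff (𝓡 n) 𝓘(ℝ, ℝ) ∞ h ∧ (∀ (g : G) m, h (g • m) = h m) ∧
        (∃ a : ℝ, 1 ≤ a ∧ ∀ m, m ∉ U → h m = a) ∧ (∀ m ∈ U', h m = 0) ∧
      ∃ p₀ : ℕ, ∀ p ≥ p₀, ∀ t : ℝ, 1 ≤ t → ∀ s : ∀ m, Twisted S L p m,
        IsInvariantTcSection aS aL s → sectionSupport s ⊆ Uᶜ →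
        C * (cutoffW1NormSq P DS DL χ s + (t - b) * cutoffL2NormSq n χ s) ≤
          cutoffL2NormSq n χ (deformedDirac P DS DL Φ (momentField B μ) f h t s) := by
  have hLC : LocallyCompactSpace G :=
    ChartedSpace.locallyCompactSpace (EuclideanSpace ℝ (Fin d)) G
  have hSC : SecondCountableTopology G :=
    ChartedSpace.secondCountable_of_sigmaCompact (EuclideanSpace ℝ (Fin d)) G
  have hLC' : LocallyCompactSpace M :=
    ChartedSpace.locallyCompactSpace (EuclideanSpace ℝ (Fin n)) M
  have hSC' : SecondCountableTopology M :=
    ChartedSpace.secondCountable_of_sigmaCompact (EuclideanSpace ℝ (Fin n)) M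
  have hTG : IsTopologicalGroup G := topologicalGroup_of_lieGroup (𝓡 d) ∞
  have hinv : haar.IsInvInvariant := isInvInvariant_of_isMulRightInvariant haar
  have hGM : IsManifold (𝓡 d) ∞ G := inferInstance
  have hsm : ContMDiff ((𝓡 d).prod (𝓡 n)) (𝓡 n) ∞ fun q : G × M ↦ q.1 • q.2 :=
    ContMDiffSMul.contMDiff_smul
  have hv := isSmoothField_momentField B (hμ.contMDiff P.rank_det hDL)
  have hvi := momentField_smul (B := B) (hμ.apply_adjointAction P.rank_det hDL_inv)
  obtain ⟨K, hK, hfK⟩ := hf_coc.exists_isCompact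
  obtain ⟨K', hK', hZK'⟩ := hZ_coc.exists_isCompact
  obtain ⟨a, ha, p₀, hp₀⟩ := exists_deformation_estimate P (B := B) h_isometric hDT hDL hDL_inv hDS
    hμ hΦ hk hf_smooth hf_inv hf_nonneg hf_one hU_open hU_inv hU_zero hZ_closed hZ_inv hK hfK hK' hZK'
  obtain ⟨η, hη, hηi, hηU, hηU'⟩ :=
    exists_invariant_function haar hsm hU_open hU_inv hU_coc hU'_inv hU'
  refine ⟨1, 1, one_pos, one_pos, fun m ↦ a * η m, contMDiff_const.mul hη,
    fun g m ↦ by simp only [hηi], ⟨a, ha, fun m hm ↦ by simp only [hηU m hm, mul_one]⟩,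
    -- The function `h = aη` is fixed independently of `p`, `t` and `s`, and the estimate holds with
    -- both constants equal to one.
    fun m hm ↦ by simp only [hηU' m hm, mul_zero], p₀, fun p hp t ht s hs hsU ↦ ?_⟩
  -- The weight depends on `s`, which is harmless since it occurs neither in the norms nor in the
  -- constants.
  obtain ⟨κ, hκ, hκc, hκ0, hκ1⟩ := exists_compact_cutoff haar hsm hs.cocompact
  have hnot : ∀ m, s m ≠ 0 → m ∉ U := fun m hm ↦ hsU (subset_closure hm)
  -- The section vanishes on `U` and `h` is multiplied by `s` without being differentiated, so `h`
  -- may be replaced everywhere by the constant `a`.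
  have hdef : deformedDirac P DS DL Φ (momentField B μ) f (fun m ↦ a * η m) t s =
      fun m ↦ twistedDirac P DS DL s m +
        (t : ℂ) • onSpinors (deformation P Φ (momentField B μ) f a m) (s m) := by
    funext m
    rw [deformedDirac, onSpinors_deformation]
    by_cases h : s m = 0
    · simp only [h, map_zero, smul_zero, sub_zero]
    · simp only [hηU m (hnot m h), mul_one]
  rw [one_mul, hdef]
  exact cutoffW1NormSq_add_le P h_isometric hDT hDL hDL_inv hDS hχ hs.smooth hs.invariant
    (isSmoothEnd_deformation P hΦ.smooth hv hf_smooth)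
    (act_deformation P hΦ.equivariant hvi hf_inv) hκ hκc hκ0 hκ1 (zero_le_one.trans ht)
    fun m hm ↦ hp₀ p hp t ht s hs.smooth hs.invariant m (hnot m hm)
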